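/- Let $k$ be a perfect field of characteristic $p>0$, let $K=k(C)$ be the function field of a smooth projective geometrically irreducible curve $C$ over $k$, let $\bar K$ be an algebraic closure of $K$, and let $L\subset\bar K$ be a finite extension of $K$ with constant field $k'$ (the algebraic closure of $k$ in $L$). For $f\in L$ put $\deg_{\mathrm{ins}} f=1$ if $f\in k'$, and $\deg_{\mathrm{ins}} f=[L:k'(f)]_i$ (the inseparable degree of the finite extension $L/k'(f)$) if $f\notin k'$. Let $E_1,E_2$ be two non-isotrivial elliptic curves over $L$, i.e. with $j$-invariants $j(E_1),j(E_2)\notin k'$. Let $\varphi:E_1\to E_2$ be an isogeny defined over $\bar K$, that is, a surjective morphism of varieties over $\bar K$ with $\varphi(0)=0$. Write $\deg\varphi$ and $\deg_{\mathrm{ins}}\varphi$ for the degree and the inseparable degree of the extension $\bar K(E_1)/\varphi^*\bar K(E_2)$; $\varphi$ is separable if this extension is. Let $\hat\varphi:E_2\to E_1$ be the dual isogeny of $\varphi$, i.e. the isogeny with $\hat\varphi\circ\varphi=[\deg\varphi]$ on $E_1$ (it exists). Then $$\deg_{\mathrm{ins}}\hat\varphi\cdot\deg_{\mathrm{ins}}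 j(E_2)=\deg_{\mathrm{ins}}\varphi\cdot\deg_{\mathrm{ins}} j(E_1).$$ In particular, if $\varphi$ is biseparable (both $\varphi$ and $\hat\varphi$ are separable), then $\deg_{\mathrm{ins}} j(E_1)=\deg_{\mathrm{ins}} j(E_2)$. -/

import Mathlib

open Polynomial

/-! ### Function fields of curves and inseparability degrees of their elements -/

/-- `K` is a function field of one variable with constant field `k`: a finite extension of a purely
transcendental extension `k(t)`, in which `k` is algebraically closed. For perfect `k` these are
exactly the fields `k(C)` for `C` a smooth projective geometrically irreducible curve over `k`. -/
structure IsFunctionFieldOfCurve (k K : Type*) [Field k] [Field K] [Algebra k K] : Prop where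
  exists_finite : ∃ t : K, Transcendental k t ∧
    FiniteDimensional (IntermediateField.adjoin k {t}) K
  constants : ∀ c : K, IsAlgebraic k c → c ∈ (algebraMap k K).range

/-- The constant field of `L`: the algebraic closure of `k` in `L`. -/
noncomputable abbrev constantField (k L : Type*) [Field k] [Field L] [Algebra k L] :
    IntermediateField k L :=
  algebraicClosure k L

open scoped Classical in
/-- The inseparability degree of `f ∈ L`, where `k'` is the constant field of `L`: it is `1` if
`f ∈ k'`, and the inseparable degree of the finite extension `L / k'(f)` otherwise. -/
noncomputable def elementDegIns (k : Type*) {L : Type*} [Field k] [Field L] [Algebra k L]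
    (f : L) : ℕ :=
  if f ∈ constantField k L then 1
  else Field.finInsepDegree (IntermediateField.adjoin (constantField k L) {f}) L

namespace WeierstrassCurve

/-- An elliptic curve over `L` is isotrivial if its `j`-invariant lies in the constant field. -/
def IsIsotrivial (k : Type*) {L : Type*} [Field k] [Field L] [Algebra k L]
    (E : WeierstrassCurve L) [E.IsElliptic] : Prop :=
  E.j ∈ constantField k L

/-! ### Rational functions and their values at points -/

section Isogeny

variable {F : Type*} [Field F]

/-- The function field `F(W)` of the curve `W`. -/
abbrev RationalFunction (W : WeierstrassCurve F) : Type _ :=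
  W.toAffine.FunctionField

/-- The coordinate function `x`. -/
noncomputable def xFunction (W : WeierstrassCurve F) : W.RationalFunction :=
  algebraMap W.toAffine.CoordinateRing _ (Affine.CoordinateRing.mk W.toAffine (C X))

/-- The coordinate function `y`. -/
noncomputable def yFunction (W : WeierstrassCurve F) : W.RationalFunction :=
  algebraMap W.toAffine.CoordinateRing _ (Affine.CoordinateRing.mk W.toAffine X)

/-- Homogeneous coordinates of a point in the projective plane: `[x : y : 1]` for an affine point
`(x, y)`, and `[0 : 1 : 0]` for the point at infinity. -/
def homogeneousCoordinates (W : WeierstrassCurve F) : W.toAffine.Point → Fin 3 → F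
  | .zero => ![0, 1, 0]
  | .some x y _ => ![x, y, 1]

/-- The rational function `f` is regular at the point `P`, with value `c` there: near `P` it is a
quotient `a / b` of two forms of the same degree with `b(P) ≠ 0`, and `c = a(P) / b(P)`. -/
def HasValueAt (W : WeierstrassCurve F) (f : W.RationalFunction) (P : W.toAffine.Point)
    (c : F) : Prop :=
  ∃ (n : ℕ) (a b : MvPolynomial (Fin 3) F), a.IsHomogeneous n ∧ b.IsHomogeneous n ∧
    MvPolynomial.eval (W.homogeneousCoordinates P) b ≠ 0 ∧
    f * MvPolynomial.aeval ![W.xFunction, W.yFunction, 1] b =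
      MvPolynomial.aeval ![W.xFunction, W.yFunction, 1] a ∧
    c = MvPolynomial.eval (W.homogeneousCoordinates P) a /
      MvPolynomial.eval (W.homogeneousCoordinates P) b

/-! ### Isogenies -/

/-- An isogeny `W₁ → W₂` of elliptic curves over an algebraically closed field `F`: a surjective
morphism of varieties that sends the neutral element to the neutral element.

The morphism is given by its map on `F`-points and by the embedding of function fields
`φ^* : F(W₂) → F(W₁)` over `F`. These determine each other: `φ^* f` is `f ∘ φ`, i.e. if `f` is
regular at `φ P`, then `φ^* f` is regular at `P`, with value `f (φ P)`. -/
structure Isogeny (W₁ W₂ : WeierstrassCurve F) where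
  /-- The map on points. -/
  toFun : W₁.toAffine.Point → W₂.toAffine.Point
  /-- The pullback `φ^*` of rational functions. -/
  pullback : W₂.RationalFunction →ₐ[F] W₁.RationalFunction
  hasValueAt_pullback : ∀ (P : W₁.toAffine.Point) (f : W₂.RationalFunction) (c : F),
    W₂.HasValueAt f (toFun P) c → W₁.HasValueAt (pullback f) P c
  surjective : Function.Surjective toFun
  map_zero : toFun 0 = 0

namespace Isogeny

variable {W₁ W₂ : WeierstrassCurve F}

/-- The degree of the extension `F(W₁) / φ^*(F(W₂))`. -/
noncomputable def degree (φ : Isogeny W₁ W₂) : ℕ :=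
  Module.finrank φ.pullback.fieldRange W₁.RationalFunction

/-- The inseparable degree of the extension `F(W₁) / φ^*(F(W₂))`. -/
noncomputable def degIns (φ : Isogeny W₁ W₂) : ℕ :=
  Field.finInsepDegree φ.pullback.fieldRange W₁.RationalFunction

/-- An isogeny is separable if the extension `F(W₁) / φ^*(F(W₂))` is. -/
def IsSeparable (φ : Isogeny W₁ W₂) : Prop :=
  Algebra.IsSeparable φ.pullback.fieldRange W₁.RationalFunction

open scoped Classical in
/-- `ψ : W₂ → W₁` is the dual isogeny of `φ : W₁ → W₂`: the composition `ψ ∘ φ` is the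
multiplication by `deg φ` on `W₁`. -/
def IsDual (φ : Isogeny W₁ W₂) (ψ : Isogeny W₂ W₁) : Prop :=
  ∀ P : W₁.toAffine.Point, ψ.toFun (φ.toFun P) = φ.degree • P

/-- An isogeny is biseparable if it and its dual are both separable. -/
def IsBiseparable (φ : Isogeny W₁ W₂) : Prop :=
  φ.IsSeparable ∧ ∃ ψ : Isogeny W₂ W₁, φ.IsDual ψ ∧ ψ.IsSeparable

end Isogeny

end Isogeny

end WeierstrassCurve

/-!
The inseparable degrees of an isogeny and of its dual are compared with the `p`-divisibility of the
`j`-invariants. By `IsCurveField.exists_finInsepDegree_eq`, the inseparability degree of a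
nonconstant function `f` is `p ^ c` for the largest `c` such that `f` is a `p ^ c`-th power, and by
`hasExponent_separableClosure` this exponent does not change on passing to the separable closure of
the field `L`. So it suffices to show that the exponent of `j(E₂)` exceeds that of `j(E₁)` by `a -
b`, where `p ^ a` and `p ^ b` are the inseparable degrees of the isogeny and of its dual.

A point of a curve over the function field of another curve is the same as a morphism between the
two, and evaluating the morphism is reduction at the places of the function field. The subfield that
belongs to an isogeny with kernel `G` and inseparable degree `p ^ a` consists of the `p ^ a`-th
powers of the `G`-invariant functions (`exists_mem_fieldRange_iff`). Multiplication by `p` kills the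
invariant differential, so its coordinates are `p`-th powers, and multiplication by the degree
factors through the isogeny: this gives the dual (`exists_mapPt_ptOf_eq_nsmul`).

A nonconstant `j`-invariant is not fixed by a power of the Frobenius automorphism, and therefore
there are exactly `p` points killed by `p` (`card_torsion_prime`): otherwise the multiplication by
`p` would be purely inseparable and identify the curve with one of its conjugates. Here the degree
of the multiplication by `n` enters only through the upper bound `n ^ 2`
(`finrank_fieldRange_le_of_ptOf_eq_nsmul`). It follows that `p ^ b` is the `p`-part of the order of
the kernel of the isogeny (`finInsepDegree_dual`).

The isogeny thus induces a separable isogeny, of degree prime to `p`, from the conjugate of `E₁` by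
the `b`-th power of the inverse Frobenius automorphism to the conjugate of `E₂` by the `a`-th power.
Let `F` be the algebraic closure, and let a separable isogeny of degree prime to `p` start from a
curve over a subfield `M` over which `F` is purely inseparable. The kernel is `M`-rational, since
the invariant differential vanishes on torsion points of order prime to `p`
(`mem_ptIn_bot_of_nsmul_eq_zero`). The sums of the translates of `x` and `y` by the kernel satisfy a
Weierstrass equation of the target (`exists_equation_sum`). They take values in `M` at infinitely
many points, so the coefficients are in `M` (`exists_eq_map_of_equation`). Therefore the
`j`-invariants of the two conjugates lie in the same fields `M` (`frobRoot_j_mem_range`), and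
applying this to the conjugates of the separable closure of `L` compares the exponents
(`add_eq_add_of_frobRoot`).
-/

/-! ### The invariant differential and the group law -/

namespace WeierstrassCurve

open scoped Classical

/-- Equality in fields is decided classically, also in subfields: the group law on points depends
on the choice of the instance. -/
noncomputable instance (priority := 10000) fieldDecidableEq {K : Type*} [Field K] : DecidableEq K :=
  fun a b => Classical.propDecidable (a = b)

section Omega

variable {F N : Type*} [Field F] [Field N] [Algebra F N] (W : WeierstrassCurve F)

/-- `W.HasOmega D P w` says that the invariant differential `dx / (2y + a₁x + a₃)` of `W`, pulled
back along the point `P` with coordinates in `N` and contracted with the derivation `D`, is `w`.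
As `P` is nonsingular, the two equations determine `w`, without a division by zero. -/
def HasOmega (D : Derivation F N N) : (W.baseChange N).toAffine.Point → N → Prop
  | .zero, w => w = 0
  | .some x y _, w =>
      D x = w * (2 * y + (W.baseChange N).a₁ * x + (W.baseChange N).a₃) ∧
      D y = w * (3 * x ^ 2 + 2 * (W.baseChange N).a₂ * x + (W.baseChange N).a₄ -
        (W.baseChange N).a₁ * y)

variable {W} {D : Derivation F N N}

lemma derivation_coeff :
    D (W.baseChange N).a₁ = 0 ∧ D (W.baseChange N).a₂ = 0 ∧ D (W.baseChange N).a₃ = 0 ∧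
      D (W.baseChange N).a₄ = 0 ∧ D (W.baseChange N).a₆ = 0 :=
  ⟨D.map_algebraMap _, D.map_algebraMap _, D.map_algebraMap _, D.map_algebraMap _,
    D.map_algebraMap _⟩

lemma derivation_equation {x y : N} (h : (W.baseChange N).toAffine.Equation x y) :
    D y * (2 * y + (W.baseChange N).a₁ * x + (W.baseChange N).a₃) =
      D x * (3 * x ^ 2 + 2 * (W.baseChange N).a₂ * x + (W.baseChange N).a₄ -
        (W.baseChange N).a₁ * y) := by
  obtain ⟨h1, h2, h3, h4, h6⟩ := derivation_coeff (W := W) (D := D)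
  rw [Affine.equation_iff] at h
  have := congrArg D h
  simp only [map_add, D.leibniz, D.leibniz_pow, h1, h2, h3, h4, h6, smul_eq_mul, nsmul_eq_mul]
    at this
  push_cast at this
  linear_combination this

lemma exists_hasOmega (P : (W.baseChange N).toAffine.Point) : ∃ w, W.HasOmega D P w := by
  rcases P with _ | ⟨x, y, h⟩
  · exact ⟨0, rfl⟩
  have he := derivation_equation (D := D) h.1
  rw [Affine.nonsingular_iff'] at h
  rcases h.2 with h2 | h2
  · refine ⟨D y / (3 * x ^ 2 + 2 * (W.baseChange N).a₂ * x + (W.baseChange N).a₄ -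
        (W.baseChange N).a₁ * y), ?_, ?_⟩
    · have h2' : (3 * x ^ 2 + 2 * (W.baseChange N).a₂ * x + (W.baseChange N).a₄ -
        (W.baseChange N).a₁ * y) ≠ 0 := fun h ↦ h2 (by linear_combination -h)
      rw [div_mul_eq_mul_div, eq_div_iff h2']
      linear_combination -he
    · have h2' : (3 * x ^ 2 + 2 * (W.baseChange N).a₂ * x + (W.baseChange N).a₄ -
        (W.baseChange N).a₁ * y) ≠ 0 := fun h ↦ h2 (by linear_combination -h)
      rw [div_mul_cancel₀ _ h2']
  · refine ⟨D x / (2 * y + (W.baseChange N).a₁ * x + (W.baseChange N).a₃), ?_, ?_⟩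
    · rw [div_mul_cancel₀ _ h2]
    · rw [div_mul_eq_mul_div, eq_div_iff h2]
      linear_combination he

lemma HasOmega.neg {P : (W.baseChange N).toAffine.Point} {w : N} (h : W.HasOmega D P w) :
    W.HasOmega D (-P) (-w) := by
  obtain ⟨h1, h2, h3, h4, h6⟩ := derivation_coeff (W := W) (D := D)
  rcases P with _ | ⟨x, y, hP⟩
  · obtain rfl : w = 0 := h
    exact neg_zero
  · obtain ⟨hx, hy⟩ := h
    rw [Affine.Point.neg_some]
    refine ⟨?_, ?_⟩
    · rw [hx, Affine.negY]; ring
    · simp only [Affine.negY, map_sub, map_neg, D.leibniz, h1, h3, smul_eq_mul, hx, hy]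
      ring

/-- Invariance of the differential: it is additive in the point. -/
lemma HasOmega.add {P Q : (W.baseChange N).toAffine.Point} {w₁ w₂ : N}
    (hP : W.HasOmega D P w₁) (hQ : W.HasOmega D Q w₂) : W.HasOmega D (P + Q) (w₁ + w₂) := by
  obtain ⟨h1, h2, h3, h4, h6⟩ := derivation_coeff (W := W) (D := D)
  rcases P with _ | ⟨x₁, y₁, hP'⟩
  · obtain rfl : w₁ = 0 := hP
    rw [← Affine.Point.zero_def, zero_add, zero_add]; exact hQ
  rcases Q with _ | ⟨x₂, y₂, hQ'⟩
  · obtain rfl : w₂ = 0 := hQ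
    rw [← Affine.Point.zero_def, add_zero, add_zero]; exact hP
  by_cases hxy : x₁ = x₂ ∧ y₁ = (W.baseChange N).toAffine.negY x₂ y₂
  · have hneg : (Affine.Point.some x₁ y₁ hP' : (W.baseChange N).toAffine.Point) =
        -Affine.Point.some x₂ y₂ hQ' := by
      rw [Affine.Point.neg_some]; simp [hxy.1, hxy.2]
    rw [hneg] at hP
    rw [hneg, neg_add_cancel]
    have h' := hQ.neg
    rw [Affine.Point.neg_some] at h' hP
    have key : w₁ = -w₂ := by
      obtain ⟨a1, a2⟩ := hP
      obtain ⟨b1, b2⟩ := h'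
      have hn := (Affine.nonsingular_iff' _ _).1 ((Affine.nonsingular_neg _ _).2 hQ')
      rcases hn.2 with hn | hn
      · refine mul_right_cancel₀ (b := -((W.baseChange N).a₁ *
          (W.baseChange N).toAffine.negY x₂ y₂ - (3 * x₂ ^ 2 + 2 * (W.baseChange N).a₂ * x₂ +
            (W.baseChange N).a₄))) (neg_ne_zero.2 hn) ?_
        linear_combination b2 - a2
      · exact mul_right_cancel₀ hn (by linear_combination b1 - a1)
    rw [key, neg_add_cancel]
    rfl
  rw [Affine.Point.add_some hxy]
  change D ((W.baseChange N).toAffine.addX x₁ x₂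
      ((W.baseChange N).toAffine.slope x₁ x₂ y₁ y₂)) = _ ∧
    D ((W.baseChange N).toAffine.addY x₁ x₂ y₁ ((W.baseChange N).toAffine.slope x₁ x₂ y₁ y₂)) = _
  set ℓ := (W.baseChange N).toAffine.slope x₁ x₂ y₁ y₂ with hℓ
  set x₃ := (W.baseChange N).toAffine.addX x₁ x₂ ℓ with hx₃
  obtain ⟨hx1, hy1⟩ := hP
  obtain ⟨hx2, hy2⟩ := hQ
  have hpoly := Affine.addPolynomial_slope hP'.1 hQ'.1 hxy
  rw [← hℓ, ← hx₃, Affine.addPolynomial_eq] at hpoly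
  have hder := congrArg Polynomial.derivative hpoly
  have ev : ∀ x : N, _ := fun x ↦ congrArg (Polynomial.eval x) hder
  simp only [Cubic.toPoly, map_neg, Polynomial.derivative_mul,
    Polynomial.derivative_add, Polynomial.derivative_sub, Polynomial.derivative_C,
    Polynomial.derivative_X, Polynomial.derivative_X_pow, Polynomial.eval_neg, Polynomial.eval_add,
    Polynomial.eval_mul, Polynomial.eval_sub, Polynomial.eval_C, Polynomial.eval_X,
    Polynomial.eval_pow, Polynomial.eval_zero, Polynomial.eval_one,
    Polynomial.eval_ofNat, Nat.cast_ofNat, map_ofNat] at ev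
  have e1 := ev x₁
  have e2 := ev x₂
  have e3 := ev x₃
  -- the line through the two points, in both the secant and the tangent case
  have hline : y₁ - y₂ = ℓ * (x₁ - x₂) := by
    by_cases hx : x₁ = x₂
    · have := Affine.Y_eq_of_Y_ne hP'.1 hQ'.1 hx (fun h ↦ hxy ⟨hx, h⟩)
      rw [hx, this]; ring
    · rw [hℓ, Affine.slope_of_X_ne hx, div_mul_cancel₀ _ (sub_ne_zero.2 hx)]
  have hx3 : x₃ = ℓ ^ 2 + (W.baseChange N).a₁ * ℓ - (W.baseChange N).a₂ - x₁ - x₂ := by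
    rw [hx₃, Affine.addX]
  clear_value x₃ ℓ
  have I1 : (3 * x₁ ^ 2 + 2 * (W.baseChange N).a₂ * x₁ + (W.baseChange N).a₄ -
        (W.baseChange N).a₁ * y₁) -
      ℓ * (2 * y₁ + (W.baseChange N).a₁ * x₁ + (W.baseChange N).a₃) =
      (x₁ - x₂) * (x₁ - x₃) := by
    linear_combination -e1
  have I2 : (3 * x₂ ^ 2 + 2 * (W.baseChange N).a₂ * x₂ + (W.baseChange N).a₄ -
        (W.baseChange N).a₁ * y₂) -
      ℓ * (2 * y₂ + (W.baseChange N).a₁ * x₂ + (W.baseChange N).a₃) =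
      (x₂ - x₁) * (x₂ - x₃) := by
    linear_combination -e2 + ((W.baseChange N).a₁ + 2 * ℓ) * hline
  have hDl : D ℓ = w₁ * (x₁ - x₃) + w₂ * (x₂ - x₃) := by
    by_cases hx : x₁ = x₂
    · have hy := Affine.Y_eq_of_Y_ne hP'.1 hQ'.1 hx (fun h ↦ hxy ⟨hx, h⟩)
      subst hx hy
      have hψ : y₁ - (W.baseChange N).toAffine.negY x₁ y₁ ≠ 0 :=
        sub_ne_zero.2 fun h ↦ hxy ⟨rfl, h⟩
      rw [Affine.negY] at hψ
      have hw : w₁ = w₂ := mul_right_cancel₀ hψ (by linear_combination hx2 - hx1)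
      subst hw
      have hl : ℓ * (2 * y₁ + (W.baseChange N).a₁ * x₁ + (W.baseChange N).a₃) =
          3 * x₁ ^ 2 + 2 * (W.baseChange N).a₂ * x₁ + (W.baseChange N).a₄ -
            (W.baseChange N).a₁ * y₁ := by
        linear_combination -I1
      have := congrArg D hl
      simp only [map_add, map_sub, D.leibniz, D.leibniz_pow, h1, h2, h3, h4, smul_eq_mul,
        nsmul_eq_mul, hx1, hy1] at this
      have t2 : D 2 = 0 := mod_cast D.map_natCast 2
      have t3 : D 3 = 0 := mod_cast D.map_natCast 3
      push_cast [t2, t3] at this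
      refine mul_right_cancel₀ hψ ?_
      linear_combination this + 2 * w₁ * (2 * y₁ + (W.baseChange N).a₁ * x₁ +
        (W.baseChange N).a₃) * hx3 +
        w₁ * (2 * ℓ + (W.baseChange N).a₁) * hl
    · have := congrArg D hline
      simp only [map_sub, D.leibniz, smul_eq_mul, hx1, hx2, hy1, hy2] at this
      refine mul_right_cancel₀ (sub_ne_zero.2 hx) ?_
      linear_combination -this + w₁ * I1 - w₂ * I2
  have hDx : D x₃ = (w₁ + w₂) * (2 * (W.baseChange N).toAffine.addY x₁ x₂ y₁ ℓ +
      (W.baseChange N).a₁ * x₃ + (W.baseChange N).a₃) := by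
    have := congrArg D hx3
    simp only [map_add, map_sub, D.leibniz, D.leibniz_pow, h1, h2, smul_eq_mul,
        nsmul_eq_mul, hx1, hx2, hDl] at this
    push_cast at this
    rw [this, Affine.addY, Affine.negAddY, Affine.negY, ← hx₃]
    linear_combination 2 * w₂ * hline
  refine ⟨hDx, ?_⟩
  rw [Affine.addY, Affine.negAddY, Affine.negY, ← hx₃] at hDx ⊢
  simp only [map_add, map_sub, map_neg, D.leibniz, h1, h3, smul_eq_mul, hDl, hDx, hx1, hy1]
  linear_combination -w₁ * I1 + (w₁ + w₂) * e3

/-- Multiplication by `n` multiplies the invariant differential by `n`: in characteristic `p`, it is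
killed by the multiplication by `p`. -/
lemma HasOmega.nsmul {P : (W.baseChange N).toAffine.Point} {w : N} (h : W.HasOmega D P w) (n : ℕ) :
    W.HasOmega D (n • P) (n * w) := by
  induction n with
  | zero => rw [zero_smul, Nat.cast_zero, zero_mul]; rfl
  | succ n ih =>
    rw [succ_nsmul, Nat.cast_succ, add_mul, one_mul]
    exact ih.add h

lemma hasOmega_zero_iff {x y : N} (h : (W.baseChange N).toAffine.Nonsingular x y) :
    W.HasOmega D (.some x y h) 0 ↔ D x = 0 ∧ D y = 0 := by
  simp [HasOmega]

lemma HasOmega.eq_zero {x y w : N} {h : (W.baseChange N).toAffine.Nonsingular x y}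
    (hw : W.HasOmega D (.some x y h) w) (hx : D x = 0) (hy : D y = 0) : w = 0 := by
  obtain ⟨h1, h2⟩ := hw
  rw [hx, zero_eq_mul] at h1
  rw [hy, zero_eq_mul] at h2
  rcases h1 with h1 | h1
  · exact h1
  rcases h2 with h2 | h2
  · exact h2
  rcases ((Affine.nonsingular_iff' _ _).1 h).2 with hn | hn
  · exact (hn (by linear_combination -h2)).elim
  · exact (hn h1).elim

end Omega

end WeierstrassCurve

/-! ### Places, values and specialization of points -/

namespace WeierstrassCurve

open scoped Classical

section Values

variable {F N : Type*} [Field F] [Field N] [Algebra F N]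

/-- A valuation subring `A` of an extension `N / F` that contains `F` and has residue field `F`. -/
structure IsPlace (F : Type*) {N : Type*} [Field F] [Field N] [Algebra F N]
    (A : ValuationSubring N) : Prop where
  algebraMap_mem : ∀ c : F, algebraMap F N c ∈ A
  exists_value : ∀ f ∈ A, ∃ c : F, A.valuation (f - algebraMap F N c) < 1

/-- The element `f` of `N` has value `c ∈ F` at `A`: it is congruent to `c` modulo the maximal
ideal of `A`. -/
def HasVal (A : ValuationSubring N) (f : N) (c : F) : Prop :=
  A.valuation (f - algebraMap F N c) < 1

variable {A : ValuationSubring N}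

lemma IsPlace.valuation_le (hA : IsPlace F A) (c : F) : A.valuation (algebraMap F N c) ≤ 1 :=
  (A.valuation_le_one_iff _).2 (hA.algebraMap_mem c)

lemma IsPlace.valuation_eq_one (hA : IsPlace F A) {c : F} (hc : c ≠ 0) :
    A.valuation (algebraMap F N c) = 1 := by
  refine le_antisymm (hA.valuation_le c) ?_
  have h := hA.valuation_le c⁻¹
  rw [map_inv₀, map_inv₀] at h
  have h0 : A.valuation (algebraMap F N c) ≠ 0 := by simp [hc]
  exact (inv_le_one₀ (zero_lt_iff.2 h0)).1 h

lemma hasVal_zero_iff {f : N} : HasVal A f (0 : F) ↔ A.valuation f < 1 := by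
  simp [HasVal]

lemma hasVal_algebraMap (c : F) : HasVal A (algebraMap F N c) c := by
  simp [HasVal]

lemma hasVal_zero : HasVal A (0 : N) (0 : F) := by simp [HasVal]

lemma hasVal_one : HasVal A (1 : N) (1 : F) := by simp [HasVal]

lemma hasVal_natCast (n : ℕ) : HasVal A (n : N) (n : F) := by simp [HasVal]

lemma hasVal_two : HasVal A (2 : N) (2 : F) := mod_cast hasVal_natCast (A := A) (F := F) 2

lemma hasVal_three : HasVal A (3 : N) (3 : F) := mod_cast hasVal_natCast (A := A) (F := F) 3

lemma HasVal.add {f g : N} {c d : F} (hf : HasVal A f c) (hg : HasVal A g d) :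
    HasVal A (f + g) (c + d) := by
  have := A.valuation.map_add_lt hf hg
  rwa [show f - algebraMap F N c + (g - algebraMap F N d) = f + g - algebraMap F N (c + d) by
    rw [map_add]; ring] at this

lemma HasVal.neg {f : N} {c : F} (hf : HasVal A f c) : HasVal A (-f) (-c) := by
  rw [HasVal, map_neg, ← Valuation.map_neg, show -(-f - -algebraMap F N c) = f - algebraMap F N c by
    ring]
  exact hf

lemma HasVal.sub {f g : N} {c d : F} (hf : HasVal A f c) (hg : HasVal A g d) :
    HasVal A (f - g) (c - d) := by
  rw [sub_eq_add_neg, sub_eq_add_neg]; exact hf.add hg.neg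

lemma HasVal.unique (hA : IsPlace F A) {f : N} {c d : F} (hc : HasVal A f c) (hd : HasVal A f d) :
    c = d := by
  by_contra hne
  have h := hc.sub hd
  rw [sub_self, HasVal, zero_sub, Valuation.map_neg, hA.valuation_eq_one (sub_ne_zero.2 hne)] at h
  exact lt_irrefl _ h

lemma HasVal.valuation_le (hA : IsPlace F A) {f : N} {c : F} (hf : HasVal A f c) :
    A.valuation f ≤ 1 := by
  have := A.valuation.map_add_le (x := f - algebraMap F N c) (y := algebraMap F N c) hf.le
    (hA.valuation_le c)
  rwa [sub_add_cancel] at this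

lemma HasVal.mem (hA : IsPlace F A) {f : N} {c : F} (hf : HasVal A f c) : f ∈ A :=
  (A.valuation_le_one_iff _).1 (hf.valuation_le hA)

lemma HasVal.valuation_eq_one (hA : IsPlace F A) {f : N} {c : F} (hf : HasVal A f c) (hc : c ≠ 0) :
    A.valuation f = 1 := by
  refine le_antisymm (hf.valuation_le hA) (not_lt.1 fun h ↦ hc ?_)
  exact hf.unique hA (hasVal_zero_iff.2 h)

lemma IsPlace.hasVal_mul_zero (_ : IsPlace F A) {f g : N} (hf : HasVal A f (0 : F)) (hg : g ∈ A) :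
    HasVal A (f * g) (0 : F) := by
  rw [hasVal_zero_iff] at *
  rw [map_mul]
  exact mul_lt_one_of_lt_of_le hf ((A.valuation_le_one_iff _).2 hg)

lemma HasVal.mul (hA : IsPlace F A) {f g : N} {c d : F} (hf : HasVal A f c) (hg : HasVal A g d) :
    HasVal A (f * g) (c * d) := by
  have h1 : HasVal A ((f - algebraMap F N c) * g) (0 : F) :=
    hA.hasVal_mul_zero (by rw [hasVal_zero_iff]; exact hf) (hg.mem hA)
  have h2 : HasVal A ((g - algebraMap F N d) * algebraMap F N c) (0 : F) :=
    hA.hasVal_mul_zero (by rw [hasVal_zero_iff]; exact hg) (hA.algebraMap_mem c)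
  have := (h1.add h2).add (hasVal_algebraMap (c * d))
  rw [map_mul] at this
  convert! this using 1 <;> ring

lemma HasVal.pow (hA : IsPlace F A) {f : N} {c : F} (hf : HasVal A f c) (n : ℕ) :
    HasVal A (f ^ n) (c ^ n) := by
  induction n with
  | zero => simpa using hasVal_one
  | succ n ih => rw [pow_succ, pow_succ]; exact ih.mul hA hf

lemma HasVal.inv (hA : IsPlace F A) {f : N} {c : F} (hf : HasVal A f c) (hc : c ≠ 0) :
    HasVal A f⁻¹ c⁻¹ := by
  have h1 := hf.valuation_eq_one hA hc
  have hf0 : f ≠ 0 := by rintro rfl; simp at h1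
  have h2 := hA.valuation_eq_one hc
  have hc0 : algebraMap F N c ≠ 0 := by simpa using hc
  have : f⁻¹ - algebraMap F N c⁻¹ = -((f - algebraMap F N c) * (f⁻¹ * (algebraMap F N c)⁻¹)) := by
    rw [map_inv₀]; field_simp; ring
  rw [HasVal, this, Valuation.map_neg, map_mul, map_mul, map_inv₀, map_inv₀, h1, h2, inv_one,
    mul_one,
    mul_one]
  exact hf

lemma HasVal.div (hA : IsPlace F A) {f g : N} {c d : F} (hf : HasVal A f c) (hg : HasVal A g d)
    (hd : d ≠ 0) : HasVal A (f / g) (c / d) := by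
  rw [div_eq_mul_inv, div_eq_mul_inv]; exact hf.mul hA (hg.inv hA hd)

lemma hasVal_inv_of_notMem {f : N} (hf : f ∉ A) : HasVal A f⁻¹ (0 : F) := by
  rw [hasVal_zero_iff, map_inv₀]
  rw [← A.valuation_le_one_iff, not_le] at hf
  exact inv_lt_one_of_one_lt₀ hf

lemma notMem_of_hasVal_inv {f : N} (h0 : f ≠ 0) (hf : HasVal A f⁻¹ (0 : F)) : f ∉ A := by
  rw [hasVal_zero_iff, map_inv₀] at hf
  rw [← A.valuation_le_one_iff, not_le]
  exact (inv_lt_one₀ (zero_lt_iff.2 (by simpa using h0))).1 hf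

lemma HasVal.sum {ι : Type*} (s : Finset ι) {f : ι → N} {c : ι → F}
    (h : ∀ i ∈ s, HasVal A (f i) (c i)) : HasVal A (∑ i ∈ s, f i) (∑ i ∈ s, c i) := by
  induction s using Finset.induction_on with
  | empty => simpa using hasVal_zero
  | insert i s hi ih =>
    rw [Finset.sum_insert hi, Finset.sum_insert hi]
    exact (h i (by simp)).add (ih fun j hj ↦ h j (by simp [hj]))

end Values

section Reduction

variable {F N : Type*} [Field F] [Field N] [Algebra F N] {W : WeierstrassCurve F}
  {A : ValuationSubring N}

lemma some_eq_some_iff {R : Type*} [CommRing R] {V : Affine R} {x y x' y' : R}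
    {h : V.Nonsingular x y} {h' : V.Nonsingular x' y'} :
    (Affine.Point.some x y h = Affine.Point.some x' y' h') ↔ x = x' ∧ y = y' :=
  ⟨fun e ↦ Affine.Point.some.inj e, by rintro ⟨rfl, rfl⟩; rfl⟩

variable (N) in
lemma nonsingular_algebraMap {x y : F} (h : W.toAffine.Nonsingular x y) :
    (W.baseChange N).toAffine.Nonsingular (algebraMap F N x) (algebraMap F N y) :=
  (W.toAffine.map_nonsingular (algebraMap F N).injective _ _).2 h

variable (W N) in
/-- The inclusion of the points of `W` over `F` into those over `N`. -/
noncomputable def constPt : W.toAffine.Point →+ (W.baseChange N).toAffine.Point where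
  toFun P := match P with
    | .zero => .zero
    | .some _ _ h => .some _ _ (nonsingular_algebraMap N h)
  map_zero' := rfl
  map_add' := by
    rintro (_ | ⟨x₁, y₁, h₁⟩) (_ | ⟨x₂, y₂, h₂⟩)
    any_goals rfl
    by_cases hxy : x₁ = x₂ ∧ y₁ = W.toAffine.negY x₂ y₂
    · rw [Affine.Point.add_of_Y_eq hxy.left hxy.right]
      exact (Affine.Point.add_of_Y_eq (congrArg _ hxy.left)
        (by rw [hxy.right]; exact (Affine.map_negY ..).symm)).symm
    · rw [Affine.Point.add_some hxy]
      refine Eq.trans ?_ (Affine.Point.add_some (W := (W.baseChange N).toAffine)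
        fun h ↦ hxy ⟨(algebraMap F N).injective h.1, (algebraMap F N).injective
          (h.2.trans (Affine.map_negY ..))⟩).symm
      refine some_eq_some_iff.2 ?_
      have hs := Affine.map_slope (W := W.toAffine) (algebraMap F N) x₁ x₂ y₁ y₂
      change _ = (W.map (algebraMap F N)).toAffine.addX _ _
        ((W.map (algebraMap F N)).toAffine.slope _ _ _ _) ∧
        _ = (W.map (algebraMap F N)).toAffine.addY _ _ _
        ((W.map (algebraMap F N)).toAffine.slope _ _ _ _)
      rw [hs, Affine.map_addX, Affine.map_addY]
      exact ⟨rfl, rfl⟩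

lemma constPt_some {x y : F} (h : W.toAffine.Nonsingular x y) :
    W.constPt N (.some x y h) = .some (algebraMap F N x) (algebraMap F N y)
      (nonsingular_algebraMap N h) := rfl

lemma constPt_injective : Function.Injective (W.constPt N) := by
  rintro (_ | ⟨x, y, h⟩) (_ | ⟨x', y', h'⟩) he
  · rfl
  · cases he
  · cases he
  · rw [constPt_some, constPt_some] at he
    rw [some_eq_some_iff, (algebraMap F N).injective.eq_iff,
      (algebraMap F N).injective.eq_iff] at he
    simp [he]

/-- The point `P` with coordinates in `N` specializes to `Q` at the place `A`. -/
def Red (A : ValuationSubring N) : (W.baseChange N).toAffine.Point → W.toAffine.Point → Prop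
  | .zero, .zero => True
  | .zero, .some _ _ _ => False
  | .some x _ _, .zero => x ∉ A
  | .some x y _, .some a b _ => HasVal A x a ∧ HasVal A y b

lemma red_const (A : ValuationSubring N) (S : W.toAffine.Point) : Red A (W.constPt N S) S := by
  rcases S with _ | ⟨a, b, h⟩
  · trivial
  · exact ⟨hasVal_algebraMap a, hasVal_algebraMap b⟩

lemma red_zero (A : ValuationSubring N) : Red A (0 : (W.baseChange N).toAffine.Point) 0 := trivial

lemma Red.unique (hA : IsPlace F A) {P : (W.baseChange N).toAffine.Point} {Q R : W.toAffine.Point}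
    (hQ : Red A P Q) (hR : Red A P R) : Q = R := by
  rcases P with _ | ⟨x, y, h⟩ <;> rcases Q with _ | ⟨a, b, hab⟩ <;> rcases R with _ | ⟨c, d, hcd⟩
  · rfl
  · exact hR.elim
  · exact hQ.elim
  · exact hQ.elim
  · rfl
  · exact (hQ (hR.1.mem hA)).elim
  · exact (hR (hQ.1.mem hA)).elim
  · obtain ⟨h1, h2⟩ := hQ
    obtain ⟨h3, h4⟩ := hR
    obtain rfl := h1.unique hA h3
    obtain rfl := h2.unique hA h4
    rfl

section coeff

variable (W A)

lemma hasVal_a₁ : HasVal A (W.baseChange N).a₁ W.a₁ := hasVal_algebraMap _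
lemma hasVal_a₂ : HasVal A (W.baseChange N).a₂ W.a₂ := hasVal_algebraMap _
lemma hasVal_a₃ : HasVal A (W.baseChange N).a₃ W.a₃ := hasVal_algebraMap _
lemma hasVal_a₄ : HasVal A (W.baseChange N).a₄ W.a₄ := hasVal_algebraMap _
lemma hasVal_a₆ : HasVal A (W.baseChange N).a₆ W.a₆ := hasVal_algebraMap _

end coeff

lemma Red.neg (hA : IsPlace F A) {P : (W.baseChange N).toAffine.Point} {Q : W.toAffine.Point}
    (h : Red A P Q) : Red A (-P) (-Q) := by
  rcases P with _ | ⟨x, y, hP⟩ <;> rcases Q with _ | ⟨a, b, hab⟩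
  · trivial
  · exact h.elim
  · exact h
  · rw [Affine.Point.neg_some, Affine.Point.neg_some]
    exact ⟨h.1, (h.2.neg.sub ((hasVal_a₁ W A).mul hA h.1)).sub (hasVal_a₃ W A)⟩

/-- The ordinate is integral over the ring generated by the abscissa. -/
lemma mem_of_equation (hA : IsPlace F A) {x y : N} (h : (W.baseChange N).toAffine.Equation x y)
    (hx : x ∈ A) : y ∈ A := by
  rw [Affine.equation_iff] at h
  by_contra hy
  have hy0 : y ≠ 0 := by rintro rfl; exact hy A.zero_mem
  have hi := hasVal_inv_of_notMem (F := F) hy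
  have hyi := hi.mem hA
  refine hy ?_
  have : y = (x ^ 3 + (W.baseChange N).a₂ * x ^ 2 + (W.baseChange N).a₄ * x +
      (W.baseChange N).a₆) * y⁻¹ - (W.baseChange N).a₁ * x - (W.baseChange N).a₃ := by
    field_simp
    linear_combination h
  rw [this]
  have m1 := hA.algebraMap_mem W.a₁
  have m2 := hA.algebraMap_mem W.a₂
  have m3 := hA.algebraMap_mem W.a₃
  have m4 := hA.algebraMap_mem W.a₄
  have m6 := hA.algebraMap_mem W.a₆
  exact sub_mem (sub_mem (mul_mem (add_mem (add_mem (add_mem (pow_mem hx 3)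
    (mul_mem m2 (pow_mem hx 2))) (mul_mem m4 hx)) m6) hyi) (mul_mem m1 hx)) m3

/-- Every point specializes at every place: the curve is proper. -/
lemma exists_red [W.IsElliptic] (hA : IsPlace F A) (P : (W.baseChange N).toAffine.Point) :
    ∃ Q : W.toAffine.Point, Red A P Q := by
  rcases P with _ | ⟨x, y, h⟩
  · exact ⟨.zero, trivial⟩
  by_cases hx : x ∈ A
  · have hy := mem_of_equation hA h.1 hx
    obtain ⟨a, ha⟩ := hA.exists_value x hx
    obtain ⟨b, hb⟩ := hA.exists_value y hy
    have ha : HasVal A x a := ha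
    have hb : HasVal A y b := hb
    have he : W.toAffine.Equation a b := by
      have h1 := (Affine.equation_iff _ _).1 h.1
      rw [Affine.equation_iff]
      have h2 := ((hb.pow hA 2).add (((hasVal_a₁ W A).mul hA ha).mul hA hb)).add
        ((hasVal_a₃ W A).mul hA hb)
      have h3 := (((ha.pow hA 3).add ((hasVal_a₂ W A).mul hA (ha.pow hA 2))).add
        ((hasVal_a₄ W A).mul hA ha)).add (hasVal_a₆ W A)
      erw [h1] at h2
      exact h2.unique hA h3
    exact ⟨.some a b (Affine.equation_iff_nonsingular.1 he), ha, hb⟩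
  · exact ⟨.zero, hx⟩

/-- Adding a point of the kernel of reduction does not change an affine reduction. -/
lemma Red.add_kernel (hA : IsPlace F A) {P Q : (W.baseChange N).toAffine.Point}
    {S : W.toAffine.Point} (hP : Red A P 0) (hQ : Red A Q S) (hS : S ≠ 0) : Red A (Q + P) S := by
  rcases S with _ | ⟨a, b, hab⟩
  · exact (hS rfl).elim
  rcases Q with _ | ⟨x₂, y₂, hQ'⟩
  · exact hQ.elim
  rcases P with _ | ⟨x, y, hP'⟩
  · rw [← Affine.Point.zero_def, add_zero]; exact hQ
  have hxA : x ∉ A := hP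
  obtain ⟨ha, hb⟩ := hQ
  have hX : x - x₂ ∉ A := fun h ↦ hxA (by simpa using add_mem h (ha.mem hA))
  have hne : x₂ ≠ x := by rintro rfl; exact hX (by simpa using A.zero_mem)
  have hX0 : x - x₂ ≠ 0 := sub_ne_zero.2 hne.symm
  have hi := hasVal_inv_of_notMem (F := F) hX
  rw [Affine.Point.add_of_X_ne hne]
  set ℓ := (W.baseChange N).toAffine.slope x₂ x y₂ y with hℓ
  have hl : ℓ * (x - x₂) = y - y₂ := by
    rw [hℓ, Affine.slope_of_X_ne hne, ← neg_sub x x₂, ← neg_sub y y₂, neg_div_neg_eq,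
      div_mul_cancel₀ _ hX0]
  have e1 := (Affine.equation_iff _ _).1 hP'.1
  have e2 := (Affine.equation_iff _ _).1 hQ'.1
  change HasVal A ((W.baseChange N).toAffine.addX x₂ x ℓ) a ∧
    HasVal A ((W.baseChange N).toAffine.addY x₂ x y₂ ℓ) b
  clear_value ℓ
  obtain rfl : y = ℓ * (x - x₂) + y₂ := by linear_combination -hl
  -- `X` is the difference of the abscissas and `μ = ℓ / X`
  obtain ⟨X, hXd⟩ : ∃ X, X = x - x₂ := ⟨_, rfl⟩
  obtain rfl : x = X + x₂ := by rw [hXd]; ring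
  rw [← hXd] at hX hX0 hi
  obtain ⟨μ, rfl⟩ : ∃ μ, ℓ = μ * X := ⟨ℓ / X, by field_simp⟩
  obtain ⟨u, hu⟩ : ∃ u, u = X⁻¹ := ⟨_, rfl⟩
  have huX : u * X = 1 := by rw [hu]; field_simp
  rw [← hu] at hi
  set ψ := 2 * y₂ + (W.baseChange N).a₁ * x₂ + (W.baseChange N).a₃ with hψ
  set w := 3 * x₂ ^ 2 + 2 * (W.baseChange N).a₂ * x₂ + (W.baseChange N).a₄ -
    (W.baseChange N).a₁ * y₂ with hw
  have vψ : HasVal A ψ _ :=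
    ((hasVal_two.mul hA hb).add ((hasVal_a₁ W A).mul hA ha)).add (hasVal_a₃ W A)
  have vw : HasVal A w _ := (((hasVal_three.mul hA (ha.pow hA 2)).add
    ((hasVal_two.mul hA (hasVal_a₂ W A)).mul hA ha)).add (hasVal_a₄ W A)).sub
      ((hasVal_a₁ W A).mul hA hb)
  have key : X * μ ^ 2 + ((W.baseChange N).a₁ * μ + ψ * u * μ) =
      1 + (3 * x₂ + (W.baseChange N).a₂) * u + w * u ^ 2 := by
    have k2 : X ^ 3 * (X * μ ^ 2 + ((W.baseChange N).a₁ * μ + ψ * u * μ)) =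
      X ^ 3 * (1 + (3 * x₂ + (W.baseChange N).a₂) * u + w * u ^ 2) := by
      rw [hψ, hw]
      linear_combination e1 - e2 + (2 * y₂ + (W.baseChange N).a₁ * x₂ + (W.baseChange N).a₃) * μ *
        X ^ 2 * huX - (3 * x₂ + (W.baseChange N).a₂) * X ^ 2 * huX -
        (3 * x₂ ^ 2 + 2 * (W.baseChange N).a₂ * x₂ + (W.baseChange N).a₄ -
          (W.baseChange N).a₁ * y₂) * X * (u * X + 1) * huX
    exact mul_left_cancel₀ (pow_ne_zero 3 hX0) k2
  have vR : HasVal A (1 + (3 * x₂ + (W.baseChange N).a₂) * u + w * u ^ 2) (1 : F) := by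
    have := (hasVal_one.add (((hasVal_three.mul hA ha).add (hasVal_a₂ W A)).mul hA hi)).add
      (vw.mul hA (hi.pow hA 2))
    convert! this using 1
    ring
  -- otherwise `X * μ ^ 2` dominates the left hand side of `key`, which is a unit
  have vμ : HasVal A μ (0 : F) := by
    rw [hasVal_zero_iff]
    by_contra hμ
    rw [not_lt] at hμ
    rw [← A.valuation_le_one_iff, not_le] at hX
    have h1 : A.valuation ((W.baseChange N).a₁ * μ + ψ * u * μ) ≤ A.valuation μ := by
      rw [← add_mul, map_mul]
      exact mul_le_of_le_one_left' (((hasVal_a₁ W A).add (vψ.mul hA hi)).valuation_le hA)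
    have h2 : A.valuation μ < A.valuation (X * μ ^ 2) := by
      rw [map_mul, map_pow, pow_two, ← mul_assoc]
      have hpos : 0 < A.valuation μ := lt_of_lt_of_le zero_lt_one hμ
      calc A.valuation μ = 1 * A.valuation μ := (one_mul _).symm
        _ < (A.valuation X * A.valuation μ) * A.valuation μ := by
          refine mul_lt_mul_of_pos_right ?_ hpos
          exact one_lt_mul_of_lt_of_le hX hμ
    have h3 := Valuation.map_add_eq_of_lt_left A.valuation (h1.trans_lt h2)
    rw [key, vR.valuation_eq_one hA one_ne_zero] at h3
    exact absurd (hμ.trans_lt h2) (by rw [← h3]; exact lt_irrefl _)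
  have vq : HasVal A (X * μ ^ 2) (1 : F) := by
    have := vR.sub (((hasVal_a₁ W A).mul hA vμ).add ((vψ.mul hA hi).mul hA vμ))
    rw [← key] at this
    convert! this using 1 <;> ring
  have hx3 : (W.baseChange N).toAffine.addX x₂ (X + x₂) (μ * X) = x₂ + w * u - ψ * μ := by
    rw [Affine.addX]
    linear_combination X * key + (- ψ * μ + (3 * x₂ + (W.baseChange N).a₂) + w * u) * huX
  have v3 : HasVal A ((W.baseChange N).toAffine.addX x₂ (X + x₂) (μ * X)) a := by
    rw [hx3]
    convert! (ha.add (vw.mul hA hi)).sub (vψ.mul hA vμ) using 1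
    ring
  refine ⟨v3, ?_⟩
  have hy3 : (W.baseChange N).toAffine.addY x₂ (X + x₂) y₂ (μ * X) =
      ψ * (X * μ ^ 2) - w * μ - y₂ - (W.baseChange N).a₁ *
        (W.baseChange N).toAffine.addX x₂ (X + x₂) (μ * X) - (W.baseChange N).a₃ := by
    rw [Affine.addY, Affine.negAddY, Affine.negY, hx3]
    linear_combination -w * μ * huX
  rw [hy3]
  convert! ((((vψ.mul hA vq).sub (vw.mul hA vμ)).sub hb).sub ((hasVal_a₁ W A).mul hA v3)).sub
    (hasVal_a₃ W A) using 1
  ring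

/-- A point minus (the constant point given by) its reduction lies in the kernel of reduction. -/
lemma Red.sub_const (hA : IsPlace F A) {P : (W.baseChange N).toAffine.Point}
    {S : W.toAffine.Point} (hP : Red A P S) : Red A (P - W.constPt N S) 0 := by
  rcases S with _ | ⟨a, b, hab⟩
  · rw [← Affine.Point.zero_def, map_zero, sub_zero]; exact hP
  rcases P with _ | ⟨x, y, hP'⟩
  · exact hP.elim
  obtain ⟨ha, hb⟩ := hP
  have hS : (W.baseChange N).toAffine.Nonsingular (algebraMap F N a) (algebraMap F N b) :=
    nonsingular_algebraMap N hab
  by_cases hxa : x = algebraMap F N a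
  · have : (.some x y hP' : (W.baseChange N).toAffine.Point) = W.constPt N (.some a b hab) := by
      rw [constPt_some]
      rcases (Affine.Point.X_eq_iff (h₁ := hP') (h₂ := hS)).1 hxa with h | h
      · exact h
      rw [Affine.Point.neg_some] at h
      have hy : y = (W.baseChange N).toAffine.negY (algebraMap F N a) (algebraMap F N b) := by
        simpa [hxa] using h
      have hy' : y = algebraMap F N (W.toAffine.negY a b) := by
        rw [hy]; exact Affine.map_negY ..
      have := hb.unique hA (hy' ▸ hasVal_algebraMap (W.toAffine.negY a b))
      rw [some_eq_some_iff]
      exact ⟨hxa, by rw [hy', ← this]⟩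
    rw [this, sub_self]
    exact red_zero A
  rw [constPt_some, sub_eq_add_neg, Affine.Point.neg_some, Affine.Point.add_of_X_ne hxa]
  set ℓ := (W.baseChange N).toAffine.slope x (algebraMap F N a) y
    ((W.baseChange N).toAffine.negY (algebraMap F N a) (algebraMap F N b)) with hℓ
  change (W.baseChange N).toAffine.addX x (algebraMap F N a) ℓ ∉ A
  have hX0 := sub_ne_zero.2 hxa
  have hl : ℓ * (x - algebraMap F N a) = y + algebraMap F N b +
      (W.baseChange N).a₁ * algebraMap F N a + (W.baseChange N).a₃ := by
    rw [hℓ, Affine.slope_of_X_ne hxa, div_mul_cancel₀ _ hX0, Affine.negY]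
    ring
  have e1 := (Affine.equation_iff _ _).1 hP'.1
  have e2 := (Affine.equation_iff _ _).1 hS.1
  have hℓA : ℓ ∉ A := by
    intro hmem
    obtain ⟨c, hc⟩ := hA.exists_value ℓ hmem
    have hc : HasVal A ℓ c := hc
    have v1 := hc.mul hA (ha.sub (hasVal_algebraMap (A := A) a))
    rw [hl] at v1
    have h1 := v1.unique hA (((hb.add (hasVal_algebraMap b)).add
      ((hasVal_a₁ W A).mul hA (hasVal_algebraMap a))).add (hasVal_a₃ W A))
    have h0 : 2 * b + W.a₁ * a + W.a₃ = 0 := by linear_combination -h1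
    have k : ℓ * (y - algebraMap F N b) = x ^ 2 + x * algebraMap F N a + algebraMap F N a ^ 2 +
        (W.baseChange N).a₂ * (x + algebraMap F N a) + (W.baseChange N).a₄ -
          (W.baseChange N).a₁ * y := by
      refine mul_right_cancel₀ hX0 ?_
      linear_combination (y - algebraMap F N b) * hl + e1 - e2
    have v2 := hc.mul hA (hb.sub (hasVal_algebraMap (A := A) b))
    rw [k] at v2
    have va := hasVal_algebraMap (A := A) (N := N) a
    have h2 := v2.unique hA (((((((ha.pow hA 2).add (ha.mul hA va)).add (va.pow hA 2)).add
      ((hasVal_a₂ W A).mul hA (ha.add va))).add (hasVal_a₄ W A)).sub ((hasVal_a₁ W A).mul hA hb)))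
    rcases ((Affine.nonsingular_iff' _ _).1 hab).2 with hn | hn
    · exact hn (by linear_combination h2)
    · exact hn h0
  intro hmem
  have hi := hasVal_inv_of_notMem (F := F) hℓA
  have hℓ0 : ℓ ≠ 0 := by rintro h; exact hℓA (h ▸ A.zero_mem)
  obtain ⟨d, hd⟩ := hA.exists_value _ hmem
  have hd : HasVal A _ d := hd
  have hii := hi.mul hA hi
  have v := (((hasVal_a₁ W A).mul hA hi).sub ((((hasVal_a₂ W A).add ha).add
    (hasVal_algebraMap a)).mul hA hii)).sub (hd.mul hA hii)
  have : (W.baseChange N).a₁ * ℓ⁻¹ - ((W.baseChange N).a₂ + x + algebraMap F N a) * (ℓ⁻¹ * ℓ⁻¹) -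
      (W.baseChange N).toAffine.addX x (algebraMap F N a) ℓ * (ℓ⁻¹ * ℓ⁻¹) = -1 := by
    rw [Affine.addX]; field_simp; ring
  rw [this] at v
  have := v.unique hA hasVal_one.neg
  simp at this

/-- Specialization at a place is a homomorphism. -/
theorem Red.add [W.IsElliptic] (hA : IsPlace F A) {P Q : (W.baseChange N).toAffine.Point}
    {S T : W.toAffine.Point} (hP : Red A P S) (hQ : Red A Q T) : Red A (P + Q) (S + T) := by
  have hker : ∀ {P Q : (W.baseChange N).toAffine.Point}, Red A P 0 → Red A Q 0 →
      Red A (P + Q) 0 := by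
    intro P Q hP hQ
    obtain ⟨R, hR⟩ := exists_red hA (P + Q)
    by_cases h : R = 0
    · exact h ▸ hR
    have h1 := Red.add_kernel hA (by simpa using hP.neg hA) hR h
    rw [add_neg_cancel_comm] at h1
    exact (h (h1.unique hA hQ)).elim
  have hcoset : ∀ {P : (W.baseChange N).toAffine.Point} {S : W.toAffine.Point},
      Red A P 0 → Red A (W.constPt N S + P) S := by
    intro P S hP
    by_cases h : S = 0
    · rw [h, map_zero, zero_add]; exact hP
    · exact Red.add_kernel hA hP (red_const A S) h
  -- write `P` and `Q` as constant points plus points of the kernel of reduction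
  have := hcoset (S := S + T) (hker (hP.sub_const hA) (hQ.sub_const hA))
  rw [map_add] at this
  convert! this using 1
  abel

lemma Red.sub [W.IsElliptic] (hA : IsPlace F A) {P Q : (W.baseChange N).toAffine.Point}
    {S T : W.toAffine.Point} (hP : Red A P S) (hQ : Red A Q T) : Red A (P - Q) (S - T) := by
  rw [sub_eq_add_neg, sub_eq_add_neg]; exact hP.add hA (hQ.neg hA)

lemma Red.nsmul [W.IsElliptic] (hA : IsPlace F A) {P : (W.baseChange N).toAffine.Point}
    {S : W.toAffine.Point} (hP : Red A P S) (n : ℕ) : Red A (n • P) (n • S) := by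
  induction n with
  | zero => rw [zero_smul, zero_smul]; exact red_zero A
  | succ n ih => rw [succ_nsmul, succ_nsmul]; exact ih.add hA hP

end Reduction

end WeierstrassCurve

/-! ### Places of function fields of one variable -/

namespace WeierstrassCurve

open scoped Classical

section CurveFields

open IntermediateField

variable {F N : Type*} [Field F] [Field N] [Algebra F N]

lemma isAlgebraic_adjoin_of_trdeg_eq_one (hN : Algebra.trdeg F N = 1) {f : N}
    (hf : Transcendental F f) : Algebra.IsAlgebraic F⟮f⟯ N := by
  have h1 : AlgebraicIndependent F (fun _ : Unit => f) :=
    algebraicIndependent_unique_type_iff.2 hf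
  have h2 : IsTranscendenceBasis F (fun _ : Unit => f) :=
    h1.isTranscendenceBasis_of_lift_trdeg_le_of_finite (by simp [hN])
  have h3 := h2.isAlgebraic_field
  rwa [Set.range_const] at h3

lemma exists_transcendental_of_trdeg_eq_one (hN : Algebra.trdeg F N = 1) :
    ∃ f : N, Transcendental F f := by
  by_contra! h
  have : Algebra.IsAlgebraic F N := ⟨fun x => by simpa [Transcendental] using h x⟩
  rw [trdeg_eq_zero] at hN
  exact zero_ne_one hN

lemma isAlgebraic_algebraAdjoin_of_trdeg_eq_one (hN : Algebra.trdeg F N = 1) {f : N}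
    (hf : Transcendental F f) : Algebra.IsAlgebraic (Algebra.adjoin F {f}) N := by
  have h1 : AlgebraicIndependent F (fun _ : Unit => f) :=
    algebraicIndependent_unique_type_iff.2 hf
  have h2 : IsTranscendenceBasis F (fun _ : Unit => f) :=
    h1.isTranscendenceBasis_of_lift_trdeg_le_of_finite (by simp [hN])
  have h3 := h2.isAlgebraic
  rwa [Set.range_const] at h3

variable [IsAlgClosed F]

lemma mem_range_or_transcendental (f : N) :
    (∃ c : F, algebraMap F N c = f) ∨ Transcendental F f := by
  by_cases hf : IsAlgebraic F f
  · left
    exact (IsAlgClosed.algebraMap_bijective_of_isIntegral (k := F) (K := integralClosure F N)).2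
      ⟨f, hf.isIntegral⟩ |>.imp fun c hc => by simpa using congrArg Subtype.val hc
  · exact Or.inr hf

/-- In a function field of one variable over an algebraically closed field, every nontrivial
valuation ring that contains the constants has residue field `F`. -/
lemma isPlace_of_ne_top (hN : Algebra.trdeg F N = 1) {A : ValuationSubring N}
    (hF : ∀ c : F, algebraMap F N c ∈ A) (hA : A ≠ ⊤) : IsPlace F A := by
  refine ⟨hF, fun f hf => ?_⟩
  obtain ⟨c, rfl⟩ | htr := mem_range_or_transcendental (F := F) f
  · exact ⟨c, by simp⟩
  by_contra! hcon
  apply hA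
  -- if `f` has no residue in `F`, then all nonzero polynomials in `f` are units, so `F(f)` and its
  -- integral closure `N` are contained in `A`
  have hunit : ∀ g : F[X], g ≠ 0 → A.valuation (aeval f g) = 1 := by
    intro g hg
    rw [(IsAlgClosed.splits g).eq_prod_roots, map_mul, map_mul]
    have h1 : A.valuation (aeval f (C g.leadingCoeff)) = 1 := by
      rw [aeval_C]
      have h0 : g.leadingCoeff ≠ 0 := by simpa using hg
      refine le_antisymm ((A.valuation_le_one_iff _).2 (hF _)) ?_
      have h := (A.valuation_le_one_iff _).2 (hF g.leadingCoeff⁻¹)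
      rw [map_inv₀, map_inv₀] at h
      have h0' : A.valuation (algebraMap F N g.leadingCoeff) ≠ 0 := by simpa using hg
      exact (inv_le_one₀ (zero_lt_iff.2 h0')).1 h
    rw [h1, one_mul, map_multiset_prod, map_multiset_prod, Multiset.map_map, Multiset.map_map]
    apply Multiset.prod_eq_one
    intro v hv
    obtain ⟨c, _, rfl⟩ := Multiset.mem_map.1 hv
    simp only [Function.comp_apply, map_sub, aeval_X, aeval_C]
    refine le_antisymm ?_ (hcon c)
    exact (A.valuation_le_one_iff _).2 (sub_mem hf (hF c))
  have hsub : ∀ z ∈ F⟮f⟯, z ∈ A := by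
    intro z hz
    obtain ⟨r, s, rfl⟩ := (mem_adjoin_simple_iff F z).1 hz
    by_cases hs : s = 0
    · simp [hs, A.zero_mem]
    by_cases hr : r = 0
    · simp [hr, A.zero_mem]
    rw [← A.valuation_le_one_iff, map_div₀, hunit r hr, hunit s hs, div_one]
  have halg := isAlgebraic_adjoin_of_trdeg_eq_one hN htr
  rw [eq_top_iff]
  intro z _
  obtain ⟨q, hq, hz⟩ := (halg.isAlgebraic z).isIntegral
  let i : F⟮f⟯ →+* A :=
    { toFun := fun z => ⟨z.1, hsub z.1 z.2⟩
      map_one' := rfl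
      map_mul' := fun _ _ => rfl
      map_zero' := rfl
      map_add' := fun _ _ => rfl }
  have hz' : _root_.IsIntegral A z := by
    refine ⟨q.map i, hq.map _, ?_⟩
    rw [eval₂_map]
    exact hz
  obtain ⟨w, hw⟩ := IsIntegrallyClosed.isIntegral_iff.1 hz'
  rw [← hw]
  exact w.2

/-- A proper ideal of a subalgebra is centred at some place. -/
lemma exists_isPlace (hN : Algebra.trdeg F N = 1) (B : Subalgebra F N) (I : Ideal B)
    (hI : I ≠ ⊤) (hI0 : I ≠ ⊥) :
    ∃ A : ValuationSubring N, IsPlace F A ∧ (∀ b ∈ B, b ∈ A) ∧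
      ∀ b ∈ I, HasVal A (b : N) (0 : F) := by
  obtain ⟨A, hBA, hA⟩ := Ideal.image_subset_nonunits_valuationSubring (A := B.toSubring) I hI
  have hval : ∀ b ∈ I, HasVal A (b : N) (0 : F) := by
    intro b hb
    rw [hasVal_zero_iff]
    exact (A.mem_nonunits_iff).1 (hA ⟨b, hb, rfl⟩)
  refine ⟨A, isPlace_of_ne_top hN (fun c => hBA (B.algebraMap_mem c)) ?_, fun b hb => hBA hb, hval⟩
  rintro rfl
  obtain ⟨b, hb, hb0⟩ := Submodule.exists_mem_ne_zero_of_ne_bot hI0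
  have h := hval b hb
  have hb0' : (b : N) ≠ 0 := fun h => hb0 (Subtype.ext h)
  have h2 : (b : N)⁻¹ ∉ (⊤ : ValuationSubring N) := by
    apply notMem_of_hasVal_inv (F := F) (inv_ne_zero hb0')
    rwa [inv_inv]
  exact h2 trivial

lemma exists_isPlace_hasVal (hN : Algebra.trdeg F N = 1) {f : N} (hf : Transcendental F f)
    (c : F) : ∃ A : ValuationSubring N, IsPlace F A ∧ HasVal A f c := by
  let B := Algebra.adjoin F {f}
  let g : B := ⟨f, Algebra.self_mem_adjoin_singleton F f⟩ - algebraMap F B c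
  have hg : (g : N) = f - algebraMap F N c := rfl
  have hfc : Transcendental F (f - algebraMap F N c) := by
    intro h
    apply hf
    simpa using h.add (isAlgebraic_algebraMap (A := N) c)
  have hI : Ideal.span {g} ≠ ⊤ := by
    rw [Ne, Ideal.span_singleton_eq_top]
    rintro ⟨u, hu⟩
    have hinv : (u : N) * ((u⁻¹ : Bˣ) : B) = 1 := by
      rw [← MulMemClass.coe_mul]; simp
    obtain ⟨q, hq⟩ : ∃ q : F[X], aeval f q = (((u⁻¹ : Bˣ) : B) : N) := by
      have := ((u⁻¹ : Bˣ) : B).2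
      simp only [B, Algebra.adjoin_singleton_eq_range_aeval] at this
      exact this
    rw [hu, hg, ← hq] at hinv
    have h0 : aeval f ((X - C c) * q - 1) = 0 := by simp [hinv]
    have h1 := (transcendental_iff.1 hf) _ h0
    have h2 := congrArg (eval c) h1
    simp at h2
  have hI0 : Ideal.span {g} ≠ ⊥ := by
    rw [Ne, Ideal.span_singleton_eq_bot]
    intro h
    have : (g : N) = 0 := by rw [h]; rfl
    rw [hg] at this
    rw [this] at hfc
    exact hfc isAlgebraic_zero
  obtain ⟨A, hA, -, h⟩ := exists_isPlace hN B (Ideal.span {g}) hI hI0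
  refine ⟨A, hA, ?_⟩
  have := h g (Ideal.mem_span_singleton_self g)
  rw [hg, hasVal_zero_iff] at this
  exact this

/-- An element that is regular at all places is constant. -/
lemma mem_range_of_forall_place (hN : Algebra.trdeg F N = 1) {f : N}
    (hf : ∀ A : ValuationSubring N, IsPlace F A → f ∈ A) : ∃ c : F, algebraMap F N c = f := by
  obtain h | h := mem_range_or_transcendental (F := F) f
  · exact h
  exfalso
  have hinv : Transcendental F f⁻¹ := fun h' => h (by simpa using h'.inv)
  obtain ⟨A, hA, hv⟩ := exists_isPlace_hasVal hN hinv 0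
  refine notMem_of_hasVal_inv ?_ hv (hf A hA)
  rintro rfl
  exact h isAlgebraic_zero

lemma exists_isPlace_of_trdeg_eq_one (hN : Algebra.trdeg F N = 1) :
    ∃ A : ValuationSubring N, IsPlace F A := by
  obtain ⟨f, hf⟩ := exists_transcendental_of_trdeg_eq_one hN
  obtain ⟨A, hA, -⟩ := exists_isPlace_hasVal hN hf 0
  exact ⟨A, hA⟩

end CurveFields

section LocalRing

open IntermediateField

variable {F N : Type*} [Field F] [Field N] [Algebra F N] {A : ValuationSubring N} {u v : N}

lemma exists_decomp_of_mem_adjoin {g : N} (hg : g ∈ Algebra.adjoin F {u, v}) :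
    ∃ c : F, ∃ g₁ ∈ Algebra.adjoin F {u, v}, ∃ g₂ ∈ Algebra.adjoin F {u, v},
      g = algebraMap F N c + u * g₁ + v * g₂ := by
  have hu : u ∈ Algebra.adjoin F {u, v} := Algebra.subset_adjoin (by simp)
  have hv : v ∈ Algebra.adjoin F {u, v} := Algebra.subset_adjoin (by simp)
  induction hg using Algebra.adjoin_induction with
  | mem z hz =>
    obtain rfl | rfl : z = u ∨ z = v := by simpa using hz
    · exact ⟨0, 1, one_mem _, 0, zero_mem _, by simp⟩
    · exact ⟨0, 0, zero_mem _, 1, one_mem _, by simp⟩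
  | algebraMap c => exact ⟨c, 0, zero_mem _, 0, zero_mem _, by simp⟩
  | add a b _ _ ha hb =>
    obtain ⟨c, a₁, h₁, a₂, h₂, rfl⟩ := ha
    obtain ⟨d, b₁, k₁, b₂, k₂, rfl⟩ := hb
    exact ⟨c + d, _, add_mem h₁ k₁, _, add_mem h₂ k₂, by rw [map_add]; ring⟩
  | mul a b ha' hb' ha hb =>
    obtain ⟨c, a₁, h₁, a₂, h₂, ea⟩ := ha
    obtain ⟨d, b₁, k₁, b₂, k₂, eb⟩ := hb
    refine ⟨c * d, algebraMap F N c * b₁ + a₁ * b, ?_, algebraMap F N c * b₂ + a₂ * b, ?_, ?_⟩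
    · exact add_mem (mul_mem (Subalgebra.algebraMap_mem _ _) k₁) (mul_mem h₁ hb')
    · exact add_mem (mul_mem (Subalgebra.algebraMap_mem _ _) k₂) (mul_mem h₂ hb')
    · rw [map_mul]
      nth_rewrite 1 [ea]
      rw [add_mul, add_mul]
      nth_rewrite 1 [eb]
      ring

lemma hasVal_of_mem_adjoin (hA : IsPlace F A) (hu : HasVal A u (0 : F)) (hv : HasVal A v (0 : F))
    {c : F} {g₁ g₂ : N} (h₁ : g₁ ∈ Algebra.adjoin F {u, v}) (h₂ : g₂ ∈ Algebra.adjoin F {u, v}) :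
    HasVal A (algebraMap F N c + u * g₁ + v * g₂) c := by
  have hBA : ∀ b ∈ Algebra.adjoin F {u, v}, b ∈ A := by
    intro b hb
    induction hb using Algebra.adjoin_induction with
    | mem z hz =>
      obtain rfl | rfl : z = u ∨ z = v := by simpa using hz
      · exact hu.mem hA
      · exact hv.mem hA
    | algebraMap c => exact hA.algebraMap_mem c
    | add a b _ _ ha hb => exact A.add_mem _ _ ha hb
    | mul a b _ _ ha hb => exact A.mul_mem _ _ ha hb
  simpa using ((hasVal_algebraMap c).add (hA.hasVal_mul_zero hu (hBA _ h₁))).add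
    (hA.hasVal_mul_zero hv (hBA _ h₂))

/-- `u`, `v` are local parameters at `A`: they vanish there, generate the field, and `u` divides
`v` in the localization of `F[u, v]` at the origin. -/
structure IsLocalParam (F : Type*) {N : Type*} [Field F] [Field N] [Algebra F N]
    (A : ValuationSubring N) (u v : N) : Prop where
  left : HasVal A u (0 : F)
  right : HasVal A v (0 : F)
  gen : ∀ f : N, ∃ g ∈ Algebra.adjoin F {u, v}, ∃ h ∈ Algebra.adjoin F {u, v}, h ≠ 0 ∧ f = g / h
  dvd : ∃ d ∈ Algebra.adjoin F {u, v}, ∃ e ∈ Algebra.adjoin F {u, v}, ∃ c : F, c ≠ 0 ∧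
    HasVal A e c ∧ v * e = u * d
  transcendental : Transcendental F u

/-- No nonzero element vanishes to infinite order along `u`, since `N` is algebraic over `F(u)`. -/
lemma IsLocalParam.exists_bound (hN : Algebra.trdeg F N = 1) (hA : IsPlace F A)
    (h : IsLocalParam F A u v) {r : N} (hr0 : r ≠ 0) :
    ∃ k : ℕ, A.valuation u ^ k ≤ A.valuation r := by
  have halg := isAlgebraic_algebraAdjoin_of_trdeg_eq_one hN h.transcendental
  obtain ⟨y, hy0, hy⟩ := (halg.isAlgebraic r⁻¹).exists_integral_multiple
  have hsub : ∀ b ∈ Algebra.adjoin F {u}, b ∈ A := by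
    intro b hb
    induction hb using Algebra.adjoin_induction with
    | mem z hz =>
      obtain rfl : z = u := by simpa using hz
      exact h.left.mem hA
    | algebraMap c => exact hA.algebraMap_mem c
    | add a b _ _ ha hb => exact A.add_mem _ _ ha hb
    | mul a b _ _ ha hb => exact A.mul_mem _ _ ha hb
  have hmem : (y : N) * r⁻¹ ∈ A := by
    obtain ⟨q, hq, hz⟩ := hy
    let i : Algebra.adjoin F {u} →+* A :=
      { toFun := fun z => ⟨z.1, hsub z.1 z.2⟩
        map_one' := rfl
        map_mul' := fun _ _ => rfl
        map_zero' := rfl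
        map_add' := fun _ _ => rfl }
    have hz' : _root_.IsIntegral A ((y : N) * r⁻¹) := by
      refine ⟨q.map i, hq.map _, ?_⟩
      rw [eval₂_map]
      exact hz
    obtain ⟨w, hw⟩ := IsIntegrallyClosed.isIntegral_iff.1 hz'
    rw [← hw]
    exact w.2
  obtain ⟨q, hq⟩ : ∃ q : F[X], aeval u q = (y : N) := by
    have := y.2
    simp only [Algebra.adjoin_singleton_eq_range_aeval F u] at this
    exact this
  have hq0 : q ≠ 0 := by
    rintro rfl
    exact hy0 (Subtype.ext (by rw [← hq]; simp))
  obtain ⟨q', hqq, hq'⟩ := exists_eq_pow_rootMultiplicity_mul_and_not_dvd q hq0 0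
  refine ⟨rootMultiplicity 0 q, ?_⟩
  have hval : ∀ g : F[X], HasVal A (aeval u g) (eval 0 g) := by
    intro g
    induction g using Polynomial.induction_on' with
    | add a b ha hb => simpa using ha.add hb
    | monomial n a =>
      have := (hasVal_algebraMap a).mul hA (h.left.pow hA n)
      simpa [aeval_monomial] using this
  have h1 : A.valuation (aeval u q') = 1 := by
    refine (hval q').valuation_eq_one hA ?_
    rw [dvd_iff_isRoot] at hq'
    exact hq'
  have h2 : A.valuation (y : N) = A.valuation u ^ rootMultiplicity 0 q := by
    rw [← hq]
    conv_lhs => rw [hqq]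
    rw [map_mul, map_mul, h1, mul_one]
    simp
  rw [← h2]
  rw [← A.valuation_le_one_iff, map_mul, map_inv₀] at hmem
  have hr0' : 0 < A.valuation r := by
    rw [zero_lt_iff]; simpa using hr0
  rwa [← div_eq_mul_inv, div_le_one₀ hr0'] at hmem

/-- Every element is a power of the first local parameter times a unit that is a quotient of
polynomials in the local parameters. -/
lemma IsLocalParam.exists_eq (hN : Algebra.trdeg F N = 1) (hA : IsPlace F A)
    (h : IsLocalParam F A u v) {f : N} (hf : f ≠ 0) :
    ∃ k : ℤ, ∃ g ∈ Algebra.adjoin F {u, v}, ∃ e ∈ Algebra.adjoin F {u, v}, ∃ a b : F,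
      a ≠ 0 ∧ b ≠ 0 ∧ HasVal A g a ∧ HasVal A e b ∧ f = u ^ k * (g / e) := by
  have hu0 : u ≠ 0 := fun h0 => h.transcendental (h0 ▸ isAlgebraic_zero)
  have humem : u ∈ Algebra.adjoin F {u, v} := Algebra.subset_adjoin (by simp)
  have key : ∀ r ∈ Algebra.adjoin F {u, v}, r ≠ 0 →
      ∃ k : ℕ, ∃ g ∈ Algebra.adjoin F {u, v}, ∃ e ∈ Algebra.adjoin F {u, v}, ∃ a b : F,
      a ≠ 0 ∧ b ≠ 0 ∧ HasVal A g a ∧ HasVal A e b ∧ r = u ^ k * (g / e) := by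
    intro r hr hr0
    obtain ⟨d, hd, e, he, c, hc, hec, hve⟩ := h.dvd
    -- as long as the numerator vanishes at the origin, a factor `u` splits off, at the cost of a
    -- unit `e`; by `exists_bound`, this ends
    have step : ∀ n : ℕ, (∃ k : ℕ, ∃ g ∈ Algebra.adjoin F {u, v},
        ∃ e ∈ Algebra.adjoin F {u, v}, ∃ a b : F,
        a ≠ 0 ∧ b ≠ 0 ∧ HasVal A g a ∧ HasVal A e b ∧ r = u ^ k * (g / e)) ∨
        (∃ g ∈ Algebra.adjoin F {u, v}, r * e ^ n = u ^ n * g) := by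
      intro n
      induction n with
      | zero => exact Or.inr ⟨r, hr, by simp⟩
      | succ n ih =>
        obtain ih | ⟨g, hg, hrg⟩ := ih
        · exact Or.inl ih
        obtain ⟨c', g₁, h₁, g₂, h₂, rfl⟩ := exists_decomp_of_mem_adjoin hg
        have he0 : e ≠ 0 := by
          rintro rfl
          exact hc (hec.unique hA hasVal_zero)
        by_cases hc' : c' = 0
        · right
          refine ⟨g₁ * e + d * g₂, add_mem (mul_mem h₁ he) (mul_mem hd h₂), ?_⟩
          subst hc'
          rw [pow_succ, ← mul_assoc, hrg, map_zero]
          linear_combination (u ^ n * g₂) * hve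
        · left
          refine ⟨n, _, hg, e ^ n, pow_mem he n, c', c ^ n, hc', pow_ne_zero _ hc,
            hasVal_of_mem_adjoin hA h.left h.right h₁ h₂, hec.pow hA n, ?_⟩
          rw [← mul_div_assoc, ← hrg, mul_div_cancel_right₀ _ (pow_ne_zero _ he0)]
    obtain ⟨k, hk⟩ := h.exists_bound hN hA hr0
    obtain h1 | ⟨g, hg, hrg⟩ := step (k + 1)
    · exact h1
    exfalso
    obtain ⟨c', g₁, h₁, g₂, h₂, rfl⟩ := exists_decomp_of_mem_adjoin hg
    have hgv := (hasVal_of_mem_adjoin hA h.left h.right (c := c') h₁ h₂).valuation_le hA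
    have h3 := congrArg A.valuation hrg
    rw [map_mul, map_mul, map_pow, map_pow, hec.valuation_eq_one hA hc, one_pow, mul_one] at h3
    have hu1 : A.valuation u < 1 := hasVal_zero_iff.1 h.left
    have hupos : 0 < A.valuation u := by rw [zero_lt_iff]; simpa using hu0
    rw [h3] at hk
    have h4 : A.valuation u ^ (k + 1) < A.valuation u ^ k :=
      pow_lt_pow_right_of_lt_one₀ hupos hu1 (by simp)
    have h5 := mul_le_of_le_one_right (zero_le (a := A.valuation u ^ (k+1))) hgv
    exact absurd (hk.trans h5) (not_le.2 h4)
  obtain ⟨g, hg, d, hd, hd0, rfl⟩ := h.gen f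
  have hg0 : g ≠ 0 := by rintro rfl; simp at hf
  obtain ⟨k, g₁, hg₁, e₁, he₁, a₁, b₁, ha₁, hb₁, hga₁, heb₁, rfl⟩ := key g hg hg0
  obtain ⟨l, g₂, hg₂, e₂, he₂, a₂, b₂, ha₂, hb₂, hga₂, heb₂, rfl⟩ := key d hd hd0
  refine ⟨k - l, g₁ * e₂, mul_mem hg₁ he₂, e₁ * g₂, mul_mem he₁ hg₂, a₁ * b₂, b₁ * a₂,
    mul_ne_zero ha₁ hb₂, mul_ne_zero hb₁ ha₂, hga₁.mul hA heb₂, heb₁.mul hA hga₂, ?_⟩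
  rw [zpow_sub₀ hu0, zpow_natCast, zpow_natCast]
  simp only [div_eq_mul_inv, mul_inv, inv_inv]
  ring

/-- The place is the localization of `F[u, v]` at the origin. -/
lemma IsLocalParam.exists_div (hN : Algebra.trdeg F N = 1) (hA : IsPlace F A)
    (h : IsLocalParam F A u v) {f : N} (hf : f ∈ A) :
    ∃ g ∈ Algebra.adjoin F {u, v}, ∃ e ∈ Algebra.adjoin F {u, v}, ∃ b : F,
      b ≠ 0 ∧ HasVal A e b ∧ f = g / e := by
  have hu0 : u ≠ 0 := fun h0 => h.transcendental (h0 ▸ isAlgebraic_zero)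
  by_cases hf0 : f = 0
  · exact ⟨0, zero_mem _, 1, one_mem _, 1, one_ne_zero, hasVal_one, by simp [hf0]⟩
  obtain ⟨k, g, hg, e, he, a, b, ha, hb, hga, heb, rfl⟩ := h.exists_eq hN hA hf0
  have humem : u ∈ Algebra.adjoin F {u, v} := Algebra.subset_adjoin (by simp)
  obtain ⟨n, rfl⟩ : ∃ n : ℕ, k = n := by
    refine Int.eq_ofNat_of_zero_le ?_
    by_contra! hk
    obtain ⟨m, rfl⟩ := Int.exists_eq_neg_ofNat hk.le
    rw [← A.valuation_le_one_iff, map_mul, map_zpow₀, map_div₀, hga.valuation_eq_one hA ha,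
      heb.valuation_eq_one hA hb, div_one, mul_one, zpow_neg, zpow_natCast] at hf
    have hu1 : A.valuation u < 1 := hasVal_zero_iff.1 h.left
    have hupos : 0 < A.valuation u := by rw [zero_lt_iff]; simpa using hu0
    rw [inv_le_one₀ (pow_pos hupos m)] at hf
    exact absurd hf (not_le.2 (pow_lt_one₀ zero_le hu1 (by omega)))
  exact ⟨u ^ n * g, mul_mem (pow_mem humem n) hg, e, he, b, hb, heb, by
    rw [zpow_natCast, mul_div_assoc]⟩

/-- A place is determined by local parameters and the fact that they vanish there. -/
lemma IsLocalParam.le (hN : Algebra.trdeg F N = 1) (hA : IsPlace F A) {A' : ValuationSubring N}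
    (hA' : IsPlace F A') (h : IsLocalParam F A u v) (hu : HasVal A' u (0 : F))
    (hv : HasVal A' v (0 : F)) : A ≤ A' := by
  intro f hf
  obtain ⟨g, hg, e, he, b, hb, heb, rfl⟩ := h.exists_div hN hA hf
  obtain ⟨c₁, g₁, h₁, g₂, h₂, rfl⟩ := exists_decomp_of_mem_adjoin hg
  obtain ⟨c₂, e₁, k₁, e₂, k₂, rfl⟩ := exists_decomp_of_mem_adjoin he
  have h2 := hasVal_of_mem_adjoin hA h.left h.right (c := c₂) k₁ k₂
  obtain rfl := h2.unique hA heb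
  have h3 := hasVal_of_mem_adjoin hA' hu hv (c := c₂) k₁ k₂
  have h4 := hasVal_of_mem_adjoin hA' hu hv (c := c₁) h₁ h₂
  exact (h4.div hA' h3 hb).mem hA'

end LocalRing

end WeierstrassCurve

/-! ### The function field of a Weierstrass curve -/

namespace WeierstrassCurve

open scoped Classical

section FunctionField

open IntermediateField
open scoped IntermediateField.algebraAdjoinAdjoin

variable {F : Type*} [Field F] (W : WeierstrassCurve F)

lemma eval₂_polynomial {N : Type*} [Field N] [Algebra F N] (x y : N) :
    W.toAffine.polynomial.eval₂ (aeval x : F[X] →ₐ[F] N).toRingHom y =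
      y ^ 2 + algebraMap F _ W.a₁ * x * y + algebraMap F _ W.a₃ * y -
      (x ^ 3 + algebraMap F _ W.a₂ * x ^ 2 + algebraMap F _ W.a₄ * x + algebraMap F _ W.a₆) := by
  rw [Affine.polynomial]
  simp only [eval₂_sub, eval₂_add, eval₂_mul, eval₂_pow, eval₂_X, eval₂_C, map_add, map_mul,
      map_pow, AlgHom.toRingHom_eq_coe, RingHom.coe_coe, aeval_X, aeval_C]
  ring

lemma algebraMap_mk (q : F[X][X]) :
    algebraMap W.toAffine.CoordinateRing W.RationalFunction (Affine.CoordinateRing.mk W.toAffine q)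
      = q.eval₂ (aeval W.xFunction : F[X] →ₐ[F] W.RationalFunction).toRingHom W.yFunction := by
  have hc : ∀ c : F, algebraMap W.toAffine.CoordinateRing W.RationalFunction
      (Affine.CoordinateRing.mk W.toAffine (C (C c))) = algebraMap F W.RationalFunction c := by
    intro c
    rw [IsScalarTower.algebraMap_apply F W.toAffine.CoordinateRing W.RationalFunction]
    rfl
  have : (algebraMap W.toAffine.CoordinateRing W.RationalFunction).comp
      (Affine.CoordinateRing.mk W.toAffine) =
      eval₂RingHom (aeval W.xFunction : F[X] →ₐ[F] W.RationalFunction).toRingHom W.yFunction := by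
    apply Polynomial.ringHom_ext'
    · apply Polynomial.ringHom_ext
      · intro a
        exact (hc a).trans (by simp)
      · simp [xFunction]
    · simp [yFunction]
  exact congrArg (fun f => f q) this

lemma equation_generic :
    (W.baseChange W.RationalFunction).toAffine.Equation W.xFunction W.yFunction := by
  have h : Affine.CoordinateRing.mk W.toAffine W.toAffine.polynomial = 0 := AdjoinRoot.mk_self
  have h2 := W.algebraMap_mk W.toAffine.polynomial
  rw [show algebraMap W.toAffine.CoordinateRing W.RationalFunction
    (Affine.CoordinateRing.mk W.toAffine W.toAffine.polynomial) = 0 by rw [h, map_zero],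
    W.eval₂_polynomial] at h2
  rw [Affine.equation_iff]
  change W.yFunction ^ 2 + algebraMap F _ W.a₁ * W.xFunction * W.yFunction +
    algebraMap F _ W.a₃ * W.yFunction = W.xFunction ^ 3 + algebraMap F _ W.a₂ * W.xFunction ^ 2 +
    algebraMap F _ W.a₄ * W.xFunction + algebraMap F _ W.a₆
  linear_combination -h2

lemma transcendental_xFunction : Transcendental F W.xFunction := by
  rw [transcendental_iff]
  intro p hp
  have h := W.algebraMap_mk (C p)
  rw [eval₂_C] at h
  have h2 : algebraMap W.toAffine.CoordinateRing W.RationalFunction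
      (Affine.CoordinateRing.mk W.toAffine (C p)) = 0 := h.trans hp
  have h3 : Affine.CoordinateRing.mk W.toAffine (C p) = 0 :=
    IsFractionRing.injective W.toAffine.CoordinateRing W.RationalFunction (by rw [h2, map_zero])
  have h4 := Affine.CoordinateRing.smul_basis_eq_zero (W' := W.toAffine) (p := p) (q := 0)
    (by rw [zero_smul, add_zero, Affine.CoordinateRing.smul, mul_one, h3])
  exact h4.1

variable {W}
variable {N : Type*} [Field N] [Algebra F N]

/-- A point with transcendental first coordinate induces an embedding of the function field. -/
lemma exists_algHom {x y : N} (h : (W.baseChange N).toAffine.Equation x y)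
    (hx : Transcendental F x) :
    ∃ α : W.RationalFunction →ₐ[F] N, α W.xFunction = x ∧ α W.yFunction = y := by
  let i : F[X] →ₐ[F] N := aeval x
  have he : W.toAffine.polynomial.eval₂ (i : F[X] →+* N) y = 0 := by
    rw [Affine.equation_iff] at h
    change y ^ 2 + algebraMap F _ W.a₁ * x * y + algebraMap F _ W.a₃ * y =
      x ^ 3 + algebraMap F _ W.a₂ * x ^ 2 + algebraMap F _ W.a₄ * x + algebraMap F _ W.a₆ at h
    exact (W.eval₂_polynomial x y).trans (sub_eq_zero.2 h)
  let β : W.toAffine.CoordinateRing →ₐ[F] N := AdjoinRoot.liftAlgHom _ i y he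
  have hβ : Function.Injective β := by
    change Function.Injective (β : W.toAffine.CoordinateRing →+* N)
    rw [RingHom.injective_iff_ker_eq_bot]
    have : Algebra.IsIntegral F[X] W.toAffine.CoordinateRing := by
      have : Module.Finite F[X] W.toAffine.CoordinateRing :=
        Module.Finite.of_basis (Affine.CoordinateRing.basis W.toAffine)
      infer_instance
    refine Ideal.eq_bot_of_comap_eq_bot (R := F[X]) ?_
    rw [eq_bot_iff]
    intro p hp
    have h1 : i p = 0 := by
      have h2 : β (algebraMap F[X] W.toAffine.CoordinateRing p) = 0 := hp
      rwa [show algebraMap F[X] W.toAffine.CoordinateRing p = AdjoinRoot.of _ p from rfl,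
        AdjoinRoot.liftAlgHom_of] at h2
    exact transcendental_iff.1 hx _ h1
  refine ⟨IsFractionRing.liftAlgHom hβ, ?_, ?_⟩
  · rw [xFunction, IsFractionRing.liftAlgHom_apply, IsFractionRing.lift_algebraMap]
    change β (AdjoinRoot.of _ X) = x
    rw [AdjoinRoot.liftAlgHom_of]
    simp [i]
  · rw [yFunction, IsFractionRing.liftAlgHom_apply, IsFractionRing.lift_algebraMap]
    change β (AdjoinRoot.root _) = y
    rw [AdjoinRoot.liftAlgHom_root]

lemma exists_eq_div (f : W.RationalFunction) :
    ∃ g ∈ Algebra.adjoin F {W.xFunction, W.yFunction},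
      ∃ h ∈ Algebra.adjoin F {W.xFunction, W.yFunction}, h ≠ 0 ∧ f = g / h := by
  have hmem : ∀ r : W.toAffine.CoordinateRing, algebraMap _ W.RationalFunction r ∈
      Algebra.adjoin F {W.xFunction, W.yFunction} := by
    intro r
    obtain ⟨q, rfl⟩ := AdjoinRoot.mk_surjective r
    have h := W.algebraMap_mk q
    refine (show _ = _ from h) ▸ ?_
    rw [eval₂_eq_sum_range]
    refine sum_mem fun n _ => mul_mem ?_ (pow_mem (Algebra.subset_adjoin (by simp)) n)
    change aeval W.xFunction (q.coeff n) ∈ _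
    rw [aeval_eq_sum_range]
    exact sum_mem fun n _ => Subalgebra.smul_mem _
      (pow_mem (Algebra.subset_adjoin (by simp)) n) _
  obtain ⟨a, b, hb, rfl⟩ := IsFractionRing.div_surjective (A := W.toAffine.CoordinateRing) f
  refine ⟨_, hmem a, _, hmem b, ?_, rfl⟩
  simpa using nonZeroDivisors.ne_zero hb

lemma algHom_ext {α β : W.RationalFunction →ₐ[F] N} (hx : α W.xFunction = β W.xFunction)
    (hy : α W.yFunction = β W.yFunction) : α = β := by
  have h1 : ∀ g ∈ Algebra.adjoin F {W.xFunction, W.yFunction}, α g = β g := by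
    intro g hg
    have : Algebra.adjoin F {W.xFunction, W.yFunction} ≤ AlgHom.equalizer α β := by
      rw [Algebra.adjoin_le_iff]
      rintro z (rfl | rfl)
      exacts [hx, hy]
    exact this hg
  refine AlgHom.ext fun f => ?_
  obtain ⟨g, hg, h, hh, -, rfl⟩ := exists_eq_div f
  rw [map_div₀, map_div₀, h1 g hg, h1 h hh]

lemma isIntegral_adjoin_of_equation {x y : N} (h : (W.baseChange N).toAffine.Equation x y) :
    _root_.IsIntegral F⟮x⟯ y := by
  rw [Affine.equation_iff] at h
  change y ^ 2 + algebraMap F _ W.a₁ * x * y + algebraMap F _ W.a₃ * y =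
    x ^ 3 + algebraMap F _ W.a₂ * x ^ 2 + algebraMap F _ W.a₄ * x + algebraMap F _ W.a₆ at h
  have hx : algebraMap F⟮x⟯ N (AdjoinSimple.gen F x) = x := AdjoinSimple.algebraMap_gen F x
  set t := AdjoinSimple.gen F x
  refine ⟨X ^ 2 + (C (algebraMap F _ W.a₁ * t + algebraMap F _ W.a₃) * X +
    C (-(t ^ 3 + algebraMap F _ W.a₂ * t ^ 2 + algebraMap F _ W.a₄ * t + algebraMap F _ W.a₆))),
    ?_, ?_⟩
  · apply monic_X_pow_add
    compute_degree!
  · rw [C_neg]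
    simp only [eval₂_neg, eval₂_add, eval₂_mul, eval₂_pow, eval₂_X, eval₂_C, map_add, map_mul,
      map_pow, hx, ← IsScalarTower.algebraMap_apply]
    linear_combination h

lemma adjoin_xFunction_yFunction : (⊤ : IntermediateField F W.RationalFunction) =
    IntermediateField.adjoin F {W.xFunction, W.yFunction} := by
  symm
  rw [eq_top_iff]
  intro f _
  obtain ⟨g, hg, h, hh, -, rfl⟩ := exists_eq_div f
  have hle := IntermediateField.algebra_adjoin_le_adjoin F {W.xFunction, W.yFunction}
  exact div_mem (hle hg) (hle hh)

lemma adjoin_yFunction_eq_top : F⟮W.xFunction⟯⟮W.yFunction⟯ = ⊤ := by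
  rw [← IntermediateField.restrictScalars_eq_top_iff (K := F),
    IntermediateField.adjoin_simple_adjoin_simple]
  exact adjoin_xFunction_yFunction.symm

instance : Module.Finite F⟮W.xFunction⟯ W.RationalFunction := by
  have h := (isIntegral_adjoin_of_equation W.equation_generic)
  have h2 := IntermediateField.adjoin.finiteDimensional h
  rw [adjoin_yFunction_eq_top] at h2
  exact Module.Finite.equiv (IntermediateField.topEquiv (F := F⟮W.xFunction⟯)
    (E := W.RationalFunction)).toLinearEquiv

lemma trdeg_eq_one_of_isAlgebraic {f : N} (hf : Transcendental F f)
    (h : Algebra.IsAlgebraic F⟮f⟯ N) : Algebra.trdeg F N = 1 := by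
  have h1 : AlgebraicIndependent F (fun _ : Unit => f) :=
    algebraicIndependent_unique_type_iff.2 hf
  have h2 : IsTranscendenceBasis F (fun _ : Unit => f) := by
    rw [h1.isTranscendenceBasis_iff_isAlgebraic, Set.range_const]
    exact (IsFractionRing.comap_isAlgebraic_iff (A := Algebra.adjoin F {f}) (K := F⟮f⟯)).2 h
  have h3 := h2.lift_cardinalMk_eq_trdeg
  simpa using h3.symm

variable (W) in
lemma trdeg_rationalFunction : Algebra.trdeg F W.RationalFunction = 1 :=
  trdeg_eq_one_of_isAlgebraic W.transcendental_xFunction inferInstance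

end FunctionField

section FnField

open IntermediateField

variable {F : Type*} [Field F] (W : WeierstrassCurve F)

/-- The function field `F(W)`, as a type with a field structure that unification does not unfold. -/
def FnField : Type _ := W.RationalFunction

noncomputable instance : Field W.FnField := inferInstanceAs (Field W.RationalFunction)

noncomputable instance : Algebra F W.FnField := inferInstanceAs (Algebra F W.RationalFunction)

/-- The identification of `F(W)` with its sealed copy. -/
noncomputable def toFn : W.RationalFunction ≃ₐ[F] W.FnField :=
  (AlgEquiv.refl : W.RationalFunction ≃ₐ[F] W.RationalFunction)

/-- The coordinate function `x`. -/
noncomputable def genX : W.FnField := W.toFn W.xFunction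

/-- The coordinate function `y`. -/
noncomputable def genY : W.FnField := W.toFn W.yFunction

lemma equation_gen : (W.baseChange W.FnField).toAffine.Equation W.genX W.genY :=
  W.equation_generic

lemma transcendental_genX : Transcendental F W.genX := W.transcendental_xFunction

variable {W}
variable {N : Type*} [Field N] [Algebra F N]

/-- A point with transcendental first coordinate induces an embedding of the function field. -/
lemma exists_algHom_gen {x y : N} (h : (W.baseChange N).toAffine.Equation x y)
    (hx : Transcendental F x) :
    ∃ α : W.FnField →ₐ[F] N, α W.genX = x ∧ α W.genY = y := by
  obtain ⟨α, h1, h2⟩ := exists_algHom h hx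
  refine ⟨α.comp W.toFn.symm, ?_, ?_⟩
  · rw [AlgHom.comp_apply, genX]
    simpa using h1
  · rw [AlgHom.comp_apply, genY]
    simpa using h2

lemma exists_eq_div_gen (f : W.FnField) :
    ∃ g ∈ Algebra.adjoin F {W.genX, W.genY},
      ∃ h ∈ Algebra.adjoin F {W.genX, W.genY}, h ≠ 0 ∧ f = g / h :=
  exists_eq_div (W := W) f

lemma algHom_gen_ext {α β : W.FnField →ₐ[F] N} (hx : α W.genX = β W.genX)
    (hy : α W.genY = β W.genY) : α = β := by
  have : α.comp W.toFn.toAlgHom = β.comp W.toFn.toAlgHom := algHom_ext hx hy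
  refine AlgHom.ext fun f => ?_
  have := congrArg (fun g => g (W.toFn.symm f)) this
  simpa using this

variable (W) in
lemma adjoin_genX_genY : IntermediateField.adjoin F {W.genX, W.genY} = ⊤ :=
  adjoin_xFunction_yFunction.symm

variable (W) in
lemma adjoin_genY_eq_top : F⟮W.genX⟯⟮W.genY⟯ = ⊤ :=
  adjoin_yFunction_eq_top

instance : Module.Finite F⟮W.genX⟯ W.FnField :=
  inferInstanceAs (Module.Finite F⟮W.xFunction⟯ W.RationalFunction)

variable (W) in
lemma trdeg_fnField : Algebra.trdeg F W.FnField = 1 := W.trdeg_rationalFunction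

end FnField

end WeierstrassCurve

/-! ### The generic point -/

namespace WeierstrassCurve

open scoped Classical

section Generic

variable {F : Type*} [Field F] (W : WeierstrassCurve F) [W.IsElliptic]

lemma isElliptic_baseChange (N : Type*) [Field N] [Algebra F N] :
    (W.baseChange N).toAffine.IsElliptic :=
  inferInstanceAs (W.map (algebraMap F N)).IsElliptic

/-- The generic point of `W`: its coordinates are the coordinate functions. -/
noncomputable def genericPoint : (W.baseChange W.FnField).toAffine.Point :=
  .some W.genX W.genY (by
    have := W.isElliptic_baseChange W.FnField
    rw [← Affine.equation_iff_nonsingular]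
    exact W.equation_gen)

variable {W} {N N' : Type*} [Field N] [Algebra F N] [Field N'] [Algebra F N']

/-- The map on points induced by a homomorphism of fields over `F`. -/
noncomputable def mapPt {W : WeierstrassCurve F} (f : N →ₐ[F] N') :
    (W.baseChange N).toAffine.Point →+ (W.baseChange N').toAffine.Point :=
  Affine.Point.map (W' := W) f

lemma mapPt_some {W : WeierstrassCurve F} (f : N →ₐ[F] N') {x y : N}
    (h : (W.baseChange N).toAffine.Nonsingular x y) :
    ∃ h', mapPt f (.some x y h) = .some (f x) (f y) h' :=
  ⟨_, rfl⟩

lemma mapPt_injective {W : WeierstrassCurve F} (f : N →ₐ[F] N') :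
    Function.Injective (mapPt (W := W) f) :=
  Affine.Point.map_injective (W' := W) f

lemma mapPt_constPt {W : WeierstrassCurve F} (f : N →ₐ[F] N') (Q : W.toAffine.Point) :
    mapPt f (W.constPt N Q) = W.constPt N' Q := by
  rcases Q with _ | ⟨a, b, h⟩
  · exact map_zero _
  · rw [constPt_some, constPt_some]
    obtain ⟨h', e⟩ := mapPt_some f (nonsingular_algebraMap N h)
    rw [e, some_eq_some_iff]
    simp

/-- The point of `W` over `N` determined by a homomorphism of `F(W)` to `N`. -/
noncomputable def ptOf (α : W.FnField →ₐ[F] N) : (W.baseChange N).toAffine.Point :=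
  mapPt α W.genericPoint

lemma ptOf_comp (α : W.FnField →ₐ[F] N) (f : N →ₐ[F] N') :
    ptOf (f.comp α) = mapPt f (ptOf α) := rfl

lemma ptOf_eq (α : W.FnField →ₐ[F] N) :
    ∃ h, ptOf α = .some (α W.genX) (α W.genY) h := ⟨_, rfl⟩

lemma ptOf_injective : Function.Injective (ptOf (W := W) (N := N)) := by
  intro α β h
  obtain ⟨h1, e1⟩ := ptOf_eq α
  obtain ⟨h2, e2⟩ := ptOf_eq β
  rw [e1, e2, some_eq_some_iff] at h
  exact algHom_gen_ext h.1 h.2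

/-- A point over an extension field is either constant or the image of the generic point under an
embedding of the function field. -/
lemma exists_constPt_or_ptOf [IsAlgClosed F] (P : (W.baseChange N).toAffine.Point) :
    (∃ Q, P = W.constPt N Q) ∨ ∃ α, P = ptOf α := by
  rcases P with _ | ⟨x, y, h⟩
  · exact Or.inl ⟨0, (map_zero _).symm⟩
  obtain ⟨a, rfl⟩ | hx := mem_range_or_transcendental (F := F) x
  · left
    obtain ⟨b, rfl⟩ : ∃ b, algebraMap F N b = y := by
      refine (mem_range_or_transcendental (F := F) y).resolve_right fun hy => hy ?_
      have he := (Affine.equation_iff _ _).1 h.1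
      change y ^ 2 + algebraMap F _ W.a₁ * algebraMap F _ a * y + algebraMap F _ W.a₃ * y =
        algebraMap F _ a ^ 3 + algebraMap F _ W.a₂ * algebraMap F _ a ^ 2 +
        algebraMap F _ W.a₄ * algebraMap F _ a + algebraMap F _ W.a₆ at he
      refine (?_ : _root_.IsIntegral F y).isAlgebraic
      refine ⟨X ^ 2 + (C (W.a₁ * a + W.a₃) * X +
        C (-(a ^ 3 + W.a₂ * a ^ 2 + W.a₄ * a + W.a₆))), ?_, ?_⟩
      · apply monic_X_pow_add
        compute_degree!
      · rw [C_neg]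
        simp only [eval₂_neg, eval₂_add, eval₂_mul, eval₂_pow, eval₂_X, eval₂_C, map_add, map_mul,
          map_pow]
        linear_combination he
    have hab : W.toAffine.Nonsingular a b :=
      (Affine.map_nonsingular W.toAffine (algebraMap F N).injective a b).1 h
    exact ⟨.some a b hab, by rw [constPt_some]⟩
  · right
    obtain ⟨α, h1, h2⟩ := exists_algHom_gen h.1 hx
    refine ⟨α, ?_⟩
    obtain ⟨h', e⟩ := ptOf_eq α
    rw [e, some_eq_some_iff]
    exact ⟨h1.symm, h2.symm⟩

lemma transcendental_algHom (α : W.FnField →ₐ[F] N) : Transcendental F (α W.genX) :=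
  fun h =>
  W.transcendental_genX ((isAlgebraic_algHom_iff α α.injective).1 h)

lemma constPt_ne_ptOf (Q : W.toAffine.Point) (α : W.FnField →ₐ[F] N) :
    W.constPt N Q ≠ ptOf α := by
  obtain ⟨h', e⟩ := ptOf_eq α
  rw [e]
  rcases Q with _ | ⟨a, b, h⟩
  · intro h
    rw [show W.constPt N .zero = 0 from map_zero _] at h
    cases h
  · rw [constPt_some]
    intro h
    rw [some_eq_some_iff] at h
    exact transcendental_algHom α (h.1 ▸ isAlgebraic_algebraMap a)

section comap

variable {A : ValuationSubring N'}

lemma hasVal_comap (f : N →ₐ[F] N') {g : N} {c : F} :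
    HasVal (A.comap (f : N →+* N')) g c ↔ HasVal A (f g) c := by
  unfold HasVal
  rw [← ValuationSubring.mem_nonunits_iff, ← ValuationSubring.mem_nonunits_iff,
    ValuationSubring.mem_nonunits_iff_or, ValuationSubring.mem_nonunits_iff_or,
    ValuationSubring.mem_comap]
  have h : (f : N →+* N') (g - algebraMap F N c)⁻¹ = (f g - algebraMap F N' c)⁻¹ := by
    simp
  rw [h]
  have h2 : f g - algebraMap F N' c = f (g - algebraMap F N c) := by simp
  rw [h2, map_eq_zero]

lemma IsPlace.comap (hA : IsPlace F A) (f : N →ₐ[F] N') :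
    IsPlace F (A.comap (f : N →+* N')) := by
  refine ⟨fun c => ?_, fun g hg => ?_⟩
  · rw [ValuationSubring.mem_comap]
    simpa using hA.algebraMap_mem c
  · obtain ⟨c, hc⟩ := hA.exists_value _ hg
    exact ⟨c, (hasVal_comap f).2 hc⟩

lemma red_comap {W : WeierstrassCurve F} (f : N →ₐ[F] N') {P : (W.baseChange N).toAffine.Point}
    {Q : W.toAffine.Point} :
    Red (A.comap (f : N →+* N')) P Q ↔ Red A (mapPt f P) Q := by
  rcases P with _ | ⟨x, y, h⟩
  · rcases Q with _ | ⟨a, b, hab⟩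
    · exact Iff.rfl
    · exact Iff.rfl
  · rcases Q with _ | ⟨a, b, hab⟩
    · exact Iff.rfl
    · exact and_congr (hasVal_comap f) (hasVal_comap f)

end comap

end Generic

end WeierstrassCurve

/-! ### Places over points, and local parameters -/

namespace WeierstrassCurve

open scoped Classical

section Places

variable {F : Type*} [Field F] [IsAlgClosed F] {W : WeierstrassCurve F} [W.IsElliptic]

lemma ptOf_id : ptOf (AlgHom.id F W.FnField) = W.genericPoint := by
  obtain ⟨h, e⟩ := ptOf_eq (AlgHom.id F W.FnField)
  rw [e]
  rfl

lemma exists_ptOf_neg {N : Type*} [Field N] [Algebra F N] (α : W.FnField →ₐ[F] N) :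
    ∃ β, ptOf β = -ptOf α := by
  obtain ⟨Q, h⟩ | ⟨β, h⟩ := exists_constPt_or_ptOf (-ptOf α)
  · rw [neg_eq_iff_eq_neg, ← map_neg] at h
    exact (constPt_ne_ptOf _ _ h.symm).elim
  · exact ⟨β, h.symm⟩

lemma exists_ptOf_add {N : Type*} [Field N] [Algebra F N] (α : W.FnField →ₐ[F] N)
    (Q : W.toAffine.Point) : ∃ β, ptOf β = ptOf α + W.constPt N Q := by
  obtain ⟨R, h⟩ | ⟨β, h⟩ := exists_constPt_or_ptOf (ptOf α + W.constPt N Q)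
  · rw [← eq_sub_iff_add_eq, ← map_sub] at h
    exact (constPt_ne_ptOf _ _ h.symm).elim
  · exact ⟨β, h.symm⟩

lemma genericPoint_equation : W.genY ^ 2 + algebraMap F _ W.a₁ * W.genX * W.genY +
    algebraMap F _ W.a₃ * W.genY = W.genX ^ 3 + algebraMap F _ W.a₂ * W.genX ^ 2 +
    algebraMap F _ W.a₄ * W.genX + algebraMap F _ W.a₆ :=
  (Affine.equation_iff _ _).1 W.equation_gen

/-- Every point of the curve is the centre of a place of the function field. -/
lemma exists_place (Q : W.toAffine.Point) :
    ∃ A : ValuationSubring W.FnField, IsPlace F A ∧ Red A W.genericPoint Q := by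
  rcases Q with _ | ⟨a, b, h⟩
  · have hx : Transcendental F W.genX⁻¹ := fun h' =>
      W.transcendental_genX (by simpa using h'.inv)
    obtain ⟨A, hA, hv⟩ := exists_isPlace_hasVal W.trdeg_fnField hx 0
    refine ⟨A, hA, notMem_of_hasVal_inv ?_ hv⟩
    intro h0
    exact W.transcendental_genX (h0 ▸ isAlgebraic_zero)
  · obtain ⟨A, hA, hv⟩ :=
      exists_isPlace_hasVal W.trdeg_fnField W.transcendental_genX a
    obtain ⟨R, hR⟩ := exists_red hA W.genericPoint
    rcases R with _ | ⟨a', b', h'⟩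
    · exact (hR (hv.mem hA)).elim
    obtain rfl := hR.1.unique hA hv
    obtain he | he := (Affine.Point.X_eq_iff (h₁ := h') (h₂ := h)).1 rfl
    · exact ⟨A, hA, he ▸ hR⟩
    · obtain ⟨ι, hι⟩ := exists_ptOf_neg (AlgHom.id F W.FnField)
      refine ⟨_, hA.comap ι, (red_comap ι).2 ?_⟩
      change Red A (ptOf ι) _
      rw [hι, ptOf_id]
      have := hR.neg hA
      rwa [he, neg_neg] at this

lemma genY_ne_const (b : F) : W.genY ≠ algebraMap F _ b := by
  intro h
  have he := W.genericPoint_equation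
  rw [h] at he
  refine W.transcendental_genX (?_ : _root_.IsIntegral F _).isAlgebraic
  refine ⟨X ^ 3 + (C W.a₂ * X ^ 2 + C (W.a₄ - W.a₁ * b) * X + C (W.a₆ - b ^ 2 - W.a₃ * b)),
    ?_, ?_⟩
  · apply monic_X_pow_add
    compute_degree!
  · simp only [eval₂_add, eval₂_mul, eval₂_pow, eval₂_X, eval₂_C]
    simp only [map_sub, map_mul, map_pow]
    linear_combination -he

lemma genX_ne_const (b : F) : W.genX ≠ algebraMap F _ b := fun h =>
  W.transcendental_genX (h ▸ isAlgebraic_algebraMap b)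

lemma transcendental_of_hasVal {N : Type*} [Field N] [Algebra F N] {A : ValuationSubring N}
    (hA : IsPlace F A) {f : N} (hf : f ≠ 0) (h : HasVal A f (0 : F)) : Transcendental F f := by
  obtain ⟨c, rfl⟩ | h' := mem_range_or_transcendental (F := F) f
  · obtain rfl := (hasVal_algebraMap c).unique hA h
    simp at hf
  · exact h'

lemma exists_eq_div_of_mem {N : Type*} [Field N] [Algebra F N] {x y : N} {B : Subalgebra F N}
    (hx : x ∈ B) (hy : y ∈ B) (h : ∀ f : N, ∃ g ∈ Algebra.adjoin F {x, y},
      ∃ h ∈ Algebra.adjoin F {x, y}, h ≠ 0 ∧ f = g / h) (f : N) :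
    ∃ g ∈ B, ∃ h ∈ B, h ≠ 0 ∧ f = g / h := by
  have hle : Algebra.adjoin F {x, y} ≤ B := by
    rw [Algebra.adjoin_le_iff]
    rintro z (rfl | rfl) <;> assumption
  obtain ⟨g, hg, k, hk, h0, e⟩ := h f
  exact ⟨g, hle hg, k, hle hk, h0, e⟩

lemma Red.hasVal_infinity {N : Type*} [Field N] [Algebra F N] {A : ValuationSubring N}
    (hA : IsPlace F A) {x y : N} {h : (W.baseChange N).toAffine.Nonsingular x y}
    (hR : Red A (.some x y h) (0 : W.toAffine.Point)) :
    HasVal A (x / y) (0 : F) ∧ HasVal A (1 / y) (0 : F) := by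
  have he := (Affine.equation_iff _ _).1 h.1
  have hx : x ∉ A := hR
  have hx0 : x ≠ 0 := by rintro rfl; exact hx A.zero_mem
  have hi := hasVal_inv_of_notMem (F := F) hx
  have hyx : y / x ∉ A := by
    intro hy
    apply hx
    have hI := hi.mem hA
    have e : x = (y / x) * (y / x) + (W.baseChange N).a₁ * (y / x) +
        (W.baseChange N).a₃ * (y / x) * x⁻¹ - ((W.baseChange N).a₂ + (W.baseChange N).a₄ * x⁻¹ +
          (W.baseChange N).a₆ * x⁻¹ * x⁻¹) := by
      field_simp
      linear_combination -he
    rw [e]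
    have h1 := (hasVal_a₁ W A).mem hA
    have h2 := (hasVal_a₂ W A).mem hA
    have h3 := (hasVal_a₃ W A).mem hA
    have h4 := (hasVal_a₄ W A).mem hA
    have h6 := (hasVal_a₆ W A).mem hA
    exact sub_mem (add_mem (add_mem (mul_mem hy hy) (mul_mem h1 hy)) (mul_mem (mul_mem h3 hy) hI))
      (add_mem (add_mem h2 (mul_mem h4 hI)) (mul_mem (mul_mem h6 hI) hI))
  have h1 := hasVal_inv_of_notMem (F := F) hyx
  rw [inv_div] at h1
  refine ⟨h1, ?_⟩
  have := h1.mul hA hi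
  rw [mul_zero] at this
  convert! this using 1
  field_simp

/-- Homogeneous coordinates `ν` of a generic point and parameters `u`, `v`, adapted to a place at
which the point reduces to `Q`. -/
lemma exists_localParam {N : Type*} [Field N] [Algebra F N]
    {x y : N} (h : (W.baseChange N).toAffine.Nonsingular x y)
    (hgen : ∀ f : N, ∃ g ∈ Algebra.adjoin F {x, y},
      ∃ h ∈ Algebra.adjoin F {x, y}, h ≠ 0 ∧ f = g / h) (hx : ∀ c, x ≠ algebraMap F N c)
    (hy : ∀ c, y ≠ algebraMap F N c) (Q : W.toAffine.Point) :
    ∃ (t : N) (ν : Fin 3 → N) (j : Fin 3) (u v : N), t ≠ 0 ∧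
      (![x, y, 1] = fun i => t * ν i) ∧ ν j = 1 ∧
      u ∈ Algebra.adjoin F (Set.range ν) ∧ v ∈ Algebra.adjoin F (Set.range ν) ∧
      ∀ A : ValuationSubring N, IsPlace F A → Red A (.some x y h) Q →
        (∀ i, HasVal A (ν i) (W.homogeneousCoordinates Q i)) ∧ IsLocalParam F A u v := by
  have he := (Affine.equation_iff _ _).1 h.1
  change y ^ 2 + algebraMap F _ W.a₁ * x * y + algebraMap F _ W.a₃ * y =
    x ^ 3 + algebraMap F _ W.a₂ * x ^ 2 + algebraMap F _ W.a₄ * x + algebraMap F _ W.a₆ at he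
  rcases Q with _ | ⟨a, b, hab⟩
  · -- at infinity: `z = x / y`, `w = 1 / y`
    have hy0 : y ≠ 0 := by simpa using hy 0
    have hx0 : x ≠ 0 := by simpa using hx 0
    obtain ⟨z, hz⟩ : ∃ z, z = x / y := ⟨_, rfl⟩
    obtain ⟨w, hw⟩ : ∃ w, w = 1 / y := ⟨_, rfl⟩
    have hz0 : z ≠ 0 := by rw [hz]; exact div_ne_zero hx0 hy0
    have hw0 : w ≠ 0 := by rw [hw]; exact one_div_ne_zero hy0
    refine ⟨y, ![z, 1, w], 1, z, w, hy0, ?_, rfl, Algebra.subset_adjoin ⟨0, rfl⟩,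
      Algebra.subset_adjoin ⟨2, rfl⟩, fun A hA hR => ?_⟩
    · ext i
      fin_cases i
      · simp [hz, mul_div_cancel₀, hy0]
      · simp
      · simp [hw, hy0]
    have hval := Red.hasVal_infinity hA hR
    rw [← hz, ← hw] at hval
    have hzm : z ∈ Algebra.adjoin F {z, w} := Algebra.subset_adjoin (by simp)
    have hwm : w ∈ Algebra.adjoin F {z, w} := Algebra.subset_adjoin (by simp)
    refine ⟨?_, hval.1, hval.2, ?_, ?_, transcendental_of_hasVal hA hz0 hval.1⟩
    · intro i
      fin_cases i
      · exact hval.1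
      · exact hasVal_one
      · exact hval.2
    · have key : ∀ g ∈ Algebra.adjoin F {x, y}, ∃ n : ℕ, g * w ^ n ∈ Algebra.adjoin F {z, w} := by
        intro g hg
        induction hg using Algebra.adjoin_induction with
        | mem g hg =>
          refine ⟨1, ?_⟩
          rcases hg with rfl | rfl
          · rw [pow_one, show g * w = z by rw [hw, hz, mul_one_div]]; exact hzm
          · rw [pow_one, show g * w = 1 by rw [hw, mul_one_div, div_self hy0]]; exact one_mem _
        | algebraMap c => exact ⟨0, by simp⟩
        | add a b _ _ ha hb =>
          obtain ⟨n, hn⟩ := ha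
          obtain ⟨m, hm⟩ := hb
          refine ⟨n + m, ?_⟩
          have := add_mem (mul_mem hn (pow_mem hwm m)) (mul_mem hm (pow_mem hwm n))
          convert! this using 1
          ring
        | mul a b _ _ ha hb =>
          obtain ⟨n, hn⟩ := ha
          obtain ⟨m, hm⟩ := hb
          refine ⟨n + m, ?_⟩
          have := mul_mem hn hm
          convert! this using 1
          ring
      intro f
      obtain ⟨g, hg, k, hk, hk0, rfl⟩ := hgen f
      obtain ⟨n, hn⟩ := key g hg
      obtain ⟨m, hm⟩ := key k hk
      refine ⟨g * w ^ n * w ^ m, mul_mem hn (pow_mem hwm m), k * w ^ m * w ^ n,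
        mul_mem hm (pow_mem hwm n), by positivity, ?_⟩
      field_simp
    · refine ⟨z ^ 2, pow_mem hzm 2, 1 + algebraMap F N W.a₁ * z + algebraMap F N W.a₃ * w -
        algebraMap F N W.a₂ * z ^ 2 - algebraMap F N W.a₄ * z * w - algebraMap F N W.a₆ * w ^ 2,
        ?_, 1, one_ne_zero, ?_, ?_⟩
      · have hc := fun c => Subalgebra.algebraMap_mem (Algebra.adjoin F {z, w}) c
        exact sub_mem (sub_mem (sub_mem (add_mem (add_mem (one_mem _) (mul_mem (hc _) hzm))
          (mul_mem (hc _) hwm)) (mul_mem (hc _) (pow_mem hzm 2)))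
          (mul_mem (mul_mem (hc _) hzm) hwm)) (mul_mem (hc _) (pow_mem hwm 2))
      · have hc := fun c : F => hasVal_algebraMap (N := N) (A := A) c
        have := ((((hasVal_one.add ((hc W.a₁).mul hA hval.1)).add ((hc W.a₃).mul hA hval.2)).sub
          ((hc W.a₂).mul hA (hval.1.pow hA 2))).sub (((hc W.a₄).mul hA hval.1).mul hA hval.2)).sub
          ((hc W.a₆).mul hA (hval.2.pow hA 2))
        convert! this using 1
        ring
      · rw [hz, hw]
        field_simp
        linear_combination he
  · -- at an affine point: `x - a`, `y - b`
    have heq := (Affine.equation_iff _ _).1 hab.1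
    have hns := ((Affine.nonsingular_iff' _ _).1 hab).2
    have heq' := congrArg (algebraMap F N) heq
    simp only [map_add, map_mul, map_pow] at heq'
    obtain ⟨U, hU⟩ : ∃ U, U = x - algebraMap F N a := ⟨_, rfl⟩
    obtain ⟨V, hV⟩ : ∃ V, V = y - algebraMap F N b := ⟨_, rfl⟩
    obtain ⟨ψ, hψ⟩ : ∃ ψ, ψ = 2 * b + W.a₁ * a + W.a₃ := ⟨_, rfl⟩
    obtain ⟨ω, hω⟩ : ∃ ω, ω = 3 * a ^ 2 + 2 * W.a₂ * a + W.a₄ - W.a₁ * b := ⟨_, rfl⟩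
    have hψ' := congrArg (algebraMap F N) hψ
    have hω' := congrArg (algebraMap F N) hω
    simp only [map_add, map_sub, map_mul, map_pow, map_ofNat] at hψ' hω'
    have hU0 : U ≠ 0 := by rw [hU, sub_ne_zero]; exact hx a
    have hV0 : V ≠ 0 := by rw [hV, sub_ne_zero]; exact hy b
    have main : V * (V + algebraMap F N ψ + algebraMap F N W.a₁ * U) =
        U * (U ^ 2 + algebraMap F N (3 * a + W.a₂) * U + algebraMap F N ω) := by
      rw [hψ', hω', hU, hV, map_add, map_mul, map_ofNat]
      linear_combination he - heq'
    have hmemU : U ∈ Algebra.adjoin F (Set.range ![x, y, 1]) := by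
      rw [hU]
      exact sub_mem (Algebra.subset_adjoin ⟨0, rfl⟩) (Subalgebra.algebraMap_mem _ _)
    have hmemV : V ∈ Algebra.adjoin F (Set.range ![x, y, 1]) := by
      rw [hV]
      exact sub_mem (Algebra.subset_adjoin ⟨1, rfl⟩) (Subalgebra.algebraMap_mem _ _)
    have hcoord : ∀ A : ValuationSubring N, Red A (.some x y h) (.some a b hab) →
        ∀ i, HasVal A ((![x, y, 1] : Fin 3 → N) i)
          (W.homogeneousCoordinates (.some a b hab) i) := by
      intro A hR i
      fin_cases i
      · exact hR.1
      · exact hR.2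
      · exact hasVal_one
    have hvalU : ∀ A : ValuationSubring N, Red A (.some x y h) (.some a b hab) →
        HasVal A U (0 : F) := by
      intro A hR
      rw [hU, hasVal_zero_iff]; exact hR.1
    have hvalV : ∀ A : ValuationSubring N, Red A (.some x y h) (.some a b hab) →
        HasVal A V (0 : F) := by
      intro A hR
      rw [hV, hasVal_zero_iff]; exact hR.2
    have hgen' : ∀ u v : N, U ∈ Algebra.adjoin F {u, v} → V ∈ Algebra.adjoin F {u, v} → ∀ f : N,
        ∃ g ∈ Algebra.adjoin F {u, v}, ∃ h ∈ Algebra.adjoin F {u, v}, h ≠ 0 ∧ f = g / h := by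
      intro u v hu hv
      have hxm : x ∈ Algebra.adjoin F {u, v} := by
        rw [show x = U + algebraMap F N a by rw [hU]; ring]
        exact add_mem hu (Subalgebra.algebraMap_mem _ _)
      have hym : y ∈ Algebra.adjoin F {u, v} := by
        rw [show y = V + algebraMap F N b by rw [hV]; ring]
        exact add_mem hv (Subalgebra.algebraMap_mem _ _)
      exact exists_eq_div_of_mem hxm hym hgen
    have hc := fun (S : Subalgebra F N) c => Subalgebra.algebraMap_mem S c
    have hcv := fun (A : ValuationSubring N) (c : F) => hasVal_algebraMap (N := N) (A := A) c
    by_cases hψ0 : ψ = 0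
    · have hω0 : ω ≠ 0 := by
        intro h0
        rcases hns with h1 | h1
        · apply h1; rw [← neg_sub, neg_eq_zero, ← h0, hω]
        · exact h1 (hψ.symm.trans hψ0)
      refine ⟨1, ![x, y, 1], 2, V, U, one_ne_zero, (funext fun _ => (one_mul _).symm), rfl, hmemV,
        hmemU,
        fun A hA hR => ⟨hcoord A hR, hvalV A hR, hvalU A hR, ?_, ?_,
        transcendental_of_hasVal hA hV0 (hvalV A hR)⟩⟩
      · exact hgen' _ _ (Algebra.subset_adjoin (by simp)) (Algebra.subset_adjoin (by simp))
      · have hUm : U ∈ Algebra.adjoin F {V, U} := Algebra.subset_adjoin (by simp)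
        have hVm : V ∈ Algebra.adjoin F {V, U} := Algebra.subset_adjoin (by simp)
        refine ⟨V + algebraMap F N ψ + algebraMap F N W.a₁ * U,
          add_mem (add_mem hVm (hc _ _)) (mul_mem (hc _ _) hUm),
          U ^ 2 + algebraMap F N (3 * a + W.a₂) * U + algebraMap F N ω,
          add_mem (add_mem (pow_mem hUm 2) (mul_mem (hc _ _) hUm)) (hc _ _), ω, hω0, ?_, main.symm⟩
        have := (((hvalU A hR).pow hA 2).add ((hcv A (3 * a + W.a₂)).mul hA (hvalU A hR))).add
          (hcv A ω)
        convert! this using 1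
        ring
    · refine ⟨1, ![x, y, 1], 2, U, V, one_ne_zero, (funext fun _ => (one_mul _).symm), rfl, hmemU,
        hmemV,
        fun A hA hR => ⟨hcoord A hR, hvalU A hR, hvalV A hR, ?_, ?_,
        transcendental_of_hasVal hA hU0 (hvalU A hR)⟩⟩
      · exact hgen' _ _ (Algebra.subset_adjoin (by simp)) (Algebra.subset_adjoin (by simp))
      · have hUm : U ∈ Algebra.adjoin F {U, V} := Algebra.subset_adjoin (by simp)
        have hVm : V ∈ Algebra.adjoin F {U, V} := Algebra.subset_adjoin (by simp)
        refine ⟨U ^ 2 + algebraMap F N (3 * a + W.a₂) * U + algebraMap F N ω,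
          add_mem (add_mem (pow_mem hUm 2) (mul_mem (hc _ _) hUm)) (hc _ _),
          V + algebraMap F N ψ + algebraMap F N W.a₁ * U,
          add_mem (add_mem hVm (hc _ _)) (mul_mem (hc _ _) hUm), ψ, hψ0, ?_, main⟩
        have := ((hvalV A hR).add (hcv A ψ)).add ((hcv A W.a₁).mul hA (hvalU A hR))
        convert! this using 1
        ring

end Places

end WeierstrassCurve

/-! ### Values of rational functions, and morphisms as points over the function field -/

namespace WeierstrassCurve

open scoped Classical

section Values

variable {F : Type*} [Field F] {N : Type*} [Field N] [Algebra F N]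

lemma aeval_smul_of_isHomogeneous {σ : Type*} [Fintype σ] {n : ℕ} {a : MvPolynomial σ F}
    (ha : a.IsHomogeneous n) (t : N) (ν : σ → N) :
    MvPolynomial.aeval (fun i => t * ν i) a = t ^ n * MvPolynomial.aeval ν a := by
  rw [MvPolynomial.aeval_def, MvPolynomial.aeval_def, MvPolynomial.eval₂_eq',
    MvPolynomial.eval₂_eq', Finset.mul_sum]
  refine Finset.sum_congr rfl fun d hd => ?_
  have h1 : ∑ i, d i = n := by
    rw [← ha (MvPolynomial.mem_support_iff.1 hd), Finsupp.weight_apply,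
      Finsupp.sum_fintype _ _ (by simp)]
    simp
  simp only [mul_pow, Finset.prod_mul_distrib,
    Finset.prod_pow_eq_pow_sum, h1]
  ring

lemma exists_isHomogeneous_of_mem_adjoin {σ : Type*} {ν : σ → N} {j : σ} (hj : ν j = 1) {g : N}
    (hg : g ∈ Algebra.adjoin F (Set.range ν)) :
    ∃ n₀ : ℕ, ∀ n ≥ n₀, ∃ a : MvPolynomial σ F, a.IsHomogeneous n ∧
      MvPolynomial.aeval ν a = g := by
  induction hg using Algebra.adjoin_induction with
  | mem g hg =>
    obtain ⟨i, rfl⟩ := hg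
    refine ⟨1, fun n hn => ⟨MvPolynomial.X i * MvPolynomial.X j ^ (n - 1), ?_, ?_⟩⟩
    · have := (MvPolynomial.isHomogeneous_X F i).mul (MvPolynomial.isHomogeneous_X_pow j (n - 1))
      rwa [Nat.add_sub_cancel' hn] at this
    · simp [hj]
  | algebraMap c =>
    refine ⟨0, fun n _ => ⟨MvPolynomial.C c * MvPolynomial.X j ^ n, ?_, ?_⟩⟩
    · exact MvPolynomial.isHomogeneous_C_mul_X_pow c j n
    · simp [hj]
  | add a b _ _ ha hb =>
    obtain ⟨n, hn⟩ := ha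
    obtain ⟨m, hm⟩ := hb
    refine ⟨max n m, fun k hk => ?_⟩
    obtain ⟨a', ha, rfl⟩ := hn k (le_of_max_le_left hk)
    obtain ⟨b', hb, rfl⟩ := hm k (le_of_max_le_right hk)
    exact ⟨a' + b', ha.add hb, map_add _ _ _⟩
  | mul a b _ _ ha hb =>
    obtain ⟨n, hn⟩ := ha
    obtain ⟨m, hm⟩ := hb
    refine ⟨n + m, fun k hk => ?_⟩
    obtain ⟨a', ha, rfl⟩ := hn n le_rfl
    obtain ⟨b', hb, rfl⟩ := hm (k - n) (by omega)
    refine ⟨a' * b', ?_, map_mul _ _ _⟩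
    have := ha.mul hb
    rwa [Nat.add_sub_cancel' (by omega)] at this

lemma hasVal_aeval {A : ValuationSubring N} (hA : IsPlace F A) {σ : Type*} {ν : σ → N} {c : σ → F}
    (h : ∀ i, HasVal A (ν i) (c i)) (a : MvPolynomial σ F) :
    HasVal A (MvPolynomial.aeval ν a) (MvPolynomial.eval c a) := by
  induction a using MvPolynomial.induction_on with
  | C r => simpa using hasVal_algebraMap r
  | add p q hp hq => simpa using hp.add hq
  | mul_X p i hp => simpa using hp.mul hA (h i)

end Values

section Places

variable {F : Type*} [Field F] [IsAlgClosed F] {W : WeierstrassCurve F} [W.IsElliptic]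

lemma hasValueAt_def {W : WeierstrassCurve F} {f : W.RationalFunction} {P : W.toAffine.Point}
    {c : F} : W.HasValueAt f P c ↔
    ∃ (n : ℕ) (a b : MvPolynomial (Fin 3) F), a.IsHomogeneous n ∧ b.IsHomogeneous n ∧
    MvPolynomial.eval (W.homogeneousCoordinates P) b ≠ 0 ∧
    W.toFn f * MvPolynomial.aeval ![W.genX, W.genY, 1] b =
      MvPolynomial.aeval ![W.genX, W.genY, 1] a ∧
    c = MvPolynomial.eval (W.homogeneousCoordinates P) a /
      MvPolynomial.eval (W.homogeneousCoordinates P) b := Iff.rfl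

variable {A : ValuationSubring W.FnField}

lemma exists_localParam_genericPoint (Q : W.toAffine.Point) :
    ∃ (t : W.FnField) (ν : Fin 3 → W.FnField) (j : Fin 3)
      (u v : W.FnField), t ≠ 0 ∧ (![W.genX, W.genY, 1] = fun i => t * ν i) ∧ ν j = 1 ∧
      u ∈ Algebra.adjoin F (Set.range ν) ∧ v ∈ Algebra.adjoin F (Set.range ν) ∧
      ∀ A : ValuationSubring W.FnField, IsPlace F A → Red A W.genericPoint Q →
        (∀ i, HasVal A (ν i) (W.homogeneousCoordinates Q i)) ∧ IsLocalParam F A u v :=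
  exists_localParam (N := W.FnField) (W := W) (x := W.genX) (y := W.genY) _
    (exists_eq_div_gen (W := W)) (genX_ne_const (W := W)) (genY_ne_const (W := W)) Q

/-- Every point of the curve is the centre of only one place, as the curve is smooth. -/
lemma place_unique {A' : ValuationSubring W.FnField} (hA : IsPlace F A)
    (hA' : IsPlace F A') {Q : W.toAffine.Point} (hR : Red A W.genericPoint Q)
    (hR' : Red A' W.genericPoint Q) : A = A' := by
  obtain ⟨t, ν, j, u, v, -, -, -, -, -, h⟩ := exists_localParam_genericPoint Q
  have h1 := (h A hA hR).2
  have h2 := (h A' hA' hR').2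
  exact le_antisymm (h1.le W.trdeg_fnField hA hA' h2.left h2.right)
    (h2.le W.trdeg_fnField hA' hA h1.left h1.right)

/-- The values of rational functions at `Q` are the residues at the place of `Q`. -/
lemma hasValueAt_iff (hA : IsPlace F A) {Q : W.toAffine.Point} (hR : Red A W.genericPoint Q)
    {f : W.RationalFunction} {c : F} : W.HasValueAt f Q c ↔ HasVal A (W.toFn f) c := by
  rw [hasValueAt_def]
  generalize W.toFn f = f
  obtain ⟨t, ν, j, u, v, ht, hν, hj, hu, hv, h⟩ := exists_localParam_genericPoint Q
  obtain ⟨hval, hloc⟩ := h A hA hR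
  constructor
  · rintro ⟨n, a, b, ha, hb, hb0, heq, rfl⟩
    rw [hν, aeval_smul_of_isHomogeneous ha, aeval_smul_of_isHomogeneous hb] at heq
    have hvb := hasVal_aeval hA hval b
    have hva := hasVal_aeval hA hval a
    have hb1 : MvPolynomial.aeval ν b ≠ 0 := by
      intro h0
      rw [h0] at hvb
      exact hb0 (hvb.unique hA hasVal_zero)
    have e : f = MvPolynomial.aeval ν a / MvPolynomial.aeval ν b := by
      rw [eq_div_iff hb1]
      have : t ^ n ≠ 0 := pow_ne_zero _ ht
      apply mul_left_cancel₀ this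
      linear_combination heq
    rw [e]
    exact hva.div hA hvb hb0
  · intro hf
    obtain ⟨g, hg, e, he, d, hd, hed, hfge⟩ :=
      hloc.exists_div W.trdeg_fnField hA (hf.mem hA)
    have hle : Algebra.adjoin F {u, v} ≤ Algebra.adjoin F (Set.range ν) := by
      rw [Algebra.adjoin_le_iff]
      rintro z (rfl | rfl) <;> assumption
    obtain ⟨n, hn⟩ := exists_isHomogeneous_of_mem_adjoin hj (hle hg)
    obtain ⟨m, hm⟩ := exists_isHomogeneous_of_mem_adjoin hj (hle he)
    obtain ⟨a, ha, rfl⟩ := hn (max n m) (le_max_left _ _)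
    obtain ⟨b, hb, rfl⟩ := hm (max n m) (le_max_right _ _)
    have hvb := hasVal_aeval hA hval b
    have hva := hasVal_aeval hA hval a
    obtain rfl := hvb.unique hA hed
    have hb1 : MvPolynomial.aeval ν b ≠ 0 := by
      intro h0
      rw [h0] at hvb
      exact hd (hvb.unique hA hasVal_zero)
    refine ⟨max n m, a, b, ha, hb, hd, ?_, ?_⟩
    · rw [hν, aeval_smul_of_isHomogeneous ha, aeval_smul_of_isHomogeneous hb, hfge]
      field_simp
    · rw [hfge] at hf
      exact hf.unique hA (hva.div hA hvb hd)

end Places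

section Morphisms

variable {F : Type*} [Field F] [IsAlgClosed F] {W₁ W₂ : WeierstrassCurve F} [W₁.IsElliptic]
  [W₂.IsElliptic]

/-- Two points with the same reduction at every place coincide. -/
lemma eq_of_forall_red {N : Type*} [Field N] [Algebra F N] (hN : Algebra.trdeg F N = 1)
    {P Q : (W₂.baseChange N).toAffine.Point}
    (h : ∀ A : ValuationSubring N, IsPlace F A → ∃ R, Red A P R ∧ Red A Q R) : P = Q := by
  obtain ⟨S, hS⟩ | ⟨α, hα⟩ := exists_constPt_or_ptOf (P - Q)
  · obtain ⟨A, hA⟩ := exists_isPlace_of_trdeg_eq_one (F := F) hN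
    obtain ⟨R, h1, h2⟩ := h A hA
    have h3 := h1.sub hA h2
    rw [hS, sub_self] at h3
    have := h3.unique hA (red_const A S)
    rw [← this, map_zero, sub_eq_zero] at hS
    exact hS
  · exfalso
    obtain ⟨A, hA, hv⟩ := exists_isPlace_hasVal hN (transcendental_algHom α) 0
    obtain ⟨R, h1, h2⟩ := h A hA
    have h3 := h1.sub hA h2
    obtain ⟨h', e⟩ := ptOf_eq α
    rw [hα, sub_self, e] at h3
    exact h3 (hv.mem hA)

/-- A point that reduces into a finite set at every place is constant. -/
lemma exists_eq_constPt_of_finite {N : Type*} [Field N] [Algebra F N]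
    (hN : Algebra.trdeg F N = 1) {P : (W₂.baseChange N).toAffine.Point}
    {S : Set W₂.toAffine.Point} (hS : S.Finite)
    (h : ∀ A : ValuationSubring N, IsPlace F A → ∃ R ∈ S, Red A P R) :
    ∃ R, P = W₂.constPt N R := by
  obtain ⟨S, hS⟩ | ⟨α, hα⟩ := exists_constPt_or_ptOf P
  · exact ⟨S, hS⟩
  exfalso
  -- the first coordinate would avoid almost all values
  let f : W₂.toAffine.Point → F := fun Q => W₂.homogeneousCoordinates Q 0
  obtain ⟨c, hc⟩ := (hS.image f).infinite_compl.nonempty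
  obtain ⟨A, hA, hv⟩ := exists_isPlace_hasVal hN (transcendental_algHom α) c
  obtain ⟨R, hRS, hR⟩ := h A hA
  obtain ⟨h', e⟩ := ptOf_eq α
  rw [hα, e] at hR
  rcases R with _ | ⟨a, b, hab⟩
  · exact hR (hv.mem hA)
  · exact hc ⟨_, hRS, (hR.1.unique hA hv)⟩

/-- The map on points induced by a point `P` of `W₂` over the function field of `W₁`: the image of
`Q` is the reduction of `P` at the place of `Q`. -/
noncomputable def redAt (P : (W₂.baseChange W₁.FnField).toAffine.Point)
    (Q : W₁.toAffine.Point) : W₂.toAffine.Point :=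
  (exists_red (exists_place Q).choose_spec.1 P).choose

lemma redAt_spec (P : (W₂.baseChange W₁.FnField).toAffine.Point)
    {Q : W₁.toAffine.Point} {A : ValuationSubring W₁.FnField} (hA : IsPlace F A)
    (hR : Red A W₁.genericPoint Q) : Red A P (redAt P Q) := by
  have h := (exists_place (W := W₁) Q).choose_spec
  have e := place_unique h.1 hA h.2 hR
  have := (exists_red h.1 P).choose_spec
  exact e ▸ this

lemma redAt_eq_iff {P : (W₂.baseChange W₁.FnField).toAffine.Point}
    {Q : W₁.toAffine.Point} {A : ValuationSubring W₁.FnField} (hA : IsPlace F A)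
    (hR : Red A W₁.genericPoint Q) {R : W₂.toAffine.Point} : redAt P Q = R ↔ Red A P R :=
  ⟨fun h => h ▸ redAt_spec P hA hR, fun h => (redAt_spec P hA hR).unique hA h⟩

lemma redAt_genericPoint (Q : W₁.toAffine.Point) : redAt W₁.genericPoint Q = Q := by
  obtain ⟨A, hA, hR⟩ := exists_place Q
  exact (redAt_eq_iff hA hR).2 hR

lemma redAt_constPt (S : W₂.toAffine.Point) (Q : W₁.toAffine.Point) :
    redAt (W₂.constPt _ S) Q = S := by
  obtain ⟨A, hA, hR⟩ := exists_place Q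
  exact (redAt_eq_iff hA hR).2 (red_const A S)

lemma redAt_add (P P' : (W₂.baseChange W₁.FnField).toAffine.Point)
    (Q : W₁.toAffine.Point) : redAt (P + P') Q = redAt P Q + redAt P' Q := by
  obtain ⟨A, hA, hR⟩ := exists_place Q
  exact (redAt_eq_iff hA hR).2 (Red.add (F := F) (N := W₁.FnField) (W := W₂) hA
    (redAt_spec P hA hR) (redAt_spec P' hA hR))

lemma redAt_nsmul (n : ℕ) (P : (W₂.baseChange W₁.FnField).toAffine.Point)
    (Q : W₁.toAffine.Point) : redAt (n • P) Q = n • redAt P Q := by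
  obtain ⟨A, hA, hR⟩ := exists_place Q
  exact (redAt_eq_iff hA hR).2 (Red.nsmul (F := F) (N := W₁.FnField) (W := W₂) hA
    (redAt_spec P hA hR) n)

lemma redAt_neg (P : (W₂.baseChange W₁.FnField).toAffine.Point)
    (Q : W₁.toAffine.Point) : redAt (-P) Q = -redAt P Q := by
  obtain ⟨A, hA, hR⟩ := exists_place Q
  exact (redAt_eq_iff hA hR).2 ((redAt_spec P hA hR).neg hA)

lemma exists_red_genericPoint {A : ValuationSubring W₁.FnField} (hA : IsPlace F A) :
    ∃ Q, Red A W₁.genericPoint Q := exists_red hA _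

/-- A point over the function field is determined by the induced map on points. -/
lemma redAt_injective {P P' : (W₂.baseChange W₁.FnField).toAffine.Point}
    (h : ∀ Q, redAt P Q = redAt P' Q) : P = P' := by
  refine eq_of_forall_red W₁.trdeg_fnField fun A hA => ?_
  obtain ⟨Q, hQ⟩ := exists_red_genericPoint hA
  exact ⟨redAt P Q, redAt_spec P hA hQ, h Q ▸ redAt_spec P' hA hQ⟩

/-- `α.comap` of the place of `Q` is the place of the image of `Q`. -/
lemma red_comap_genericPoint (α : W₂.FnField →ₐ[F] W₁.FnField)
    {Q : W₁.toAffine.Point} {A : ValuationSubring W₁.FnField} (hA : IsPlace F A)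
    (hR : Red A W₁.genericPoint Q) :
    Red (A.comap (α : W₂.FnField →+* W₁.FnField)) W₂.genericPoint
      (redAt (ptOf α) Q) :=
  (red_comap α).2 (redAt_spec _ hA hR)

lemma redAt_mapPt {W₃ : WeierstrassCurve F} [W₃.IsElliptic]
    (α : W₂.FnField →ₐ[F] W₁.FnField)
    (P : (W₃.baseChange W₂.FnField).toAffine.Point) (Q : W₁.toAffine.Point) :
    redAt (mapPt α P) Q = redAt P (redAt (ptOf α) Q) := by
  obtain ⟨A, hA, hR⟩ := exists_place Q
  rw [redAt_eq_iff hA hR, ← red_comap]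
  exact redAt_spec P (hA.comap α) (red_comap_genericPoint α hA hR)

/-- Places extend along an extension of function fields of one variable. -/
lemma exists_isPlace_comap_eq {N N' : Type*} [Field N] [Algebra F N] [Field N'] [Algebra F N']
    (hN' : Algebra.trdeg F N' = 1) (α : N →ₐ[F] N') {A : ValuationSubring N} (hA : IsPlace F A)
    (hA' : A ≠ ⊤) : ∃ B : ValuationSubring N', IsPlace F B ∧
      ∀ (f : N) (c : F), HasVal A f c → HasVal B (α f) c := by
  let S₀ : Subalgebra F N :=
    { A.toSubring with algebraMap_mem' := hA.algebraMap_mem }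
  have hS₀ : ∀ f, f ∈ S₀ ↔ f ∈ A := fun f => Iff.rfl
  let I₀ : Ideal S₀ :=
    { carrier := {b | HasVal A (b : N) (0 : F)}
      add_mem' := fun {a b} ha hb => by
        have := HasVal.add (F := F) (A := A) ha hb
        rwa [add_zero] at this
      zero_mem' := hasVal_zero
      smul_mem' := fun c x hx => by
        have := hA.hasVal_mul_zero hx c.2
        rwa [mul_comm] at this }
  have hI₀ : ∀ b : S₀, b ∈ I₀ ↔ HasVal A (b : N) (0 : F) := fun b => Iff.rfl
  let e := S₀.equivMapOfInjective α α.injective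
  have he : ∀ b : S₀, ((e b : S₀.map α) : N') = α b := fun b => rfl
  let I : Ideal (S₀.map α) := I₀.comap (e.symm : S₀.map α →ₐ[F] S₀)
  have hI : ∀ b : S₀, e b ∈ I ↔ b ∈ I₀ := by
    intro b
    rw [Ideal.mem_comap]
    change e.symm (e b) ∈ I₀ ↔ _
    rw [AlgEquiv.symm_apply_apply]
  have h1 : I ≠ ⊤ := by
    apply Ideal.comap_ne_top
    rw [Ideal.ne_top_iff_one, hI₀]
    intro h
    exact one_ne_zero (hasVal_one.unique hA h)
  have h2 : I ≠ ⊥ := by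
    obtain ⟨f, hf⟩ : ∃ f, f ∉ A := by
      by_contra! h
      exact hA' (eq_top_iff.2 fun x _ => h x)
    have hv := hasVal_inv_of_notMem (F := F) hf
    intro h
    have h3 : (⟨f⁻¹, hv.mem hA⟩ : S₀) ∈ I₀ := hv
    rw [← hI, h, Ideal.mem_bot, EmbeddingLike.map_eq_zero_iff] at h3
    have h4 : f⁻¹ = 0 := congrArg Subtype.val h3
    rw [inv_eq_zero] at h4
    exact hf (h4 ▸ A.zero_mem)
  obtain ⟨B, hB, -, hBI⟩ := exists_isPlace hN' (S₀.map α) I h1 h2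
  refine ⟨B, hB, fun f c hf => ?_⟩
  have h3 : f - algebraMap F N c ∈ S₀ := sub_mem (hf.mem hA) (hA.algebraMap_mem c)
  have h4 : (⟨_, h3⟩ : S₀) ∈ I₀ := by
    rw [hI₀, hasVal_zero_iff]; exact hf
  have h5 := hBI _ ((hI _).2 h4)
  rw [he, hasVal_zero_iff] at h5
  simpa [HasVal] using h5

/-- The map on points induced by an embedding of function fields is surjective. -/
lemma redAt_surjective (α : W₂.FnField →ₐ[F] W₁.FnField) :
    Function.Surjective (redAt (ptOf α)) := by
  intro R
  obtain ⟨A, hA, hR⟩ := exists_place R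
  have hA' : A ≠ ⊤ := by
    rintro rfl
    obtain ⟨t, ν, j, u, v, -, -, -, -, -, h⟩ := exists_localParam_genericPoint R
    have h1 := (h _ hA hR).2
    have h0 : u ≠ 0 := fun h0 => h1.transcendental (h0 ▸ isAlgebraic_zero)
    have h2 : u⁻¹ ∉ (⊤ : ValuationSubring W₂.FnField) := by
      apply notMem_of_hasVal_inv (F := F) (inv_ne_zero h0)
      rw [inv_inv]
      exact h1.left
    exact h2 trivial
  obtain ⟨B, hB, hBA⟩ := exists_isPlace_comap_eq W₁.trdeg_fnField α hA hA'
  obtain ⟨Q, hQ⟩ := exists_red_genericPoint hB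
  refine ⟨Q, (redAt_eq_iff hB hQ).2 ?_⟩
  rcases R with _ | ⟨a, b, hab⟩
  · have hx : W₂.genX ∉ A := hR
    change α W₂.genX ∉ B
    have h0 : α W₂.genX ≠ 0 := by
      rw [Ne, map_eq_zero]
      simpa using genX_ne_const (W := W₂) 0
    have := hBA _ _ (hasVal_inv_of_notMem (F := F) hx)
    rw [map_inv₀] at this
    exact notMem_of_hasVal_inv h0 this
  · exact ⟨hBA _ _ hR.1, hBA _ _ hR.2⟩

/-- A homomorphism of function fields, on the sealed copies. -/
noncomputable def Isogeny.pull (φ : Isogeny W₁ W₂) : W₂.FnField →ₐ[F] W₁.FnField :=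
  (W₁.toFn.toAlgHom.comp φ.pullback).comp W₂.toFn.symm.toAlgHom

lemma Isogeny.toFn_pullback (φ : Isogeny W₁ W₂) (f : W₂.RationalFunction) :
    W₁.toFn (φ.pullback f) = φ.pull (W₂.toFn f) := by
  simp [Isogeny.pull]

/-- An isogeny from an embedding of function fields whose map on points fixes zero. -/
noncomputable def Isogeny.ofAlgHom (α : W₂.FnField →ₐ[F] W₁.FnField)
    (h : redAt (ptOf α) 0 = 0) : Isogeny W₁ W₂ where
  toFun := redAt (ptOf α)
  pullback := (W₁.toFn.symm.toAlgHom.comp α).comp W₂.toFn.toAlgHom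
  hasValueAt_pullback P f c hf := by
    obtain ⟨A, hA, hR⟩ := exists_place P
    rw [hasValueAt_iff hA hR]
    have e : W₁.toFn (((W₁.toFn.symm.toAlgHom.comp α).comp W₂.toFn.toAlgHom) f) =
      α (W₂.toFn f) := by simp
    rw [e, ← hasVal_comap, ← hasValueAt_iff (hA.comap α) (red_comap_genericPoint α hA hR)]
    exact hf
  surjective := redAt_surjective α
  map_zero := h

lemma Isogeny.toFun_eq (φ : Isogeny W₁ W₂) : φ.toFun = redAt (ptOf φ.pull) := by
  funext P
  obtain ⟨A, hA, hR⟩ := exists_place P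
  symm
  rw [redAt_eq_iff hA hR]
  obtain ⟨B, hB, hRB⟩ := exists_place (φ.toFun P)
  have key : ∀ (f : W₂.FnField) (c : F), HasVal B f c → HasVal A (φ.pull f) c := by
    intro f c h
    obtain ⟨f, rfl⟩ := W₂.toFn.surjective f
    rw [← φ.toFn_pullback]
    exact (hasValueAt_iff hA hR).1 (φ.hasValueAt_pullback P f c ((hasValueAt_iff hB hRB).2 h))
  change Red A (mapPt φ.pull W₂.genericPoint) _
  rw [← red_comap]
  rcases hQ : φ.toFun P with _ | ⟨a, b, hab⟩
  · rw [hQ] at hRB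
    have hx : W₂.genX ∉ B := hRB
    change W₂.genX ∉ A.comap (φ.pull : W₂.FnField →+* W₁.FnField)
    have h0 : W₂.genX ≠ 0 := by simpa using genX_ne_const (W := W₂) 0
    exact notMem_of_hasVal_inv h0 ((hasVal_comap _).2 (key _ 0 (hasVal_inv_of_notMem hx)))
  · rw [hQ] at hRB
    exact ⟨(hasVal_comap _).2 (key _ a hRB.1), (hasVal_comap _).2 (key _ b hRB.2)⟩

end Morphisms

end WeierstrassCurve

/-! ### Function fields of one variable and their subfields of powers -/

namespace WeierstrassCurve

open scoped Classical

section CurveField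

open IntermediateField

/-- `N` is a function field of one variable over `F`: finitely generated of transcendence
degree one. -/
structure IsCurveField (F N : Type*) [Field F] [Field N] [Algebra F N] : Prop where
  trdeg : Algebra.trdeg F N = 1
  ess : Algebra.EssFiniteType F N

variable {F N : Type*} [Field F] [Field N] [Algebra F N]

lemma finite_of_essFiniteType_of_isAlgebraic [Algebra.EssFiniteType F N] [Algebra.IsAlgebraic F N] :
    FiniteDimensional F N := by
  obtain ⟨s, hs⟩ := IntermediateField.fg_top F N
  have : FiniteDimensional F (IntermediateField.adjoin F (s : Set N)) :=
    IntermediateField.finiteDimensional_adjoin fun x _ => Algebra.IsIntegral.isIntegral x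
  rw [hs] at this
  exact Module.Finite.equiv (IntermediateField.topEquiv (F := F) (E := N)).toLinearEquiv

lemma isAlgebraic_tower_of_trdeg_eq_one (hN : Algebra.trdeg F N = 1) {E : Type*} [Field E]
    [Algebra F E] [Algebra E N] [IsScalarTower F E N] {s : E} (hs : Transcendental F s) :
    Algebra.IsAlgebraic E N := by
  have h := lift_trdeg_add_eq F E N
  rw [hN, Cardinal.lift_one] at h
  have h1 : Algebra.trdeg F E ≠ 0 := by
    rw [Ne, trdeg_eq_zero_iff]
    intro h
    exact hs (h.isAlgebraic s)
  rw [← trdeg_eq_zero_iff (R := E)]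
  by_contra h2
  have key : ∀ a b : Cardinal, a + b = 1 → a ≠ 0 → b ≠ 0 → False := by
    intro a b hab ha hb
    have h4 := add_le_add (Cardinal.one_le_iff_ne_zero.2 ha) (Cardinal.one_le_iff_ne_zero.2 hb)
    rw [hab] at h4
    norm_num at h4
  exact key _ _ h (by rwa [Ne, Cardinal.lift_eq_zero]) (by rwa [Ne, Cardinal.lift_eq_zero])

lemma IsCurveField.finite_tower (h : IsCurveField F N) {E : Type*} [Field E]
    [Algebra F E] [Algebra E N] [IsScalarTower F E N] {s : E} (hs : Transcendental F s) :
    FiniteDimensional E N := by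
  have := isAlgebraic_tower_of_trdeg_eq_one h.trdeg hs
  have := h.ess
  have := Algebra.EssFiniteType.of_comp F E N
  exact finite_of_essFiniteType_of_isAlgebraic

lemma transcendental_gen {f : N} (hf : Transcendental F f) :
    Transcendental F (AdjoinSimple.gen F f) := fun h =>
  hf ((isAlgebraic_algHom_iff F⟮f⟯.val F⟮f⟯.val.injective).2 h)

lemma IsCurveField.finite (h : IsCurveField F N) {f : N} (hf : Transcendental F f) :
    FiniteDimensional F⟮f⟯ N :=
  h.finite_tower (transcendental_gen hf)

lemma isCurveField_of_finite {f : N} (hf : Transcendental F f) (h : FiniteDimensional F⟮f⟯ N) :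
    IsCurveField F N := by
  refine ⟨trdeg_eq_one_of_isAlgebraic hf inferInstance, ?_⟩
  have : Algebra.EssFiniteType F F⟮f⟯ := by
    rw [IntermediateField.essFiniteType_iff]
    exact ⟨{f}, by simp⟩
  exact Algebra.EssFiniteType.comp F F⟮f⟯ N

lemma IsCurveField.intermediate (h : IsCurveField F N) (S : IntermediateField F N) {s : N}
    (hs : s ∈ S) (hs' : Transcendental F s) : IsCurveField F S := by
  have hs'' : Transcendental F (⟨s, hs⟩ : S) := fun h' =>
    hs' ((isAlgebraic_algHom_iff S.val S.val.injective).2 h')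
  refine isCurveField_of_finite hs'' ?_
  have := h.finite_tower (E := F⟮(⟨s, hs⟩ : S)⟯) (transcendental_gen hs'')
  exact Module.Finite.of_injective
    (IsScalarTower.toAlgHom F⟮(⟨s, hs⟩ : S)⟯ S N).toLinearMap (algebraMap S N).injective

lemma isCurveField_fnField (W : WeierstrassCurve F) : IsCurveField F W.FnField :=
  isCurveField_of_finite W.transcendental_genX inferInstance

/-- A function field of one variable over a perfect field has a separating element. -/
lemma IsCurveField.exists_separating [PerfectField F] (h : IsCurveField F N) :
    ∃ t : N, Transcendental F t ∧ Algebra.IsSeparable F⟮t⟯ N := by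
  have := h.ess
  obtain ⟨s, hs, hsep⟩ := exists_isTranscendenceBasis_and_isSeparable_of_perfectField F N
  have hc := hs.lift_cardinalMk_eq_trdeg
  rw [h.trdeg] at hc
  have hc1 : s.card = 1 := by
    have : Cardinal.mk s = 1 := by simpa using hc
    simpa using this
  obtain ⟨t, rfl⟩ := Finset.card_eq_one.1 hc1
  refine ⟨t, hs.1.transcendental ⟨t, by simp⟩, ?_⟩
  rwa [Finset.coe_singleton] at hsep

variable (F N) in
/-- The subfield of `p ^ n`-th powers, for `F` perfect of characteristic `p`. -/
def frobField (p : ℕ) [Fact p.Prime] [CharP F p] [PerfectField F] (n : ℕ) :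
    IntermediateField F N where
  carrier := {x | ∃ y, y ^ p ^ n = x}
  mul_mem' := by
    rintro _ _ ⟨x, rfl⟩ ⟨y, rfl⟩
    exact ⟨x * y, mul_pow _ _ _⟩
  add_mem' := by
    rintro _ _ ⟨x, rfl⟩ ⟨y, rfl⟩
    have := charP_of_injective_algebraMap (algebraMap F N).injective p
    exact ⟨x + y, add_pow_char_pow _ _ _ _⟩
  inv_mem' := by
    rintro _ ⟨x, rfl⟩
    exact ⟨x⁻¹, inv_pow _ _⟩
  algebraMap_mem' c := by
    have := PerfectField.toPerfectRing (K := F) p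
    obtain ⟨d, rfl⟩ := (bijective_iterateFrobenius F p n).2 c
    exact ⟨algebraMap F N d, by rw [← map_pow]; rfl⟩

variable {p : ℕ} [Fact p.Prime] [CharP F p] [PerfectField F]

lemma mem_frobField {n : ℕ} {x : N} : x ∈ frobField F N p n ↔ ∃ y, y ^ p ^ n = x := Iff.rfl

lemma frobField_le {m n : ℕ} (h : m ≤ n) : frobField F N p n ≤ frobField F N p m := by
  rintro _ ⟨y, rfl⟩
  exact ⟨y ^ p ^ (n - m), by rw [← pow_mul, ← pow_add, Nat.sub_add_cancel h]⟩

lemma isPurelyInseparable_frobField (n : ℕ) : IsPurelyInseparable (frobField F N p n) N := by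
  have := charP_of_injective_algebraMap (algebraMap F (frobField F N p n)).injective p
  rw [isPurelyInseparable_iff_pow_mem _ p]
  exact fun x => ⟨n, ⟨x ^ p ^ n, x, rfl⟩, rfl⟩

/-- A separating element is not a `p`-th power. -/
lemma notMem_frobField_of_isSeparable {t : N} (ht : Transcendental F t)
    (h : Algebra.IsSeparable F⟮t⟯ N) : t ∉ frobField F N p 1 := by
  rintro ⟨s, hs⟩
  rw [pow_one] at hs
  have hs' : s ∈ F⟮t⟯ := by
    have := charP_of_injective_algebraMap (algebraMap F F⟮t⟯).injective p
    have h1 : IsPurelyInseparable F⟮t⟯ F⟮t⟯⟮s⟯ := by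
      rw [IntermediateField.isPurelyInseparable_adjoin_simple_iff_pow_mem F⟮t⟯ N p]
      exact ⟨1, ⟨⟨t, mem_adjoin_simple_self F t⟩, by simp [hs]⟩⟩
    have h2 := IntermediateField.eq_bot_of_isPurelyInseparable_of_isSeparable F⟮t⟯⟮s⟯
    have h3 : s ∈ F⟮t⟯⟮s⟯ := mem_adjoin_simple_self _ s
    rw [h2, IntermediateField.mem_bot] at h3
    obtain ⟨z, rfl⟩ := h3
    exact z.2
  obtain ⟨a, b, rfl⟩ := (mem_adjoin_simple_iff F s).1 hs'
  have hb0 : b ≠ 0 := by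
    rintro rfl
    simp only [map_zero, div_zero] at hs
    rw [zero_pow (Fact.out : p.Prime).ne_zero] at hs
    exact ht (hs ▸ isAlgebraic_zero)
  have hb1 : aeval t b ≠ 0 := fun h => hb0 (transcendental_iff.1 ht _ h)
  rw [div_pow, div_eq_iff (pow_ne_zero _ hb1)] at hs
  have h1 : aeval t (a ^ p - X * b ^ p) = 0 := by
    simp [hs]
  have h2 := sub_eq_zero.1 (transcendental_iff.1 ht _ h1)
  have h3 := congrArg natDegree h2
  rw [natDegree_pow, natDegree_X_mul (pow_ne_zero _ hb0), natDegree_pow] at h3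
  -- the degrees of the two sides differ modulo `p`
  have h4 : p ∣ 1 := by
    have h5 : p ∣ p * b.natDegree + 1 := h3 ▸ dvd_mul_right _ _
    exact (Nat.dvd_add_right (dvd_mul_right _ _)).1 h5
  exact (Fact.out : p.Prime).one_lt.ne' (Nat.dvd_one.1 h4)

lemma adjoin_frobField_eq_top {t : N} (h : Algebra.IsSeparable F⟮t⟯ N) (n : ℕ) :
    (frobField F N p n)⟮t⟯ = ⊤ := by
  have h1 := isPurelyInseparable_frobField (F := F) (N := N) (p := p) n
  have h2 : IsPurelyInseparable (frobField F N p n)⟮t⟯ N := inferInstance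
  have h3 : Algebra.IsSeparable (frobField F N p n)⟮t⟯ N := by
    have hle : F⟮t⟯ ≤ (frobField F N p n)⟮t⟯.restrictScalars F := by
      rw [adjoin_simple_le_iff]
      exact mem_adjoin_simple_self _ t
    let i := (IntermediateField.inclusion hle).toRingHom
    let : Algebra F⟮t⟯ (frobField F N p n)⟮t⟯ := i.toAlgebra
    have : IsScalarTower F⟮t⟯ (frobField F N p n)⟮t⟯ N :=
      IsScalarTower.of_algebraMap_eq fun _ => rfl
    exact Algebra.isSeparable_tower_top_of_isSeparable F⟮t⟯ (frobField F N p n)⟮t⟯ N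
  rw [eq_top_iff]
  intro x _
  obtain ⟨z, rfl⟩ := IsPurelyInseparable.surjective_algebraMap_of_isSeparable
    (frobField F N p n)⟮t⟯ N x
  exact z.2

/-- A function field of one variable has degree `p ^ n` over the subfield of `p ^ n`-th powers. -/
lemma IsCurveField.finrank_frobField (h : IsCurveField F N) (n : ℕ) :
    FiniteDimensional (frobField F N p n) N ∧ Module.finrank (frobField F N p n) N = p ^ n := by
  obtain ⟨t, ht, hsep⟩ := h.exists_separating
  have h1 := isPurelyInseparable_frobField (F := F) (N := N) (p := p) n
  have htop := adjoin_frobField_eq_top (p := p) hsep n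
  have hint : _root_.IsIntegral (frobField F N p n) t := Algebra.IsIntegral.isIntegral t
  have hfin := IntermediateField.adjoin.finiteDimensional hint
  rw [htop] at hfin
  have hfin' : FiniteDimensional (frobField F N p n) N :=
    Module.Finite.equiv (IntermediateField.topEquiv (F := frobField F N p n)
      (E := N)).toLinearEquiv
  refine ⟨hfin', ?_⟩
  have hfr := IntermediateField.adjoin.finrank hint
  rw [htop, IntermediateField.finrank_top'] at hfr
  have := charP_of_injective_algebraMap (algebraMap F (frobField F N p n)).injective p
  obtain ⟨k, y, hk⟩ := IsPurelyInseparable.minpoly_eq_X_pow_sub_C (frobField F N p n) p t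
  have hp1 := (Fact.out : p.Prime).one_lt
  rw [hfr, hk, natDegree_X_pow_sub_C]
  refine le_antisymm ?_ ?_
  · have h2 : minpoly (frobField F N p n) t ∣
        X ^ p ^ n - C (⟨t ^ p ^ n, t, rfl⟩ : frobField F N p n) := by
      apply minpoly.dvd
      simp only [map_sub, map_pow, aeval_X, aeval_C]
      exact sub_self _
    have h3 := natDegree_le_of_dvd h2 (X_pow_sub_C_ne_zero (by positivity) _)
    rwa [hk, natDegree_X_pow_sub_C, natDegree_X_pow_sub_C] at h3
  · refine Nat.pow_le_pow_right hp1.le ?_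
    by_contra! hkn
    have h2 := minpoly.aeval (frobField F N p n) t
    rw [hk] at h2
    simp only [map_sub, map_pow, aeval_X, aeval_C, sub_eq_zero] at h2
    obtain ⟨z, hz⟩ := y.2
    have h3 : z ^ p ^ n = t ^ p ^ k := by rw [h2, hz]; rfl
    have := charP_of_injective_algebraMap (algebraMap F N).injective p
    have h4 : z ^ p ^ (n - k) = t := by
      apply iterateFrobenius_inj N p k
      rw [iterateFrobenius_def, iterateFrobenius_def, ← h3, ← pow_mul, ← pow_add,
        Nat.sub_add_cancel hkn.le]
    exact notMem_frobField_of_isSeparable (p := p) ht hsep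
      (frobField_le (by omega : 1 ≤ n - k) ⟨z, h4⟩)

/-- A subfield over which `N` is purely inseparable of degree `p ^ n` consists of the
`p ^ n`-th powers. -/
lemma IsCurveField.eq_frobField (h : IsCurveField F N) (S : IntermediateField F N)
    (hS : IsPurelyInseparable S N) [FiniteDimensional S N] {n : ℕ}
    (hn : Module.finrank S N = p ^ n) : S = frobField F N p n := by
  have := charP_of_injective_algebraMap (algebraMap F S).injective p
  have hle : frobField F N p n ≤ S := by
    rintro _ ⟨y, rfl⟩
    obtain ⟨k, z, hk⟩ := IsPurelyInseparable.minpoly_eq_X_pow_sub_C S p y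
    have h1 := minpoly.natDegree_le (A := S) y
    rw [hk, natDegree_X_pow_sub_C, hn] at h1
    have hkn : k ≤ n := (Nat.pow_le_pow_iff_right (Fact.out : p.Prime).one_lt).1 h1
    have h2 := minpoly.aeval S y
    rw [hk] at h2
    simp only [map_sub, map_pow, aeval_X, aeval_C, sub_eq_zero] at h2
    rw [← Nat.sub_add_cancel hkn, pow_add, mul_comm, pow_mul, h2]
    exact pow_mem z.2 _
  symm
  obtain ⟨h1, h2⟩ := h.finrank_frobField (p := p) n
  exact IntermediateField.eq_of_le_of_finrank_le' hle (by rw [h2, hn])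

/-- If `N` is purely inseparable of degree `p ^ n` over a field `E`, then the image of `E` consists
of the `p ^ n`-th powers. -/
lemma IsCurveField.mem_range_algebraMap_iff (h : IsCurveField F N) {E : Type*} [Field E]
    [Algebra F E] [Algebra E N] [IsScalarTower F E N] (hE : IsPurelyInseparable E N)
    [FiniteDimensional E N] {n : ℕ} (hn : Module.finrank E N = p ^ n) (f : N) :
    f ∈ (algebraMap E N).range ↔ ∃ g, g ^ p ^ n = f := by
  let i := IsScalarTower.toAlgHom F E N
  let e : E ≃ₐ[F] i.fieldRange := AlgEquiv.ofInjectiveField i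
  have hc : ∀ z, algebraMap i.fieldRange N (e z) = algebraMap E N z := fun z => rfl
  have h1 := charP_of_injective_algebraMap (algebraMap F E).injective p
  have h2 := charP_of_injective_algebraMap (algebraMap F i.fieldRange).injective p
  have hpi : IsPurelyInseparable i.fieldRange N := by
    rw [isPurelyInseparable_iff_pow_mem _ p] at hE ⊢
    intro x
    obtain ⟨n, y, hy⟩ := hE x
    exact ⟨n, e y, by rw [hc, hy]⟩
  have hfd : FiniteDimensional i.fieldRange N :=
    Module.Finite.of_equiv_equiv (e : E ≃+* i.fieldRange) (RingEquiv.refl N)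
      (RingHom.ext fun _ => rfl)
  have hrk : Module.finrank i.fieldRange N = p ^ n := by
    rw [← hn]
    exact (Algebra.finrank_eq_of_equiv_equiv (e : E ≃+* i.fieldRange) (RingEquiv.refl N)
      (RingHom.ext fun _ => rfl)).symm
  rw [← mem_frobField (F := F), ← h.eq_frobField i.fieldRange hpi hrk]
  rfl

end CurveField

end WeierstrassCurve

/-! ### Multiplication by the characteristic -/

namespace WeierstrassCurve

open scoped Classical

section Points

variable {F N : Type*} [Field F] [Field N] [Algebra F N]

/-- A finitely generated extension without nonzero derivations is separable. -/
lemma isSeparable_of_derivation_eq_zero [Algebra.EssFiniteType F N]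
    (hder : ∀ D : Derivation F N N, D = 0) : Algebra.IsSeparable F N := by
  have hsub : Subsingleton (KaehlerDifferential F N) := by
    refine subsingleton_of_forall_eq 0 fun v => ?_
    rw [← Module.forall_dual_apply_eq_zero_iff N v]
    intro φ
    have h1 := hder (φ.compDer (KaehlerDifferential.D F N))
    have h2 : φ = 0 := by
      apply (KaehlerDifferential.linearMapEquivDerivation F N).injective
      rw [map_zero]
      exact h1
    rw [h2, LinearMap.zero_apply]
  have hunr : Algebra.FormallyUnramified F N := ⟨hsub⟩
  exact (Algebra.FormallyUnramified.iff_isSeparable F N).1 hunr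

variable (W : WeierstrassCurve F)

/-- The points of `W` with coordinates in the intermediate field `S`. -/
noncomputable def ptIn (S : IntermediateField F N) :
    AddSubgroup (W.baseChange N).toAffine.Point :=
  AddMonoidHom.range (G := (W.baseChange S).toAffine.Point) (mapPt (W := W) S.val)

variable {W}

lemma some_mem_ptIn {S : IntermediateField F N} {x y : N}
    {h : (W.baseChange N).toAffine.Nonsingular x y} :
    (.some x y h : (W.baseChange N).toAffine.Point) ∈ W.ptIn S ↔ x ∈ S ∧ y ∈ S := by
  constructor
  · rintro ⟨P, hP⟩
    rcases P with _ | ⟨a, b, hab⟩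
    · cases hP
    · obtain ⟨h', e⟩ := mapPt_some (W := W) S.val hab
      rw [e, some_eq_some_iff] at hP
      exact ⟨hP.1 ▸ a.2, hP.2 ▸ b.2⟩
  · rintro ⟨hx, hy⟩
    have h' : (W.baseChange S).toAffine.Nonsingular ⟨x, hx⟩ ⟨y, hy⟩ :=
      (Affine.baseChange_nonsingular (W := W.toAffine) (f := S.val) S.val.injective _ _).1 h
    exact ⟨.some _ _ h', by
      obtain ⟨h'', e⟩ := mapPt_some (W := W) S.val h'
      rw [e]; rfl⟩

end Points

section Frobenius

open IntermediateField

variable {F N : Type*} [Field F] [Field N] [Algebra F N]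
variable {p : ℕ} [Fact p.Prime] [CharP F p] [PerfectField F]

/-- In a function field of one variable, the elements killed by all derivations are the `p`-th
powers. -/
lemma IsCurveField.mem_frobField_of_derivation (h : IsCurveField F N) {f : N}
    (hD : ∀ D : Derivation F N N, D f = 0) : f ∈ frobField F N p 1 := by
  by_contra hf
  set M := frobField F N p 1 with hM
  obtain ⟨hfin, hrank⟩ := h.finrank_frobField (p := p) 1
  rw [← hM, pow_one] at hrank
  rw [← hM] at hfin
  have hsimple := IntermediateField.isSimpleOrder_of_finrank_prime M N
    (hrank ▸ (Fact.out : p.Prime))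
  have htop : M⟮f⟯ = ⊤ := by
    refine (hsimple.eq_bot_or_eq_top M⟮f⟯).resolve_left fun hbot => hf ?_
    have h1 : f ∈ M⟮f⟯ := mem_adjoin_simple_self M f
    rw [hbot, IntermediateField.mem_bot] at h1
    obtain ⟨z, rfl⟩ := h1
    exact z.2
  have hadj : Algebra.adjoin M {f} = ⊤ := by
    rw [← IntermediateField.adjoin_simple_toSubalgebra_of_isAlgebraic
      (Algebra.IsAlgebraic.isAlgebraic f), htop]
    rfl
  have hder : ∀ D : Derivation M N N, D = 0 := by
    intro D
    refine Derivation.ext fun x => ?_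
    have hx : x ∈ Algebra.adjoin M {f} := hadj ▸ Algebra.mem_top
    refine Derivation.eqOn_adjoin (D1 := D) (D2 := 0) (s := {f}) ?_ hx
    rintro z rfl
    exact hD (D.restrictScalars F)
  have hsep : Algebra.IsSeparable M N := isSeparable_of_derivation_eq_zero hder
  have hpi := isPurelyInseparable_frobField (F := F) (N := N) (p := p) 1
  obtain ⟨z, hz⟩ := IsPurelyInseparable.surjective_algebraMap_of_isSeparable M N f
  exact hf (hz ▸ z.2)

variable {W : WeierstrassCurve F}

/-- Multiplication by `p` maps to points whose coordinates are `p`-th powers, since these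
coordinates are killed by all derivations. -/
lemma IsCurveField.nsmul_mem_ptIn_frobField_one (h : IsCurveField F N)
    (P : (W.baseChange N).toAffine.Point) : p • P ∈ W.ptIn (frobField F N p 1) := by
  have := charP_of_injective_algebraMap (algebraMap F N).injective p
  have hom : ∀ D : Derivation F N N, W.HasOmega D (p • P) 0 := by
    intro D
    obtain ⟨w, hw⟩ := exists_hasOmega (W := W) (D := D) P
    have := hw.nsmul p
    rwa [CharP.cast_eq_zero, zero_mul] at this
  rcases hP : p • P with _ | ⟨x, y, hxy⟩
  · exact zero_mem _
  · rw [hP] at hom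
    rw [some_mem_ptIn]
    exact ⟨h.mem_frobField_of_derivation fun D => ((hasOmega_zero_iff hxy).1 (hom D)).1,
      h.mem_frobField_of_derivation fun D => ((hasOmega_zero_iff hxy).1 (hom D)).2⟩

lemma IsCurveField.isCurveField_frobField (h : IsCurveField F N) (n : ℕ) :
    IsCurveField F (frobField F N p n) := by
  obtain ⟨t, ht⟩ := exists_transcendental_of_trdeg_eq_one h.trdeg
  refine h.intermediate _ (s := t ^ p ^ n) ⟨t, rfl⟩ ?_
  exact ht.pow (pow_pos (Fact.out : p.Prime).pos n)

lemma mapPt_mem_ptIn_frobField_succ {n : ℕ}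
    {P : (W.baseChange (frobField F N p n)).toAffine.Point}
    (hP : P ∈ W.ptIn (frobField F (frobField F N p n) p 1)) :
    mapPt (W := W) (frobField F N p n).val P ∈ W.ptIn (frobField F N p (n + 1)) := by
  rcases P with _ | ⟨x, y, hxy⟩
  · rw [← Affine.Point.zero_def, map_zero]; exact zero_mem _
  · rw [some_mem_ptIn] at hP
    obtain ⟨h', e⟩ := mapPt_some (W := W) (frobField F N p n).val hxy
    rw [e, some_mem_ptIn]
    have key : ∀ z ∈ frobField F (frobField F N p n) p 1,
        (z : N) ∈ frobField F N p (n + 1) := by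
      rintro _ ⟨⟨_, u, rfl⟩, rfl⟩
      exact ⟨u, by rw [pow_succ, pow_mul, pow_one]; rfl⟩
    exact ⟨key _ hP.1, key _ hP.2⟩

lemma mem_ptIn_frobField_zero (P : (W.baseChange N).toAffine.Point) :
    P ∈ W.ptIn (frobField F N p 0) := by
  rcases P with _ | ⟨x, y, hxy⟩
  · exact zero_mem _
  · rw [some_mem_ptIn]
    exact ⟨⟨x, by simp⟩, ⟨y, by simp⟩⟩

/-- Multiplication by `p ^ n` maps to points whose coordinates are `p ^ n`-th powers. -/
lemma IsCurveField.nsmul_mem_ptIn_frobField (h : IsCurveField F N) (n : ℕ)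
    (P : (W.baseChange N).toAffine.Point) : p ^ n • P ∈ W.ptIn (frobField F N p n) := by
  induction n with
  | zero => exact mem_ptIn_frobField_zero _
  | succ n ih =>
    obtain ⟨P₀, hP₀⟩ := ih
    rw [pow_succ', mul_smul, ← hP₀, ← map_nsmul]
    exact mapPt_mem_ptIn_frobField_succ
      ((h.isCurveField_frobField (p := p) n).nsmul_mem_ptIn_frobField_one (p := p) P₀)

end Frobenius

end WeierstrassCurve

/-! ### Points over rational function fields are constant -/

namespace WeierstrassCurve

open scoped Classical

section Rigidity

open IntermediateField

variable {F N : Type*} [Field F] [Field N] [Algebra F N] {W : WeierstrassCurve F}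

lemma HasOmega.smul {D : Derivation F N N} {P : (W.baseChange N).toAffine.Point} {w : N}
    (h : W.HasOmega D P w) (c : N) : W.HasOmega (c • D) P (c * w) := by
  rcases P with _ | ⟨x, y, hxy⟩
  · change c * w = 0
    rw [show w = 0 from h, mul_zero]
  · obtain ⟨h1, h2⟩ := h
    constructor
    · rw [Derivation.smul_apply, h1, smul_eq_mul]; ring
    · rw [Derivation.smul_apply, h2, smul_eq_mul]; ring

lemma hasOmega_constPt (D : Derivation F N N) (Q : W.toAffine.Point) :
    W.HasOmega D (W.constPt N Q) 0 := by
  rcases Q with _ | ⟨a, b, h⟩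
  · rfl
  · rw [constPt_some, hasOmega_zero_iff]
    exact ⟨D.map_algebraMap a, D.map_algebraMap b⟩

section place

variable {A : ValuationSubring N}

/-- A derivation that preserves the ring of a place has a regular contraction with the invariant
differential there, as long as the point reduces to an affine point. -/
lemma HasOmega.mem_of_red [W.IsElliptic] (hA : IsPlace F A) {D : Derivation F N N}
    (hD : ∀ f ∈ A, D f ∈ A) {P : (W.baseChange N).toAffine.Point} {w : N}
    (h : W.HasOmega D P w) {Q : W.toAffine.Point} (hQ : Q ≠ 0) (hR : Red A P Q) : w ∈ A := by
  rcases Q with _ | ⟨a, b, hab⟩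
  · exact (hQ rfl).elim
  rcases P with _ | ⟨x, y, hxy⟩
  · exact hR.elim
  obtain ⟨hx, hy⟩ := hR
  obtain ⟨h1, h2⟩ := h
  have e1 := ((hasVal_two.mul hA hy).add ((hasVal_a₁ W A).mul hA hx)).add (hasVal_a₃ W A)
  have e2 := (((hasVal_three.mul hA (hx.pow hA 2)).add
    ((hasVal_two.mul hA (hasVal_a₂ W A)).mul hA hx)).add (hasVal_a₄ W A)).sub
      ((hasVal_a₁ W A).mul hA hy)
  have key : ∀ {u d : N} {c : F}, HasVal A u c → c ≠ 0 → d ∈ A → d = w * u → w ∈ A := by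
    intro u d c hu hc hd he
    have hu0 : u ≠ 0 := by
      rintro rfl
      exact hc (hu.unique hA hasVal_zero)
    rw [show w = d * u⁻¹ by rw [he]; field_simp]
    exact mul_mem hd ((hu.inv hA hc).mem hA)
  rcases ((Affine.nonsingular_iff' _ _).1 hab).2 with h0 | h0
  · refine key e2 ?_ (hD y (hy.mem hA)) h2
    intro h; apply h0; linear_combination -h
  · exact key e1 h0 (hD x (hx.mem hA)) h1

/-- On a rational function field, a derivation that is regular on a coordinate is regular at all
places where this coordinate vanishes. -/
lemma derivation_mem_of_isLocalParam (hN : Algebra.trdeg F N = 1) (hA : IsPlace F A) {u : N}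
    (hgen : F⟮u⟯ = ⊤) (hu : HasVal A u (0 : F)) (hu' : Transcendental F u)
    {D : Derivation F N N} {c : F} (hD : D u = algebraMap F N c) {f : N} (hf : f ∈ A) :
    D f ∈ A := by
  have hloc : IsLocalParam F A u 0 := by
    refine ⟨hu, hasVal_zero, fun f => ?_, ⟨0, zero_mem _, 1, one_mem _, 1, one_ne_zero, hasVal_one,
      by simp⟩, hu'⟩
    have hf : f ∈ F⟮u⟯ := hgen ▸ IntermediateField.mem_top
    obtain ⟨r, s, rfl⟩ := (mem_adjoin_simple_iff F f).1 hf
    have hmem : ∀ q : F[X], aeval u q ∈ Algebra.adjoin F {u, 0} := fun q =>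
      Algebra.adjoin_mono (by simp) (aeval_mem_adjoin_singleton F u)
    by_cases hs : aeval u s = 0
    · exact ⟨0, zero_mem _, 1, one_mem _, one_ne_zero, by simp [hs]⟩
    · exact ⟨_, hmem r, _, hmem s, hs, rfl⟩
  have hBA : ∀ b ∈ Algebra.adjoin F {u, 0}, b ∈ A ∧ D b ∈ A := by
    intro b hb
    induction hb using Algebra.adjoin_induction with
    | mem z hz =>
      rcases hz with rfl | rfl
      · exact ⟨hu.mem hA, hD ▸ hA.algebraMap_mem c⟩
      · exact ⟨A.zero_mem, by rw [map_zero]; exact A.zero_mem⟩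
    | algebraMap c => exact ⟨hA.algebraMap_mem c, by rw [D.map_algebraMap]; exact A.zero_mem⟩
    | add a b _ _ ha hb =>
      exact ⟨add_mem ha.1 hb.1, by rw [map_add]; exact add_mem ha.2 hb.2⟩
    | mul a b _ _ ha hb =>
      refine ⟨mul_mem ha.1 hb.1, ?_⟩
      rw [D.leibniz]
      exact add_mem (mul_mem ha.1 hb.2) (mul_mem hb.1 ha.2)
  obtain ⟨g, hg, e, he, b, hb, heb, rfl⟩ := hloc.exists_div hN hA hf
  have he0 : e ≠ 0 := by
    rintro rfl
    exact hb (heb.unique hA hasVal_zero)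
  have hei := (heb.inv hA hb).mem hA
  have : D (g / e) = (D g - (g / e) * D e) * e⁻¹ := by
    have h1 : D (g / e * e) = D g := by rw [div_mul_cancel₀ _ he0]
    rw [D.leibniz, smul_eq_mul, smul_eq_mul] at h1
    field_simp
    rw [← h1]
    field_simp
    ring
  rw [this]
  exact mul_mem (sub_mem (hBA g hg).2 (mul_mem hf (hBA e he).2)) hei

end place

lemma exists_point_ne_zero [IsAlgClosed F] [W.IsElliptic] : ∃ Q : W.toAffine.Point, Q ≠ 0 := by
  obtain ⟨A, hA, hv⟩ := exists_isPlace_hasVal W.trdeg_fnField W.transcendental_genX 0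
  obtain ⟨Q, hQ⟩ := exists_red_genericPoint hA
  refine ⟨Q, ?_⟩
  rintro rfl
  exact hQ (hv.mem hA)

variable {p : ℕ} [Fact p.Prime] [CharP F p] [IsAlgClosed F]

/-- The invariant differential has no regular pull back to a rational function field but zero: it
would be a regular differential on the projective line. -/
lemma HasOmega.eq_zero_of_adjoin_eq_top [W.IsElliptic] (hN : Algebra.trdeg F N = 1) {t : N}
    (ht : Transcendental F t) (hgen : F⟮t⟯ = ⊤) {D : Derivation F N N} (hD : D t = 1)
    {P : (W.baseChange N).toAffine.Point} {w : N} (h : W.HasOmega D P w) : w = 0 := by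
  obtain ⟨S, hS⟩ := exists_point_ne_zero (W := W)
  have hreg : ∀ A : ValuationSubring N, IsPlace F A → ∀ (D : Derivation F N N) (w : N),
      (∀ f ∈ A, D f ∈ A) → W.HasOmega D P w → w ∈ A := by
    intro A hA D w hD h
    obtain ⟨Q, hQ⟩ := exists_red hA P
    by_cases hQ0 : Q = 0
    · subst hQ0
      have h1 := hQ.add hA (red_const A S)
      have h2 := h.add (hasOmega_constPt D S)
      rw [zero_add] at h1
      rw [add_zero] at h2
      exact h2.mem_of_red hA hD hS h1
    · exact h.mem_of_red hA hD hQ0 hQ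
  have ht0 : t ≠ 0 := fun h0 => ht (h0 ▸ isAlgebraic_zero)
  have hinf : ∀ A : ValuationSubring N, IsPlace F A → t ∉ A → HasVal A w (0 : F) := by
    intro A hA htA
    have hv := hasVal_inv_of_notMem (F := F) htA
    have hti : Transcendental F t⁻¹ := fun h => ht (by simpa using h.inv)
    have hgen' : F⟮t⁻¹⟯ = ⊤ := by
      rw [eq_top_iff, ← hgen, adjoin_simple_le_iff]
      simpa using inv_mem (mem_adjoin_simple_self F t⁻¹)
    -- `t⁻¹` is a coordinate at infinity, and `t ^ 2 • D` is minus the derivation with respect to it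
    have hDt : (t ^ 2 • D) t⁻¹ = algebraMap F N (-1) := by
      rw [Derivation.smul_apply, D.leibniz_inv, hD]
      simp
      field_simp
    have h1 := hreg A hA (t ^ 2 • D) (t ^ 2 * w)
      (fun f hf => derivation_mem_of_isLocalParam hN hA hgen' hv hti hDt hf) (h.smul _)
    have := hA.hasVal_mul_zero (f := t⁻¹ ^ 2) (g := t ^ 2 * w) (by
      simpa using hv.pow hA 2) h1
    convert! this using 1
    field_simp
  obtain ⟨c, rfl⟩ := mem_range_of_forall_place (F := F) hN (f := w) fun A hA => by
    by_cases htA : t ∈ A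
    · obtain ⟨c, hc⟩ := hA.exists_value t htA
      have hv : HasVal A (t - algebraMap F N c) (0 : F) := by rw [hasVal_zero_iff]; exact hc
      have hti : Transcendental F (t - algebraMap F N c) := fun h =>
        ht (by simpa using h.add (isAlgebraic_algebraMap (A := N) c))
      have hgen' : F⟮t - algebraMap F N c⟯ = ⊤ := by
        rw [eq_top_iff, ← hgen, adjoin_simple_le_iff]
        simpa using add_mem (mem_adjoin_simple_self F (t - algebraMap F N c))
          (IntermediateField.algebraMap_mem F⟮t - algebraMap F N c⟯ c)
      refine hreg A hA D w (fun f hf => derivation_mem_of_isLocalParam hN hA hgen' hv hti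
        (c := 1) ?_ hf) h
      rw [map_sub, D.map_algebraMap, hD, sub_zero, map_one]
    · exact (hinf A hA htA).mem hA
  have hti : Transcendental F t⁻¹ := fun h => ht (by simpa using h.inv)
  obtain ⟨A, hA, hv⟩ := exists_isPlace_hasVal hN hti 0
  have := (hinf A hA (notMem_of_hasVal_inv ht0 hv)).unique hA (hasVal_algebraMap c)
  rw [← this, map_zero]

/-- The coordinates of a point over a rational function field are `p`-th powers, since the invariant
differential pulls back to zero. -/
lemma mem_ptIn_frobField_of_adjoin_eq_top [W.IsElliptic] {t : N}
    (ht : Transcendental F t) (hgen : F⟮t⟯ = ⊤) (P : (W.baseChange N).toAffine.Point) :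
    P ∈ W.ptIn (frobField F N p 1) := by
  have hsep : Algebra.IsSeparable F⟮t⟯ N := by
    refine ⟨fun x => ?_⟩
    have hx : x ∈ F⟮t⟯ := hgen ▸ IntermediateField.mem_top
    exact isSeparable_algebraMap (⟨x, hx⟩ : F⟮t⟯)
  have hfin : FiniteDimensional F⟮t⟯ N := by
    refine Module.Finite.of_surjective (Algebra.linearMap F⟮t⟯ N) fun x => ?_
    have hx : x ∈ F⟮t⟯ := hgen ▸ IntermediateField.mem_top
    exact ⟨⟨x, hx⟩, rfl⟩
  have hN : IsCurveField F N := isCurveField_of_finite ht hfin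
  obtain ⟨D, hD⟩ : ∃ D : Derivation F N N, D t ≠ 0 := by
    by_contra! h
    exact notMem_frobField_of_isSeparable ht hsep (hN.mem_frobField_of_derivation (p := p) h)
  obtain ⟨E, hE⟩ : ∃ E : Derivation F N N, E t = 1 := ⟨(D t)⁻¹ • D, by simp [hD]⟩
  obtain ⟨w, hw⟩ := exists_hasOmega (W := W) (D := E) P
  obtain rfl := hw.eq_zero_of_adjoin_eq_top hN.trdeg ht hgen hE
  have key : ∀ (D : Derivation F N N) (f : N), E f = 0 → D f = 0 := by
    intro D f hf
    have h0 : D - D t • E = 0 := by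
      refine Derivation.ext fun z => ?_
      have hz : z ∈ F⟮t⟯ := hgen ▸ IntermediateField.mem_top
      obtain ⟨r, s, rfl⟩ := (mem_adjoin_simple_iff F z).1 hz
      have hq : ∀ q : F[X], (D - D t • E) (aeval t q) = 0 := fun q => by
        refine Derivation.eqOn_adjoin (D1 := D - D t • E) (D2 := 0) (s := {t}) ?_
          (aeval_mem_adjoin_singleton F t)
        rintro _ rfl
        simp [hE]
      rw [Derivation.leibniz_div, hq, hq]
      simp
    have := congrArg (fun d : Derivation F N N => d f) h0
    simpa [hf, sub_eq_zero] using this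
  rcases P with _ | ⟨x, y, hxy⟩
  · exact zero_mem _
  rw [hasOmega_zero_iff] at hw
  rw [some_mem_ptIn]
  exact ⟨hN.mem_frobField_of_derivation fun D => key D x hw.1,
    hN.mem_frobField_of_derivation fun D => key D y hw.2⟩

/-- An element that is a `p ^ n`-th power for all `n` is constant. -/
lemma IsCurveField.mem_range_of_forall_mem_frobField (hN : IsCurveField F N) {f : N}
    (h : ∀ n, f ∈ frobField F N p n) : ∃ c, algebraMap F N c = f := by
  refine (mem_range_or_transcendental (F := F) f).resolve_right fun hf => ?_
  have hfin := hN.finite hf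
  have hd : Module.finrank F⟮f⟯ N < p ^ Module.finrank F⟮f⟯ N :=
    Nat.lt_pow_self (Fact.out : p.Prime).one_lt
  have hle : F⟮f⟯ ≤ frobField F N p (Module.finrank F⟮f⟯ N) := by
    rw [adjoin_simple_le_iff]; exact h _
  have := IntermediateField.finrank_le_of_le_left hle
  rw [(hN.finrank_frobField (p := p) _).2] at this
  omega

lemma adjoin_pow_frobField_eq_top {t : N} (hgen : F⟮t⟯ = ⊤) (n : ℕ) {T : frobField F N p n}
    (hT : (T : N) = t ^ p ^ n) : F⟮T⟯ = ⊤ := by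
  have := charP_of_injective_algebraMap (algebraMap F N).injective p
  have key : ∀ y ∈ F⟮t⟯, y ^ p ^ n ∈ F⟮T⟯.map (frobField F N p n).val := by
    intro y hy
    induction hy using IntermediateField.adjoin_induction with
    | mem z hz =>
      obtain rfl := Set.mem_singleton_iff.1 hz
      exact ⟨T, mem_adjoin_simple_self F T, hT⟩
    | algebraMap c => rw [← map_pow]; exact IntermediateField.algebraMap_mem _ _
    | add a b _ _ ha hb => rw [add_pow_char_pow]; exact add_mem ha hb
    | inv a _ ha => rw [inv_pow]; exact inv_mem ha
    | mul a b _ _ ha hb => rw [mul_pow]; exact mul_mem ha hb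
  rw [eq_top_iff]
  rintro ⟨_, y, rfl⟩ -
  obtain ⟨z, hz, e⟩ := key y (hgen ▸ IntermediateField.mem_top)
  convert! hz using 1
  exact Subtype.ext e.symm

/-- Elliptic curves have no nonconstant points over a rational function field. -/
theorem exists_eq_constPt_of_adjoin_eq_top (p : ℕ) [Fact p.Prime] [CharP F p] [W.IsElliptic] {t : N}
    (ht : Transcendental F t) (hgen : F⟮t⟯ = ⊤) (P : (W.baseChange N).toAffine.Point) :
    ∃ Q, P = W.constPt N Q := by
  have hfin : FiniteDimensional F⟮t⟯ N := by
    refine Module.Finite.of_surjective (Algebra.linearMap F⟮t⟯ N) fun x => ?_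
    have hx : x ∈ F⟮t⟯ := hgen ▸ IntermediateField.mem_top
    exact ⟨⟨x, hx⟩, rfl⟩
  have hN : IsCurveField F N := isCurveField_of_finite ht hfin
  have hmem : ∀ n, P ∈ W.ptIn (frobField F N p n) := by
    intro n
    induction n with
    | zero => exact mem_ptIn_frobField_zero _
    | succ n ih =>
      obtain ⟨P₀, rfl⟩ := ih
      refine mapPt_mem_ptIn_frobField_succ ?_
      have hmt : t ^ p ^ n ∈ frobField F N p n := ⟨t, rfl⟩
      have htn : Transcendental F (⟨_, hmt⟩ : frobField F N p n) := by
        intro h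
        refine ht.pow (pow_pos (Fact.out : p.Prime).pos n) ?_
        exact (isAlgebraic_algHom_iff (frobField F N p n).val
          (frobField F N p n).val.injective (a := ⟨_, hmt⟩)).2 h
      refine mem_ptIn_frobField_of_adjoin_eq_top htn (adjoin_pow_frobField_eq_top hgen n rfl) P₀
  rcases P with _ | ⟨x, y, hxy⟩
  · exact ⟨0, (map_zero _).symm⟩
  have hx := fun n => (some_mem_ptIn.1 (hmem n)).1
  have hy := fun n => (some_mem_ptIn.1 (hmem n)).2
  obtain ⟨a, rfl⟩ := hN.mem_range_of_forall_mem_frobField hx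
  obtain ⟨b, rfl⟩ := hN.mem_range_of_forall_mem_frobField hy
  exact ⟨.some a b ((W.toAffine.map_nonsingular (algebraMap F N).injective _ _).1 hxy),
    by rw [constPt_some]⟩

end Rigidity

end WeierstrassCurve

/-! ### Morphisms that fix the origin are homomorphisms -/

namespace WeierstrassCurve

open scoped Classical

section Additivity

open IntermediateField

variable {F : Type*} [Field F] {W : WeierstrassCurve F}

lemma adjoin_gen_eq_top {N : Type*} [Field N] [Algebra F N] (t : N) :
    F⟮AdjoinSimple.gen F t⟯ = ⊤ := by
  apply IntermediateField.map_injective F⟮t⟯.val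
  rw [adjoin_map, Set.image_singleton, ← AlgHom.fieldRange_eq_map]
  simp

/-- The function field is spanned by `1` and `y` over the field of rational functions in `x`. -/
lemma exists_eq_add_mul_genY (f : W.FnField) :
    ∃ a ∈ F⟮W.genX⟯, ∃ b ∈ F⟮W.genX⟯, f = a + b * W.genY := by
  have hint : _root_.IsIntegral F⟮W.genX⟯ W.genY := Algebra.IsIntegral.isIntegral _
  have hf : f ∈ F⟮W.genX⟯⟮W.genY⟯ := by rw [adjoin_genY_eq_top]; exact IntermediateField.mem_top
  rw [← IntermediateField.mem_toSubalgebra,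
    IntermediateField.adjoin_simple_toSubalgebra_of_isAlgebraic hint.isAlgebraic] at hf
  have hx := mem_adjoin_simple_self F W.genX
  have hc : ∀ c, algebraMap F W.FnField c ∈ F⟮W.genX⟯ := IntermediateField.algebraMap_mem _
  induction hf using Algebra.adjoin_induction with
  | mem z hz =>
    obtain rfl := Set.mem_singleton_iff.1 hz
    exact ⟨0, zero_mem _, 1, one_mem _, by ring⟩
  | algebraMap c => exact ⟨c, c.2, 0, zero_mem _, by simp⟩
  | add u v _ _ hu hv =>
    obtain ⟨a, ha, b, hb, rfl⟩ := hu
    obtain ⟨c, hc, d, hd, rfl⟩ := hv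
    exact ⟨a + c, add_mem ha hc, b + d, add_mem hb hd, by ring⟩
  | mul u v _ _ hu hv =>
    obtain ⟨a, ha, b, hb, rfl⟩ := hu
    obtain ⟨c, hc', d, hd, rfl⟩ := hv
    have he := (Affine.equation_iff _ _).1 W.equation_gen
    change W.genY ^ 2 + algebraMap F _ W.a₁ * W.genX * W.genY +
      algebraMap F _ W.a₃ * W.genY = W.genX ^ 3 + algebraMap F _ W.a₂ * W.genX ^ 2 +
      algebraMap F _ W.a₄ * W.genX + algebraMap F _ W.a₆ at he
    refine ⟨a * c + b * d * (W.genX ^ 3 + algebraMap F _ W.a₂ * W.genX ^ 2 +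
        algebraMap F _ W.a₄ * W.genX + algebraMap F _ W.a₆), ?_,
      a * d + b * c - b * d * (algebraMap F _ W.a₁ * W.genX + algebraMap F _ W.a₃), ?_, ?_⟩
    · exact add_mem (mul_mem ha hc') (mul_mem (mul_mem hb hd) (add_mem (add_mem (add_mem
        (pow_mem hx 3) (mul_mem (hc _) (pow_mem hx 2))) (mul_mem (hc _) hx)) (hc _)))
    · exact sub_mem (add_mem (mul_mem ha hd) (mul_mem hb hc')) (mul_mem (mul_mem hb hd)
        (add_mem (mul_mem (hc _) hx) (hc _)))
    · linear_combination b * d * he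

variable [IsAlgClosed F] [W.IsElliptic]

variable (W) in
/-- The function field of an elliptic curve is not generated by `x`: it is not rational. -/
lemma genY_notMem_adjoin_genX (p : ℕ) [Fact p.Prime] [CharP F p] : W.genY ∉ F⟮W.genX⟯ := by
  intro hy
  have htop : F⟮W.genX⟯ = ⊤ := by
    refine eq_top_iff.2 fun f _ => ?_
    obtain ⟨a, ha, b, hb, rfl⟩ := exists_eq_add_mul_genY f
    exact add_mem ha (mul_mem hb hy)
  obtain ⟨Q, hQ⟩ := exists_eq_constPt_of_adjoin_eq_top p W.transcendental_genX htop W.genericPoint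
  exact constPt_ne_ptOf Q _ (hQ.symm.trans ptOf_id.symm)

variable (W) in
/-- The generic point is not of order two. -/
lemma two_mul_genY_ne_zero (p : ℕ) [Fact p.Prime] [CharP F p] :
    2 * W.genY + algebraMap F _ W.a₁ * W.genX + algebraMap F _ W.a₃ ≠ 0 := by
  intro h
  have hx := mem_adjoin_simple_self F W.genX
  have hc : ∀ c, algebraMap F W.FnField c ∈ F⟮W.genX⟯ := IntermediateField.algebraMap_mem _
  by_cases h2 : (2 : F) = 0
  · have h2' : (2 : W.FnField) = 0 := by rw [← map_ofNat (algebraMap F W.FnField) 2, h2, map_zero]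
    rw [h2', zero_mul, zero_add] at h
    have h1 : W.a₁ = 0 := by
      by_contra h1
      refine genX_ne_const (W := W) (-W.a₃ / W.a₁) ?_
      have : algebraMap F W.FnField W.a₁ ≠ 0 := by simpa using h1
      rw [map_div₀, map_neg, eq_div_iff this]
      linear_combination h
    have h3 : W.a₃ = 0 := by simpa [h1] using h
    apply W.isUnit_Δ.ne_zero
    rw [Δ, b₂, b₄, b₆, b₈, h1, h3]
    linear_combination (-8 * W.a₂ ^ 2 * (4 * W.a₂ * W.a₆ - W.a₄ ^ 2) - 32 * W.a₄ ^ 3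
      - 216 * W.a₆ ^ 2 + 144 * W.a₂ * W.a₄ * W.a₆) * h2
  · refine W.genY_notMem_adjoin_genX p ?_
    have : W.genY = algebraMap F _ (2⁻¹) *
        (-(algebraMap F _ W.a₁ * W.genX + algebraMap F _ W.a₃)) := by
      rw [show -(algebraMap F _ W.a₁ * W.genX + algebraMap F _ W.a₃) = 2 * W.genY by
          linear_combination -h, ← mul_assoc,
        ← map_ofNat (algebraMap F W.FnField) 2, ← map_mul, inv_mul_cancel₀ h2, map_one, one_mul]
    rw [this]
    exact mul_mem (hc _) (neg_mem (add_mem (mul_mem (hc _) hx) (hc _)))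

lemma neg_genericPoint_ne (p : ℕ) [Fact p.Prime] [CharP F p] :
    -W.genericPoint ≠ W.genericPoint := by
  intro h
  have h1 : (W.baseChange W.FnField).toAffine.negY W.genX W.genY = W.genY := by
    have h2 := h
    rw [genericPoint, Affine.Point.neg_some, some_eq_some_iff] at h2
    exact h2.2
  refine W.two_mul_genY_ne_zero p ?_
  rw [Affine.negY] at h1
  change -W.genY - algebraMap F _ W.a₁ * W.genX - algebraMap F _ W.a₃ = W.genY at h1
  linear_combination -h1

lemma two_nsmul_surjective (p : ℕ) [Fact p.Prime] [CharP F p] (Q : W.toAffine.Point) :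
    ∃ R, 2 • R = Q := by
  obtain ⟨S, hS⟩ | ⟨α, hα⟩ := exists_constPt_or_ptOf (2 • W.genericPoint)
  · have h0 : S = 0 := by
      have h1 := redAt_nsmul (W₁ := W) 2 W.genericPoint 0
      rw [hS, redAt_constPt, redAt_genericPoint, smul_zero] at h1
      exact h1
    rw [h0, _root_.map_zero, two_smul] at hS
    exact (neg_genericPoint_ne (W := W) p (neg_eq_of_add_eq_zero_left hS)).elim
  · obtain ⟨R, hR⟩ := redAt_surjective α Q
    exact ⟨R, by rw [← hR, ← hα, redAt_nsmul, redAt_genericPoint]⟩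

variable {W₂ : WeierstrassCurve F} [W₂.IsElliptic]

/-- For a morphism `f` to an elliptic curve, `f(Q) + f(-Q)` is constant: it is a function of the
abscissa of `Q`, that is, a point over a rational function field. -/
lemma exists_add_mapPt_neg_eq_constPt (p : ℕ) [Fact p.Prime] [CharP F p]
    {ι : W.FnField →ₐ[F] W.FnField} (hι : ptOf ι = -W.genericPoint)
    (P : (W₂.baseChange W.FnField).toAffine.Point) :
    ∃ S, P + mapPt ι P = W₂.constPt W.FnField S := by
  obtain ⟨h', e⟩ := ptOf_eq ι
  have hι2 := hι
  rw [e, genericPoint, Affine.Point.neg_some, some_eq_some_iff] at hι2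
  obtain ⟨hx, hy⟩ := hι2
  have hfix : ∀ f, ι f = f → f ∈ F⟮W.genX⟯ := by
    intro f hf
    have hfx : ∀ g ∈ F⟮W.genX⟯, ι g = g := by
      intro g hg
      obtain ⟨r, s, rfl⟩ := (mem_adjoin_simple_iff F g).1 hg
      rw [map_div₀, ← aeval_algHom_apply, ← aeval_algHom_apply, hx]
    obtain ⟨a, ha, b, hb, rfl⟩ := exists_eq_add_mul_genY f
    rw [_root_.map_add, _root_.map_mul, hfx a ha, hfx b hb, hy] at hf
    have hb0 : b = 0 := by
      refine (mul_eq_zero.1 ?_).resolve_right (W.two_mul_genY_ne_zero p)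
      rw [Affine.negY] at hf
      change a + b * (-W.genY - algebraMap F _ W.a₁ * W.genX - algebraMap F _ W.a₃) = _ at hf
      linear_combination -hf
    rw [hb0, zero_mul, add_zero]
    exact ha
  have hcomp : ι.comp ι = AlgHom.id F _ := by
    apply ptOf_injective
    rw [ptOf_comp, hι, _root_.map_neg, ← ptOf_id, ← ptOf_comp]
    rw [show ι.comp (AlgHom.id F _) = ι from rfl, hι, neg_neg, ptOf_id]
  have hinv : mapPt ι (P + mapPt ι P) = P + mapPt ι P := by
    rw [_root_.map_add, add_comm]
    congr 1
    rcases P with _ | ⟨x, y, h⟩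
    · rfl
    · obtain ⟨h1, e1⟩ := mapPt_some (W := W₂) ι h
      rw [e1]
      obtain ⟨h2, e2⟩ := mapPt_some (W := W₂) ι h1
      rw [e2, some_eq_some_iff]
      exact ⟨DFunLike.congr_fun hcomp x, DFunLike.congr_fun hcomp y⟩
  have hmem : P + mapPt ι P ∈ W₂.ptIn F⟮W.genX⟯ := by
    generalize P + mapPt ι P = R at hinv ⊢
    rcases R with _ | ⟨x, y, h⟩
    · exact zero_mem _
    · obtain ⟨h1, e1⟩ := mapPt_some (W := W₂) ι h
      rw [e1, some_eq_some_iff] at hinv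
      rw [some_mem_ptIn]
      exact ⟨hfix _ hinv.1, hfix _ hinv.2⟩
  obtain ⟨R, hR⟩ := hmem
  obtain ⟨S, hS⟩ := exists_eq_constPt_of_adjoin_eq_top p (transcendental_gen W.transcendental_genX)
    (adjoin_gen_eq_top W.genX) R
  refine ⟨S, ?_⟩
  rw [← hR, hS]
  exact mapPt_constPt (W := W₂) _ S

/-- A morphism of elliptic curves that maps zero to zero is a homomorphism. -/
theorem redAt_add_right (p : ℕ) [Fact p.Prime] [CharP F p]
    {P : (W₂.baseChange W.FnField).toAffine.Point} (h0 : redAt P 0 = 0) (Q R : W.toAffine.Point) :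
    redAt P (Q + R) = redAt P Q + redAt P R := by
  obtain ⟨ι, hι⟩ := exists_ptOf_neg (AlgHom.id F W.FnField)
  rw [ptOf_id] at hι
  -- the constant sum of the morphism translated by `U`, evaluated at zero
  have par : ∀ U Q, redAt P (U + Q) + redAt P (U - Q) = redAt P U + redAt P U := by
    intro U Q
    obtain ⟨τ, hτ⟩ := exists_ptOf_add (AlgHom.id F W.FnField) U
    rw [ptOf_id] at hτ
    have hτ' : ∀ Q, redAt (mapPt τ P) Q = redAt P (U + Q) := fun Q => by
      rw [redAt_mapPt, hτ, redAt_add, redAt_genericPoint, redAt_constPt, add_comm]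
    obtain ⟨S, hS⟩ := exists_add_mapPt_neg_eq_constPt p hι (mapPt τ P)
    have h1 : ∀ Q, redAt P (U + Q) + redAt P (U - Q) = S := fun Q => by
      rw [← redAt_constPt S Q, ← hS, redAt_add, redAt_mapPt ι, hι, redAt_neg, redAt_genericPoint,
        hτ', hτ', sub_eq_add_neg]
    rw [h1, ← h1 0, add_zero, sub_zero]
  -- take `U` to be half of `Q + R`, so that `Q` and `R` are symmetric with respect to `U`
  obtain ⟨U, hU⟩ := two_nsmul_surjective p (Q + R)
  rw [two_smul] at hU
  have h1 := par U (Q - U)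
  rw [show U + (Q - U) = Q by abel, show U - (Q - U) = U + U - Q by abel, hU,
    add_sub_cancel_left] at h1
  have h2 := par U U
  rw [sub_self, h0, add_zero, hU] at h2
  rw [h1, h2]

end Additivity

end WeierstrassCurve

/-! ### Translations and the structure of the subfield of an isogeny -/

namespace WeierstrassCurve

open scoped Classical

section Galois

open IntermediateField

variable {F : Type*} [Field F] [IsAlgClosed F] {W : WeierstrassCurve F} [W.IsElliptic]

lemma mapPt_genericPoint {N : Type*} [Field N] [Algebra F N] (f : W.FnField →ₐ[F] N) :
    mapPt f W.genericPoint = ptOf f := by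
  rw [← ptOf_id, ← ptOf_comp]
  rfl

/-- The endomorphism of the function field given by the translation by a point. -/
noncomputable def translHom (Q : W.toAffine.Point) : W.FnField →ₐ[F] W.FnField :=
  (exists_ptOf_add (AlgHom.id F W.FnField) Q).choose

lemma ptOf_translHom (Q : W.toAffine.Point) :
    ptOf (translHom Q) = W.genericPoint + W.constPt W.FnField Q := by
  rw [← ptOf_id]
  exact (exists_ptOf_add (AlgHom.id F W.FnField) Q).choose_spec

lemma redAt_mapPt_translHom {W₂ : WeierstrassCurve F} [W₂.IsElliptic] (Q R : W.toAffine.Point)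
    (P : (W₂.baseChange W.FnField).toAffine.Point) :
    redAt (mapPt (translHom Q) P) R = redAt P (R + Q) := by
  rw [redAt_mapPt, ptOf_translHom, redAt_add, redAt_genericPoint, redAt_constPt]

lemma translHom_comp (Q R : W.toAffine.Point) :
    (translHom Q).comp (translHom R) = translHom (Q + R) := by
  apply ptOf_injective
  rw [ptOf_comp, ptOf_translHom, ptOf_translHom, _root_.map_add, mapPt_constPt, mapPt_genericPoint,
    ptOf_translHom, _root_.map_add, add_assoc]

lemma translHom_zero : translHom (0 : W.toAffine.Point) = AlgHom.id F W.FnField := by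
  apply ptOf_injective
  rw [ptOf_translHom, _root_.map_zero, add_zero, ptOf_id]

lemma translHom_injective : Function.Injective (translHom (W := W)) := by
  intro Q R h
  have h1 := congrArg ptOf h
  rw [ptOf_translHom, ptOf_translHom, add_right_inj] at h1
  exact constPt_injective h1

/-- The functions that are invariant under the translations by a group of points. -/
noncomputable def fixedBy (H : AddSubgroup W.toAffine.Point) : IntermediateField F W.FnField where
  carrier := {f | ∀ Q ∈ H, translHom Q f = f}
  mul_mem' hf hg Q hQ := by rw [_root_.map_mul, hf Q hQ, hg Q hQ]
  add_mem' hf hg Q hQ := by rw [_root_.map_add, hf Q hQ, hg Q hQ]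
  inv_mem' f hf Q hQ := by rw [map_inv₀, hf Q hQ]
  algebraMap_mem' c Q _ := AlgHom.commutes _ c

lemma mem_fixedBy {H : AddSubgroup W.toAffine.Point} {f : W.FnField} :
    f ∈ fixedBy H ↔ ∀ Q ∈ H, translHom Q f = f := Iff.rfl

lemma fixedBy_anti {H H' : AddSubgroup W.toAffine.Point} (h : H ≤ H') : fixedBy H' ≤ fixedBy H :=
  fun _ hf Q hQ => hf Q (h hQ)

lemma mem_ptIn_fixedBy {W₂ : WeierstrassCurve F} {H : AddSubgroup W.toAffine.Point}
    {P : (W₂.baseChange W.FnField).toAffine.Point} :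
    P ∈ W₂.ptIn (fixedBy H) ↔ ∀ Q ∈ H, mapPt (translHom Q) P = P := by
  rcases P with _ | ⟨x, y, h⟩
  · exact ⟨fun _ _ _ => rfl, fun _ => zero_mem _⟩
  · rw [some_mem_ptIn, mem_fixedBy, mem_fixedBy, ← forall₂_and]
    refine forall₂_congr fun Q _ => ?_
    obtain ⟨h', e⟩ := mapPt_some (W := W₂) (translHom Q) h
    rw [e, some_eq_some_iff]

variable {W₂ : WeierstrassCurve F} [W₂.IsElliptic]
variable (p : ℕ) [Fact p.Prime] [CharP F p]

/-- The homomorphism of groups induced by a morphism of elliptic curves that fixes zero. -/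
noncomputable def redHom (P : (W₂.baseChange W.FnField).toAffine.Point) (h0 : redAt P 0 = 0) :
    W.toAffine.Point →+ W₂.toAffine.Point :=
  AddMonoidHom.mk' (redAt P) (redAt_add_right p h0)

lemma redHom_apply {P : (W₂.baseChange W.FnField).toAffine.Point} (h0 : redAt P 0 = 0)
    (Q : W.toAffine.Point) : redHom p P h0 Q = redAt P Q := rfl

lemma mem_ker_redHom {P : (W₂.baseChange W.FnField).toAffine.Point} {h0 : redAt P 0 = 0}
    {Q : W.toAffine.Point} : Q ∈ (redHom p P h0).ker ↔ redAt P Q = 0 := Iff.rfl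

lemma finiteDimensional_fieldRange (α : W₂.FnField →ₐ[F] W.FnField) :
    FiniteDimensional α.fieldRange W.FnField :=
  (isCurveField_fnField W).finite_tower (E := α.fieldRange) (s := ⟨α W₂.genX, _, rfl⟩) fun h =>
    transcendental_algHom α ((isAlgebraic_algHom_iff α.fieldRange.val
      α.fieldRange.val.injective).2 h)

variable {α : W₂.FnField →ₐ[F] W.FnField} (h0 : redAt (ptOf α) 0 = 0)

/-- Translations by points of the kernel fix the subfield of an isogeny. -/
lemma translHom_comp_of_mem_ker (p : ℕ) [Fact p.Prime] [CharP F p]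
    {α : W₂.FnField →ₐ[F] W.FnField} (h0 : redAt (ptOf α) 0 = 0) {Q : W.toAffine.Point}
    (hQ : redAt (ptOf α) Q = 0) :
    (translHom Q).comp α = α := by
  apply ptOf_injective
  rw [ptOf_comp]
  refine redAt_injective fun R => ?_
  rw [redAt_mapPt_translHom, redAt_add_right p h0, hQ, add_zero]

/-- The translation by a point of the kernel, as an automorphism over the smaller field. -/
noncomputable def translAut (Q : (redHom p (ptOf α) h0).ker) :
    W.FnField →ₐ[α.fieldRange] W.FnField :=
  { translHom (Q : W.toAffine.Point) with
    commutes' := by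
      rintro ⟨_, f, rfl⟩
      exact DFunLike.congr_fun (translHom_comp_of_mem_ker p h0 Q.2) f }

lemma translAut_injective : Function.Injective (translAut p h0) := by
  intro Q R h
  apply Subtype.ext
  apply translHom_injective
  exact AlgHom.ext fun f => DFunLike.congr_fun h f

lemma finite_ker_redHom : Finite (redHom p (ptOf α) h0).ker := by
  have := finiteDimensional_fieldRange α
  exact Finite.of_injective _ (translAut_injective p h0)

/-- Every embedding over the subfield of an isogeny is a translation by a point of the kernel: the
difference of the generic point and its image under the embedding reduces to points of the kernel,
so it is constant. -/
lemma exists_eq_translAut {Ω : Type*} [Field Ω] [Algebra W.FnField Ω]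
    [Algebra.IsAlgebraic W.FnField Ω]
    (σ : W.FnField →ₐ[α.fieldRange] Ω) :
    ∃ Q : (redHom p (ptOf α) h0).ker, ∀ f, σ f = algebraMap W.FnField Ω (translAut p h0 Q f) := by
  let : Algebra F Ω := ((algebraMap W.FnField Ω).comp (algebraMap F W.FnField)).toAlgebra
  have : IsScalarTower F W.FnField Ω := IsScalarTower.of_algebraMap_eq fun _ => rfl
  let i : W.FnField →ₐ[F] Ω := IsScalarTower.toAlgHom F W.FnField Ω
  let s : W.FnField →ₐ[F] Ω :=
    { (σ : W.FnField →+* Ω) with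
      commutes' := fun c => σ.commutes (algebraMap F α.fieldRange c) }
  have hs : s.comp α = i.comp α := AlgHom.ext fun f => σ.commutes ⟨α f, f, rfl⟩
  have hΩ : Algebra.trdeg F Ω = 1 := by
    have h := lift_trdeg_add_eq F W.FnField Ω
    rw [trdeg_fnField, Cardinal.lift_one, trdeg_eq_zero (R := W.FnField) (A := Ω),
      Cardinal.lift_zero, add_zero] at h
    exact Cardinal.lift_eq_one.1 h.symm
  have hred : ∀ A : ValuationSubring Ω, IsPlace F A →
      ∃ Q ∈ (redHom p (ptOf α) h0).ker, Red A (ptOf s - ptOf i) Q := by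
    intro A hA
    obtain ⟨R, hR⟩ := exists_red hA (ptOf s)
    obtain ⟨R', hR'⟩ := exists_red hA (ptOf i)
    refine ⟨R - R', ?_, hR.sub hA hR'⟩
    have h1 : ∀ (j : W.FnField →ₐ[F] Ω) (R : W.toAffine.Point), Red A (ptOf j) R →
        Red A (mapPt j (ptOf α)) (redAt (ptOf α) R) := by
      intro j R hR
      rw [← red_comap]
      refine redAt_spec _ (hA.comap j) ?_
      rw [red_comap, mapPt_genericPoint]
      exact hR
    have h2 := h1 s R hR
    have h3 := h1 i R' hR'
    rw [← ptOf_comp] at h2 h3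
    rw [hs] at h2
    rw [AddMonoidHom.mem_ker, _root_.map_sub, sub_eq_zero]
    exact h2.unique hA h3
  have hfin := finite_ker_redHom p h0
  obtain ⟨Q, hQ⟩ := exists_eq_constPt_of_finite hΩ (Set.toFinite _) hred
  obtain ⟨A, hA⟩ := exists_isPlace_of_trdeg_eq_one (F := F) hΩ
  obtain ⟨Q', hQ', hR⟩ := hred A hA
  rw [hQ] at hR
  obtain rfl := hR.unique hA (red_const A Q)
  refine ⟨⟨Q', hQ'⟩, ?_⟩
  have : s = i.comp (translHom Q') := by
    apply ptOf_injective
    rw [ptOf_comp, ptOf_translHom, _root_.map_add, mapPt_constPt, mapPt_genericPoint, ← hQ]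
    abel
  exact fun f => DFunLike.congr_fun this f

/-- The separable degree of an isogeny is the order of its kernel. -/
theorem finSepDegree_eq_card_ker :
    Field.finSepDegree α.fieldRange W.FnField = Nat.card (redHom p (ptOf α) h0).ker := by
  rw [Field.finSepDegree]
  symm
  refine Nat.card_congr (Equiv.ofBijective (fun Q => (Algebra.algHom α.fieldRange W.FnField
    (AlgebraicClosure W.FnField)).comp (translAut p h0 Q)) ⟨?_, ?_⟩)
  · intro Q R h
    apply translAut_injective p h0
    refine AlgHom.ext fun f => ?_
    exact (algebraMap W.FnField (AlgebraicClosure W.FnField)).injective (DFunLike.congr_fun h f)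
  · intro σ
    obtain ⟨Q, hQ⟩ := exists_eq_translAut p h0 σ
    exact ⟨Q, AlgHom.ext fun f => (hQ f).symm⟩

lemma fixedBy_ker_eq [FiniteDimensional α.fieldRange W.FnField] :
    fixedBy (redHom p (ptOf α) h0).ker =
      (fixedField (⊤ : Subgroup Gal(W.FnField/α.fieldRange))).restrictScalars F := by
  ext f
  rw [mem_restrictScalars, mem_fixedField_iff, mem_fixedBy]
  constructor
  · intro h σ _
    obtain ⟨Q, hQ⟩ := exists_eq_translAut p h0 (σ : W.FnField →ₐ[α.fieldRange] W.FnField)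
    exact (hQ f).trans (h Q Q.2)
  · intro h Q hQ
    exact h (Algebra.IsAlgebraic.algEquivEquivAlgHom α.fieldRange W.FnField |>.symm
      (translAut p h0 ⟨Q, hQ⟩)) trivial

lemma isSeparable_fixedBy_ker :
    Algebra.IsSeparable (fixedBy (redHom p (ptOf α) h0).ker) W.FnField := by
  have := finiteDimensional_fieldRange α
  rw [fixedBy_ker_eq]
  exact (IsGalois.of_fixed_field W.FnField
    (⊤ : Subgroup Gal(W.FnField/α.fieldRange))).to_isSeparable

lemma finrank_fixedBy_ker :
    Module.finrank (fixedBy (redHom p (ptOf α) h0).ker) W.FnField =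
      Nat.card (redHom p (ptOf α) h0).ker := by
  have := finiteDimensional_fieldRange α
  have h1 := finrank_fixedField_eq_card (⊤ : Subgroup Gal(W.FnField/α.fieldRange))
  rw [fixedBy_ker_eq]
  refine h1.trans (Nat.card_congr ?_)
  refine (Subgroup.topEquiv.toEquiv).trans
    ((Algebra.IsAlgebraic.algEquivEquivAlgHom α.fieldRange W.FnField).toEquiv.trans
      (Equiv.ofBijective (translAut p h0) ⟨translAut_injective p h0, fun σ => ?_⟩).symm)
  obtain ⟨Q, hQ⟩ := exists_eq_translAut p h0 σ
  exact ⟨Q, AlgHom.ext fun f => (hQ f).symm⟩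

/-- The structure of the subfield of an isogeny: it consists of the `p ^ a`-th powers of the
functions that are invariant under the kernel. -/
theorem exists_mem_fieldRange_iff :
    ∃ a, Field.finInsepDegree α.fieldRange W.FnField = p ^ a ∧
      ∀ f, f ∈ α.fieldRange ↔ ∃ g ∈ fixedBy (redHom p (ptOf α) h0).ker, g ^ p ^ a = f := by
  have hfd := finiteDimensional_fieldRange α
  set S := α.fieldRange with hS
  set T := fixedField (⊤ : Subgroup Gal(W.FnField/S)) with hT
  have hTe : fixedBy (redHom p (ptOf α) h0).ker = T.restrictScalars F := fixedBy_ker_eq p h0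
  have hsep : Algebra.IsSeparable T W.FnField :=
    (IsGalois.of_fixed_field W.FnField (⊤ : Subgroup Gal(W.FnField/S))).to_isSeparable
  have h1 := Field.finSepDegree_mul_finSepDegree_of_isAlgebraic S T W.FnField
  have h2 := finrank_fixedBy_ker p h0
  rw [hTe] at h2
  change Module.finrank T W.FnField = _ at h2
  rw [finSepDegree_eq_card_ker p h0, Field.finSepDegree_eq_finrank_of_isSeparable T, h2] at h1
  have hfin := finite_ker_redHom p h0
  have hcard : Nat.card (redHom p (ptOf α) h0).ker ≠ 0 := Nat.card_pos.ne'
  have h3 : Field.finSepDegree S T = 1 := by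
    exact Nat.eq_of_mul_eq_mul_right (Nat.pos_of_ne_zero hcard) (by rw [h1, one_mul])
  have hpi : IsPurelyInseparable S T := (isPurelyInseparable_iff_finSepDegree_eq_one S T).2 h3
  have := charP_of_injective_algebraMap (algebraMap F S).injective p
  obtain ⟨a, ha⟩ : ∃ a, Module.finrank S T = p ^ a :=
    IsPurelyInseparable.finrank_eq_pow S T p
  refine ⟨a, ?_, ?_⟩
  · have h4 := Field.finSepDegree_mul_finInsepDegree S W.FnField
    rw [finSepDegree_eq_card_ker p h0, ← Module.finrank_mul_finrank S T W.FnField, h2, ha,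
      mul_comm (p ^ a)] at h4
    exact Nat.eq_of_mul_eq_mul_left (Nat.pos_of_ne_zero hcard) h4
  · have hle : S ≤ T.restrictScalars F := fun f hf => T.algebraMap_mem ⟨f, hf⟩
    have hcurve : IsCurveField F (T.restrictScalars F) :=
      (isCurveField_fnField W).intermediate _ (s := α W₂.genX) (hle ⟨_, rfl⟩)
        (transcendental_algHom α)
    intro f
    rw [hTe]
    have hcurve' : IsCurveField F T := hcurve
    have h5 := hcurve'.mem_range_algebraMap_iff (E := S) (p := p) hpi ha
    constructor
    · intro hf
      obtain ⟨g, hg⟩ := (h5 ⟨f, hle hf⟩).1 ⟨⟨f, hf⟩, rfl⟩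
      exact ⟨g, g.2, congrArg Subtype.val hg⟩
    · rintro ⟨g, hg, rfl⟩
      obtain ⟨z, hz⟩ := (h5 (⟨g, hg⟩ ^ p ^ a)).2 ⟨_, rfl⟩
      have : (z : W.FnField) = g ^ p ^ a := congrArg Subtype.val hz
      exact this ▸ z.2

end Galois

end WeierstrassCurve

/-! ### The dual isogeny -/

namespace WeierstrassCurve

open scoped Classical

section Dual

open IntermediateField

variable {F : Type*} [Field F] [IsAlgClosed F] {W : WeierstrassCurve F} [W.IsElliptic]

lemma nsmul_genericPoint_eq_zero_or (n : ℕ) :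
    n • W.genericPoint = 0 ∨ ∃ β, ptOf β = n • W.genericPoint ∧ redAt (ptOf β) 0 = 0 := by
  have h1 := redAt_nsmul (W₁ := W) n W.genericPoint 0
  rw [redAt_genericPoint, smul_zero] at h1
  obtain ⟨S, hS⟩ | ⟨α, hα⟩ := exists_constPt_or_ptOf (n • W.genericPoint)
  · left
    rw [hS, redAt_constPt] at h1
    rw [hS, h1, _root_.map_zero]
  · exact Or.inr ⟨α, hα.symm, by rw [← hα, h1]⟩

/-- Outside of characteristic two, a root of the cubic `ψ₂ ^ 2` gives a point of order two. -/
lemma exists_two_torsion (h2 : (2 : F) ≠ 0) : ∃ Q : W.toAffine.Point, Q ≠ 0 ∧ 2 • Q = 0 := by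
  have hd : (4 : F) ≠ 0 := by
    have := mul_ne_zero h2 h2
    norm_num at this
    exact this
  let q : F[X] := C 4 * X ^ 3 + C W.b₂ * X ^ 2 + C (2 * W.b₄) * X + C W.b₆
  have hq : q.degree ≠ 0 := by
    rw [degree_cubic hd]; decide
  obtain ⟨a, ha⟩ := IsAlgClosed.exists_root q hq
  have ha' : 4 * a ^ 3 + W.b₂ * a ^ 2 + 2 * W.b₄ * a + W.b₆ = 0 := by
    simpa [q] using ha
  obtain ⟨b, hb⟩ : ∃ b, 2 * b = -(W.a₁ * a + W.a₃) :=
    ⟨-(W.a₁ * a + W.a₃) / 2, mul_div_cancel₀ _ h2⟩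
  have heq : W.toAffine.Equation a b := by
    rw [Affine.equation_iff]
    apply mul_left_cancel₀ hd
    rw [b₂, b₄, b₆] at ha'
    linear_combination (2 * b + W.a₁ * a + W.a₃) * hb - ha'
  refine ⟨.some a b ((W.toAffine.equation_iff_nonsingular).1 heq), nofun, ?_⟩
  rw [two_smul, add_eq_zero_iff_eq_neg, Affine.Point.neg_some, some_eq_some_iff]
  refine ⟨rfl, ?_⟩
  rw [Affine.negY]
  linear_combination hb

variable (W) in
/-- The invariant differential is not zero. -/
lemma exists_hasOmega_genericPoint_ne_zero (p : ℕ) [Fact p.Prime] [CharP F p] :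
    ∃ (D : Derivation F W.FnField W.FnField) (w : W.FnField),
      W.HasOmega D W.genericPoint w ∧ w ≠ 0 := by
  by_contra! h
  have hN := isCurveField_fnField W
  have hxy : ∀ D : Derivation F W.FnField W.FnField, D W.genX = 0 ∧ D W.genY = 0 := by
    intro D
    obtain ⟨w, hw⟩ := exists_hasOmega (W := W) (D := D) W.genericPoint
    obtain rfl := h D w hw
    exact (hasOmega_zero_iff _).1 hw
  have htop : frobField F W.FnField p 1 = ⊤ := by
    rw [eq_top_iff, ← adjoin_genX_genY, adjoin_le_iff]
    rintro z (rfl | rfl)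
    · exact hN.mem_frobField_of_derivation fun D => (hxy D).1
    · exact hN.mem_frobField_of_derivation fun D => (hxy D).2
  have h1 := (hN.finrank_frobField (p := p) 1).2
  rw [htop, pow_one, IntermediateField.finrank_top] at h1
  exact (Fact.out : p.Prime).one_lt.ne h1

/-- Multiplication by an integer prime to `p` does not lead into the field of `p`-th powers. -/
lemma nsmul_genericPoint_notMem_ptIn (p : ℕ) [Fact p.Prime] [CharP F p] {n : ℕ} (hn : ¬ p ∣ n) :
    n • W.genericPoint ∉ W.ptIn (frobField F W.FnField p 1) := by
  intro h
  have := charP_of_injective_algebraMap (algebraMap F W.FnField).injective p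
  obtain ⟨D, w, hw, hw0⟩ := exists_hasOmega_genericPoint_ne_zero W p
  have h1 := hw.nsmul n
  have hz : (n : W.FnField) * w ≠ 0 :=
    mul_ne_zero (by rwa [Ne, CharP.cast_eq_zero_iff _ p]) hw0
  have hD : ∀ f ∈ frobField F W.FnField p 1, D f = 0 := by
    rintro _ ⟨f, rfl⟩
    rw [D.leibniz_pow, pow_one, ← Nat.cast_smul_eq_nsmul W.FnField, CharP.cast_eq_zero, zero_smul]
  rcases hP : n • W.genericPoint with _ | ⟨x, y, hxy⟩
  · rw [hP] at h1
    exact hz h1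
  · rw [hP] at h h1
    rw [some_mem_ptIn] at h
    exact hz (h1.eq_zero (hD x h.1) (hD y h.2))

/-- Multiplication by `n ≠ 0` is not the zero map. For a prime `n ≠ p` this is seen on the invariant
differential, and for `n = p` on a point of order two, or on the generic point if `p = 2`. -/
lemma nsmul_genericPoint_ne_zero (p : ℕ) [Fact p.Prime] [CharP F p] {n : ℕ} (hn : n ≠ 0) :
    n • W.genericPoint ≠ 0 := by
  induction n using Nat.recOnMul with
  | zero => exact (hn rfl).elim
  | one =>
    rw [one_smul]
    nofun
  | prime ℓ hl =>
    by_cases hp : p ∣ ℓ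
    · obtain rfl := (Nat.prime_dvd_prime_iff_eq Fact.out hl).1 hp
      intro h
      by_cases h2 : (2 : F) = 0
      · have hp2 : p = 2 := by
          have h2' : ((2 : ℕ) : F) = 0 := by exact_mod_cast h2
          rw [CharP.cast_eq_zero_iff F p] at h2'
          exact (Nat.prime_dvd_prime_iff_eq Fact.out Nat.prime_two).1 h2'
        subst hp2
        rw [two_smul] at h
        exact neg_genericPoint_ne (W := W) 2 (neg_eq_of_add_eq_zero_left h)
      · obtain ⟨Q, hQ, hQ2⟩ := exists_two_torsion (W := W) h2
        have h3 := redAt_nsmul (W₁ := W) p W.genericPoint Q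
        rw [h, redAt_genericPoint, ← _root_.map_zero (W.constPt W.FnField), redAt_constPt] at h3
        apply hQ
        have h4 : Nat.Coprime p 2 := by
          rw [Nat.coprime_primes Fact.out Nat.prime_two]
          rintro rfl
          exact h2 (by exact_mod_cast CharP.cast_eq_zero F 2)
        rw [← AddMonoid.addOrderOf_eq_one_iff, ← Nat.dvd_one, ← h4]
        exact Nat.dvd_gcd (addOrderOf_dvd_of_nsmul_eq_zero h3.symm)
          (addOrderOf_dvd_of_nsmul_eq_zero hQ2)
    · intro h
      exact nsmul_genericPoint_notMem_ptIn p hp (h ▸ zero_mem _)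
  | mul a b ha hb =>
    obtain ⟨ha0, hb0⟩ := mul_ne_zero_iff.1 hn
    obtain ⟨β, hβ, -⟩ := (nsmul_genericPoint_eq_zero_or (W := W) b).resolve_left (hb hb0)
    rw [mul_smul, ← hβ, ← mapPt_genericPoint, ← map_nsmul]
    intro h
    exact ha ha0 (mapPt_injective (W := W) β (h.trans (_root_.map_zero _).symm))

/-- The multiplication by `n`, as an embedding of the function field into itself. -/
lemma exists_ptOf_eq_nsmul (p : ℕ) [Fact p.Prime] [CharP F p] {n : ℕ} (hn : n ≠ 0) :
    ∃ β, ptOf β = n • W.genericPoint ∧ redAt (ptOf β) 0 = 0 :=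
  (nsmul_genericPoint_eq_zero_or n).resolve_left (nsmul_genericPoint_ne_zero p hn)

variable {W₂ : WeierstrassCurve F} [W₂.IsElliptic]

lemma exists_mapPt_eq_of_mem_ptIn {W₃ : WeierstrassCurve F} {α : W₂.FnField →ₐ[F] W.FnField}
    {P : (W₃.baseChange W.FnField).toAffine.Point} (h : P ∈ W₃.ptIn α.fieldRange) :
    ∃ P', mapPt α P' = P := by
  obtain ⟨P₀, rfl⟩ := h
  let e : α.fieldRange ≃ₐ[F] W₂.FnField := (AlgEquiv.ofInjectiveField α).symm
  refine ⟨mapPt (W := W₃) e.toAlgHom P₀, ?_⟩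
  have hc : ∀ z : α.fieldRange, α (e z) = z := fun z =>
    congrArg Subtype.val ((AlgEquiv.ofInjectiveField α).apply_symm_apply z)
  rcases P₀ with _ | ⟨x, y, h⟩
  · rfl
  · obtain ⟨h1, e1⟩ := mapPt_some (W := W₃) e.toAlgHom h
    obtain ⟨h2, e2⟩ := mapPt_some (W := W₃) α h1
    obtain ⟨h3, e3⟩ := mapPt_some (W := W₃) α.fieldRange.val h
    rw [e1, e2, e3, some_eq_some_iff]
    exact ⟨hc x, hc y⟩

variable {α : W₂.FnField →ₐ[F] W.FnField}

/-- Multiplication by the degree factors through the isogeny: multiplication by the order of the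
kernel has invariant coordinates, and multiplication by `p ^ a` turns these into `p ^ a`-th powers.
-/
lemma nsmul_genericPoint_mem_ptIn_fieldRange (p : ℕ) [Fact p.Prime] [CharP F p]
    (h0 : redAt (ptOf α) 0 = 0) {a : ℕ}
    (ha : ∀ f, f ∈ α.fieldRange ↔ ∃ g ∈ fixedBy (redHom p (ptOf α) h0).ker, g ^ p ^ a = f) :
    (p ^ a * Nat.card (redHom p (ptOf α) h0).ker) • W.genericPoint ∈ W.ptIn α.fieldRange := by
  set G := (redHom p (ptOf α) h0).ker with hG
  have hmem : Nat.card G • W.genericPoint ∈ W.ptIn (fixedBy G) := by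
    rw [mem_ptIn_fixedBy]
    intro Q hQ
    rw [map_nsmul, mapPt_genericPoint, ptOf_translHom, smul_add, ← map_nsmul]
    have : Nat.card G • (⟨Q, hQ⟩ : G) = 0 := card_nsmul_eq_zero'
    rw [show Nat.card G • Q = 0 from congrArg Subtype.val this, _root_.map_zero, add_zero]
  obtain ⟨P₀, hP₀⟩ := hmem
  have hle : α.fieldRange ≤ fixedBy G := by
    intro f hf
    obtain ⟨g, hg, rfl⟩ := (ha f).1 hf
    exact pow_mem hg _
  have hcurve : IsCurveField F (fixedBy G) :=
    (isCurveField_fnField W).intermediate _ (s := α W₂.genX) (hle ⟨_, rfl⟩)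
      (transcendental_algHom α)
  rw [mul_smul, ← hP₀, ← map_nsmul]
  have h1 := hcurve.nsmul_mem_ptIn_frobField (p := p) a P₀
  rcases hP : p ^ a • P₀ with _ | ⟨x, y, h⟩
  · exact zero_mem _
  · obtain ⟨h2, e2⟩ := mapPt_some (W := W) (fixedBy G).val h
    rw [hP, some_mem_ptIn] at h1
    rw [e2, some_mem_ptIn, ha, ha]
    obtain ⟨⟨u, hu⟩, v, hv⟩ := h1
    exact ⟨⟨u, u.2, congrArg Subtype.val hu⟩, ⟨v, v.2, congrArg Subtype.val hv⟩⟩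

/-- The dual isogeny. -/
theorem exists_mapPt_ptOf_eq_nsmul (p : ℕ) [Fact p.Prime] [CharP F p]
    (h0 : redAt (ptOf α) 0 = 0) :
    ∃ β : W.FnField →ₐ[F] W₂.FnField, redAt (ptOf β) 0 = 0 ∧
      mapPt α (ptOf β) = Module.finrank α.fieldRange W.FnField • W.genericPoint := by
  obtain ⟨a, hi, ha⟩ := exists_mem_fieldRange_iff p h0
  have hn : Module.finrank α.fieldRange W.FnField =
      p ^ a * Nat.card (redHom p (ptOf α) h0).ker := by
    rw [← Field.finSepDegree_mul_finInsepDegree, hi, finSepDegree_eq_card_ker p h0, mul_comm]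
  have hn0 : Module.finrank α.fieldRange W.FnField ≠ 0 := by
    have := finiteDimensional_fieldRange α
    exact Module.finrank_pos.ne'
  obtain ⟨P, hP⟩ := exists_mapPt_eq_of_mem_ptIn (nsmul_genericPoint_mem_ptIn_fieldRange p h0 ha)
  rw [← hn] at hP
  have h1 : redAt P 0 = 0 := by
    rw [← h0, ← redAt_mapPt, hP, redAt_nsmul, redAt_genericPoint, smul_zero]
  obtain ⟨S, hS⟩ | ⟨β, rfl⟩ := exists_constPt_or_ptOf P
  · exfalso
    rw [hS, redAt_constPt] at h1
    rw [hS, h1, _root_.map_zero, _root_.map_zero] at hP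
    exact nsmul_genericPoint_ne_zero p hn0 hP.symm
  · exact ⟨β, h1, hP⟩

end Dual

section Translate

variable {F : Type*} [Field F] {W₁ W₂ : WeierstrassCurve F} (φ : Isogeny W₁ W₂)

lemma Isogeny.degree_eq : φ.degree = Module.finrank φ.pull.fieldRange W₁.FnField := rfl

lemma Isogeny.degIns_eq : φ.degIns = Field.finInsepDegree φ.pull.fieldRange W₁.FnField := rfl

lemma Isogeny.isSeparable_iff :
    φ.IsSeparable ↔ Algebra.IsSeparable φ.pull.fieldRange W₁.FnField := Iff.rfl

end Translate

end WeierstrassCurve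

/-! ### Degrees of fractions -/

namespace WeierstrassCurve

open scoped Classical

section Formulas

variable {N : Type*} [Field N] {V : WeierstrassCurve N}

/-- The sum and the product of the first coordinates of `P + Q` and `P - Q`. -/
lemma exists_add_sub_some {x₁ y₁ x₂ y₂ : N} (h₁ : V.toAffine.Nonsingular x₁ y₁)
    (h₂ : V.toAffine.Nonsingular x₂ y₂) (hx : x₁ ≠ x₂) :
    ∃ x₃ y₃ h₃ x₄ y₄ h₄, (.some x₁ y₁ h₁ : V.toAffine.Point) + .some x₂ y₂ h₂ = .some x₃ y₃ h₃ ∧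
      (.some x₁ y₁ h₁ : V.toAffine.Point) - .some x₂ y₂ h₂ = .some x₄ y₄ h₄ ∧
      (x₃ + x₄) * (x₁ - x₂) ^ 2 = 2 * (x₁ + x₂) * (x₁ * x₂) + V.b₂ * (x₁ * x₂) +
        V.b₄ * (x₁ + x₂) + V.b₆ ∧
      (x₃ * x₄) * (x₁ - x₂) ^ 2 = (x₁ * x₂) ^ 2 - V.b₄ * (x₁ * x₂) - V.b₆ * (x₁ + x₂) - V.b₈ := by
  have hd : x₁ - x₂ ≠ 0 := sub_ne_zero.2 hx
  have E₁ := (Affine.equation_iff _ _).1 h₁.1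
  have E₂ := (Affine.equation_iff _ _).1 h₂.1
  have hs : ∀ y, V.toAffine.slope x₁ x₂ y₁ y * (x₁ - x₂) = y₁ - y := fun y => by
    rw [Affine.slope_of_X_ne hx, div_mul_cancel₀ _ hd]
  have h₂' : V.toAffine.Nonsingular x₂ (V.toAffine.negY x₂ y₂) :=
    (V.toAffine.nonsingular_neg x₂ y₂).2 h₂
  have hsub : (.some x₁ y₁ h₁ : V.toAffine.Point) - .some x₂ y₂ h₂ =
      .some x₁ y₁ h₁ + .some x₂ _ h₂' := by
    rw [sub_eq_add_neg, Affine.Point.neg_some]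
  refine ⟨_, _, _, _, _, _, Affine.Point.add_some fun h => hx h.1,
    hsub.trans (Affine.Point.add_some fun h => hx h.1), ?_, ?_⟩
  all_goals
    have e1 := hs y₂
    have e2 := hs (V.toAffine.negY x₂ y₂)
    rw [Affine.addX, Affine.addX]
    generalize V.toAffine.slope x₁ x₂ y₁ y₂ = l at *
    generalize V.toAffine.slope x₁ x₂ y₁ (V.toAffine.negY x₂ y₂) = k at *
    rw [Affine.negY] at e2
  · rw [b₂, b₄, b₆]
    linear_combination 2 * E₁ + 2 * E₂ + (l * (x₁ - x₂) + y₁ - y₂ + V.a₁ * (x₁ - x₂)) * e1 +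
      (k * (x₁ - x₂) + y₁ + y₂ + V.a₁ * x₂ + V.a₃ + V.a₁ * (x₁ - x₂)) * e2
  · apply mul_right_cancel₀ (pow_ne_zero 2 hd)
    have e3 : (l ^ 2 + V.a₁ * l - V.a₂ - x₁ - x₂) * (x₁ - x₂) ^ 2 = (y₁ - y₂) ^ 2 +
        V.a₁ * (y₁ - y₂) * (x₁ - x₂) - (V.a₂ + x₁ + x₂) * (x₁ - x₂) ^ 2 := by
      linear_combination (l * (x₁ - x₂) + y₁ - y₂ + V.a₁ * (x₁ - x₂)) * e1
    have e4 : (k ^ 2 + V.a₁ * k - V.a₂ - x₁ - x₂) * (x₁ - x₂) ^ 2 = (y₁ + y₂ + V.a₁ * x₂ + V.a₃) ^ 2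
        + V.a₁ * (y₁ + y₂ + V.a₁ * x₂ + V.a₃) * (x₁ - x₂) -
        (V.a₂ + x₁ + x₂) * (x₁ - x₂) ^ 2 := by
      linear_combination
        (k * (x₁ - x₂) + y₁ + y₂ + V.a₁ * x₂ + V.a₃ + V.a₁ * (x₁ - x₂)) * e2
    have e5 : ∀ s t : N, s * t * (x₁ - x₂) ^ 2 * (x₁ - x₂) ^ 2 =
        (s * (x₁ - x₂) ^ 2) * (t * (x₁ - x₂) ^ 2) := fun s t => by ring
    rw [e5, e3, e4, b₄, b₆, b₈]
    clear e1 e2 e3 e4 e5 hs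
    grind

lemma exists_two_nsmul_some {x y : N} (h : V.toAffine.Nonsingular x y)
    (hy : 2 * y + V.a₁ * x + V.a₃ ≠ 0) :
    ∃ x₃ y₃ h₃, 2 • (.some x y h : V.toAffine.Point) = .some x₃ y₃ h₃ ∧
      4 * x ^ 3 + V.b₂ * x ^ 2 + 2 * V.b₄ * x + V.b₆ ≠ 0 ∧
      x₃ * (4 * x ^ 3 + V.b₂ * x ^ 2 + 2 * V.b₄ * x + V.b₆) =
        x ^ 4 - V.b₄ * x ^ 2 - 2 * V.b₆ * x - V.b₈ := by
  have E := (Affine.equation_iff _ _).1 h.1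
  have hn : y ≠ V.toAffine.negY x y := fun he => by
    apply hy
    rw [Affine.negY] at he
    linear_combination he
  have hd : 4 * x ^ 3 + V.b₂ * x ^ 2 + 2 * V.b₄ * x + V.b₆ = (2 * y + V.a₁ * x + V.a₃) ^ 2 := by
    rw [b₂, b₄, b₆]
    linear_combination -4 * E
  refine ⟨_, _, _, (two_smul ℕ _).trans (Affine.Point.add_some fun h => hn h.2), ?_, ?_⟩
  · rw [hd]
    exact pow_ne_zero 2 hy
  · have hs : V.toAffine.slope x x y y * (2 * y + V.a₁ * x + V.a₃) =
        3 * x ^ 2 + 2 * V.a₂ * x + V.a₄ - V.a₁ * y := by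
      rw [Affine.slope_of_Y_ne rfl hn, show y - V.toAffine.negY x y = 2 * y + V.a₁ * x + V.a₃ by
        rw [Affine.negY]; ring, div_mul_cancel₀ _ hy]
    rw [hd, Affine.addX]
    generalize V.toAffine.slope x x y y = l at *
    have e3 : (l ^ 2 + V.a₁ * l - V.a₂ - x - x) * (2 * y + V.a₁ * x + V.a₃) ^ 2 =
        (3 * x ^ 2 + 2 * V.a₂ * x + V.a₄ - V.a₁ * y) ^ 2 + V.a₁ *
          (3 * x ^ 2 + 2 * V.a₂ * x + V.a₄ - V.a₁ * y) * (2 * y + V.a₁ * x + V.a₃) -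
          (V.a₂ + 2 * x) * (2 * y + V.a₁ * x + V.a₃) ^ 2 := by
      linear_combination (l * (2 * y + V.a₁ * x + V.a₃) + (3 * x ^ 2 + 2 * V.a₂ * x + V.a₄ -
        V.a₁ * y) + V.a₁ * (2 * y + V.a₁ * x + V.a₃)) * hs
    rw [e3, b₄, b₆, b₈]
    clear e3 hs hn hy hd
    grind

end Formulas

section RationalDegree

variable {F N : Type*} [Field F] [Field N] [Algebra F N] {t : N}

/-- A presentation of an element of `F(t)` as a reduced fraction. -/
structure IsReducedFraction (t f : N) (a b : F[X]) : Prop where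
  coprime : IsCoprime a b
  ne_zero : b ≠ 0
  eq : f * aeval t b = aeval t a

lemma exists_isReducedFraction (ht : Transcendental F t) {f : N} {A B : F[X]} (hB : B ≠ 0)
    (h : f * aeval t B = aeval t A) : ∃ a b : F[X], IsReducedFraction t f a b := by
  refine ⟨A / gcd A B, B / gcd A B, isCoprime_div_gcd_div_gcd hB, ?_, ?_⟩
  · intro h0
    have h1 := EuclideanDomain.mul_div_cancel' (gcd_ne_zero_of_right hB) (gcd_dvd_right A B)
    rw [h0, mul_zero] at h1
    exact hB h1.symm
  · have h1 := EuclideanDomain.mul_div_cancel' (gcd_ne_zero_of_right hB) (gcd_dvd_right A B)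
    have h2 := EuclideanDomain.mul_div_cancel' (gcd_ne_zero_of_right hB) (gcd_dvd_left A B)
    have hg : aeval t (gcd A B) ≠ 0 := fun h0 =>
      gcd_ne_zero_of_right hB (transcendental_iff.1 ht _ h0)
    apply mul_left_cancel₀ hg
    rw [← map_mul, h2, ← h, mul_left_comm, ← map_mul, h1]

/-- A reduced fraction has the least degree among all presentations. -/
lemma IsReducedFraction.max_le (ht : Transcendental F t) {f : N} {a b A B : F[X]}
    (hf : IsReducedFraction t f a b) (hB : B ≠ 0) (h : f * aeval t B = aeval t A) :
    max a.natDegree b.natDegree ≤ max A.natDegree B.natDegree := by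
  have h1 : A * b = B * a := by
    apply transcendental_iff_injective.1 ht
    rw [map_mul, map_mul, ← h, ← hf.eq]
    ring
  obtain ⟨c, rfl⟩ : b ∣ B := hf.coprime.symm.dvd_of_dvd_mul_right ⟨A, by rw [← h1, mul_comm]⟩
  have hc : c ≠ 0 := right_ne_zero_of_mul hB
  obtain rfl : A = a * c := mul_right_cancel₀ hf.ne_zero (by rw [h1]; ring)
  have key : ∀ q : F[X], q.natDegree ≤ (q * c).natDegree := by
    intro q
    by_cases hq : q = 0
    · simp [hq]
    · rw [natDegree_mul hq hc]; omega
  exact max_le_max (key a) (key b)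

/-- The degree of the fraction is at most the degree of a pair of polynomials that are proportional
to the elementary symmetric functions of two fractions. -/
lemma IsReducedFraction.add_le (ht : Transcendental F t) {f g : N} {a b c d S T U : F[X]}
    (hf : IsReducedFraction t f a b) (hg : IsReducedFraction t g c d) (hU : U ≠ 0)
    (hT : (f + g) * aeval t U = aeval t T) (hS : f * g * aeval t U = aeval t S) {n : ℕ}
    (hSn : S.natDegree ≤ n) (hTn : T.natDegree ≤ n) (hUn : U.natDegree ≤ n) :
    max a.natDegree b.natDegree + max c.natDegree d.natDegree ≤ n := by
  have h1 : U * (a * c) = S * (b * d) := by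
    apply transcendental_iff_injective.1 ht
    simp only [map_mul]
    rw [← hS, ← hf.eq, ← hg.eq]
    ring
  have h2 : U * (a * d + c * b) = T * (b * d) := by
    apply transcendental_iff_injective.1 ht
    simp only [map_mul, map_add]
    rw [← hT, ← hf.eq, ← hg.eq]
    ring
  -- the product of the primitive forms `a + b Z` and `c + d Z` is primitive, by the Gauss lemma
  have htop : Ideal.span {a * c, a * d + c * b, b * d} = ⊤ := by
    by_contra hne
    obtain ⟨M, hM, hle⟩ := Ideal.exists_le_maximal _ hne
    have hp := hM.isPrime
    have m1 : a * c ∈ M := hle (Ideal.subset_span (by simp))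
    have m2 : a * d + c * b ∈ M := hle (Ideal.subset_span (by simp))
    have m3 : b * d ∈ M := hle (Ideal.subset_span (by simp))
    have hc : ∀ {u v : F[X]}, IsCoprime u v → u ∈ M → v ∈ M → False := by
      rintro u v ⟨r, s, e⟩ hu hv
      exact hM.ne_top ((Ideal.eq_top_iff_one _).2
        (e ▸ add_mem (M.mul_mem_left _ hu) (M.mul_mem_left _ hv)))
    rcases hp.mem_or_mem m1 with ha | hc'
    · have hb : b ∉ M := fun hb => hc hf.coprime ha hb
      have hd := (hp.mem_or_mem m3).resolve_left hb
      rw [M.add_mem_iff_right (M.mul_mem_right _ ha)] at m2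
      exact hc hg.coprime ((hp.mem_or_mem m2).resolve_right hb) hd
    · have hd : d ∉ M := fun hd => hc hg.coprime hc' hd
      have hb := (hp.mem_or_mem m3).resolve_right hd
      rw [M.add_mem_iff_left (M.mul_mem_right _ hc')] at m2
      exact hc hf.coprime ((hp.mem_or_mem m2).resolve_right hd) hb
  have h3 : (1 : F[X]) ∈ Ideal.span {a * c, a * d + c * b, b * d} := htop ▸ Submodule.mem_top
  obtain ⟨x, y, z, e⟩ : ∃ x y z, x * (a * c) + y * (a * d + c * b) + z * (b * d) = 1 := by
    obtain ⟨x, w, hw, e⟩ := Ideal.mem_span_insert.1 h3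
    obtain ⟨y, z, e'⟩ := Ideal.mem_span_pair.1 hw
    exact ⟨x, y, z, by rw [e, ← e']; ring⟩
  have hbd : b * d ≠ 0 := mul_ne_zero hf.ne_zero hg.ne_zero
  obtain ⟨r, hr⟩ : b * d ∣ U := ⟨x * S + y * T + z * U, by
    linear_combination (-U) * e + x * h1 + y * h2⟩
  have hr0 : r ≠ 0 := by
    rintro rfl
    exact hU (by rw [hr, mul_zero])
  have hT' : T = r * (a * d + c * b) := mul_right_cancel₀ hbd (by rw [← h2, hr]; ring)
  have hS' : S = r * (a * c) := mul_right_cancel₀ hbd (by rw [← h1, hr]; ring)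
  have key : ∀ q : F[X], q.natDegree ≤ (r * q).natDegree := by
    intro q
    by_cases hq : q = 0
    · simp [hq]
    · rw [natDegree_mul hr0 hq]; omega
  have k1 := (key (a * c)).trans (hS' ▸ hSn)
  have k2 := (key (a * d + c * b)).trans (hT' ▸ hTn)
  have k3 := (key (b * d)).trans (mul_comm r _ ▸ hr ▸ hUn)
  rw [natDegree_mul hf.ne_zero hg.ne_zero] at k3
  have mixed : ∀ {u v w z : F[X]}, v.natDegree < u.natDegree → w.natDegree < z.natDegree →
      (u * z + w * v).natDegree = u.natDegree + z.natDegree := by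
    intro u v w z h h'
    have hu : u ≠ 0 := by rintro rfl; simp at h
    have hz : z ≠ 0 := by rintro rfl; simp at h'
    rw [natDegree_add_eq_left_of_natDegree_lt, natDegree_mul hu hz]
    rw [natDegree_mul hu hz]
    exact natDegree_mul_le.trans_lt (by omega)
  rcases le_or_gt a.natDegree b.natDegree with hab | hab <;>
    rcases le_or_gt c.natDegree d.natDegree with hcd | hcd
  · rw [max_eq_right hab, max_eq_right hcd]; exact k3
  · rcases hab.lt_or_eq with hab' | hab'
    · rw [add_comm (a * d), mixed hcd hab'] at k2
      rw [max_eq_right hab, max_eq_left hcd.le, add_comm]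
      exact k2
    · by_cases ha : a = 0
      · subst ha
        rw [zero_mul, zero_add, natDegree_mul (by rintro rfl; simp at hcd) hf.ne_zero] at k2
        rw [max_eq_right hab, max_eq_left hcd.le, add_comm]
        exact k2
      · rw [natDegree_mul ha (by rintro rfl; simp at hcd)] at k1
        rw [max_eq_left hab'.ge, max_eq_left hcd.le]
        exact k1
  · rcases hcd.lt_or_eq with hcd' | hcd'
    · rw [mixed hab hcd'] at k2
      rw [max_eq_left hab.le, max_eq_right hcd]
      exact k2
    · by_cases hc : c = 0
      · subst hc
        rw [zero_mul, add_zero, natDegree_mul (by rintro rfl; simp at hab) hg.ne_zero] at k2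
        rw [max_eq_left hab.le, max_eq_right hcd]
        exact k2
      · rw [natDegree_mul (by rintro rfl; simp at hab) hc] at k1
        rw [max_eq_left hab.le, max_eq_left hcd'.ge]
        exact k1
  · rw [natDegree_mul (by rintro rfl; simp at hab) (by rintro rfl; simp at hcd)] at k1
    rw [max_eq_left hab.le, max_eq_left hcd.le]
    exact k1

end RationalDegree

end WeierstrassCurve

/-! ### The degree of multiplication maps -/

namespace WeierstrassCurve

open scoped Classical

section Degree

open IntermediateField

variable {F : Type*} [Field F] [IsAlgClosed F] {W : WeierstrassCurve F} [W.IsElliptic]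

variable (W) in
/-- The point `m • P` for the generic point `P` has a first coordinate that is a rational function
of degree `d` in `x`. -/
def HasXDegree (m d : ℕ) : Prop :=
  ∃ x y h, m • W.genericPoint = .some x y h ∧
    ∃ a b : F[X], IsReducedFraction W.genX x a b ∧ max a.natDegree b.natDegree = d

lemma hasXDegree_one : W.HasXDegree 1 1 :=
  ⟨W.genX, W.genY, _, one_smul _ _, X, 1, ⟨isCoprime_one_right, one_ne_zero, by simp⟩, by simp⟩

lemma exists_hasXDegree_two (p : ℕ) [Fact p.Prime] [CharP F p] :
    ∃ d, W.HasXDegree 2 d ∧ d ≤ 4 := by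
  obtain ⟨hgen, hg⟩ : ∃ h, W.genericPoint = .some W.genX W.genY h := ⟨_, rfl⟩
  obtain ⟨x₃, y₃, h₃, e, h0, h⟩ := exists_two_nsmul_some (V := W.baseChange W.FnField) hgen
    (W.two_mul_genY_ne_zero p)
  let A : F[X] := X ^ 4 - C W.b₄ * X ^ 2 - C (2 * W.b₆) * X - C W.b₈
  let B : F[X] := C 4 * X ^ 3 + C W.b₂ * X ^ 2 + C (2 * W.b₄) * X + C W.b₆
  have hA : aeval W.genX A = W.genX ^ 4 - (W.baseChange W.FnField).b₄ * W.genX ^ 2 -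
      2 * (W.baseChange W.FnField).b₆ * W.genX - (W.baseChange W.FnField).b₈ := by
    simp only [A, baseChange, map_sub, map_mul, map_pow, aeval_X, aeval_C, map_b₄, map_b₆, map_b₈,
      map_ofNat]
  have hB : aeval W.genX B = 4 * W.genX ^ 3 + (W.baseChange W.FnField).b₂ * W.genX ^ 2 +
      2 * (W.baseChange W.FnField).b₄ * W.genX + (W.baseChange W.FnField).b₆ := by
    simp only [B, baseChange, map_add, map_mul, map_pow, aeval_X, aeval_C, map_b₂, map_b₄, map_b₆,
      map_ofNat]
  rw [← hB] at h h0
  rw [← hA] at h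
  have hB0 : B ≠ 0 := fun h' => h0 (by rw [h', map_zero])
  obtain ⟨a, b, hab⟩ := exists_isReducedFraction W.transcendental_genX hB0 h
  refine ⟨_, ⟨x₃, y₃, h₃, e, a, b, hab, rfl⟩, ?_⟩
  refine (hab.max_le W.transcendental_genX hB0 h).trans (max_le ?_ ?_)
  · dsimp only [A]; compute_degree
  · refine le_trans (b := 3) ?_ (by norm_num)
    dsimp only [B]; compute_degree

/-- The approximate parallelogram law for the degree of the first coordinate. -/
lemma HasXDegree.exists_add_le (p : ℕ) [Fact p.Prime] [CharP F p] {m d d' : ℕ} (hm : m ≠ 0)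
    (hd : W.HasXDegree m d) (hd' : W.HasXDegree (m + 1) d') :
    ∃ d'', W.HasXDegree (m + 2) d'' ∧ d'' + d ≤ 2 * d' + 2 := by
  obtain ⟨x₀, y₀, h₀, e₀, a₀, b₀, hab₀, rfl⟩ := hd
  obtain ⟨x₁, y₁, h₁, e₁, a, b, hab, rfl⟩ := hd'
  set d' := max a.natDegree b.natDegree with hd'
  obtain ⟨hgen, hg⟩ : ∃ h, W.genericPoint = .some W.genX W.genY h := ⟨_, rfl⟩
  have hx : x₁ ≠ W.genX := by
    rintro rfl
    have h2 := (W.baseChange W.FnField).toAffine.Y_eq_of_X_eq h₁.1 W.equation_gen rfl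
    rcases h2 with h2 | h2
    · have : (m + 1) • W.genericPoint = W.genericPoint := by
        rw [e₁, hg, some_eq_some_iff]; exact ⟨rfl, h2⟩
      rw [add_smul, one_smul, add_eq_right] at this
      exact nsmul_genericPoint_ne_zero p hm this
    · have : (m + 1) • W.genericPoint = -W.genericPoint := by
        rw [e₁, hg, Affine.Point.neg_some, some_eq_some_iff]; exact ⟨rfl, h2⟩
      rw [← add_eq_zero_iff_eq_neg, ← succ_nsmul] at this
      exact nsmul_genericPoint_ne_zero p (Nat.succ_ne_zero _) this
  obtain ⟨x₃, y₃, h₃, x₄, y₄, h₄, e3, e4, hs, hp⟩ := exists_add_sub_some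
    (V := W.baseChange W.FnField) h₁ hgen hx
  rw [← e₁, ← hg] at e3 e4
  rw [← succ_nsmul] at e3
  rw [add_smul, one_smul, add_sub_cancel_right, e₀, some_eq_some_iff] at e4
  rw [← e4.1] at hs hp
  -- the homogeneous coordinates of the pair of points with first coordinates `x₁` and `x`
  let s : F[X] := a * X
  let t : F[X] := a + b * X
  let U : F[X] := (a - b * X) ^ 2
  let T : F[X] := C 2 * (t * s) + C W.b₂ * (s * b) + C W.b₄ * (t * b) + C W.b₆ * (b * b)
  let S : F[X] := s * s - C W.b₄ * (s * b) - C W.b₆ * (t * b) - C W.b₈ * (b * b)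
  have hbX : aeval W.genX b ≠ 0 := fun h => hab.ne_zero
    (transcendental_iff.1 W.transcendental_genX _ h)
  have hU : aeval W.genX U = (x₁ - W.genX) ^ 2 * aeval W.genX b ^ 2 := by
    simp only [U, map_pow, map_sub, map_mul, aeval_X, ← hab.eq]
    ring
  have hU0 : U ≠ 0 := by
    intro h
    rw [h, map_zero] at hU
    exact mul_ne_zero (pow_ne_zero 2 (sub_ne_zero.2 hx)) (pow_ne_zero 2 hbX) hU.symm
  have hT : (x₃ + x₀) * aeval W.genX U = aeval W.genX T := by
    rw [hU, ← mul_assoc, hs]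
    simp only [T, s, t, map_add, map_mul, aeval_X, aeval_C, ← hab.eq, baseChange, map_b₂, map_b₄,
      map_b₆, map_ofNat]
    ring
  have hS : x₃ * x₀ * aeval W.genX U = aeval W.genX S := by
    rw [hU, ← mul_assoc, hp]
    simp only [S, s, t, map_add, map_sub, map_mul, aeval_X, aeval_C, ← hab.eq, baseChange, map_b₈,
      map_b₄, map_b₆]
    ring
  have hb : b.natDegree ≤ d' + 1 := (le_max_right _ _).trans (Nat.le_succ _)
  have hsd : s.natDegree ≤ d' + 1 :=
    natDegree_mul_le.trans (add_le_add (le_max_left _ _) natDegree_X_le)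
  have hbX' : (b * X).natDegree ≤ d' + 1 :=
    natDegree_mul_le.trans (add_le_add (le_max_right _ _) natDegree_X_le)
  have ha : a.natDegree ≤ d' + 1 := (le_max_left _ _).trans (Nat.le_succ _)
  have htd : t.natDegree ≤ d' + 1 := natDegree_add_le_of_degree_le ha hbX'
  have hm2 : ∀ {u v : F[X]}, u.natDegree ≤ d' + 1 → v.natDegree ≤ d' + 1 →
      (u * v).natDegree ≤ 2 * d' + 2 := fun hu hv =>
    natDegree_mul_le.trans ((add_le_add hu hv).trans (by omega))
  have hc : ∀ {u : F[X]} (c : F), u.natDegree ≤ 2 * d' + 2 → (C c * u).natDegree ≤ 2 * d' + 2 :=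
    fun c hu => (natDegree_C_mul_le c _).trans hu
  have hsub : ∀ {u v : F[X]} {k : ℕ}, u.natDegree ≤ k → v.natDegree ≤ k →
      (u - v).natDegree ≤ k := fun hu hv => (natDegree_sub_le _ _).trans (max_le hu hv)
  have hUn : U.natDegree ≤ 2 * d' + 2 := by
    dsimp only [U]
    rw [sq]
    exact hm2 (hsub ha hbX') (hsub ha hbX')
  have hTn : T.natDegree ≤ 2 * d' + 2 :=
    natDegree_add_le_of_degree_le (natDegree_add_le_of_degree_le (natDegree_add_le_of_degree_le
      (hc _ (hm2 htd hsd)) (hc _ (hm2 hsd hb))) (hc _ (hm2 htd hb))) (hc _ (hm2 hb hb))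
  have hSn : S.natDegree ≤ 2 * d' + 2 :=
    hsub (hsub (hsub
      (hm2 hsd hsd) (hc _ (hm2 hsd hb))) (hc _ (hm2 htd hb))) (hc _ (hm2 hb hb))
  have hrep : ∃ A B : F[X], B ≠ 0 ∧ x₃ * aeval W.genX B = aeval W.genX A := by
    refine ⟨T * b₀ - U * a₀, U * b₀, mul_ne_zero hU0 hab₀.ne_zero, ?_⟩
    simp only [map_sub, map_mul, ← hT, ← hab₀.eq]
    ring
  obtain ⟨A, B, hB, hAB⟩ := hrep
  obtain ⟨a₃, b₃, hab₃⟩ := exists_isReducedFraction W.transcendental_genX hB hAB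
  exact ⟨_, ⟨x₃, y₃, h₃, e3, a₃, b₃, hab₃, rfl⟩,
    hab₃.add_le W.transcendental_genX hab₀ hU0 hT hS hSn hTn hUn⟩

/-- The degree of the abscissa of `n • P` is at most `n ^ 2`. By `HasXDegree.exists_add_le`, the
second differences of these degrees are at most two, so the induction carries a bound on the first
differences along. -/
lemma exists_hasXDegree (p : ℕ) [Fact p.Prime] [CharP F p] (m : ℕ) :
    ∃ d d', W.HasXDegree (m + 1) d ∧ W.HasXDegree (m + 2) d' ∧ d ≤ (m + 1) ^ 2 ∧
      d' ≤ d + 2 * m + 3 := by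
  induction m with
  | zero =>
    obtain ⟨d, hd, h4⟩ := exists_hasXDegree_two (W := W) p
    exact ⟨1, d, hasXDegree_one, hd, le_rfl, by omega⟩
  | succ m ih =>
    obtain ⟨d, d', hd, hd', h1, h2⟩ := ih
    obtain ⟨d'', hd'', h3⟩ := hd.exists_add_le p (Nat.succ_ne_zero m) hd'
    refine ⟨d', d'', hd', hd'', ?_, by omega⟩
    nlinarith

/-- The degree of the multiplication by `m` is at most `m ^ 2`. -/
theorem finrank_fieldRange_le_of_ptOf_eq_nsmul (p : ℕ) [Fact p.Prime] [CharP F p] {m : ℕ}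
    (hm : m ≠ 0) {β : W.FnField →ₐ[F] W.FnField} (hβ : ptOf β = m • W.genericPoint) :
    Module.finrank β.fieldRange W.FnField ≤ m ^ 2 := by
  obtain ⟨n, rfl⟩ := Nat.exists_eq_succ_of_ne_zero hm
  obtain ⟨d, -, ⟨x, y, h, e, a, b, hab, rfl⟩, -, hd, -⟩ := exists_hasXDegree (W := W) p n
  refine le_trans ?_ hd
  obtain ⟨h', e'⟩ := ptOf_eq β
  rw [← hβ, e', some_eq_some_iff] at e
  obtain ⟨hx, -⟩ := e
  have hxt : Transcendental F x := hx ▸ transcendental_algHom β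
  have hbX : aeval W.genX b ≠ 0 := fun h => hab.ne_zero
    (transcendental_iff.1 W.transcendental_genX _ h)
  -- `x` is a root of a polynomial of small degree over `F(β x)`
  let g := AdjoinSimple.gen F x
  let q : F⟮x⟯[X] := a.map (algebraMap F F⟮x⟯) - C g * b.map (algebraMap F F⟮x⟯)
  have hq : aeval W.genX q = 0 := by
    simp only [q, map_sub, map_mul, aeval_map_algebraMap, aeval_C, ← hab.eq]
    exact sub_self _
  have hq0 : q ≠ 0 := by
    intro h0
    obtain ⟨i, hi⟩ : ∃ i, b.coeff i ≠ 0 := by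
      by_contra! h
      exact hab.ne_zero (Polynomial.ext fun i => by simpa using h i)
    have h1 := congrArg (fun r : F⟮x⟯[X] => (r.coeff i : W.FnField)) h0
    simp only [q, coeff_sub, coeff_map, coeff_C_mul, coeff_zero] at h1
    change algebraMap F W.FnField (a.coeff i) - x * algebraMap F W.FnField (b.coeff i) = 0 at h1
    refine hxt ?_
    have hb' : algebraMap F W.FnField (b.coeff i) ≠ 0 := by simpa using hi
    have : x = algebraMap F W.FnField (a.coeff i / b.coeff i) := by
      rw [map_div₀, eq_div_iff hb']
      linear_combination -h1
    rw [this]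
    exact isAlgebraic_algebraMap _
  have hqd : q.natDegree ≤ max a.natDegree b.natDegree :=
    (natDegree_sub_le _ _).trans (max_le_max natDegree_map_le
      ((natDegree_C_mul_le _ _).trans natDegree_map_le))
  have halg : IsAlgebraic F⟮x⟯ W.genX := ⟨q, hq0, hq⟩
  have hdeg : Module.finrank F⟮x⟯ F⟮x⟯⟮W.genX⟯ ≤ max a.natDegree b.natDegree := by
    rw [IntermediateField.adjoin.finrank halg.isIntegral]
    exact (natDegree_le_of_dvd (minpoly.dvd _ _ hq) hq0).trans hqd
  have hxmem : x ∈ F⟮W.genX⟯ := by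
    rw [mem_adjoin_simple_iff]
    exact ⟨a, b, by rw [eq_div_iff hbX, hab.eq]⟩
  have hle : F⟮x⟯ ≤ F⟮W.genX⟯ := adjoin_simple_le_iff.2 hxmem
  have hrel : relfinrank F⟮x⟯ F⟮W.genX⟯ ≤ max a.natDegree b.natDegree := by
    rw [relfinrank_eq_finrank_of_le hle]
    have he : extendScalars hle = F⟮x⟯⟮W.genX⟯ := by
      apply restrictScalars_injective F
      rw [extendScalars_restrictScalars, restrictScalars_adjoin_eq_sup]
      exact (sup_eq_right.2 hle).symm
    rw [he]
    exact hdeg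
  have h1 := relfinrank_mul_finrank_top hle
  have hmap : F⟮x⟯ = F⟮W.genX⟯.map β := by
    rw [adjoin_map, Set.image_singleton, hx]
  have htop : β.fieldRange = (⊤ : IntermediateField F W.FnField).map β := AlgHom.fieldRange_eq_map β
  have hle2 : F⟮x⟯ ≤ β.fieldRange := by
    rw [hmap, htop]
    exact IntermediateField.map_mono β le_top
  have h2 := relfinrank_mul_finrank_top hle2
  have h3 : relfinrank F⟮x⟯ β.fieldRange = Module.finrank F⟮W.genX⟯ W.FnField := by
    rw [hmap, htop, relfinrank_map_map, relfinrank_top_right]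
  have hpos : 0 < Module.finrank F⟮W.genX⟯ W.FnField := Module.finrank_pos
  rw [h3, ← h1, mul_comm] at h2
  rw [Nat.eq_of_mul_eq_mul_right hpos h2]
  exact hrel

end Degree

end WeierstrassCurve

/-! ### Poles at infinity and the coordinate ring -/

namespace WeierstrassCurve

open scoped Classical

section Infinity

variable {F N : Type*} [Field F] [IsAlgClosed F] [Field N] [Algebra F N] {W : WeierstrassCurve F}
  [W.IsElliptic]
variable {A : ValuationSubring N} {x y : N} {h : (W.baseChange N).toAffine.Nonsingular x y}

/-- At a point that reduces to infinity, the leading terms of the equation are `y ^ 2 = x ^ 3`. -/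
lemma Red.hasVal_cube_div_sq (hA : IsPlace F A) (hR : Red A (.some x y h) (0 : W.toAffine.Point)) :
    HasVal A (x ^ 3 / y ^ 2) (1 : F) := by
  obtain ⟨hz, hw⟩ := hR.hasVal_infinity hA
  have he := (Affine.equation_iff _ _).1 h.1
  have hx : x ∉ A := hR
  have hy0 : y ≠ 0 := by
    rintro rfl
    have hx0 : x ≠ 0 := by rintro rfl; exact hx A.zero_mem
    apply hx
    have h2 := hasVal_inv_of_notMem (F := F) hx
    have h1 := (((hasVal_a₂ W A).add ((hasVal_a₄ W A).mul hA h2)).add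
      (((hasVal_a₆ W A).mul hA h2).mul hA h2)).neg.mem hA
    have : -((W.baseChange N).a₂ + (W.baseChange N).a₄ * x⁻¹ + (W.baseChange N).a₆ * x⁻¹ * x⁻¹) =
        x := by
      field_simp
      linear_combination he
    rwa [this] at h1
  have h1 := ((((hasVal_one (A := A) (F := F)).add ((hasVal_a₁ W A).mul hA hz)).add
    ((hasVal_a₃ W A).mul hA hw)).sub ((hasVal_a₂ W A).mul hA (hz.pow hA 2))).sub
    (((hasVal_a₄ W A).mul hA hz).mul hA hw) |>.sub ((hasVal_a₆ W A).mul hA (hw.pow hA 2))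
  convert! h1 using 1
  · field_simp
    linear_combination -he
  · ring

lemma Red.y_ne_zero (hA : IsPlace F A) (hR : Red A (.some x y h) (0 : W.toAffine.Point)) :
    y ≠ 0 := by
  rintro rfl
  have h1 := (hR.hasVal_cube_div_sq hA).unique hA (d := 0) (by simpa using hasVal_zero)
  exact one_ne_zero h1

/-- At infinity, `x` and `y` have valuations in the ratio `2 : 3`, with common root `y / x`. -/
lemma Red.valuation_infinity (hA : IsPlace F A) (hR : Red A (.some x y h) (0 : W.toAffine.Point)) :
    1 < A.valuation (y / x) ∧ A.valuation x = A.valuation (y / x) ^ 2 ∧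
      A.valuation y = A.valuation (y / x) ^ 3 := by
  have hx : x ∉ A := hR
  have hx0 : x ≠ 0 := by rintro rfl; exact hx A.zero_mem
  have hy0 := hR.y_ne_zero hA
  have h1 := (hR.hasVal_cube_div_sq hA).valuation_eq_one hA one_ne_zero
  have h2 := (hR.hasVal_infinity hA).1
  rw [hasVal_zero_iff, ← inv_div, map_inv₀] at h2
  have hne : A.valuation (y / x) ≠ 0 := by simp [hx0, hy0]
  refine ⟨(inv_lt_one₀ (zero_lt_iff.2 hne)).1 h2, ?_, ?_⟩
  · rw [← map_pow, ← mul_one (A.valuation ((y / x) ^ 2)), ← h1, ← map_mul]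
    congr 1
    field_simp
  · rw [← map_pow, ← mul_one (A.valuation ((y / x) ^ 3)), ← h1, ← map_mul]
    congr 1
    field_simp

lemma IsPlace.valuation_aeval (hA : IsPlace F A) (hx : 1 < A.valuation x) {P : F[X]} (hP : P ≠ 0) :
    A.valuation (aeval x P) = A.valuation x ^ P.natDegree := by
  induction hn : P.natDegree using Nat.strong_induction_on generalizing P with
  | _ n ih =>
    have h1 : aeval x P = aeval x P.eraseLead + algebraMap F N P.leadingCoeff * x ^ n := by
      conv_lhs => rw [← P.eraseLead_add_C_mul_X_pow]
      rw [map_add, map_mul, map_pow, aeval_X, aeval_C, hn]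
    have h2 : A.valuation (algebraMap F N P.leadingCoeff * x ^ n) = A.valuation x ^ n := by
      rw [map_mul, map_pow, hA.valuation_eq_one (leadingCoeff_ne_zero.2 hP), one_mul]
    by_cases h0 : P.eraseLead = 0
    · rw [h1, h0, map_zero, zero_add, h2]
    · have hlt : P.eraseLead.natDegree < n := by
        rcases P.eraseLead_natDegree_lt_or_eraseLead_eq_zero with h | h
        · exact hn ▸ h
        · exact (h0 h).elim
      have h3 := ih _ hlt h0 rfl
      rw [h1, Valuation.map_add_eq_of_lt_right, h2]
      rw [h2, h3]
      exact pow_lt_pow_right₀ hx hlt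

/-- The pole order at infinity of a polynomial in the coordinates. -/
lemma Red.exists_valuation_eq (hA : IsPlace F A)
    (hR : Red A (.some x y h) (0 : W.toAffine.Point)) {P Q : F[X]} (hPQ : P ≠ 0 ∨ Q ≠ 0) :
    ∃ k, A.valuation (aeval x P + aeval x Q * y) = A.valuation (y / x) ^ k ∧
      (P ≠ 0 → 2 * P.natDegree ≤ k) ∧ (Q ≠ 0 → 2 * Q.natDegree + 3 ≤ k) ∧
      (P ≠ 0 ∧ k = 2 * P.natDegree ∨ Q ≠ 0 ∧ k = 2 * Q.natDegree + 3) := by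
  obtain ⟨h1, hx, hy⟩ := hR.valuation_infinity hA
  set w := A.valuation (y / x) with hw
  have hx1 : 1 < A.valuation x := by rw [hx]; exact one_lt_pow₀ h1 two_ne_zero
  have hP : P ≠ 0 → A.valuation (aeval x P) = w ^ (2 * P.natDegree) := fun h => by
    rw [hA.valuation_aeval hx1 h, hx, pow_mul]
  have hQ : Q ≠ 0 → A.valuation (aeval x Q * y) = w ^ (2 * Q.natDegree + 3) := fun h => by
    rw [map_mul, hA.valuation_aeval hx1 h, hx, hy, pow_add, pow_mul]
  by_cases hP0 : P = 0
  · have hQ0 := hPQ.resolve_left (not_not.2 hP0)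
    exact ⟨_, by rw [hP0, map_zero, zero_add, hQ hQ0], fun h => (h hP0).elim, fun _ => le_rfl,
      Or.inr ⟨hQ0, rfl⟩⟩
  by_cases hQ0 : Q = 0
  · exact ⟨_, by rw [hQ0, map_zero, zero_mul, add_zero, hP hP0], fun _ => le_rfl,
      fun h => (h hQ0).elim, Or.inl ⟨hP0, rfl⟩⟩
  rcases lt_or_gt_of_ne (show 2 * P.natDegree ≠ 2 * Q.natDegree + 3 by omega) with hlt | hlt
  · refine ⟨_, ?_, fun _ => hlt.le, fun _ => le_rfl, Or.inr ⟨hQ0, rfl⟩⟩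
    rw [Valuation.map_add_eq_of_lt_right, hQ hQ0]
    rw [hP hP0, hQ hQ0]
    exact pow_lt_pow_right₀ h1 hlt
  · refine ⟨_, ?_, fun _ => le_rfl, fun _ => hlt.le, Or.inl ⟨hP0, rfl⟩⟩
    rw [Valuation.map_add_eq_of_lt_left, hP hP0]
    rw [hP hP0, hQ hQ0]
    exact pow_lt_pow_right₀ h1 hlt

end Infinity

section CoordinateRing

variable {F : Type*} [Field F] {W : WeierstrassCurve F}

/-- The coordinate ring is generated by `1` and `y` over the polynomials in `x`. -/
lemma exists_eq_aeval_of_mem_adjoin {f : W.FnField} (hf : f ∈ Algebra.adjoin F {W.genX, W.genY}) :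
    ∃ P Q : F[X], f = aeval W.genX P + aeval W.genX Q * W.genY := by
  induction hf using Algebra.adjoin_induction with
  | mem z hz =>
    rcases hz with rfl | rfl
    · exact ⟨X, 0, by simp⟩
    · exact ⟨0, 1, by simp⟩
  | algebraMap c => exact ⟨C c, 0, by simp⟩
  | add u v _ _ hu hv =>
    obtain ⟨P, Q, rfl⟩ := hu
    obtain ⟨P', Q', rfl⟩ := hv
    exact ⟨P + P', Q + Q', by rw [map_add, map_add]; ring⟩
  | mul u v _ _ hu hv =>
    obtain ⟨P, Q, rfl⟩ := hu
    obtain ⟨P', Q', rfl⟩ := hv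
    have he := (Affine.equation_iff _ _).1 W.equation_gen
    change W.genY ^ 2 + algebraMap F _ W.a₁ * W.genX * W.genY +
      algebraMap F _ W.a₃ * W.genY = W.genX ^ 3 + algebraMap F _ W.a₂ * W.genX ^ 2 +
      algebraMap F _ W.a₄ * W.genX + algebraMap F _ W.a₆ at he
    refine ⟨P * P' + Q * Q' * (X ^ 3 + C W.a₂ * X ^ 2 + C W.a₄ * X + C W.a₆),
      P * Q' + Q * P' - Q * Q' * (C W.a₁ * X + C W.a₃), ?_⟩
    simp only [map_add, map_sub, map_mul, map_pow, aeval_X, aeval_C]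
    linear_combination aeval W.genX Q * aeval W.genX Q' * he

variable [IsAlgClosed F] [W.IsElliptic]

/-- A function that is regular at all affine points is a polynomial in the coordinates. -/
theorem mem_adjoin_of_forall_red {f : W.FnField}
    (hf : ∀ (A : ValuationSubring W.FnField) (Q : W.toAffine.Point), IsPlace F A → Q ≠ 0 →
      Red A W.genericPoint Q → f ∈ A) :
    f ∈ Algebra.adjoin F {W.genX, W.genY} := by
  set B := Algebra.adjoin F {W.genX, W.genY} with hB
  -- the ideal of denominators
  let I : Ideal B :=
    { carrier := {b | (b : W.FnField) * f ∈ B}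
      add_mem' := fun {a b} ha hb => by
        change ((a + b : B) : W.FnField) * f ∈ B
        rw [Subalgebra.coe_add, add_mul]
        exact add_mem ha hb
      zero_mem' := by
        change ((0 : B) : W.FnField) * f ∈ B
        rw [Subalgebra.coe_zero, zero_mul]
        exact zero_mem _
      smul_mem' := fun c b hb => by
        change ((c • b : B) : W.FnField) * f ∈ B
        rw [smul_eq_mul, Subalgebra.coe_mul, mul_assoc]
        exact mul_mem c.2 hb }
  have hI : ∀ b : B, b ∈ I ↔ (b : W.FnField) * f ∈ B := fun b => Iff.rfl
  by_cases htop : I = ⊤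
  · have := (hI 1).1 ((Ideal.eq_top_iff_one I).1 htop)
    simpa using this
  exfalso
  obtain ⟨g, hg, e, he, he0, rfl⟩ := exists_eq_div_gen f
  have hI0 : I ≠ ⊥ := by
    intro h0
    have h1 : (⟨e, he⟩ : B) ∈ I := by
      rw [hI]
      change e * (g / e) ∈ B
      rw [mul_div_cancel₀ _ he0]
      exact hg
    rw [h0, Ideal.mem_bot] at h1
    exact he0 (congrArg Subtype.val h1)
  -- at the centre of `A`, `f` is a fraction whose denominator does not vanish there, but lies in
  -- `I`
  obtain ⟨A, hA, hBA, hIA⟩ := exists_isPlace W.trdeg_fnField B I htop hI0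
  obtain ⟨Q, hQ⟩ := exists_red_genericPoint hA
  have hx := hBA W.genX (Algebra.subset_adjoin (by simp))
  have hQ0 : Q ≠ 0 := by
    rintro rfl
    exact hQ hx
  obtain ⟨c, hc⟩ := hA.exists_value _ (hf A Q hA hQ0 hQ)
  obtain ⟨f', hf'⟩ := W.toFn.surjective (g / e)
  have hv : W.HasValueAt f' Q c := (hasValueAt_iff hA hQ).2 (by rw [hf']; exact hc)
  rw [hasValueAt_def] at hv
  obtain ⟨n, a, b, -, -, hb0, hab, -⟩ := hv
  rw [hf'] at hab
  rcases Q with _ | ⟨x₀, y₀, hQ'⟩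
  · exact hQ0 rfl
  have hν : ∀ i, HasVal A ((![W.genX, W.genY, 1] : Fin 3 → W.FnField) i)
      (W.homogeneousCoordinates (.some x₀ y₀ hQ') i) := by
    intro i
    fin_cases i
    · exact hQ.1
    · exact hQ.2
    · exact hasVal_one
  have h1 := hasVal_aeval hA hν b
  have hmem : ∀ c : MvPolynomial (Fin 3) F,
      MvPolynomial.aeval (![W.genX, W.genY, 1] : Fin 3 → W.FnField) c ∈ B := by
    intro c
    refine (Algebra.adjoin_le (S := B) ?_ :
      Algebra.adjoin F (Set.range (![W.genX, W.genY, 1] : Fin 3 → W.FnField)) ≤ B) (by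
        rw [Algebra.adjoin_range_eq_range_aeval]
        exact ⟨c, rfl⟩)
    rintro _ ⟨i, rfl⟩
    fin_cases i
    · exact Algebra.subset_adjoin (by simp)
    · exact Algebra.subset_adjoin (by simp)
    · exact B.one_mem
  have h2 : (⟨_, hmem b⟩ : B) ∈ I := by
    rw [hI]
    change MvPolynomial.aeval _ b * (g / e) ∈ B
    rw [mul_comm, hab]
    exact hmem a
  exact hb0 (h1.unique hA (hIA _ h2))

end CoordinateRing

end WeierstrassCurve

/-! ### Sums of translates -/

namespace WeierstrassCurve

open scoped Classical

section Sums

variable {F : Type*} [Field F] [IsAlgClosed F] {W : WeierstrassCurve F} [W.IsElliptic]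

/-- The sum of the translates of the coordinate function `x` by a finite set of points. -/
noncomputable def sumX (S : Finset W.toAffine.Point) : W.FnField := ∑ T ∈ S, translHom T W.genX

/-- The sum of the translates of the coordinate function `y` by a finite set of points. -/
noncomputable def sumY (S : Finset W.toAffine.Point) : W.FnField := ∑ T ∈ S, translHom T W.genY

lemma sum_translHom_mem_fixedBy {H : AddSubgroup W.toAffine.Point} {S : Finset W.toAffine.Point}
    (hS : ∀ T, T ∈ S ↔ T ∈ H) (f : W.FnField) : ∑ T ∈ S, translHom T f ∈ fixedBy H := by
  intro Q hQ
  rw [map_sum]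
  have h1 : ∀ T, translHom Q (translHom T f) = translHom (Q + T) f := fun T =>
    DFunLike.congr_fun (translHom_comp Q T) f
  simp only [h1]
  refine Finset.sum_equiv (Equiv.addLeft Q) (fun T => ?_) fun T _ => rfl
  rw [hS, hS, Equiv.coe_addLeft, add_mem_cancel_left hQ]

variable {A : ValuationSubring W.FnField} {R : W.toAffine.Point}

lemma red_translHom (hA : IsPlace F A) (hR : Red A W.genericPoint R) (T : W.toAffine.Point) :
    ∃ h, Red A (W := W) (.some (translHom T W.genX) (translHom T W.genY) h) (R + T) := by
  obtain ⟨h, e⟩ := ptOf_eq (translHom T)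
  refine ⟨h, ?_⟩
  rw [← e, ptOf_translHom]
  exact hR.add hA (red_const A T)

lemma translHom_mem (hA : IsPlace F A) (hR : Red A W.genericPoint R) {T : W.toAffine.Point}
    (hT : R + T ≠ 0) : translHom T W.genX ∈ A ∧ translHom T W.genY ∈ A := by
  obtain ⟨h, hr⟩ := red_translHom hA hR T
  revert hr
  rcases hRT : R + T with _ | ⟨a, b, hab⟩
  · exact (hT hRT).elim
  · exact fun hr => ⟨hr.1.mem hA, hr.2.mem hA⟩

lemma sumX_mem (hA : IsPlace F A) (hR : Red A W.genericPoint R) {S : Finset W.toAffine.Point}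
    (hS : ∀ T ∈ S, R + T ≠ 0) : sumX S ∈ A :=
  sum_mem fun T hT => (translHom_mem hA hR (hS T hT)).1

lemma sumY_mem (hA : IsPlace F A) (hR : Red A W.genericPoint R) {S : Finset W.toAffine.Point}
    (hS : ∀ T ∈ S, R + T ≠ 0) : sumY S ∈ A :=
  sum_mem fun T hT => (translHom_mem hA hR (hS T hT)).2

/-- At the origin, only the trivial translate contributes to the pole of the sum. -/
lemma sum_sub_mem (hA : IsPlace F A) (hR : Red A W.genericPoint 0) {S : Finset W.toAffine.Point}
    (h0 : 0 ∈ S) : sumX S - W.genX ∈ A ∧ sumY S - W.genY ∈ A := by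
  rw [sumX, sumY, ← Finset.add_sum_erase _ _ h0, ← Finset.add_sum_erase _ _ h0, translHom_zero]
  have h : ∀ T ∈ S.erase 0, (0 : W.toAffine.Point) + T ≠ 0 := fun T hT => by
    rw [zero_add]
    exact Finset.ne_of_mem_erase hT
  constructor
  · rw [AlgHom.id_apply, add_sub_cancel_left]
    exact sum_mem fun T hT => (translHom_mem hA hR (h T hT)).1
  · rw [AlgHom.id_apply, add_sub_cancel_left]
    exact sum_mem fun T hT => (translHom_mem hA hR (h T hT)).2

/-- At infinity the sums of translates have the same leading terms as the coordinates. -/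
lemma hasVal_sum_div (hA : IsPlace F A) (hR : Red A W.genericPoint 0)
    {S : Finset W.toAffine.Point} (h0 : 0 ∈ S) :
    HasVal A (sumX S / W.genX) (1 : F) ∧ HasVal A (sumY S / W.genY) (1 : F) := by
  obtain ⟨hgen, hg⟩ : ∃ h, W.genericPoint = .some W.genX W.genY h := ⟨_, rfl⟩
  rw [hg] at hR
  have hR' := hR
  rw [← hg] at hR'
  obtain ⟨hx, hy⟩ := sum_sub_mem hA hR' h0
  have hX0 : W.genX ≠ 0 := fun h => W.genX_ne_const 0 (by rw [h, map_zero])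
  have hY0 := hR.y_ne_zero hA
  constructor
  · have h1 := (hasVal_one (A := A) (F := F)).add (hA.hasVal_mul_zero
      (hasVal_inv_of_notMem (F := F) (show W.genX ∉ A from hR)) hx)
    rw [add_zero] at h1
    convert! h1 using 1
    field_simp
    ring
  · have h1 := (hasVal_one (A := A) (F := F)).add (hA.hasVal_mul_zero (hR.hasVal_infinity hA).2 hy)
    rw [add_zero] at h1
    convert! h1 using 1
    field_simp
    ring

end Sums

section Quotient

variable {F : Type*} [Field F] [IsAlgClosed F] {W W₂ : WeierstrassCurve F} [W.IsElliptic]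
  [W₂.IsElliptic]

/-- A function on the source that is regular away from the kernel and comes from the target is a
polynomial in the coordinates of the target. -/
lemma exists_eq_aeval_of_forall_mem (p : ℕ) [Fact p.Prime] [CharP F p]
    {α : W₂.FnField →ₐ[F] W.FnField} {f : W₂.FnField}
    (hf : ∀ (A : ValuationSubring W.FnField) (R : W.toAffine.Point), IsPlace F A →
      Red A W.genericPoint R → redAt (ptOf α) R ≠ 0 → α f ∈ A) :
    ∃ P Q : F[X], α f = aeval (α W₂.genX) P + aeval (α W₂.genX) Q * α W₂.genY := by
  obtain ⟨P, Q, rfl⟩ : ∃ P Q : F[X], f = aeval W₂.genX P + aeval W₂.genX Q * W₂.genY := by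
    refine exists_eq_aeval_of_mem_adjoin (mem_adjoin_of_forall_red fun B Q hB hQ hBQ => ?_)
    obtain ⟨R, rfl⟩ := redAt_surjective α Q
    obtain ⟨A, hA, hR⟩ := exists_place R
    have h1 := place_unique hB (hA.comap α) hBQ (red_comap_genericPoint α hA hR)
    rw [h1, ValuationSubring.mem_comap]
    exact hf A R hA hR hQ
  exact ⟨P, Q, by rw [map_add, map_mul, ← aeval_algHom_apply, ← aeval_algHom_apply]⟩

/-- The value group at infinity is generated by the value of `y / x`. -/
lemma exists_valuation_eq_div {A : ValuationSubring W.FnField} (hA : IsPlace F A)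
    (hR : Red A W.genericPoint 0) {f : W.FnField} (hf : f ≠ 0) :
    ∃ a b : ℕ, A.valuation f * A.valuation (W.genY / W.genX) ^ b =
      A.valuation (W.genY / W.genX) ^ a := by
  obtain ⟨hgen, hg⟩ : ∃ h, W.genericPoint = .some W.genX W.genY h := ⟨_, rfl⟩
  rw [hg] at hR
  obtain ⟨g, hg, h, hh, hh0, rfl⟩ := exists_eq_div_gen f
  have hg0 : g ≠ 0 := by rintro rfl; simp at hf
  obtain ⟨P, Q, rfl⟩ := exists_eq_aeval_of_mem_adjoin hg
  obtain ⟨P', Q', rfl⟩ := exists_eq_aeval_of_mem_adjoin hh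
  have h1 : ∀ {P Q : F[X]}, aeval W.genX P + aeval W.genX Q * W.genY ≠ 0 → P ≠ 0 ∨ Q ≠ 0 := by
    intro P Q h
    by_contra! h0
    rw [h0.1, h0.2] at h
    simp at h
  obtain ⟨a, ha, -⟩ := hR.exists_valuation_eq hA (h1 hg0)
  obtain ⟨b, hb, -⟩ := hR.exists_valuation_eq hA (h1 hh0)
  refine ⟨a, b, ?_⟩
  rw [← ha, ← hb, ← map_mul, div_mul_cancel₀ _ hh0]

/-- The sums of translates of the coordinates by the kernel of a separable isogeny are, up to a
change of variables, the coordinates of the target: both have a double, respectively triple, pole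
along the kernel. -/
theorem exists_sum_eq (p : ℕ) [Fact p.Prime] [CharP F p] {α : W₂.FnField →ₐ[F] W.FnField}
    (h0 : redAt (ptOf α) 0 = 0) {S : Finset W.toAffine.Point}
    (hS : ∀ T, T ∈ S ↔ redAt (ptOf α) T = 0)
    (hα : ∀ f ∈ fixedBy (redHom p (ptOf α) h0).ker, f ∈ α.fieldRange) :
    ∃ c d c' e f : F, c ≠ 0 ∧ c' ≠ 0 ∧ c ^ 3 = c' ^ 2 ∧
      sumX S = algebraMap F _ c * α W₂.genX + algebraMap F _ d ∧
      sumY S = algebraMap F _ c' * α W₂.genY + algebraMap F _ e * α W₂.genX + algebraMap F _ f := by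
  obtain ⟨g, hg⟩ := hα _ (sum_translHom_mem_fixedBy hS W.genX)
  obtain ⟨h, hh⟩ := hα _ (sum_translHom_mem_fixedBy hS W.genY)
  change α g = sumX S at hg
  change α h = sumY S at hh
  have hreg : ∀ R : W.toAffine.Point, redAt (ptOf α) R ≠ 0 → ∀ T ∈ S, R + T ≠ 0 := by
    intro R hR T hT h
    apply hR
    rw [eq_neg_of_add_eq_zero_left h]
    have h1 : T ∈ (redHom p (ptOf α) h0).ker := (hS T).1 hT
    exact neg_mem h1
  obtain ⟨P, Q, hPQ⟩ := exists_eq_aeval_of_forall_mem p (α := α) (f := g)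
    fun A R hA hR hne => hg ▸ sumX_mem hA hR (hreg R hne)
  obtain ⟨P', Q', hPQ'⟩ := exists_eq_aeval_of_forall_mem p (α := α) (f := h)
    fun A R hA hR hne => hh ▸ sumY_mem hA hR (hreg R hne)
  obtain ⟨A, hA, hR⟩ := exists_place (W := W) 0
  obtain ⟨hX, hY⟩ := hasVal_sum_div hA hR ((hS 0).2 h0)
  obtain ⟨hgen, hge⟩ : ∃ h, W.genericPoint = .some W.genX W.genY h := ⟨_, rfl⟩
  have hR3 := hR
  rw [hge] at hR3
  obtain ⟨hα', hαe⟩ := ptOf_eq α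
  have hR4 := redAt_spec (ptOf α) hA hR
  rw [h0, hαe] at hR4
  have hX0 : W.genX ≠ 0 := fun h => W.genX_ne_const 0 (by rw [h, map_zero])
  have hY0 := hR3.y_ne_zero hA
  have hx : α W₂.genX ∉ A := hR4
  have hx0 : α W₂.genX ≠ 0 := by intro h; exact hx (h ▸ A.zero_mem)
  have hy0 := hR4.y_ne_zero hA
  obtain ⟨h31, h3x, h3y⟩ := hR3.valuation_infinity hA
  obtain ⟨h41, h4x, h4y⟩ := hR4.valuation_infinity hA
  have hvX : A.valuation (sumX S) = A.valuation W.genX := by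
    have := hX.valuation_eq_one hA one_ne_zero
    rw [map_div₀, div_eq_one_iff_eq (by simpa using hX0)] at this
    exact this
  have hvY : A.valuation (sumY S) = A.valuation W.genY := by
    have := hY.valuation_eq_one hA one_ne_zero
    rw [map_div₀, div_eq_one_iff_eq (by simpa using hY0)] at this
    exact this
  set w := A.valuation (W.genY / W.genX)
  set w' := A.valuation (α W₂.genY / α W₂.genX) with hw'
  rw [← hg, hPQ, h3x] at hvX
  rw [← hh, hPQ', h3y] at hvY
  have hne : ∀ {P Q : F[X]} {n : ℕ}, A.valuation (aeval (α W₂.genX) P + aeval (α W₂.genX) Q *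
      α W₂.genY) = w ^ n → P ≠ 0 ∨ Q ≠ 0 := by
    intro P Q n h
    by_contra! h0
    rw [h0.1, h0.2] at h
    simp only [map_zero, zero_mul, add_zero] at h
    exact (pow_pos (zero_lt_one.trans h31) n).ne h
  -- comparing pole orders at the origin: those of the sums are in the ratio `2 : 3`, and the value
  -- group is generated by that of `y / x`
  obtain ⟨k, hk, hk1, hk2, hk3⟩ := hR4.exists_valuation_eq hA (hne hvX)
  obtain ⟨k', hk', hk1', hk2', hk3'⟩ := hR4.exists_valuation_eq hA (hne hvY)
  rw [hvX] at hk
  rw [hvY] at hk'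
  have hpow : ∀ {m n : ℕ}, w' ^ m = w' ^ n → m = n := fun {m n} h =>
    (pow_right_strictMono₀ h41).injective h
  have hkk : 3 * k = 2 * k' := by
    apply hpow
    rw [mul_comm, pow_mul, ← hk, mul_comm, pow_mul, ← hk', ← pow_mul, ← pow_mul]
  obtain ⟨j, rfl⟩ : ∃ j, k = 2 * j := ⟨k' - k, by omega⟩
  obtain rfl : k' = 3 * j := by omega
  have hw : w = w' ^ j := by
    have h1 : w ^ 2 * w = w ^ 2 * w' ^ j := by
      rw [← pow_succ, hk', hk, ← pow_add]
      congr 1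
      ring
    exact mul_left_cancel₀ (pow_pos (zero_lt_one.trans h31) 2).ne' h1
  obtain rfl : j = 1 := by
    obtain ⟨a, b, hab⟩ := exists_valuation_eq_div hA hR (div_ne_zero hy0 hx0)
    change w' * w ^ b = w ^ a at hab
    rw [hw, ← pow_mul, ← pow_mul, ← pow_succ'] at hab
    have := hpow hab
    exact Nat.dvd_one.1 ((Nat.dvd_add_right (dvd_mul_right j b)).1 (this ▸ dvd_mul_right j a))
  have hQ0 : Q = 0 := by
    by_contra h
    have := hk2 h
    omega
  have hP : P ≠ 0 ∧ 2 = 2 * P.natDegree := by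
    rcases hk3 with h | ⟨h, -⟩
    · exact h
    · exact (h hQ0).elim
  have hQ' : Q' ≠ 0 ∧ 3 = 2 * Q'.natDegree + 3 := by
    rcases hk3' with ⟨-, h⟩ | h
    · omega
    · exact h
  have hP' : P'.natDegree ≤ 1 := by
    by_cases h : P' = 0
    · simp [h]
    · have := hk1' h
      omega
  have hPe := eq_X_add_C_of_natDegree_le_one (p := P) (by omega)
  have hPe' := eq_X_add_C_of_natDegree_le_one hP'
  have hQe' := eq_C_of_natDegree_eq_zero (p := Q') (by omega)
  have hc : P.coeff 1 ≠ 0 := by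
    have h1 : P.natDegree = 1 := by omega
    rw [← h1]
    exact leadingCoeff_ne_zero.2 hP.1
  have hc' : Q'.coeff 0 ≠ 0 := by
    intro h
    rw [h, C_0] at hQe'
    exact hQ'.1 hQe'
  have eX : sumX S = algebraMap F _ (P.coeff 1) * α W₂.genX + algebraMap F _ (P.coeff 0) := by
    rw [← hg, hPQ, hQ0, map_zero, zero_mul, add_zero]
    conv_lhs => rw [hPe]
    simp
  have eY : sumY S = algebraMap F _ (Q'.coeff 0) * α W₂.genY +
      algebraMap F _ (P'.coeff 1) * α W₂.genX + algebraMap F _ (P'.coeff 0) := by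
    rw [← hh, hPQ']
    conv_lhs => rw [hPe', hQe']
    simp
    ring
  refine ⟨_, _, _, _, _, hc, hc', ?_, eX, eY⟩
  -- compare the leading coefficients at infinity
  generalize P.coeff 1 = c at *
  generalize P.coeff 0 = d at *
  generalize Q'.coeff 0 = c' at *
  generalize P'.coeff 1 = e at *
  generalize P'.coeff 0 = f at *
  have h1 := ((hX.pow hA 3).mul hA (hR3.hasVal_cube_div_sq hA)).div hA (hY.pow hA 2)
    (pow_ne_zero 2 one_ne_zero)
  have h2 := ((hasVal_algebraMap (A := A) c).add ((hasVal_algebraMap d).mul hA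
    (hasVal_inv_of_notMem (F := F) hx))).pow hA 3
  obtain ⟨h3, h4⟩ := hR4.hasVal_infinity hA
  have h5 := (((hasVal_algebraMap (A := A) c').add ((hasVal_algebraMap e).mul hA h3)).add
    ((hasVal_algebraMap f).mul hA h4)).pow hA 2
  have h6 := (h2.mul hA (hR4.hasVal_cube_div_sq hA)).div hA h5 (by simpa using hc')
  have hsY0 : sumY S ≠ 0 := by
    intro h
    have := hY.unique hA (d := 0) (by rw [h, zero_div]; exact hasVal_zero)
    exact one_ne_zero this
  have h7 : HasVal A (sumX S ^ 3 / sumY S ^ 2) (1 : F) := by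
    convert! h1 using 1
    · field_simp
    · simp
  have h8 : HasVal A (sumX S ^ 3 / sumY S ^ 2) (c ^ 3 / c' ^ 2) := by
    convert! h6 using 1
    · rw [eX]
      have e2 : algebraMap F W.FnField c' + algebraMap F W.FnField e * (α W₂.genX / α W₂.genY) +
        algebraMap F W.FnField f * (1 / α W₂.genY) = sumY S / α W₂.genY := by
        rw [eY]
        field_simp
      rw [e2]
      field_simp
    · simp
  have h9 := h7.unique hA h8
  rw [eq_div_iff (pow_ne_zero 2 hc'), one_mul] at h9
  exact h9.symm

/-- The sums of translates of the coordinates by the kernel of a separable isogeny are coordinates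
of a Weierstrass equation of the target. -/
theorem exists_equation_sum (p : ℕ) [Fact p.Prime] [CharP F p] {α : W₂.FnField →ₐ[F] W.FnField}
    (h0 : redAt (ptOf α) 0 = 0) {S : Finset W.toAffine.Point}
    (hS : ∀ T, T ∈ S ↔ redAt (ptOf α) T = 0)
    (hα : ∀ f ∈ fixedBy (redHom p (ptOf α) h0).ker, f ∈ α.fieldRange) :
    ∃ C : VariableChange F,
      ((C • W₂).baseChange W.FnField).toAffine.Equation (sumX S) (sumY S) := by
  obtain ⟨c, d, c', e, f, hc, hc', hcc, hX, hY⟩ := exists_sum_eq p h0 hS hα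
  obtain ⟨hα', -⟩ := ptOf_eq α
  have he := (Affine.equation_iff _ _).1 hα'.1
  -- the scaling factor is a common root of the two leading coefficients
  obtain ⟨σ, rfl, rfl⟩ : ∃ σ, c = σ ^ 2 ∧ c' = σ ^ 3 := by
    refine ⟨c' / c, ?_, ?_⟩
    · rw [div_pow, ← hcc, pow_succ c 2, mul_div_cancel_left₀ _ (pow_ne_zero 2 hc)]
    · rw [div_pow, hcc, pow_succ c' 2, mul_div_cancel_left₀ _ (pow_ne_zero 2 hc')]
  have hσ : σ ≠ 0 := by rintro rfl; simp at hc
  obtain ⟨r, rfl⟩ : ∃ r, d = -(σ ^ 2 * r) := ⟨-d / σ ^ 2, by field_simp⟩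
  obtain ⟨s, rfl⟩ : ∃ s, e = -(σ ^ 3 * s) := ⟨-e / σ ^ 3, by field_simp⟩
  obtain ⟨t, rfl⟩ : ∃ t, f = σ ^ 3 * (s * r - t) :=
    ⟨s * r - f / σ ^ 3, by field_simp; ring⟩
  refine ⟨⟨(Units.mk0 σ hσ)⁻¹, r, s, t⟩, ?_⟩
  rw [Affine.equation_iff]
  change sumY S ^ 2 + algebraMap F _ _ * sumX S * sumY S + algebraMap F _ _ * sumY S =
    sumX S ^ 3 + algebraMap F _ _ * sumX S ^ 2 + algebraMap F _ _ * sumX S + algebraMap F _ _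
  change α W₂.genY ^ 2 + algebraMap F _ W₂.a₁ * α W₂.genX * α W₂.genY +
    algebraMap F _ W₂.a₃ * α W₂.genY = α W₂.genX ^ 3 + algebraMap F _ W₂.a₂ * α W₂.genX ^ 2 +
    algebraMap F _ W₂.a₄ * α W₂.genX + algebraMap F _ W₂.a₆ at he
  simp only [variableChange_a₁, variableChange_a₂, variableChange_a₃, variableChange_a₄,
    variableChange_a₆, inv_inv, Units.val_mk0, hX, hY, _root_.map_add, _root_.map_mul,
    _root_.map_sub, _root_.map_neg, map_pow, map_ofNat]
  linear_combination algebraMap F W.FnField σ ^ 6 * he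

end Quotient

end WeierstrassCurve

/-! ### Uniqueness of Weierstrass equations -/

namespace WeierstrassCurve

open scoped Classical

lemma HasVal.aeval {F N : Type*} [Field F] [Field N] [Algebra F N] {A : ValuationSubring N}
    (hA : IsPlace F A) {x : N} {c : F} (h : HasVal A x c) (P : F[X]) :
    HasVal A (aeval x P) (P.eval c) := by
  induction P using Polynomial.induction_on' with
  | add P Q hP hQ => rw [_root_.map_add, eval_add]; exact hP.add hQ
  | monomial n a =>
    rw [aeval_monomial, eval_monomial]
    exact (hasVal_algebraMap a).mul hA (h.pow hA n)

section Independence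

variable {F : Type*} [Field F] [IsAlgClosed F] {W : WeierstrassCurve F} [W.IsElliptic]

section Infinity

variable {N : Type*} [Field N] [Algebra F N] {A : ValuationSubring N} {x y : N}
  {h : (W.baseChange N).toAffine.Nonsingular x y}

/-- The functions `x ^ i` and `x ^ i * y` are linearly independent. -/
lemma Red.eq_zero_of_aeval_add_eq_zero (hA : IsPlace F A)
    (hR : Red A (.some x y h) (0 : W.toAffine.Point)) {P Q : F[X]}
    (hPQ : aeval x P + aeval x Q * y = 0) : P = 0 ∧ Q = 0 := by
  by_contra h0
  obtain ⟨k, hk, -⟩ := hR.exists_valuation_eq hA (P := P) (Q := Q) (by tauto)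
  rw [hPQ, map_zero] at hk
  exact (pow_pos (zero_lt_one.trans (hR.valuation_infinity hA).1) k).ne hk

/-- A point that reduces to infinity satisfies only one Weierstrass equation, up to a factor. -/
lemma Red.eq_zero_of_relation (hA : IsPlace F A)
    (hR : Red A (.some x y h) (0 : W.toAffine.Point)) {b₁ b₂ b₃ b₄ b₆ : F}
    (hb : algebraMap F N b₁ * x * y + algebraMap F N b₃ * y =
      algebraMap F N b₂ * x ^ 2 + algebraMap F N b₄ * x + algebraMap F N b₆) :
    b₁ = 0 ∧ b₂ = 0 ∧ b₃ = 0 ∧ b₄ = 0 ∧ b₆ = 0 := by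
  obtain ⟨h1, h2⟩ := hR.eq_zero_of_aeval_add_eq_zero hA
    (P := -(C b₂ * X ^ 2 + C b₄ * X + C b₆)) (Q := C b₁ * X + C b₃) (by
      simp only [map_neg, map_add, map_mul, map_pow, aeval_C, aeval_X]
      linear_combination hb)
  rw [neg_eq_zero] at h1
  have e := fun n => congrArg (fun P : F[X] => P.coeff n) h1
  have e' := fun n => congrArg (fun P : F[X] => P.coeff n) h2
  refine ⟨?_, ?_, ?_, ?_, ?_⟩
  · simpa using e' 1
  · simpa [coeff_X, coeff_C] using e 2
  · simpa using e' 0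
  · simpa [coeff_X, coeff_C] using e 1
  · simpa using e 0

end Infinity

lemma red_genericPoint_zero {A : ValuationSubring W.FnField} (hR : Red A W.genericPoint 0) :
    ∃ h, Red A (.some W.genX W.genY h) (0 : W.toAffine.Point) := by
  obtain ⟨hgen, hg⟩ : ∃ h, W.genericPoint = .some W.genX W.genY h := ⟨_, rfl⟩
  exact ⟨hgen, hg ▸ hR⟩

/-- A function with infinitely many zeros vanishes: the norm of its numerator is a polynomial in
`x`. -/
theorem eq_zero_of_infinite {f : W.FnField} {Z : Set F} (hZ : Z.Infinite)
    (h : ∀ x₀ ∈ Z, ∃ A : ValuationSubring W.FnField, IsPlace F A ∧ HasVal A W.genX x₀ ∧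
      HasVal A f (0 : F)) : f = 0 := by
  obtain ⟨B, hB, hRB⟩ := exists_place (W := W) 0
  obtain ⟨hgen, hRB⟩ := red_genericPoint_zero hRB
  obtain ⟨g, hg, e, he, he0, rfl⟩ := exists_eq_div_gen f
  have hmem : ∀ A : ValuationSubring W.FnField, IsPlace F A → W.genX ∈ A →
      ∀ u ∈ Algebra.adjoin F {W.genX, W.genY}, u ∈ A := by
    intro A hA hx u hu
    have hy := mem_of_equation hA hgen.1 hx
    induction hu using Algebra.adjoin_induction with
    | mem z hz => rcases hz with rfl | rfl <;> assumption
    | algebraMap c => exact hA.algebraMap_mem c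
    | add u v _ _ hu hv => exact add_mem hu hv
    | mul u v _ _ hu hv => exact mul_mem hu hv
  obtain ⟨P, Q, rfl⟩ := exists_eq_aeval_of_mem_adjoin hg
  have heq := W.genericPoint_equation
  set N : F[X] := P ^ 2 - P * Q * (C W.a₁ * X + C W.a₃) -
    Q ^ 2 * (X ^ 3 + C W.a₂ * X ^ 2 + C W.a₄ * X + C W.a₆) with hN
  set v := aeval W.genX (P - Q * (C W.a₁ * X + C W.a₃)) + aeval W.genX (-Q) * W.genY with hv
  have hNv : aeval W.genX N = (aeval W.genX P + aeval W.genX Q * W.genY) * v := by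
    simp only [hN, hv, map_sub, map_add, map_neg, map_mul, map_pow, aeval_C, aeval_X]
    linear_combination aeval W.genX Q ^ 2 * heq
  have hvadj : v ∈ Algebra.adjoin F {W.genX, W.genY} := by
    have hx : W.genX ∈ Algebra.adjoin F {W.genX, W.genY} := Algebra.subset_adjoin (by simp)
    have hy : W.genY ∈ Algebra.adjoin F {W.genX, W.genY} := Algebra.subset_adjoin (by simp)
    have hP : ∀ P : F[X], aeval W.genX P ∈ Algebra.adjoin F {W.genX, W.genY} := fun P =>
      Algebra.adjoin_mono (by simp) (aeval_mem_adjoin_singleton F W.genX)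
    exact add_mem (hP _) (mul_mem (hP _) hy)
  have hroot : ∀ x₀ ∈ Z, N.IsRoot x₀ := by
    intro x₀ hx₀
    obtain ⟨A, hA, hx, hf⟩ := h x₀ hx₀
    have h1 := hA.hasVal_mul_zero hf (mul_mem (hmem A hA (hx.mem hA) e he)
      (hmem A hA (hx.mem hA) v hvadj))
    rw [← mul_assoc, div_mul_cancel₀ _ he0, ← hNv] at h1
    exact (hx.aeval hA N).unique hA h1
  have hN0 : N = 0 := eq_zero_of_infinite_isRoot N (hZ.mono hroot)
  rw [hN0, map_zero] at hNv
  rcases mul_eq_zero.1 hNv.symm with h1 | h1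
  · rw [h1, zero_div]
  · obtain ⟨h2, h3⟩ := hRB.eq_zero_of_aeval_add_eq_zero hB h1
    rw [neg_eq_zero] at h3
    rw [h3, zero_mul, sub_zero] at h2
    simp [h2, h3]

end Independence

section Isomorphism

variable {F : Type*} [Field F] [IsAlgClosed F] {W W₂ : WeierstrassCurve F} [W.IsElliptic]
  [W₂.IsElliptic]

/-- An isomorphism of function fields that fixes the origin comes from a change of variables. -/
theorem j_eq_of_surjective (p : ℕ) [Fact p.Prime] [CharP F p] {α : W₂.FnField →ₐ[F] W.FnField}
    (h0 : redAt (ptOf α) 0 = 0) (hα : Function.Surjective α) : W₂.j = W.j := by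
  have hS : ∀ T : W.toAffine.Point, T ∈ ({0} : Finset W.toAffine.Point) ↔ redAt (ptOf α) T = 0 := by
    intro T
    rw [Finset.mem_singleton]
    refine ⟨fun h => h ▸ h0, fun h => translHom_injective ?_⟩
    rw [translHom_zero]
    refine AlgHom.ext fun f => ?_
    obtain ⟨g, rfl⟩ := hα f
    exact DFunLike.congr_fun (translHom_comp_of_mem_ker p h0 h) g
  obtain ⟨C, hC⟩ := exists_equation_sum p h0 hS fun f _ => hα f
  have hX : sumX {(0 : W.toAffine.Point)} = W.genX := by
    rw [sumX, Finset.sum_singleton, translHom_zero, AlgHom.id_apply]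
  have hY : sumY {(0 : W.toAffine.Point)} = W.genY := by
    rw [sumY, Finset.sum_singleton, translHom_zero, AlgHom.id_apply]
  rw [hX, hY] at hC
  rw [← variableChange_j (W := W₂) C]
  suffices key : ∀ (W' : WeierstrassCurve F) [W'.IsElliptic],
      (W'.baseChange W.FnField).toAffine.Equation W.genX W.genY → W'.j = W.j from key _ hC
  clear hC
  intro W' hell hC
  rw [Affine.equation_iff] at hC
  have he := W.genericPoint_equation
  obtain ⟨A, hA, hR⟩ := exists_place (W := W) 0
  obtain ⟨hgen, hR⟩ := red_genericPoint_zero hR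
  change W.genY ^ 2 + algebraMap F _ W'.a₁ * W.genX * W.genY +
    algebraMap F _ W'.a₃ * W.genY = W.genX ^ 3 + algebraMap F _ W'.a₂ * W.genX ^ 2 +
    algebraMap F _ W'.a₄ * W.genX + algebraMap F _ W'.a₆ at hC
  obtain ⟨h1, h2, h3, h4, h6⟩ := hR.eq_zero_of_relation hA (b₁ := W'.a₁ - W.a₁)
    (b₂ := W'.a₂ - W.a₂) (b₃ := W'.a₃ - W.a₃) (b₄ := W'.a₄ - W.a₄) (b₆ := W'.a₆ - W.a₆) (by
      simp only [_root_.map_sub]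
      linear_combination hC - he)
  have hWW : W' = W := by
    ext
    · exact sub_eq_zero.1 h1
    · exact sub_eq_zero.1 h2
    · exact sub_eq_zero.1 h3
    · exact sub_eq_zero.1 h4
    · exact sub_eq_zero.1 h6
  subst hWW
  rfl

end Isomorphism

end WeierstrassCurve

/-! ### Rational points over separably closed fields, and the field of definition of quotients -/

namespace WeierstrassCurve

open scoped Classical

section RationalPoints

open IntermediateField

variable {M F : Type*} [Field M] [Field F] [Algebra M F] [IsPurelyInseparable M F]

/-- Points of finite order prime to the characteristic are not inseparable over the field of
definition: the invariant differential vanishes on them. -/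
lemma mem_ptIn_bot_of_nsmul_eq_zero {W : WeierstrassCurve M} {m : ℕ} (hm : (m : F) ≠ 0)
    {T : (W.baseChange F).toAffine.Point} (hT : m • T = 0) :
    T ∈ W.ptIn (⊥ : IntermediateField M F) := by
  rcases T with _ | ⟨x, y, h⟩
  · exact zero_mem _
  set N := IntermediateField.adjoin M {x, y} with hN
  have hx : x ∈ N := subset_adjoin _ _ (by simp)
  have hy : y ∈ N := subset_adjoin _ _ (by simp)
  have halg : ∀ z : F, IsAlgebraic M z := fun z => Algebra.IsAlgebraic.isAlgebraic z
  have hfd : FiniteDimensional M N :=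
    IntermediateField.finiteDimensional_adjoin fun z _ => (halg z).isIntegral
  have hsep : Algebra.IsSeparable M N := by
    refine isSeparable_of_derivation_eq_zero fun D => ?_
    obtain ⟨P, hP⟩ : (.some x y h : (W.baseChange F).toAffine.Point) ∈ W.ptIn N :=
      some_mem_ptIn.2 ⟨hx, hy⟩
    have hmP : m • P = 0 := by
      apply mapPt_injective N.val
      rw [map_nsmul, hP, hT, _root_.map_zero]
    rcases P with _ | ⟨a, b, hab⟩
    · cases hP
    obtain ⟨h', e⟩ := mapPt_some (W := W) N.val hab
    rw [e, some_eq_some_iff] at hP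
    obtain ⟨w, hw⟩ := exists_hasOmega (W := W) (D := D) (.some a b hab)
    have h1 := hw.nsmul m
    rw [hmP] at h1
    have h2 : (m : N) * w = 0 := h1
    have hmN : (m : N) ≠ 0 := by
      intro h0
      apply hm
      have := congrArg (algebraMap N F) h0
      simpa using this
    obtain rfl := (mul_eq_zero.1 h2).resolve_left hmN
    rw [hasOmega_zero_iff] at hw
    have key : ∀ z (hz : z ∈ Algebra.adjoin M {x, y}), ∃ hz' : z ∈ N, D ⟨z, hz'⟩ = 0 := by
      intro z hz
      induction hz using Algebra.adjoin_induction with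
      | mem z hz =>
        rcases hz with rfl | rfl
        · refine ⟨hx, ?_⟩
          rw [← hw.1]
          congr 1
          exact Subtype.ext hP.1.symm
        · refine ⟨hy, ?_⟩
          rw [← hw.2]
          congr 1
          exact Subtype.ext hP.2.symm
      | algebraMap c => exact ⟨N.algebraMap_mem c, D.map_algebraMap c⟩
      | add u v _ _ hu hv =>
        obtain ⟨hu', hu⟩ := hu
        obtain ⟨hv', hv⟩ := hv
        refine ⟨add_mem hu' hv', ?_⟩
        have : D (⟨u, hu'⟩ + ⟨v, hv'⟩) = 0 := by rw [_root_.map_add, hu, hv, add_zero]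
        exact this
      | mul u v _ _ hu hv =>
        obtain ⟨hu', hu⟩ := hu
        obtain ⟨hv', hv⟩ := hv
        refine ⟨mul_mem hu' hv', ?_⟩
        have : D (⟨u, hu'⟩ * ⟨v, hv'⟩) = 0 := by
          rw [D.leibniz, hu, hv, smul_zero, smul_zero, add_zero]
        exact this
    refine Derivation.ext fun z => ?_
    have hz : (z : F) ∈ Algebra.adjoin M {x, y} := by
      rw [← adjoin_toSubalgebra_of_isAlgebraic fun z _ => halg z]
      exact z.2
    obtain ⟨hz', h0⟩ := key _ hz
    exact h0
  have hbot : ∀ z ∈ N, z ∈ (⊥ : IntermediateField M F) := by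
    intro z hz
    have := IsPurelyInseparable.tower_bot M N F
    obtain ⟨c, hc⟩ := IsPurelyInseparable.surjective_algebraMap_of_isSeparable M N ⟨z, hz⟩
    exact IntermediateField.mem_bot.2 ⟨c, congrArg Subtype.val hc⟩
  rw [some_mem_ptIn]
  exact ⟨hbot x hx, hbot y hy⟩

variable [IsAlgClosed F]

lemma infinite_of_isPurelyInseparable (M F : Type*) [Field M] [Field F] [Algebra M F]
    [IsPurelyInseparable M F] [IsAlgClosed F] : Infinite M := by
  by_contra h
  rw [not_infinite_iff_finite] at h
  have h1 : Function.Surjective (algebraMap M F) :=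
    IsPurelyInseparable.surjective_algebraMap_of_isSeparable M F
  have := Finite.of_surjective _ h1
  have := IsAlgClosed.instInfinite (K := F)
  exact not_finite F

variable {W : WeierstrassCurve M} [(W.baseChange F).IsElliptic]

/-- There are infinitely many points with coordinates in the smaller field: for all but finitely
many abscissas, the equation for the ordinate is separable. -/
lemma infinite_ptIn_bot (p : ℕ) [Fact p.Prime] [CharP F p] :
    {x : F | ∃ y h, (.some x y h : (W.baseChange F).toAffine.Point) ∈
      W.ptIn (⊥ : IntermediateField M F)}.Infinite := by
  have hinf := infinite_of_isPurelyInseparable M F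
  set B : F[X] := (2 : F[X]) ^ 2 *
    (X ^ 3 + C (W.baseChange F).a₂ * X ^ 2 + C (W.baseChange F).a₄ * X +
    C (W.baseChange F).a₆) + (C (W.baseChange F).a₁ * X + C (W.baseChange F).a₃) ^ 2 with hB
  have hB0 : B ≠ 0 := by
    intro h0
    have h1 := (W.baseChange F).two_mul_genY_ne_zero p
    apply pow_ne_zero 2 h1
    have h2 : aeval (W.baseChange F).genX B = 0 := by rw [h0, _root_.map_zero]
    simp only [hB, _root_.map_add, _root_.map_mul, map_pow, aeval_X, aeval_C, map_ofNat] at h2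
    have h3 := (W.baseChange F).genericPoint_equation
    linear_combination h2 + 4 * h3
  refine Set.Infinite.mono (s := Set.range (algebraMap M F) \ {x | B.IsRoot x}) ?_ ?_
  · rintro _ ⟨⟨u, rfl⟩, hu⟩
    set q : M[X] := X ^ 2 + C (W.a₁ * u + W.a₃) * X -
      C (u ^ 3 + W.a₂ * u ^ 2 + W.a₄ * u + W.a₆) with hq
    set d : M := 4 * (u ^ 3 + W.a₂ * u ^ 2 + W.a₄ * u + W.a₆) + (W.a₁ * u + W.a₃) ^ 2 with hd
    have hd0 : d ≠ 0 := by
      intro h0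
      apply hu
      have := congrArg (algebraMap M F) h0
      simp only [hd, _root_.map_add, _root_.map_mul, map_pow, map_ofNat, _root_.map_zero] at this
      change B.eval _ = 0
      simp only [hB, eval_add, eval_mul, eval_pow, eval_X, eval_C, eval_ofNat]
      simp only [baseChange, map_a₁, map_a₂, map_a₃, map_a₄, map_a₆]
      linear_combination this
    have hsep : q.Separable := by
      have hder : derivative q = 2 * X + C (W.a₁ * u + W.a₃) := by
        simp only [hq, derivative_sub, derivative_add, derivative_X_pow, derivative_C_mul,
          derivative_X, derivative_C]
        simp
        rfl
      refine ⟨-4 * C d⁻¹, C d⁻¹ * derivative q, ?_⟩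
      have hdd : C d⁻¹ * C d = 1 := by rw [← C_mul, inv_mul_cancel₀ hd0, C_1]
      rw [hder, ← hdd, hq, hd]
      simp only [C_add, C_mul, C_pow, map_ofNat]
      ring
    have hdeg : q.degree ≠ 0 := by
      have : q.degree = 2 := by
        rw [hq]
        compute_degree!
      rw [this]
      decide
    obtain ⟨y, hy⟩ := IsAlgClosed.exists_aeval_eq_zero F q hdeg
    have hys : IsSeparable M y := hsep.of_dvd (minpoly.dvd M y hy)
    obtain ⟨v, rfl⟩ := IsPurelyInseparable.inseparable' (F := M) y hys
    have heq : (W.baseChange F).toAffine.Equation (algebraMap M F u) (algebraMap M F v) := by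
      rw [Affine.equation_iff]
      simp only [baseChange, map_a₁, map_a₂, map_a₃, map_a₄, map_a₆]
      simp only [hq, _root_.map_sub, _root_.map_add, _root_.map_mul, map_pow, aeval_X,
        aeval_C] at hy
      linear_combination hy
    have hell : (W.baseChange F).toAffine.IsElliptic := inferInstanceAs (W.baseChange F).IsElliptic
    refine ⟨_, (Affine.equation_iff_nonsingular).1 heq, ?_⟩
    rw [some_mem_ptIn]
    exact ⟨IntermediateField.algebraMap_mem _ u, IntermediateField.algebraMap_mem _ v⟩
  · exact (Set.infinite_range_of_injective (algebraMap M F).injective).sdiff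
      (finite_setOfPred_isRoot hB0)

/-- The sums of translates by rational points take rational values at rational points. -/
lemma exists_hasVal_sum {S : Finset (W.baseChange F).toAffine.Point}
    (hS : ∀ T ∈ S, T ∈ W.ptIn (⊥ : IntermediateField M F)) {R : (W.baseChange F).toAffine.Point}
    (hR : R ∈ W.ptIn (⊥ : IntermediateField M F)) (hne : ∀ T ∈ S, R + T ≠ 0)
    {A : ValuationSubring (W.baseChange F).FnField} (hA : IsPlace F A)
    (hRed : Red A (W.baseChange F).genericPoint R) :
    ∃ u v : M, HasVal A (sumX S) (algebraMap M F u) ∧ HasVal A (sumY S) (algebraMap M F v) := by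
  have key : ∀ T : (W.baseChange F).toAffine.Point, ∃ u v : M, T ∈ S →
      HasVal A (translHom T (W.baseChange F).genX) (algebraMap M F u) ∧
      HasVal A (translHom T (W.baseChange F).genY) (algebraMap M F v) := by
    intro T
    by_cases hT : T ∈ S
    swap
    · exact ⟨0, 0, fun h => (hT h).elim⟩
    have h1 := add_mem hR (hS T hT)
    have h2 := hne T hT
    obtain ⟨h, h3⟩ := red_translHom hA hRed T
    revert h1 h2 h3
    generalize R + T = Q
    intro h1 h2 h3
    rcases Q with _ | ⟨a, b, hab⟩
    · exact (h2 rfl).elim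
    · rw [some_mem_ptIn] at h1
      obtain ⟨u, rfl⟩ := IntermediateField.mem_bot.1 h1.1
      obtain ⟨v, rfl⟩ := IntermediateField.mem_bot.1 h1.2
      exact ⟨u, v, fun _ => h3⟩
  choose u v huv using key
  refine ⟨∑ T ∈ S, u T, ∑ T ∈ S, v T, ?_, ?_⟩
  · rw [map_sum]
    exact HasVal.sum S fun T hT => (huv T hT).1
  · rw [map_sum]
    exact HasVal.sum S fun T hT => (huv T hT).2

/-- A Weierstrass equation that is satisfied by two functions with a pole along a finite set of
points, and with infinitely many values in a subfield, has its coefficients in this subfield. -/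
lemma exists_eq_map_of_equation (p : ℕ) [Fact p.Prime] [CharP F p]
    {S : Finset (W.baseChange F).toAffine.Point} (h0 : 0 ∈ S)
    (hS : ∀ T ∈ S, T ∈ W.ptIn (⊥ : IntermediateField M F)) {V : WeierstrassCurve F} [V.IsElliptic]
    (hV : (V.baseChange (W.baseChange F).FnField).toAffine.Equation (sumX S) (sumY S)) :
    ∃ V₀ : WeierstrassCurve M, V = V₀.map (algebraMap M F) := by
  -- with an `M`-linear retraction `ρ` of `F` onto `M`, the equation with coefficients `ρ aᵢ` holds
  -- at infinitely many points, hence identically; but the equation is unique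
  obtain ⟨ρ, hρ⟩ := (Algebra.linearMap M F).exists_leftInverse_of_injective
    (LinearMap.ker_eq_bot.2 (algebraMap M F).injective)
  have hρ' : ∀ (u : M) (c : F), ρ (c * algebraMap M F u) = ρ c * u := fun u c => by
    rw [mul_comm, ← Algebra.smul_def, map_smul, smul_eq_mul, mul_comm]
  have hρ1 : ∀ u : M, ρ (algebraMap M F u) = u := fun u => LinearMap.congr_fun hρ u
  have he := (Affine.equation_iff _ _).1 hV
  change sumY S ^ 2 + algebraMap F _ V.a₁ * sumX S * sumY S + algebraMap F _ V.a₃ * sumY S =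
    sumX S ^ 3 + algebraMap F _ V.a₂ * sumX S ^ 2 + algebraMap F _ V.a₄ * sumX S +
    algebraMap F _ V.a₆ at he
  set r : F → F := fun c => c - algebraMap M F (ρ c) with hr
  have hf : algebraMap F (W.baseChange F).FnField (r V.a₁) * sumX S * sumY S +
      algebraMap F _ (r V.a₃) * sumY S - (algebraMap F _ (r V.a₂) * sumX S ^ 2 +
      algebraMap F _ (r V.a₄) * sumX S + algebraMap F _ (r V.a₆)) = 0 := by
    have hinf := infinite_ptIn_bot (W := W) (F := F) p
    have hfin : (((fun P : (W.baseChange F).toAffine.Point =>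
        (W.baseChange F).homogeneousCoordinates P 0) '' S) : Set F).Finite :=
      S.finite_toSet.image _
    refine eq_zero_of_infinite (hinf.sdiff hfin) ?_
    rintro x ⟨⟨y, h, hR⟩, hx⟩
    obtain ⟨A, hA, hRed⟩ := exists_place (.some x y h : (W.baseChange F).toAffine.Point)
    refine ⟨A, hA, hRed.1, ?_⟩
    have hne : ∀ T ∈ S, (.some x y h : (W.baseChange F).toAffine.Point) + T ≠ 0 := by
      intro T hT h1
      obtain rfl := eq_neg_of_add_eq_zero_right h1
      refine hx ⟨_, hT, ?_⟩
      rw [Affine.Point.neg_some]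
      rfl
    obtain ⟨u, v, hu, hv⟩ := exists_hasVal_sum hS hR hne hA hRed
    have hval : ∀ b₁ b₂ b₃ b₄ b₆ : F, HasVal A (algebraMap F (W.baseChange F).FnField b₁ * sumX S *
        sumY S + algebraMap F _ b₃ * sumY S - (algebraMap F _ b₂ * sumX S ^ 2 +
        algebraMap F _ b₄ * sumX S + algebraMap F _ b₆))
        (b₁ * algebraMap M F u * algebraMap M F v + b₃ * algebraMap M F v -
          (b₂ * algebraMap M F u ^ 2 + b₄ * algebraMap M F u + b₆)) := fun b₁ b₂ b₃ b₄ b₆ =>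
      ((((hasVal_algebraMap b₁).mul hA hu).mul hA hv).add ((hasVal_algebraMap b₃).mul hA hv)).sub
        ((((hasVal_algebraMap b₂).mul hA (hu.pow hA 2)).add ((hasVal_algebraMap b₄).mul hA hu)).add
          (hasVal_algebraMap b₆))
    have h1 : HasVal A (sumX S ^ 3 - sumY S ^ 2)
        (algebraMap M F u ^ 3 - algebraMap M F v ^ 2) := (hu.pow hA 3).sub (hv.pow hA 2)
    have h2 := (hval V.a₁ V.a₂ V.a₃ V.a₄ V.a₆).unique hA
      (d := algebraMap M F u ^ 3 - algebraMap M F v ^ 2) (by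
        convert! h1 using 1
        linear_combination he)
    -- the equation for the values, and its image under the retraction to the smaller field
    have h3 : ρ V.a₁ * u * v + ρ V.a₃ * v - (ρ V.a₂ * u ^ 2 + ρ V.a₄ * u + ρ V.a₆) =
        u ^ 3 - v ^ 2 := by
      have := congrArg ρ h2
      rw [← map_pow, ← map_pow, ← map_pow, ← _root_.map_sub (algebraMap M F), hρ1] at this
      simpa only [_root_.map_add, _root_.map_sub, hρ'] using this
    have h4 := congrArg (algebraMap M F) h3
    simp only [_root_.map_add, _root_.map_sub, _root_.map_mul, map_pow] at h4
    convert! hval (r V.a₁) (r V.a₂) (r V.a₃) (r V.a₄) (r V.a₆) using 1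
    simp only [hr]
    linear_combination h4 - h2
  obtain ⟨A, hA, hRed⟩ := exists_place (W := W.baseChange F) 0
  obtain ⟨hX, -⟩ := hasVal_sum_div hA hRed h0
  have hell : (V.baseChange (W.baseChange F).FnField).toAffine.IsElliptic :=
    V.isElliptic_baseChange _
  have hinfty : Red A (.some (sumX S) (sumY S) (Affine.equation_iff_nonsingular.1 hV))
      (0 : V.toAffine.Point) := by
    change sumX S ∉ A
    intro hmem
    have h1 := (sum_sub_mem hA hRed h0).1
    have h2 : (W.baseChange F).genX ∉ A := hRed
    apply h2
    have := sub_mem hmem h1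
    rwa [sub_sub_cancel] at this
  obtain ⟨h1, h2, h3, h4, h6⟩ := hinfty.eq_zero_of_relation hA (sub_eq_zero.1 hf)
  refine ⟨⟨ρ V.a₁, ρ V.a₂, ρ V.a₃, ρ V.a₄, ρ V.a₆⟩, ?_⟩
  ext
  · exact sub_eq_zero.1 h1
  · exact sub_eq_zero.1 h2
  · exact sub_eq_zero.1 h3
  · exact sub_eq_zero.1 h4
  · exact sub_eq_zero.1 h6

/-- The target of a separable isogeny of degree prime to the characteristic is defined over the
same separably closed field as the source. -/
theorem j_mem_range_of_nsmul_ker_eq_zero (p : ℕ) [Fact p.Prime] [CharP F p]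
    {W₂ : WeierstrassCurve F} [W₂.IsElliptic] {α : W₂.FnField →ₐ[F] (W.baseChange F).FnField}
    (h0 : redAt (ptOf α) 0 = 0)
    (hα : ∀ f ∈ fixedBy (redHom p (ptOf α) h0).ker, f ∈ α.fieldRange) {m : ℕ} (hm : ¬ p ∣ m)
    (hker : ∀ T, redAt (ptOf α) T = 0 → m • T = 0) : W₂.j ∈ (algebraMap M F).range := by
  have hfin := finite_ker_redHom p h0
  set S : Finset (W.baseChange F).toAffine.Point :=
    (Set.toFinite ((redHom p (ptOf α) h0).ker : Set _)).toFinset with hSdef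
  have hS : ∀ T, T ∈ S ↔ redAt (ptOf α) T = 0 := fun T => by
    rw [hSdef, Set.Finite.mem_toFinset]
    rfl
  have hmF : (m : F) ≠ 0 := by rwa [Ne, CharP.cast_eq_zero_iff F p]
  obtain ⟨C, hC⟩ := exists_equation_sum p h0 hS hα
  obtain ⟨V₀, hV₀⟩ := exists_eq_map_of_equation p ((hS 0).2 h0)
    (fun T hT => mem_ptIn_bot_of_nsmul_eq_zero hmF (hker T ((hS T).1 hT))) hC
  rw [← variableChange_j (W := W₂) C]
  clear hC
  suffices key : ∀ (V : WeierstrassCurve F) [V.IsElliptic], V = V₀.map (algebraMap M F) →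
      V.j ∈ (algebraMap M F).range from key _ hV₀
  rintro V hV rfl
  have hell : V₀.IsElliptic := by
    have h1 := hV.isUnit
    rw [map_Δ] at h1
    exact ⟨(isUnit_map_iff (algebraMap M F) _).1 h1⟩
  exact ⟨V₀.j, (V₀.map_j (algebraMap M F)).symm⟩

end RationalPoints

end WeierstrassCurve

/-! ### Separable isogenies of degree prime to the characteristic -/

namespace WeierstrassCurve

open scoped Classical

section InseparableDegree

open IntermediateField

lemma finInsepDegree_eq_of_surjective (E E' N : Type*) [Field E] [Field E'] [Field N] [Algebra E E']
    [Algebra E' N] [Algebra E N] [IsScalarTower E E' N]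
    (h : Function.Surjective (algebraMap E E')) :
    Field.finInsepDegree E N = Field.finInsepDegree E' N := by
  have hsep : Algebra.IsSeparable E E' := ⟨fun z => by
    obtain ⟨c, rfl⟩ := h z
    exact isSeparable_algebraMap c⟩
  rw [← Field.finInsepDegree_mul_finInsepDegree_of_isAlgebraic E E' N,
    Algebra.IsSeparable.finInsepDegree_eq, one_mul]

/-- The inseparable degree is multiplicative in compositions. -/
lemma finInsepDegree_fieldRange_comp {F N₁ N₂ N₃ : Type*} [Field F] [Field N₁] [Field N₂] [Field N₃]
    [Algebra F N₁] [Algebra F N₂] [Algebra F N₃] (f : N₁ →ₐ[F] N₂) (g : N₂ →ₐ[F] N₃)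
    [Algebra.IsAlgebraic f.fieldRange N₂] :
    Field.finInsepDegree (g.comp f).fieldRange N₃ =
      Field.finInsepDegree f.fieldRange N₂ * Field.finInsepDegree g.fieldRange N₃ := by
  let : Algebra N₂ N₃ := g.toRingHom.toAlgebra
  have h1 : Field.finInsepDegree N₂ N₃ = Field.finInsepDegree g.fieldRange N₃ := by
    let : Algebra N₂ g.fieldRange := g.rangeRestrict.toRingHom.toAlgebra
    have : IsScalarTower N₂ g.fieldRange N₃ := IsScalarTower.of_algebraMap_eq fun _ => rfl
    exact finInsepDegree_eq_of_surjective _ _ _ g.rangeRestrict_surjective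
  have h2 : Field.finInsepDegree f.fieldRange N₃ =
      Field.finInsepDegree (g.comp f).fieldRange N₃ := by
    let i : f.fieldRange →+* (g.comp f).fieldRange :=
      { toFun := fun z => ⟨g z, by obtain ⟨_, w, rfl⟩ := z; exact ⟨w, rfl⟩⟩
        map_one' := Subtype.ext (map_one g)
        map_zero' := Subtype.ext (map_zero g)
        map_mul' := fun a b => Subtype.ext (map_mul g _ _)
        map_add' := fun a b => Subtype.ext (map_add g _ _) }
    let : Algebra f.fieldRange (g.comp f).fieldRange := i.toAlgebra
    have : IsScalarTower f.fieldRange (g.comp f).fieldRange N₃ :=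
      IsScalarTower.of_algebraMap_eq fun _ => rfl
    refine finInsepDegree_eq_of_surjective _ _ _ ?_
    rintro ⟨_, w, rfl⟩
    exact ⟨⟨f w, w, rfl⟩, rfl⟩
  rw [← h2, ← h1, Field.finInsepDegree_mul_finInsepDegree_of_isAlgebraic]

lemma finInsepDegree_fieldRange_of_surjective {F N₁ N₂ : Type*} [Field F] [Field N₁] [Field N₂]
    [Algebra F N₁] [Algebra F N₂] {f : N₁ →ₐ[F] N₂} (hf : Function.Surjective f) :
    Field.finInsepDegree f.fieldRange N₂ = 1 := by
  have : Algebra.IsSeparable f.fieldRange N₂ := ⟨fun z => by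
    obtain ⟨w, rfl⟩ := hf z
    exact isSeparable_algebraMap (⟨f w, w, rfl⟩ : f.fieldRange)⟩
  exact Algebra.IsSeparable.finInsepDegree_eq _ _

end InseparableDegree

section ChangeOfVariables

variable {F : Type*} [Field F] [IsAlgClosed F] {W W₂ : WeierstrassCurve F} [W.IsElliptic]
  [W₂.IsElliptic]

/-- A change of variables, as an isomorphism of function fields that fixes the origin. -/
lemma exists_algHom_of_variableChange (C : VariableChange F) (hC : W₂ = C • W) :
    ∃ ε : W₂.FnField →ₐ[F] W.FnField, Function.Surjective ε ∧ redAt (ptOf ε) 0 = 0 := by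
  set u : F := C.u⁻¹.val with hu
  have hu0 : u ≠ 0 := C.u⁻¹.ne_zero
  set x : W.FnField := algebraMap F _ (u ^ 2) * (W.genX - algebraMap F _ C.r) with hx
  set y : W.FnField := algebraMap F _ (u ^ 3) *
    (W.genY - algebraMap F _ C.s * (W.genX - algebraMap F _ C.r) - algebraMap F _ C.t) with hy
  have he := W.genericPoint_equation
  have h : (W₂.baseChange W.FnField).toAffine.Equation x y := by
    rw [Affine.equation_iff]
    change y ^ 2 + algebraMap F _ W₂.a₁ * x * y + algebraMap F _ W₂.a₃ * y =
      x ^ 3 + algebraMap F _ W₂.a₂ * x ^ 2 + algebraMap F _ W₂.a₄ * x + algebraMap F _ W₂.a₆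
    simp only [hC, variableChange_a₁, variableChange_a₂, variableChange_a₃, variableChange_a₄,
      variableChange_a₆, ← hu, hx, hy, _root_.map_add, _root_.map_mul,
      _root_.map_sub, map_pow, map_ofNat]
    linear_combination algebraMap F W.FnField u ^ 6 * he
  have hgx : W.genX = algebraMap F _ (u ^ 2)⁻¹ * x + algebraMap F _ C.r := by
    rw [hx, ← mul_assoc, ← _root_.map_mul, inv_mul_cancel₀ (pow_ne_zero 2 hu0)]
    simp
  have hgy : W.genY = algebraMap F _ (u ^ 3)⁻¹ * y +
      algebraMap F _ C.s * (W.genX - algebraMap F _ C.r) + algebraMap F _ C.t := by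
    rw [hy, ← mul_assoc, ← _root_.map_mul, inv_mul_cancel₀ (pow_ne_zero 3 hu0)]
    simp only [_root_.map_one, one_mul]
    ring
  have hxt : Transcendental F x := by
    intro hxa
    apply W.transcendental_genX
    rw [hgx]
    exact ((isAlgebraic_algebraMap _).mul hxa).add (isAlgebraic_algebraMap _)
  obtain ⟨ε, hεx, hεy⟩ := exists_algHom_gen h hxt
  refine ⟨ε, ?_, ?_⟩
  · have htop : ε.fieldRange = ⊤ := by
      rw [eq_top_iff, ← adjoin_genX_genY, IntermediateField.adjoin_le_iff]
      have h1 : W.genX ∈ ε.fieldRange := by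
        rw [hgx]
        exact add_mem (mul_mem (IntermediateField.algebraMap_mem _ _) ⟨_, hεx⟩)
          (IntermediateField.algebraMap_mem _ _)
      rintro z (rfl | rfl)
      · exact h1
      · rw [hgy]
        exact add_mem (add_mem (mul_mem (IntermediateField.algebraMap_mem _ _) ⟨_, hεy⟩)
          (mul_mem (IntermediateField.algebraMap_mem _ _) (sub_mem h1
            (IntermediateField.algebraMap_mem _ _)))) (IntermediateField.algebraMap_mem _ _)
    exact AlgHom.fieldRange_eq_top.1 htop
  · obtain ⟨A, hA, hR⟩ := exists_place (W := W) 0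
    rw [redAt_eq_iff hA hR]
    obtain ⟨h', e⟩ := ptOf_eq ε
    rw [e]
    change ε W₂.genX ∉ A
    rw [hεx]
    intro hxA
    have hgX : W.genX ∉ A := hR
    apply hgX
    rw [hgx]
    exact add_mem (mul_mem (hA.algebraMap_mem _) hxA) (hA.algebraMap_mem _)

end ChangeOfVariables

section Transfer

variable {F : Type*} [Field F] [IsAlgClosed F] {W₁ W₂ W₃ : WeierstrassCurve F} [W₁.IsElliptic]
  [W₂.IsElliptic] [W₃.IsElliptic]

/-- The subfield of a separable isogeny consists of all functions invariant under the kernel. -/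
lemma mem_fieldRange_of_finInsepDegree_eq_one (p : ℕ) [Fact p.Prime] [CharP F p]
    {α : W₂.FnField →ₐ[F] W₁.FnField} (h0 : redAt (ptOf α) 0 = 0)
    (hα : Field.finInsepDegree α.fieldRange W₁.FnField = 1) :
    ∀ f ∈ fixedBy (redHom p (ptOf α) h0).ker, f ∈ α.fieldRange := by
  obtain ⟨a, ha, h⟩ := exists_mem_fieldRange_iff p h0
  rw [hα, eq_comm, Nat.pow_eq_one] at ha
  obtain rfl := ha.resolve_left (Fact.out : p.Prime).one_lt.ne'
  exact fun f hf => (h f).2 ⟨f, hf, by simp⟩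

lemma redAt_ptOf_comp (α : W₂.FnField →ₐ[F] W₁.FnField) (β : W₃.FnField →ₐ[F] W₂.FnField)
    (Q : W₁.toAffine.Point) :
    redAt (ptOf (α.comp β)) Q = redAt (ptOf β) (redAt (ptOf α) Q) := by
  rw [ptOf_comp, redAt_mapPt]

/-- The target of a separable isogeny of degree prime to the characteristic is defined over the
same separably closed field as the source, up to isomorphism. -/
theorem j_mem_range_of_separable (p : ℕ) [Fact p.Prime] [CharP F p] {M : Type*} [Field M]
    [Algebra M F] [IsPurelyInseparable M F] {α : W₂.FnField →ₐ[F] W₁.FnField}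
    (h0 : redAt (ptOf α) 0 = 0) (hα : Field.finInsepDegree α.fieldRange W₁.FnField = 1)
    {m : ℕ} (hm : ¬ p ∣ m) (hker : ∀ T, redAt (ptOf α) T = 0 → m • T = 0)
    (hj : W₁.j ∈ (algebraMap M F).range) : W₂.j ∈ (algebraMap M F).range := by
  obtain ⟨j, hj⟩ := hj
  have hell : ((ofJ j).baseChange F).IsElliptic :=
    inferInstanceAs ((ofJ j).map (algebraMap M F)).IsElliptic
  -- replace the source by a curve that is defined over `M`
  obtain ⟨C, hC⟩ : ∃ C : VariableChange F, C • ((ofJ j).baseChange F) = W₁ := by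
    refine exists_variableChange_of_j_eq _ _ ?_
    rw [← hj]
    exact ((ofJ j).map_j (algebraMap M F)).trans (by rw [ofJ_j])
  obtain ⟨ε, hε, hε0⟩ := exists_algHom_of_variableChange C hC.symm
  have h0' : redAt (ptOf (ε.comp α)) 0 = 0 := by rw [redAt_ptOf_comp, hε0, h0]
  refine j_mem_range_of_nsmul_ker_eq_zero p h0'
    (mem_fieldRange_of_finInsepDegree_eq_one p h0' ?_) hm fun T hT => ?_
  · have := finiteDimensional_fieldRange α
    rw [finInsepDegree_fieldRange_comp, hα, one_mul, finInsepDegree_fieldRange_of_surjective hε]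
  · rw [redAt_ptOf_comp] at hT
    have h1 := hker _ hT
    have h2 : redAt (ptOf ε) (m • T) = 0 := by
      rw [← redHom_apply p hε0, map_nsmul, redHom_apply, h1]
    apply translHom_injective
    rw [translHom_zero]
    refine AlgHom.ext fun f => ?_
    obtain ⟨g, rfl⟩ := hε f
    exact DFunLike.congr_fun (translHom_comp_of_mem_ker p hε0 h2) g

end Transfer

end WeierstrassCurve

/-! ### Conjugates by the Frobenius automorphism -/

namespace WeierstrassCurve

open scoped Classical

section Twist

open IntermediateField

variable {F : Type*} [Field F] [IsAlgClosed F] {p : ℕ} [Fact p.Prime] [CharP F p]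

variable (F p) in
/-- The inverse of the `n`-th power of the Frobenius automorphism. -/
noncomputable def frobRoot (n : ℕ) : F →+* F :=
  have : ExpChar F p := .prime Fact.out
  ((iterateFrobeniusEquiv F p n).symm : F →+* F)

lemma frobRoot_pow (n : ℕ) (c : F) : frobRoot F p n c ^ p ^ n = c := by
  have : ExpChar F p := .prime Fact.out
  exact (iterateFrobeniusEquiv F p n).apply_symm_apply c

variable (p) in
lemma pow_injective_of_charP {N : Type*} [Field N] [CharP N p] (n : ℕ) :
    Function.Injective fun f : N => f ^ p ^ n := by
  have : ExpChar N p := .prime Fact.out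
  exact iterateFrobenius_inj N p n

variable (W W₂ : WeierstrassCurve F)

variable (p) in
/-- The conjugate of a curve by the inverse of the `n`-th power of the Frobenius automorphism. -/
noncomputable def rootTwist (n : ℕ) : WeierstrassCurve F := W.map (frobRoot F p n)

instance [W.IsElliptic] (n : ℕ) : (W.rootTwist p n).IsElliptic :=
  inferInstanceAs (W.map (frobRoot F p n)).IsElliptic

lemma rootTwist_j [W.IsElliptic] (n : ℕ) : (W.rootTwist p n).j = frobRoot F p n W.j :=
  W.map_j (frobRoot F p n)

variable {W W₂} {N : Type*} [Field N] [Algebra F N]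

/-- If the image of an embedding of the function field consists of `p ^ n`-th powers, then the roots
form the image of the function field of a conjugate curve. -/
lemma exists_algHom_rootTwist [W₂.IsElliptic] {α : W₂.FnField →ₐ[F] N} {n : ℕ}
    (h : α.fieldRange ≤ frobField F N p n) :
    ∃ γ : (W₂.rootTwist p n).FnField →ₐ[F] N,
      γ (W₂.rootTwist p n).genX ^ p ^ n = α W₂.genX ∧
      ∀ f, f ∈ γ.fieldRange ↔ f ^ p ^ n ∈ α.fieldRange := by
  have := charP_of_injective_algebraMap (algebraMap F N).injective p
  have : ExpChar N p := .prime Fact.out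
  have hinj := pow_injective_of_charP p (N := N) n
  obtain ⟨x, hx⟩ : ∃ x, x ^ p ^ n = α W₂.genX := h ⟨_, rfl⟩
  obtain ⟨y, hy⟩ : ∃ y, y ^ p ^ n = α W₂.genY := h ⟨_, rfl⟩
  have he : (((W₂.rootTwist p n).baseChange N).toAffine.Equation x y) := by
    rw [Affine.equation_iff]
    apply hinj
    have h1 := congrArg α W₂.genericPoint_equation
    simp only [_root_.map_add, _root_.map_mul, map_pow, AlgHom.commutes] at h1
    have hc : ∀ c : F, algebraMap F N (frobRoot F p n c) ^ p ^ n = algebraMap F N c := fun c => by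
      rw [← map_pow, frobRoot_pow]
    simp only [← iterateFrobenius_def] at hx hy hc ⊢
    simp only [_root_.map_add, _root_.map_mul, map_pow, hx, hy]
    change _ ^ 2 + iterateFrobenius N p n (algebraMap F N (frobRoot F p n _)) * _ * _ +
      iterateFrobenius N p n (algebraMap F N (frobRoot F p n _)) * _ = _ ^ 3 +
      iterateFrobenius N p n (algebraMap F N (frobRoot F p n _)) * _ ^ 2 +
      iterateFrobenius N p n (algebraMap F N (frobRoot F p n _)) * _ +
      iterateFrobenius N p n (algebraMap F N (frobRoot F p n _))
    simp only [hc]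
    exact h1
  have hxt : Transcendental F x := fun hxa =>
    transcendental_algHom α (hx ▸ hxa.pow _)
  obtain ⟨γ, hγx, hγy⟩ := exists_algHom_gen he hxt
  refine ⟨γ, by rw [hγx, hx], ?_⟩
  have hfx : γ.fieldRange = IntermediateField.adjoin F {x, y} := by
    rw [AlgHom.fieldRange_eq_map, ← adjoin_genX_genY, adjoin_map, Set.image_pair, hγx, hγy]
  have hfα : α.fieldRange = IntermediateField.adjoin F {α W₂.genX, α W₂.genY} := by
    rw [AlgHom.fieldRange_eq_map, ← adjoin_genX_genY, adjoin_map, Set.image_pair]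
  intro f
  constructor
  · intro hf
    rw [hfx] at hf
    induction hf using IntermediateField.adjoin_induction with
    | mem z hz =>
      rcases hz with rfl | rfl
      · exact ⟨_, hx.symm⟩
      · exact ⟨_, hy.symm⟩
    | algebraMap c => rw [← map_pow]; exact IntermediateField.algebraMap_mem _ _
    | add u v _ _ hu hv => rw [add_pow_expChar_pow]; exact add_mem hu hv
    | mul u v _ _ hu hv => rw [mul_pow]; exact mul_mem hu hv
    | inv u _ hu => rw [inv_pow]; exact inv_mem hu
  · intro hf
    suffices key : ∀ z ∈ α.fieldRange, ∃ w ∈ γ.fieldRange, w ^ p ^ n = z by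
      obtain ⟨w, hw, hwf⟩ := key _ hf
      exact hinj hwf ▸ hw
    intro z hz
    rw [hfα] at hz
    induction hz using IntermediateField.adjoin_induction with
    | mem z hz =>
      rcases hz with rfl | rfl
      · exact ⟨x, ⟨_, hγx⟩, hx⟩
      · exact ⟨y, ⟨_, hγy⟩, hy⟩
    | algebraMap c =>
      exact ⟨_, IntermediateField.algebraMap_mem _ (frobRoot F p n c), by
        rw [← map_pow, frobRoot_pow]⟩
    | add u v _ _ hu hv =>
      obtain ⟨a, ha, rfl⟩ := hu
      obtain ⟨b, hb, rfl⟩ := hv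
      exact ⟨a + b, add_mem ha hb, add_pow_expChar_pow _ _ _ _⟩
    | mul u v _ _ hu hv =>
      obtain ⟨a, ha, rfl⟩ := hu
      obtain ⟨b, hb, rfl⟩ := hv
      exact ⟨a * b, mul_mem ha hb, mul_pow _ _ _⟩
    | inv u _ hu =>
      obtain ⟨a, ha, rfl⟩ := hu
      exact ⟨a⁻¹, inv_mem ha, inv_pow _ _⟩

/-- The conjugate curve is the target of an isogeny with the same kernel, whose image is the fixed
field of the kernel. -/
lemma exists_algHom_fixedBy_ker [W.IsElliptic] [W₂.IsElliptic] {α : W₂.FnField →ₐ[F] W.FnField}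
    (h0 : redAt (ptOf α) 0 = 0) {a : ℕ}
    (ha : ∀ f, f ∈ α.fieldRange ↔ ∃ g ∈ fixedBy (redHom p (ptOf α) h0).ker, g ^ p ^ a = f) :
    ∃ γ : (W₂.rootTwist p a).FnField →ₐ[F] W.FnField,
      (∀ Q, redAt (ptOf γ) Q = 0 ↔ redAt (ptOf α) Q = 0) ∧
      γ.fieldRange = fixedBy (redHom p (ptOf α) h0).ker := by
  have := charP_of_injective_algebraMap (algebraMap F W.FnField).injective p
  obtain ⟨γ, hx, h⟩ := exists_algHom_rootTwist (p := p) (α := α) (n := a) fun f hf => by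
    obtain ⟨g, -, hg⟩ := (ha f).1 hf
    exact ⟨g, hg⟩
  refine ⟨γ, fun Q => ?_, ?_⟩
  · obtain ⟨A, hA, hR⟩ := exists_place Q
    rw [redAt_eq_iff hA hR, redAt_eq_iff hA hR]
    obtain ⟨h1, e1⟩ := ptOf_eq γ
    obtain ⟨h2, e2⟩ := ptOf_eq α
    rw [e1, e2]
    change γ (W₂.rootTwist p a).genX ∉ A ↔ α W₂.genX ∉ A
    rw [← hx, not_iff_not]
    refine ⟨fun h => pow_mem h _, fun h => ?_⟩
    rw [← A.valuation_le_one_iff, map_pow] at h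
    rw [← A.valuation_le_one_iff]
    exact (pow_le_one_iff (pow_ne_zero _ (Fact.out : p.Prime).ne_zero)).1 h
  · ext f
    rw [h, ha]
    constructor
    · rintro ⟨g, hg, e⟩
      exact pow_injective_of_charP p a e ▸ hg
    · exact fun hf => ⟨f, hf, rfl⟩

end Twist

end WeierstrassCurve

/-! ### Torsion points of nonisotrivial curves -/

namespace WeierstrassCurve

open scoped Classical

section Torsion

open IntermediateField

lemma card_ker_comp {A B C : Type*} [AddCommGroup A] [AddCommGroup B] [AddCommGroup C] (g : B →+ C)
    {f : A →+ B} (hf : Function.Surjective f) :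
    Nat.card (g.comp f).ker = Nat.card f.ker * Nat.card g.ker := by
  let f' : (g.comp f).ker →+ B := f.comp (g.comp f).ker.subtype
  have h1 : f'.range = g.ker := by
    ext R
    constructor
    · rintro ⟨Q, rfl⟩
      exact Q.2
    · intro hR
      obtain ⟨Q, rfl⟩ := hf R
      exact ⟨⟨Q, hR⟩, rfl⟩
  have h2 : Nat.card f'.ker = Nat.card f.ker := by
    refine Nat.card_congr ⟨fun Q => ⟨Q.1.1, Q.2⟩, fun Q => ⟨⟨Q.1, ?_⟩, Q.2⟩, fun _ => rfl,
      fun _ => rfl⟩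
    change g (f Q) = 0
    rw [show f Q = 0 from Q.2, map_zero]
  rw [← f'.ker.card_mul_index, AddSubgroup.index_ker, h1, h2]

/-- A field over which a function field is separable does not consist of `p`-th powers. -/
lemma IsCurveField.not_le_frobField_one {F N : Type*} [Field F] [Field N] [Algebra F N] {p : ℕ}
    [Fact p.Prime] [CharP F p] [PerfectField F] (h : IsCurveField F N) (S : IntermediateField F N)
    [Algebra.IsSeparable S N] : ¬ S ≤ frobField F N p 1 := by
  intro hle
  have h1 := isPurelyInseparable_frobField (F := F) (N := N) (p := p) 1
  let : Algebra S (frobField F N p 1) := (IntermediateField.inclusion hle).toRingHom.toAlgebra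
  have : IsScalarTower S (frobField F N p 1) N := IsScalarTower.of_algebraMap_eq fun _ => rfl
  have h2 : Algebra.IsSeparable (frobField F N p 1) N :=
    Algebra.isSeparable_tower_top_of_isSeparable S _ N
  have h3 := IsPurelyInseparable.surjective_algebraMap_of_isSeparable (frobField F N p 1) N
  have h4 : frobField F N p 1 = ⊤ := by
    rw [eq_top_iff]
    intro z _
    obtain ⟨w, rfl⟩ := h3 z
    exact w.2
  have h5 := (h.finrank_frobField (p := p) 1).2
  rw [h4, pow_one, IntermediateField.finrank_top] at h5
  exact (Fact.out : p.Prime).one_lt.ne h5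

variable {F : Type*} [Field F] [IsAlgClosed F] {W : WeierstrassCurve F} [W.IsElliptic]

variable (W) in
/-- The points whose order divides `n`. -/
noncomputable def torsion (n : ℕ) : AddSubgroup W.toAffine.Point :=
  (nsmulAddMonoidHom n).ker

lemma mem_torsion {n : ℕ} {Q : W.toAffine.Point} : Q ∈ W.torsion n ↔ n • Q = 0 := Iff.rfl

variable {n : ℕ} {β : W.FnField →ₐ[F] W.FnField}

lemma redAt_of_ptOf_eq_nsmul (hβ : ptOf β = n • W.genericPoint) (Q : W.toAffine.Point) :
    redAt (ptOf β) Q = n • Q := by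
  rw [hβ, redAt_nsmul, redAt_genericPoint]

lemma redAt_zero_of_ptOf_eq_nsmul (hβ : ptOf β = n • W.genericPoint) :
    redAt (ptOf β) 0 = 0 := by
  rw [redAt_of_ptOf_eq_nsmul hβ, smul_zero]

variable (p : ℕ) [Fact p.Prime] [CharP F p]

lemma ker_redHom_of_ptOf_eq_nsmul (hβ : ptOf β = n • W.genericPoint) (h0 : redAt (ptOf β) 0 = 0) :
    (redHom p (ptOf β) h0).ker = W.torsion n := by
  ext Q
  rw [mem_ker_redHom, mem_torsion, redAt_of_ptOf_eq_nsmul hβ]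

lemma nsmul_surjective (p : ℕ) [Fact p.Prime] [CharP F p] (hn : n ≠ 0) :
    Function.Surjective fun Q : W.toAffine.Point => n • Q := by
  obtain ⟨β, hβ, -⟩ := exists_ptOf_eq_nsmul (W := W) p hn
  intro R
  obtain ⟨Q, hQ⟩ := redAt_surjective β R
  exact ⟨Q, by rw [← hQ, redAt_of_ptOf_eq_nsmul hβ]⟩

lemma finite_torsion (p : ℕ) [Fact p.Prime] [CharP F p] (hn : n ≠ 0) : Finite (W.torsion n) := by
  obtain ⟨β, hβ, h0⟩ := exists_ptOf_eq_nsmul (W := W) p hn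
  rw [← ker_redHom_of_ptOf_eq_nsmul p hβ h0]
  exact finite_ker_redHom p h0

lemma card_torsion_mul (p : ℕ) [Fact p.Prime] [CharP F p] (m : ℕ) (hn : n ≠ 0) :
    Nat.card (W.torsion (m * n)) = Nat.card (W.torsion m) * Nat.card (W.torsion n) := by
  have h : ((nsmulAddMonoidHom m).comp (nsmulAddMonoidHom n) :
      W.toAffine.Point →+ W.toAffine.Point).ker = W.torsion (m * n) := by
    ext Q
    rw [mem_torsion, mul_smul]
    rfl
  rw [← h, card_ker_comp _ (nsmul_surjective p hn), mul_comm]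
  rfl

lemma fieldRange_le_frobField (p : ℕ) [Fact p.Prime] [CharP F p]
    (hβ : ptOf β = n • W.genericPoint) {s : ℕ} (hs : p ^ s ∣ n) :
    β.fieldRange ≤ frobField F W.FnField p s := by
  obtain ⟨m, rfl⟩ := hs
  have h1 := (isCurveField_fnField W).nsmul_mem_ptIn_frobField (p := p) s (m • W.genericPoint)
  obtain ⟨h, e⟩ := ptOf_eq β
  rw [← mul_smul, ← hβ, e, some_mem_ptIn] at h1
  rw [AlgHom.fieldRange_eq_map, ← adjoin_genX_genY, adjoin_map, Set.image_pair,
    IntermediateField.adjoin_le_iff]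
  rintro z (rfl | rfl)
  · exact h1.1
  · exact h1.2

variable {a : ℕ}

/-- The inseparable degree of the multiplication by `n` is at least the `p`-part of `n`. -/
lemma le_of_finInsepDegree_eq {p : ℕ} [Fact p.Prime] [CharP F p]
    (hβ : ptOf β = n • W.genericPoint) {s : ℕ} (hs : p ^ s ∣ n)
    (ha : Field.finInsepDegree β.fieldRange W.FnField = p ^ a) : s ≤ a := by
  have h0 := redAt_zero_of_ptOf_eq_nsmul hβ
  have := charP_of_injective_algebraMap (algebraMap F W.FnField).injective p
  obtain ⟨a', ha', h⟩ := exists_mem_fieldRange_iff p h0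
  obtain rfl : a = a' := Nat.pow_right_injective (Fact.out : p.Prime).two_le (ha.symm.trans ha')
  by_contra! hlt
  have hsep := isSeparable_fixedBy_ker p h0
  refine (isCurveField_fnField W).not_le_frobField_one (p := p)
    (fixedBy (redHom p (ptOf β) h0).ker) fun g hg => ?_
  obtain ⟨k, hk⟩ := fieldRange_le_frobField p hβ hs ((h _).2 ⟨g, hg, rfl⟩)
  refine ⟨k ^ p ^ (s - a - 1), ?_⟩
  apply pow_injective_of_charP p a
  change (_ ^ _) ^ _ = g ^ p ^ a
  rw [← hk, ← pow_mul, ← pow_mul, ← pow_add, ← pow_add]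
  congr 2
  omega

lemma finInsepDegree_eq_one_of_not_dvd {p : ℕ} [Fact p.Prime] [CharP F p]
    (hβ : ptOf β = n • W.genericPoint) (hn : ¬ p ∣ n) :
    Field.finInsepDegree β.fieldRange W.FnField = 1 := by
  have h0 := redAt_zero_of_ptOf_eq_nsmul hβ
  obtain ⟨a, ha, h⟩ := exists_mem_fieldRange_iff p h0
  rw [ha]
  rcases a with _ | a
  · rfl
  exfalso
  apply nsmul_genericPoint_notMem_ptIn (W := W) p hn
  obtain ⟨h', e⟩ := ptOf_eq β
  rw [← hβ, e, some_mem_ptIn]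
  have hle : β.fieldRange ≤ frobField F W.FnField p 1 := by
    intro f hf
    obtain ⟨g, -, rfl⟩ := (h f).1 hf
    exact frobField_le (Nat.succ_le_succ (Nat.zero_le a)) ⟨g, rfl⟩
  exact ⟨hle ⟨_, rfl⟩, hle ⟨_, rfl⟩⟩

/-- The degree bound for the multiplication by `n`, in terms of separable and inseparable degree. -/
lemma card_torsion_mul_finInsepDegree_le (p : ℕ) [Fact p.Prime] [CharP F p] (hn : n ≠ 0)
    (hβ : ptOf β = n • W.genericPoint) :
    Nat.card (W.torsion n) * Field.finInsepDegree β.fieldRange W.FnField ≤ n ^ 2 := by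
  have h0 := redAt_zero_of_ptOf_eq_nsmul hβ
  rw [← ker_redHom_of_ptOf_eq_nsmul p hβ h0, ← finSepDegree_eq_card_ker p h0,
    Field.finSepDegree_mul_finInsepDegree]
  exact finrank_fieldRange_le_of_ptOf_eq_nsmul p hn hβ

end Torsion

section Ordinary

variable {F : Type*} [Field F] [IsAlgClosed F] {W : WeierstrassCurve F} [W.IsElliptic]
variable {p : ℕ} [Fact p.Prime] [CharP F p]

/-- A curve that is not defined over a finite field has nonzero points of order `p`: otherwise, the
multiplication by `p` identifies it with a conjugate by a power of the Frobenius automorphism. -/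
theorem card_torsion_prime (hj : ∀ r, r ≠ 0 → W.j ^ p ^ r ≠ W.j) : Nat.card (W.torsion p) = p := by
  have hp0 : p ≠ 0 := (Fact.out : p.Prime).ne_zero
  have hp1 := (Fact.out : p.Prime).one_lt
  have hfin := finite_torsion (W := W) p hp0
  obtain ⟨β, hβ, h0⟩ := exists_ptOf_eq_nsmul (W := W) p hp0
  obtain ⟨a, ha, h⟩ := exists_mem_fieldRange_iff p h0
  have ha1 : 1 ≤ a := le_of_finInsepDegree_eq hβ (pow_one p).dvd ha
  have h1 := card_torsion_mul_finInsepDegree_le p hp0 hβ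
  rw [ha] at h1
  have hle : Nat.card (W.torsion p) ≤ p := by
    have h2 : Nat.card (W.torsion p) * p ≤ p * p :=
      (Nat.mul_le_mul_left _ (Nat.le_self_pow (by omega) p)).trans (h1.trans (sq p).le)
    exact Nat.le_of_mul_le_mul_right h2 (by omega)
  have hne : Nat.card (W.torsion p) ≠ 1 := by
    intro hc
    have hbot : (redHom p (ptOf β) h0).ker = ⊥ := by
      rw [ker_redHom_of_ptOf_eq_nsmul p hβ h0]
      exact AddSubgroup.card_eq_one.1 hc
    -- a trivial kernel makes the separable part of the multiplication by `p` an isomorphism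
    obtain ⟨γ, hγ, hr⟩ := exists_algHom_fixedBy_ker h0 h
    have htop : γ.fieldRange = ⊤ := by
      rw [hr, hbot, eq_top_iff]
      intro f _ Q hQ
      obtain rfl := AddSubgroup.mem_bot.1 hQ
      rw [translHom_zero]
      rfl
    have h3 := j_eq_of_surjective p ((hγ 0).2 h0) (AlgHom.fieldRange_eq_top.1 htop)
    rw [rootTwist_j] at h3
    apply hj a (by omega)
    conv_lhs => rw [← h3]
    exact frobRoot_pow a W.j
  obtain ⟨Q, hQ⟩ : ∃ Q : W.torsion p, Q ≠ 0 := by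
    by_contra! hQ
    exact hne (Nat.card_eq_one_iff_unique.2 ⟨⟨fun a b => (hQ a).trans (hQ b).symm⟩, ⟨0⟩⟩)
  have hord : addOrderOf Q = p :=
    addOrderOf_eq_prime (Subtype.ext Q.2) hQ
  have hdvd := addOrderOf_dvd_natCard Q
  rw [hord] at hdvd
  exact le_antisymm hle (Nat.le_of_dvd Nat.card_pos hdvd)

lemma card_torsion_pow (hj : ∀ r, r ≠ 0 → W.j ^ p ^ r ≠ W.j) (n : ℕ) :
    Nat.card (W.torsion (p ^ n)) = p ^ n := by
  induction n with
  | zero =>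
    rw [pow_zero, Nat.card_eq_one_iff_unique]
    refine ⟨⟨fun a b => Subtype.ext ?_⟩, ⟨0⟩⟩
    have h : ∀ c : W.torsion 1, (c : W.toAffine.Point) = 0 := fun c => by
      have := c.2
      rwa [mem_torsion, one_smul] at this
    rw [h a, h b]
  | succ n ih =>
    rw [pow_succ, card_torsion_mul p _ (Fact.out : p.Prime).ne_zero, ih, card_torsion_prime hj]

lemma not_dvd_card_torsion {m : ℕ} (hm : ¬ p ∣ m) : ¬ p ∣ Nat.card (W.torsion m) := by
  have hm0 : m ≠ 0 := by rintro rfl; exact hm (dvd_zero p)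
  have hfin := finite_torsion (W := W) p hm0
  intro h
  obtain ⟨Q, hQ⟩ := exists_prime_addOrderOf_dvd_card' p h
  apply hm
  rw [← hQ]
  exact addOrderOf_dvd_of_nsmul_eq_zero (Subtype.ext Q.2)

/-- For a curve with points of order `p`, the inseparable degree of the multiplication by `n` is the
`p`-part of `n`. -/
lemma finInsepDegree_nsmul (hj : ∀ r, r ≠ 0 → W.j ^ p ^ r ≠ W.j) {s m : ℕ} (hm : ¬ p ∣ m)
    {β : W.FnField →ₐ[F] W.FnField} (hβ : ptOf β = (p ^ s * m) • W.genericPoint) :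
    Field.finInsepDegree β.fieldRange W.FnField = p ^ s := by
  have hp1 := (Fact.out : p.Prime).one_lt
  have hs0 : p ^ s ≠ 0 := pow_ne_zero _ (Fact.out : p.Prime).ne_zero
  have hm0 : m ≠ 0 := by rintro rfl; exact hm (dvd_zero p)
  obtain ⟨β₁, h1, h10⟩ := exists_ptOf_eq_nsmul (W := W) p hs0
  obtain ⟨β₂, h2, h20⟩ := exists_ptOf_eq_nsmul (W := W) p hm0
  obtain rfl : β = β₁.comp β₂ := by
    apply ptOf_injective
    rw [ptOf_comp, h2, map_nsmul, mapPt_genericPoint, h1, hβ, ← mul_smul, mul_comm]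
  have := finiteDimensional_fieldRange β₂
  rw [finInsepDegree_fieldRange_comp, finInsepDegree_eq_one_of_not_dvd h2 hm, one_mul]
  obtain ⟨a, ha, -⟩ := exists_mem_fieldRange_iff p h10
  have h3 := card_torsion_mul_finInsepDegree_le p hs0 h1
  rw [card_torsion_pow hj, ha, sq] at h3
  rw [ha, le_antisymm ((Nat.pow_le_pow_iff_right hp1).1
    (Nat.le_of_mul_le_mul_left h3 (Nat.pos_of_ne_zero hs0)))
    (le_of_finInsepDegree_eq h1 dvd_rfl ha)]

end Ordinary

end WeierstrassCurve

/-! ### Isogenies between conjugates -/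

namespace WeierstrassCurve

open scoped Classical

section Transfer

open IntermediateField

lemma exists_algHom_comp_eq {F N₁ N₂ N₃ : Type*} [Field F] [Field N₁] [Field N₂] [Field N₃]
    [Algebra F N₁] [Algebra F N₂] [Algebra F N₃] {f : N₁ →ₐ[F] N₃} {g : N₂ →ₐ[F] N₃}
    (h : f.fieldRange ≤ g.fieldRange) : ∃ ψ : N₁ →ₐ[F] N₂, g.comp ψ = f := by
  let e : g.fieldRange ≃ₐ[F] N₂ := (AlgEquiv.ofInjectiveField g).symm
  refine ⟨(e.toAlgHom.comp (IntermediateField.inclusion h)).comp f.rangeRestrict,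
    AlgHom.ext fun z => ?_⟩
  exact congrArg Subtype.val ((AlgEquiv.ofInjectiveField g).apply_symm_apply
    (IntermediateField.inclusion h (f.rangeRestrict z)))

variable {F : Type*} [Field F] [IsAlgClosed F] {W₁ W₂ : WeierstrassCurve F} [W₁.IsElliptic]
  [W₂.IsElliptic] {p : ℕ} [Fact p.Prime] [CharP F p]

/-- A finite group of points contains all points of order `p ^ b`, if `p ^ b` is the `p`-part of
its order: the points of `p`-power order form a chain. -/
lemma torsion_le_of_card_eq (hj : ∀ r, r ≠ 0 → W₁.j ^ p ^ r ≠ W₁.j)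
    {G : AddSubgroup W₁.toAffine.Point} {b m : ℕ} (hm : ¬ p ∣ m) (hG : Nat.card G = p ^ b * m) :
    W₁.torsion (p ^ b) ≤ G := by
  have hp := (Fact.out : p.Prime)
  have hm0 : m ≠ 0 := by rintro rfl; exact hm (dvd_zero p)
  have hle : G ≤ W₁.torsion (p ^ b * m) := by
    intro T hT
    rw [mem_torsion, ← hG]
    exact congrArg Subtype.val (card_nsmul_eq_zero' (x := (⟨T, hT⟩ : G)))
  have h1 := card_torsion_mul (W := W₁) p (p ^ b) hm0
  rw [card_torsion_pow hj] at h1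
  set H := G.addSubgroupOf (W₁.torsion (p ^ b * m)) with hH
  have h2 : Nat.card H = Nat.card G :=
    Nat.card_congr (AddSubgroup.addSubgroupOfEquivOfLe hle).toEquiv
  have h3 := H.card_mul_index
  rw [h2, hG, h1, mul_assoc] at h3
  have h4 := Nat.eq_of_mul_eq_mul_left (pow_pos hp.pos b) h3
  have h5 : ¬ p ∣ H.index := fun h => not_dvd_card_torsion (W := W₁) hm (h4 ▸ h.mul_left m)
  intro T hT
  have hT' : T ∈ W₁.torsion (p ^ b * m) := by
    rw [mem_torsion, mul_comm, mul_smul, show p ^ b • T = 0 from hT, smul_zero]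
  have h6 : H.index • T ∈ G := AddSubgroup.nsmul_index_mem H ⟨T, hT'⟩
  have hcop : IsCoprime (H.index : ℤ) ((p ^ b : ℕ) : ℤ) :=
    Nat.isCoprime_iff_coprime.2 ((hp.coprime_iff_not_dvd.2 h5).symm.pow_right b)
  obtain ⟨u, v, huv⟩ := hcop
  -- the index of the group in the torsion subgroup is prime to `p`, and multiples by it lie in the
  -- group
  have h7 : T = u • (H.index • T) + v • (p ^ b • T) := by
    rw [← natCast_zsmul, ← natCast_zsmul T (p ^ b), ← mul_smul, ← mul_smul, ← add_smul, huv,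
      one_smul]
  rw [h7, show p ^ b • T = 0 from hT, smul_zero, add_zero]
  exact zsmul_mem h6 u

/-- The conjugates of source and target of an isogeny by the Frobenius automorphism that correspond
to its inseparable degree and to the `p`-part of its separable degree are connected by a separable
isogeny of degree prime to `p`, so their `j`-invariants lie in the same separably closed fields. -/
theorem frobRoot_j_mem_range {α : W₂.FnField →ₐ[F] W₁.FnField} (h0 : redAt (ptOf α) 0 = 0)
    {a b m : ℕ} (ha : Field.finInsepDegree α.fieldRange W₁.FnField = p ^ a) (hm : ¬ p ∣ m)
    (hG : Nat.card (redHom p (ptOf α) h0).ker = p ^ b * m)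
    (hj : ∀ r, r ≠ 0 → W₁.j ^ p ^ r ≠ W₁.j) {M : Type*} [Field M] [Algebra M F]
    [IsPurelyInseparable M F] (hM : frobRoot F p b W₁.j ∈ (algebraMap M F).range) :
    frobRoot F p a W₂.j ∈ (algebraMap M F).range := by
  have hp := (Fact.out : p.Prime)
  have hpb : p ^ b ≠ 0 := pow_ne_zero _ hp.ne_zero
  obtain ⟨a', ha', h⟩ := exists_mem_fieldRange_iff p h0
  obtain rfl : a = a' := Nat.pow_right_injective hp.two_le (ha.symm.trans ha')
  -- the separable part of the given isogeny, and that of the multiplication by `p ^ b`; the former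
  -- factors through the latter, as its kernel contains all points of order `p ^ b`
  obtain ⟨γ₂, hγ₂, hr₂⟩ := exists_algHom_fixedBy_ker h0 h
  obtain ⟨β, hβ, hβ0⟩ := exists_ptOf_eq_nsmul (W := W₁) p hpb
  obtain ⟨b', hb', hb⟩ := exists_mem_fieldRange_iff p hβ0
  obtain rfl : b = b' := by
    refine Nat.pow_right_injective hp.two_le ((finInsepDegree_nsmul hj (s := b) (m := 1)
      hp.not_dvd_one ?_).symm.trans hb')
    rw [mul_one, hβ]
  obtain ⟨γ₁, hγ₁, hr₁⟩ := exists_algHom_fixedBy_ker hβ0 hb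
  rw [ker_redHom_of_ptOf_eq_nsmul p hβ hβ0] at hr₁
  have hle : γ₂.fieldRange ≤ γ₁.fieldRange := by
    rw [hr₁, hr₂]
    exact fixedBy_anti (torsion_le_of_card_eq hj hm hG)
  obtain ⟨ψ, rfl⟩ := exists_algHom_comp_eq hle
  have hγ₁0 := (hγ₁ 0).2 hβ0
  have hψ0 : redAt (ptOf ψ) 0 = 0 := by
    have h1 := (hγ₂ 0).2 h0
    rwa [redAt_ptOf_comp, hγ₁0] at h1
  have hψ : Field.finInsepDegree ψ.fieldRange (W₁.rootTwist p b).FnField = 1 := by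
    have := finiteDimensional_fieldRange ψ
    have h1 := finInsepDegree_fieldRange_comp ψ γ₁
    have h2 := isSeparable_fixedBy_ker p h0
    rw [← hr₂] at h2
    rw [Algebra.IsSeparable.finInsepDegree_eq, eq_comm, mul_eq_one] at h1
    exact h1.1
  rw [← rootTwist_j] at hM ⊢
  refine j_mem_range_of_separable p hψ0 hψ hm (fun T hT => ?_) hM
  obtain ⟨R, rfl⟩ := redAt_surjective γ₁ T
  rw [← redAt_ptOf_comp, hγ₂] at hT
  have h1 : (p ^ b * m) • R = 0 := by
    rw [← hG]
    exact congrArg Subtype.val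
      (card_nsmul_eq_zero' (x := (⟨R, hT⟩ : (redHom p (ptOf α) h0).ker)))
  rw [← redHom_apply p hγ₁0, ← map_nsmul, redHom_apply, hγ₁, redAt_of_ptOf_eq_nsmul hβ, ← mul_smul,
    h1]

end Transfer

end WeierstrassCurve

/-! ### Duality and exponents of invariants -/

namespace WeierstrassCurve

open scoped Classical

lemma eq_of_pow_mul_eq {p x y u v : ℕ} (hp : p.Prime) (hu : ¬ p ∣ u) (hv : ¬ p ∣ v)
    (h : p ^ x * u = p ^ y * v) : x = y := by
  have hu0 : u ≠ 0 := by rintro rfl; exact hu (dvd_zero p)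
  have hv0 : v ≠ 0 := by rintro rfl; exact hv (dvd_zero p)
  have h1 := congrArg (fun n => n.factorization p) h
  simpa [Nat.factorization_mul, pow_ne_zero, hp.ne_zero, hu0, hv0, hp.factorization,
    Nat.factorization_eq_zero_of_not_dvd hu, Nat.factorization_eq_zero_of_not_dvd hv] using h1

section Duality

variable {F : Type*} [Field F] [IsAlgClosed F] {W₁ W₂ : WeierstrassCurve F} [W₁.IsElliptic]
  [W₂.IsElliptic] {p : ℕ} [Fact p.Prime] [CharP F p]

/-- The inseparable degree of the dual is the `p`-part of the separable degree, and conversely. -/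
theorem finInsepDegree_dual {α : W₂.FnField →ₐ[F] W₁.FnField} (h0 : redAt (ptOf α) 0 = 0)
    {β : W₁.FnField →ₐ[F] W₂.FnField} (hβ0 : redAt (ptOf β) 0 = 0)
    (hβ : mapPt α (ptOf β) = Module.finrank α.fieldRange W₁.FnField • W₁.genericPoint)
    {a b m : ℕ} (ha : Field.finInsepDegree α.fieldRange W₁.FnField = p ^ a) (hm : ¬ p ∣ m)
    (hG : Nat.card (redHom p (ptOf α) h0).ker = p ^ b * m)
    (hj : ∀ r, r ≠ 0 → W₁.j ^ p ^ r ≠ W₁.j) :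
    Field.finInsepDegree β.fieldRange W₂.FnField = p ^ b ∧
      ∃ m', ¬ p ∣ m' ∧ Nat.card (redHom p (ptOf β) hβ0).ker = p ^ a * m' := by
  have hp := (Fact.out : p.Prime)
  have hm0 : m ≠ 0 := by rintro rfl; exact hm (dvd_zero p)
  have hn : Module.finrank α.fieldRange W₁.FnField = p ^ (a + b) * m := by
    rw [← Field.finSepDegree_mul_finInsepDegree, ha, finSepDegree_eq_card_ker p h0, hG]
    ring
  -- the multiplication by the degree has inseparable degree `p ^ (a + b)`, and the `p`-part of the
  -- order of its kernel is the same
  have hc : ptOf (α.comp β) = (p ^ (a + b) * m) • W₁.genericPoint := by rw [ptOf_comp, hβ, hn]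
  have hfin := finite_ker_redHom p hβ0
  have hfd := finiteDimensional_fieldRange β
  constructor
  · have h1 := finInsepDegree_nsmul hj hm hc
    rw [finInsepDegree_fieldRange_comp, ha, add_comm a b, pow_add] at h1
    exact Nat.eq_of_mul_eq_mul_right (pow_pos hp.pos a) h1
  · have h1 : ((redHom p (ptOf β) hβ0).comp (redHom p (ptOf α) h0)).ker =
        W₁.torsion (p ^ (a + b) * m) := by
      ext Q
      rw [mem_torsion, ← redAt_of_ptOf_eq_nsmul hc, redAt_ptOf_comp]
      rfl
    have h2 := card_ker_comp (redHom p (ptOf β) hβ0) (f := redHom p (ptOf α) h0)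
      (redAt_surjective α)
    rw [h1, card_torsion_mul p _ hm0, card_torsion_pow hj, hG] at h2
    obtain ⟨x, m', hm', hx⟩ := Nat.exists_eq_pow_mul_and_not_dvd
      (Nat.card_pos (α := (redHom p (ptOf β) hβ0).ker)).ne' p hp.ne_one
    have h3 : a + b = b + x := by
      refine eq_of_pow_mul_eq hp (not_dvd_card_torsion (W := W₁) hm)
        (fun h => (hp.dvd_mul.1 h).elim hm hm') (h2.trans ?_)
      rw [hx]
      ring
    obtain rfl : a = x := by omega
    exact ⟨m', hm', hx⟩

end Duality

section Exponent

variable {F : Type*} [Field F] {p : ℕ} [Fact p.Prime] [CharP F p]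

variable (p) in
/-- The element `f` of the subfield `M` is a `p ^ c`-th power in `M`, but not a `p ^ (c + 1)`-th
power. -/
def HasExponent (M : Subfield F) (f : F) (c : ℕ) : Prop :=
  (∃ g ∈ M, g ^ p ^ c = f) ∧ ¬ ∃ g ∈ M, g ^ p ^ (c + 1) = f

/-- An element of exponent `c` is a `p ^ c`-th power and no higher one, and its `p ^ b`-th power has
exponent `c + b`. -/
lemma HasExponent.exists_pow_eq_iff {M : Subfield F} {f : F} {c : ℕ} (h : HasExponent p M f c)
    (b e : ℕ) : (∃ g ∈ M, g ^ p ^ e = f ^ p ^ b) ↔ e ≤ c + b := by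
  obtain ⟨⟨g, hg, rfl⟩, hn⟩ := h
  constructor
  · rintro ⟨k, hk, e1⟩
    by_contra! hlt
    refine hn ⟨k ^ p ^ (e - (c + b) - 1), pow_mem hk _, ?_⟩
    apply pow_injective_of_charP p b
    change (_ ^ _) ^ _ = (g ^ p ^ c) ^ p ^ b
    rw [← e1, ← pow_mul, ← pow_mul, ← pow_add, ← pow_add]
    congr 2
    omega
  · intro hle
    refine ⟨g ^ p ^ (c + b - e), pow_mem hg _, ?_⟩
    rw [← pow_mul, ← pow_mul, ← pow_add, ← pow_add]
    congr 2
    omega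

variable [IsAlgClosed F] {W₁ W₂ : WeierstrassCurve F} [W₁.IsElliptic] [W₂.IsElliptic]

/-- If two conjugates of the `j`-invariants by powers of the Frobenius automorphism lie in the same
separably closed fields, then their exponents differ by the same amount. -/
lemma add_eq_add_of_frobRoot {j₁ j₂ : F} {a b : ℕ}
    (h : ∀ (M : Subfield F) [IsPurelyInseparable M F],
      frobRoot F p b j₁ ∈ (algebraMap M F).range ↔ frobRoot F p a j₂ ∈ (algebraMap M F).range)
    (M : Subfield F) [IsPurelyInseparable M F] {c₁ c₂ : ℕ} (h₁ : HasExponent p M j₁ c₁)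
    (h₂ : HasExponent p M j₂ c₂) : b + c₂ = a + c₁ := by
  have : ExpChar F p := .prime Fact.out
  have hM : IsPurelyInseparable M F := inferInstance
  have hcM : CharP M p := M.subtype.charP M.subtype_injective p
  rw [isPurelyInseparable_iff_pow_mem M p] at hM
  have key : ∀ c, c ≤ c₁ ↔ c + a ≤ c₂ + b := by
    intro c
    -- this is the image of `M` under the `(c - b)`-th power of the Frobenius automorphism
    let M' : Subfield F := (M.map (iterateFrobenius F p c)).comap (iterateFrobenius F p b)
    have hM' : ∀ f, f ∈ M' ↔ ∃ g ∈ M, g ^ p ^ c = f ^ p ^ b := fun f => Iff.rfl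
    have hcM' : CharP M' p := M'.subtype.charP M'.subtype_injective p
    have : IsPurelyInseparable M' F := by
      rw [isPurelyInseparable_iff_pow_mem M' p]
      intro f
      obtain ⟨n, g, hg⟩ := hM f
      refine ⟨n + c, ⟨f ^ p ^ (n + c), (hM' _).2 ⟨(g : F) ^ p ^ b, pow_mem g.2 _, ?_⟩⟩, rfl⟩
      rw [show (g : F) = f ^ p ^ n from hg]
      ring
    have hr : ∀ f, f ∈ (algebraMap M' F).range ↔ f ∈ M' := fun f =>
      ⟨fun ⟨g, hg⟩ => hg ▸ g.2, fun hf => ⟨⟨f, hf⟩, rfl⟩⟩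
    have h3 := h M'
    rw [hr, hr, hM', hM', frobRoot_pow] at h3
    have h4 := h₁.exists_pow_eq_iff 0 c
    rw [pow_zero, pow_one, add_zero] at h4
    rw [← h4, ← h₂.exists_pow_eq_iff b (c + a), h3]
    refine exists_congr fun g => and_congr_right fun _ => ?_
    rw [← (pow_injective_of_charP p (N := F) a).eq_iff]
    rw [← pow_mul, ← pow_add, pow_right_comm, frobRoot_pow]
  have k1 := (key c₁).1 le_rfl
  have k2 : ¬ c₁ + 1 + a ≤ c₂ + b := fun h => Nat.not_succ_le_self c₁ ((key (c₁ + 1)).2 h)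
  omega

/-- The relation between the inseparable degrees of an isogeny and its dual and the exponents of
the `j`-invariants. -/
theorem finInsepDegree_mul_eq {α : W₂.FnField →ₐ[F] W₁.FnField} (h0 : redAt (ptOf α) 0 = 0)
    {β : W₁.FnField →ₐ[F] W₂.FnField} (hβ0 : redAt (ptOf β) 0 = 0)
    (hβ : mapPt α (ptOf β) = Module.finrank α.fieldRange W₁.FnField • W₁.genericPoint)
    (hj₁ : ∀ r, r ≠ 0 → W₁.j ^ p ^ r ≠ W₁.j) (hj₂ : ∀ r, r ≠ 0 → W₂.j ^ p ^ r ≠ W₂.j)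
    (M : Subfield F) [IsPurelyInseparable M F] {c₁ c₂ : ℕ} (h₁ : HasExponent p M W₁.j c₁)
    (h₂ : HasExponent p M W₂.j c₂) :
    Field.finInsepDegree β.fieldRange W₂.FnField * p ^ c₂ =
      Field.finInsepDegree α.fieldRange W₁.FnField * p ^ c₁ := by
  have hfin := finite_ker_redHom p h0
  obtain ⟨a, ha, -⟩ := exists_mem_fieldRange_iff p h0
  obtain ⟨b, m, hm, hG⟩ := Nat.exists_eq_pow_mul_and_not_dvd
    (Nat.card_pos (α := (redHom p (ptOf α) h0).ker)).ne' p (Fact.out : p.Prime).ne_one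
  obtain ⟨hb, m', hm', hG'⟩ := finInsepDegree_dual h0 hβ0 hβ ha hm hG hj₁
  rw [ha, hb, ← pow_add, ← pow_add, add_eq_add_of_frobRoot (fun M _ =>
    ⟨frobRoot_j_mem_range h0 ha hm hG hj₁, frobRoot_j_mem_range hβ0 hb hm' hG' hj₂⟩) M h₁ h₂]

end Exponent

end WeierstrassCurve

/-! ### Inseparability degrees of functions -/

namespace WeierstrassCurve

open scoped Classical

section FunctionField

open IntermediateField

lemma IsCurveField.of_finite {F N N' : Type*} [Field F] [Field N] [Field N'] [Algebra F N]
    [Algebra F N'] [Algebra N N'] [IsScalarTower F N N'] [FiniteDimensional N N']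
    (h : IsCurveField F N) : IsCurveField F N' := by
  have h1 := lift_trdeg_add_eq F N N'
  rw [h.trdeg, Cardinal.lift_one, trdeg_eq_zero (R := N) (A := N'), Cardinal.lift_zero,
    add_zero] at h1
  have := h.ess
  exact ⟨Cardinal.lift_eq_one.1 h1.symm, Algebra.EssFiniteType.comp F N N'⟩

/-- A function field of one variable is one over its constant field as well. -/
lemma IsCurveField.algebraicClosure {F N : Type*} [Field F] [Field N] [Algebra F N]
    (h : IsCurveField F N) : IsCurveField (algebraicClosure F N) N := by
  have h1 := lift_trdeg_add_eq F (_root_.algebraicClosure F N) N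
  rw [h.trdeg, Cardinal.lift_one, trdeg_eq_zero (R := F) (A := _root_.algebraicClosure F N),
    Cardinal.lift_zero, zero_add] at h1
  have := h.ess
  exact ⟨Cardinal.lift_eq_one.1 h1, Algebra.EssFiniteType.of_comp F _ N⟩

lemma _root_.IsFunctionFieldOfCurve.isCurveField {k K : Type*} [Field k] [Field K] [Algebra k K]
    (h : IsFunctionFieldOfCurve k K) : IsCurveField k K := by
  obtain ⟨t, ht, hfin⟩ := h.exists_finite
  exact isCurveField_of_finite ht hfin

variable {F N : Type*} [Field F] [Field N] [Algebra F N] {p : ℕ} [Fact p.Prime] [CharP F p]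
  [PerfectField F]

/-- The inseparable degree of a function field over the field generated by a nonconstant function
`f` is the largest power `p ^ c` such that `f` is a `p ^ c`-th power. -/
theorem IsCurveField.exists_finInsepDegree_eq (h : IsCurveField F N) {f : N}
    (hf : Transcendental F f) :
    ∃ c, Field.finInsepDegree F⟮f⟯ N = p ^ c ∧ (∃ g, g ^ p ^ c = f) ∧
      ¬ ∃ g, g ^ p ^ (c + 1) = f := by
  have hfin := h.finite hf
  have hcN := charP_of_injective_algebraMap (algebraMap F N).injective p
  set S := separableClosure F⟮f⟯ N with hS
  have hcS : CharP S p := charP_of_injective_algebraMap (algebraMap F S).injective p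
  have hpi : IsPurelyInseparable S N := inferInstance
  obtain ⟨c, hc⟩ := IsPurelyInseparable.finrank_eq_pow S N p
  have : IsScalarTower F S N := IsScalarTower.of_algebraMap_eq fun _ => rfl
  have hmem := h.mem_range_algebraMap_iff (E := S) (p := p) hpi hc
  refine ⟨c, hc, (hmem f).1 ⟨algebraMap F⟮f⟯ S (AdjoinSimple.gen F f), rfl⟩, ?_⟩
  rintro ⟨g, hg⟩
  set T := frobField F N p (c + 1) with hT
  have hle : F⟮f⟯ ≤ T := adjoin_simple_le_iff.2 ⟨g, hg⟩
  let : Algebra F⟮f⟯ T := (IntermediateField.inclusion hle).toRingHom.toAlgebra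
  have : IsScalarTower F⟮f⟯ T N := IsScalarTower.of_algebraMap_eq fun _ => rfl
  have hTpi : IsPurelyInseparable T N := isPurelyInseparable_frobField (c + 1)
  have htop : Algebra.IsSeparable (⊤ : IntermediateField F N) N :=
    ⟨fun z => isSeparable_algebraMap (⟨z, trivial⟩ : (⊤ : IntermediateField F N))⟩
  -- otherwise all `p ^ c`-th powers would be both separable and purely inseparable over the field
  -- of `p ^ (c + 1)`-th powers
  refine h.not_le_frobField_one (p := p) ⊤ fun z _ => ?_
  obtain ⟨w, hw⟩ := (hmem (z ^ p ^ c)).2 ⟨z, rfl⟩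
  have hsep : IsSeparable F⟮f⟯ (z ^ p ^ c) := hw ▸ mem_separableClosure_iff.1 w.2
  obtain ⟨⟨_, u, rfl⟩, hv⟩ := IsPurelyInseparable.inseparable' (F := T) _ (hsep.tower_top T)
  refine ⟨u, pow_injective_of_charP p c ?_⟩
  change (u ^ p ^ 1) ^ p ^ c = z ^ p ^ c
  rw [← hv, ← pow_mul, ← pow_add, add_comm]
  rfl

/-- Passing to the separable closure does not change the exponent of an element. -/
lemma hasExponent_separableClosure {L Ω : Type*} [Field L] [Field Ω] [Algebra L Ω] [CharP Ω p]
    {f : L} {c : ℕ} (h1 : ∃ g, g ^ p ^ c = f) (h2 : ¬ ∃ g, g ^ p ^ (c + 1) = f) :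
    HasExponent p (separableClosure L Ω).toSubfield (algebraMap L Ω f) c := by
  obtain ⟨g, rfl⟩ := h1
  have hcL : CharP L p := (algebraMap L Ω).charP (algebraMap L Ω).injective p
  have : ExpChar L p := .prime Fact.out
  refine ⟨⟨algebraMap L Ω g, (separableClosure L Ω).algebraMap_mem g, (map_pow _ _ _).symm⟩, ?_⟩
  rintro ⟨s, hs, hsg⟩
  have hsp : s ^ p ^ 1 = algebraMap L Ω g := by
    apply pow_injective_of_charP p c
    change (s ^ p ^ 1) ^ p ^ c = _ ^ p ^ c
    rw [← map_pow, ← hsg, ← pow_mul, ← pow_add, add_comm]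
  have h3 : s ∈ separableClosure L Ω ⊓ perfectClosure L Ω :=
    ⟨hs, (mem_perfectClosure_iff_pow_mem p).2 ⟨1, g, hsp.symm⟩⟩
  rw [separableClosure_inf_perfectClosure] at h3
  obtain ⟨t, rfl⟩ := IntermediateField.mem_bot.1 h3
  refine h2 ⟨t, (algebraMap L Ω).injective ?_⟩
  rw [map_pow, hsg]

end FunctionField

section Isogenies

variable {F : Type*} [Field F] [IsAlgClosed F] {W₁ W₂ : WeierstrassCurve F} [W₁.IsElliptic]
  [W₂.IsElliptic] (p : ℕ) [Fact p.Prime] [CharP F p]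

lemma Isogeny.redAt_pull_zero (φ : Isogeny W₁ W₂) : redAt (ptOf φ.pull) 0 = 0 := by
  rw [← φ.toFun_eq, φ.map_zero]

/-- Every isogeny has a dual. -/
theorem Isogeny.exists_isDual (p : ℕ) [Fact p.Prime] [CharP F p] (φ : Isogeny W₁ W₂) :
    ∃ ψ : Isogeny W₂ W₁, φ.IsDual ψ := by
  obtain ⟨β, hβ0, hβ⟩ := exists_mapPt_ptOf_eq_nsmul p φ.redAt_pull_zero
  refine ⟨Isogeny.ofAlgHom β hβ0, fun P => ?_⟩
  change redAt (ptOf β) (φ.toFun P) = φ.degree • P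
  rw [φ.toFun_eq, ← redAt_mapPt, hβ, redAt_nsmul, redAt_genericPoint, φ.degree_eq]

lemma Isogeny.IsDual.mapPt_eq {φ : Isogeny W₁ W₂} {ψ : Isogeny W₂ W₁} (h : φ.IsDual ψ) :
    mapPt φ.pull (ptOf ψ.pull) =
      Module.finrank φ.pull.fieldRange W₁.FnField • W₁.genericPoint := by
  refine redAt_injective fun P => ?_
  have h1 : ψ.toFun (φ.toFun P) = φ.degree • P := h P
  rw [redAt_mapPt, ← φ.toFun_eq, ← ψ.toFun_eq, h1, redAt_nsmul, redAt_genericPoint, φ.degree_eq]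

end Isogenies

end WeierstrassCurve

namespace WeierstrassCurve

open scoped Classical

section Invariant

variable {k L Ω : Type*} [Field k] [PerfectField k] [Field L] [Algebra k L] [Field Ω] [Algebra L Ω]
  {p : ℕ} [Fact p.Prime] [CharP Ω p]

/-- The inseparability degree of a nonconstant function is `p ^ c`, where `c` is its exponent in the
separable closure. -/
lemma exists_elementDegIns_eq (h : IsCurveField k L) {f : L} (hf : f ∉ constantField k L) :
    ∃ c, elementDegIns k f = p ^ c ∧
      HasExponent p (separableClosure L Ω).toSubfield (algebraMap L Ω f) c := by
  have hcL : CharP L p := (algebraMap L Ω).charP (algebraMap L Ω).injective p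
  have hck : CharP (constantField k L) p :=
    (algebraMap (constantField k L) L).charP (algebraMap (constantField k L) L).injective p
  have hperf : PerfectField (constantField k L) := Algebra.IsAlgebraic.perfectField (K := k)
  have hft : Transcendental (constantField k L) f := fun ha =>
    hf (mem_algebraicClosure_iff.2 (ha.restrictScalars k))
  obtain ⟨c, hc, h1, h2⟩ := h.algebraicClosure.exists_finInsepDegree_eq (p := p) hft
  refine ⟨c, ?_, hasExponent_separableClosure h1 h2⟩
  rw [elementDegIns, if_neg hf, hc]

/-- A nonconstant function is not fixed by a power of the Frobenius endomorphism. -/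
lemma algebraMap_pow_ne {f : L} (hf : f ∉ constantField k L) (r : ℕ) (hr : r ≠ 0) :
    algebraMap L Ω f ^ p ^ r ≠ algebraMap L Ω f := by
  intro h
  rw [← map_pow] at h
  apply hf
  refine mem_algebraicClosure_iff.2 ⟨X ^ p ^ r - X, ?_, ?_⟩
  · exact FiniteField.X_pow_card_pow_sub_X_ne_zero k hr (Fact.out : p.Prime).one_lt
  · rw [map_sub, map_pow, aeval_X, (algebraMap L Ω).injective h, sub_self]

end Invariant

end WeierstrassCurve

theorem corollary4p3 (p : ℕ) [Fact p.Prime]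
    {k K L Kbar : Type*} [Field k] [PerfectField k] [Field K] [CharP K p] [Algebra k K]
    (hK : IsFunctionFieldOfCurve k K)
    [Field L] [Algebra k L] [Algebra K L] [IsScalarTower k K L] [FiniteDimensional K L]
    [Field Kbar] [Algebra K Kbar] [IsAlgClosure K Kbar] [Algebra L Kbar] [IsScalarTower K L Kbar]
    (E₁ E₂ : WeierstrassCurve L) [E₁.IsElliptic] [E₂.IsElliptic]
    (hE₁ : ¬ E₁.IsIsotrivial k) (hE₂ : ¬ E₂.IsIsotrivial k)
    (φ : WeierstrassCurve.Isogeny (E₁.baseChange Kbar) (E₂.baseChange Kbar)) :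
    (∃ φ' : WeierstrassCurve.Isogeny (E₂.baseChange Kbar) (E₁.baseChange Kbar), φ.IsDual φ') ∧
    (∀ φ' : WeierstrassCurve.Isogeny (E₂.baseChange Kbar) (E₁.baseChange Kbar), φ.IsDual φ' →
      φ'.degIns * elementDegIns k E₂.j = φ.degIns * elementDegIns k E₁.j) ∧
    (φ.IsBiseparable → elementDegIns k E₁.j = elementDegIns k E₂.j) := by
  have : IsAlgClosed Kbar := IsAlgClosure.isAlgClosed K
  have : Algebra.IsAlgebraic K Kbar := IsAlgClosure.isAlgebraic
  have : Algebra.IsAlgebraic L Kbar := Algebra.IsAlgebraic.tower_top (K := K) L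
  have := charP_of_injective_algebraMap (algebraMap K Kbar).injective p
  have : (E₁.baseChange Kbar).IsElliptic := inferInstanceAs (E₁.map (algebraMap L Kbar)).IsElliptic
  have : (E₂.baseChange Kbar).IsElliptic := inferInstanceAs (E₂.map (algebraMap L Kbar)).IsElliptic
  have hj₁ : (E₁.baseChange Kbar).j = algebraMap L Kbar E₁.j := E₁.map_j (algebraMap L Kbar)
  have hj₂ : (E₂.baseChange Kbar).j = algebraMap L Kbar E₂.j := E₂.map_j (algebraMap L Kbar)
  have hL : WeierstrassCurve.IsCurveField k L := hK.isCurveField.of_finite (N := K)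
  obtain ⟨c₁, hd₁, hc₁⟩ := WeierstrassCurve.exists_elementDegIns_eq (Ω := Kbar) (p := p) hL hE₁
  obtain ⟨c₂, hd₂, hc₂⟩ := WeierstrassCurve.exists_elementDegIns_eq (Ω := Kbar) (p := p) hL hE₂
  have : IsPurelyInseparable (separableClosure L Kbar).toSubfield Kbar :=
    inferInstanceAs (IsPurelyInseparable (separableClosure L Kbar) Kbar)
  have key : ∀ φ' : WeierstrassCurve.Isogeny (E₂.baseChange Kbar) (E₁.baseChange Kbar),
      φ.IsDual φ' → φ'.degIns * elementDegIns k E₂.j = φ.degIns * elementDegIns k E₁.j := by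
    intro φ' h
    rw [hd₁, hd₂, φ.degIns_eq, φ'.degIns_eq]
    refine WeierstrassCurve.finInsepDegree_mul_eq φ.redAt_pull_zero φ'.redAt_pull_zero h.mapPt_eq
      ?_ ?_ _ (hj₁ ▸ hc₁) (hj₂ ▸ hc₂)
    · rw [hj₁]
      exact WeierstrassCurve.algebraMap_pow_ne hE₁
    · rw [hj₂]
      exact WeierstrassCurve.algebraMap_pow_ne hE₂
  refine ⟨φ.exists_isDual p, key, ?_⟩
  rintro ⟨hφ, φ', hdual, hφ'⟩
  have h1 : φ.degIns = 1 := by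
    have := φ.isSeparable_iff.1 hφ
    rw [φ.degIns_eq]
    exact Algebra.IsSeparable.finInsepDegree_eq _ _
  have h2 : φ'.degIns = 1 := by
    have := φ'.isSeparable_iff.1 hφ'
    rw [φ'.degIns_eq]
    exact Algebra.IsSeparable.finInsepDegree_eq _ _
  have h3 := key φ' hdual
  rw [h1, h2, one_mul, one_mul] at h3
  exact h3.symm
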